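/- Let $M$ be a smooth manifold (Hausdorff, second countable) of dimension $d$ with a smooth, nowhere vanishing volume form $\mu$; in particular $M$ is orientable. Test functions are complex-valued, smooth and compactly supported. Distributions on $M\times M$ are continuous linear functionals on compactly supported smooth densities $F\cdot(\mu\otimes\mu)$, $F\in C_0^\infty(M\times M)$; we write $u(F)$ for the value of $u$ on $F\cdot(\mu\otimes\mu)$, so that a smooth function $a$ is the distribution $F\mapsto\int aF\,|\mu|\otimes|\mu|$. A distribution $u$ on $M\times M$ is of positive type if $u(\mu\bar f\otimes\mu f)\ge 0$ for all $f\in C_0^\infty(M)$. For a chart $\kappa:O\to\mathbb{R}^{2d}$ of $M\times M$, $\varphi\in C_0^\infty(O)$ and $k\in\mathbb{R}^{2d}$ put $\widehat{(\varphi u)_\kappa}(k):=u(\varphi\,e^{-ik\cdot\kappa})$. For $s\in\mathbb{R}$ and a covector $(x,\xi)\in T^*(M\times M)$ with $\xi\neq0$, $(x,\xi)\notin WF^{(s)}(u)$ means that there are a chart $\kappa:O\to\mathbb{R}^{2d}$ with $x\in O$, a $\varphi\in C_0^\infty(O)$ with $\varphi(x)\ne0$ and an open convex cone $\Gamma\subset\mathbb{R}^{2d}$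 with $(D_{\kappa(x)}\kappa^{-1})^t\xi\in\Gamma$ such that $$\int_\Gamma (1+|k|^2)^s\,\bigl|\widehat{(\varphi u)_\kappa}(k)\bigr|^2\,dk<\infty .$$ A distribution $w$ on $M\times M$ is called the product $u_1\cdot u_2$ (localised Fourier product in the sense of Ambrose, in charts) if, for all charts $\kappa,\kappa'$ of $M$, every point of the domain of $\kappa\times\kappa'$ has an open neighbourhood $V$ in this domain such that for all $\varphi,\psi\in C_0^\infty(V)$ the function $k\mapsto\widehat{(\varphi u_1)_{\kappa\times\kappa'}}(k)\,\widehat{(\psi u_2)_{\kappa\times\kappa'}}(-k)$ is integrable on $\mathbb{R}^{2d}$ and $$w(m\,\varphi\,\psi)=(2\pi)^{-2d}\int_{\mathbb{R}^{2d}}\widehat{(\varphi u_1)_{\kappa\times\kappa'}}(k)\,\widehat{(\psi u_2)_{\kappa\times\kappa'}}(-k)\,dk ,$$ where $m>0$ is the density of $|\mu|\otimes|\mu|$ with respect to Lebesgue measure in the chart $\kappa\times\kappa'$. (For smooth functions $u_1,u_2$ this is Parseval's formula for the pointwise product.) **Theorem.** Let $u_1,u_2$ be distributions of positive type on $M\times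 M$ such that for every $(x,\xi)\in T^*(M\times M)$ with $\xi\neq 0$ there are $s_1,s_2\in\mathbb{R}$ with $s_1+s_2\ge0$, $(x,\xi)\notin WF^{(s_1)}(u_1)$ and $(x,-\xi)\notin WF^{(s_2)}(u_2)$. Then the product $u_1\cdot u_2$ is well-defined, i.e. there is exactly one distribution $w$ on $M\times M$ which is the product of $u_1$ and $u_2$, and $u_1\cdot u_2$ is again of positive type. -/

import Mathlib

open scoped ContDiff Manifold

noncomputable section

/-- The space `C₀^∞(N)` of smooth complex-valued functions with compact support on a manifold `N`. -/
def testFunctions {E H : Type*} [NormedAddCommGroup E] [NormedSpace ℝ E] [TopologicalSpace H]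
    (I : ModelWithCorners ℝ E H) (N : Type*) [TopologicalSpace N] [ChartedSpace H N] :
    Submodule ℂ (N → ℂ) where
  carrier := {f | ContMDiff I 𝓘(ℝ, ℂ) ∞ f ∧ HasCompactSupport f}
  add_mem' hf hg := ⟨hf.1.add hg.1, hf.2.add hg.2⟩
  zero_mem' := ⟨contMDiff_const, HasCompactSupport.zero⟩
  smul_mem' c f hf := by
    have h : ContMDiff I 𝓘(ℝ, ℂ) ∞ (fun p => c * f p) :=
      ((contDiff_const.mul contDiff_id : ContDiff ℝ ∞ (fun z : ℂ => c * z)).contMDiff).comp hf.1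
    exact ⟨h, hf.2.mul_left (f := fun _ => c)⟩

/-- A test function supported in an open set, multiplied by a function that is smooth on
that open set, is a test function. -/
theorem mul_mem_testFunctions {E H : Type*} [NormedAddCommGroup E] [NormedSpace ℝ E]
    [TopologicalSpace H] {I : ModelWithCorners ℝ E H} {N : Type*} [TopologicalSpace N]
    [ChartedSpace H N] {f g : N → ℂ} {O : Set N} (hf : f ∈ testFunctions I N) (hO : IsOpen O)
    (hfO : tsupport f ⊆ O) (hg : ContMDiffOn I 𝓘(ℝ, ℂ) ∞ g O) :
    (fun p => f p * g p) ∈ testFunctions I N := by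
  refine show _ ∧ _ from ⟨fun p => ?_, hf.2.mul_right⟩
  by_cases hp : p ∈ tsupport f
  · have h2 : ContMDiffAt I 𝓘(ℝ, ℂ × ℂ) ∞ (fun q => (f q, g q)) p :=
      (hf.1 p).prodMk_space (hg.contMDiffAt (hO.mem_nhds (hfO hp)))
    exact (contDiff_mul (𝕜 := ℝ) (𝔸 := ℂ)).contMDiff.contMDiffAt.comp p h2
  · refine (contMDiffAt_const (c := (0 : ℂ))).congr_of_eventuallyEq ?_
    filter_upwards [(isClosed_tsupport f).isOpen_compl.mem_nhds hp] with q hq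
    simp [image_eq_zero_of_notMem_tsupport hq]

/-! ### Volume forms on `M` -/

section Manifold

variable {d : ℕ} {M : Type*} [TopologicalSpace M] [ChartedSpace (EuclideanSpace ℝ (Fin d)) M]

/-- The component `η(∂₁, …, ∂_d)` at the point `κ⁻¹ y`, in the chart `κ`, of a field `η` of
alternating `d`-forms on a `d`-dimensional manifold. -/
def formComponent (η : ∀ x : M, (TangentSpace (𝓡 d) x) [⋀^Fin d]→ₗ[ℝ] ℝ)
    (κ : OpenPartialHomeomorph M (EuclideanSpace ℝ (Fin d))) (y : EuclideanSpace ℝ (Fin d)) : ℝ :=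
  η (κ.symm y) fun i => mfderiv (𝓡 d) (𝓡 d) κ.symm y (EuclideanSpace.basisFun (Fin d) ℝ i)

variable (d M) in
/-- A smooth, nowhere vanishing volume form on the `d`-dimensional manifold `M`
(whose existence makes `M` orientable). -/
structure VolumeForm where
  form : ∀ x : M, (TangentSpace (𝓡 d) x) [⋀^Fin d]→ₗ[ℝ] ℝ
  smooth : ∀ κ ∈ IsManifold.maximalAtlas (𝓡 d) ∞ M,
    ContDiffOn ℝ ∞ (formComponent form κ) κ.target
  ne_zero : ∀ x, form x ≠ 0

theorem VolumeForm.formComponent_ne_zero [IsManifold (𝓡 d) ∞ M] (μ : VolumeForm d M)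
    {κ : OpenPartialHomeomorph M (EuclideanSpace ℝ (Fin d))}
    (hκ : κ ∈ IsManifold.maximalAtlas (𝓡 d) ∞ M) {y : EuclideanSpace ℝ (Fin d)}
    (hy : y ∈ κ.target) : formComponent μ.form κ y ≠ 0 := by
  have h1 : κ ∈ IsManifold.maximalAtlas (𝓡 d) 1 M :=
    IsManifold.maximalAtlas_subset_of_le (by simp) hκ
  have hd : κ.MDifferentiable (𝓡 d) (𝓡 d) :=
    ⟨fun x hx => (mdifferentiableAt_of_mem_maximalAtlas h1 hx).mdifferentiableWithinAt,
      fun x hx => (mdifferentiableAt_symm_of_mem_maximalAtlas h1 hx).mdifferentiableWithinAt⟩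
  intro h0
  apply μ.ne_zero (κ.symm y)
  let e := (hd.symm.mfderiv (x := y) hy).toLinearEquiv
  let b := (EuclideanSpace.basisFun (Fin d) ℝ).toBasis.map e
  refine (AlternatingMap.map_basis_eq_zero_iff b _).1 ?_
  convert h0 using 1
  unfold formComponent
  congr 1

/-- The density of the measure `|μ| ⊗ |μ|` with respect to Lebesgue measure in the product
chart `κ × κ'` of `M × M`, as a function on the domain of that chart. -/
def VolumeForm.density (μ : VolumeForm d M)
    (κ κ' : OpenPartialHomeomorph M (EuclideanSpace ℝ (Fin d))) (p : M × M) : ℝ :=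
  |formComponent μ.form κ (κ p.1)| * |formComponent μ.form κ' (κ' p.2)|

/-! ### Distributions on `M × M` -/

variable (d M) in
/-- The test functions on `M × M`. -/
abbrev TestFunctions₂ : Submodule ℂ (M × M → ℂ) := testFunctions ((𝓡 d).prod (𝓡 d)) (M × M)

variable (d M) in
/-- Distributions on `M × M`, as functionals on test functions. Test functions `F` are identified
with test densities `F · (μ ⊗ μ)` by means of the fixed volume form `μ` of `M`, so that `u F`
stands for the value of `u` on `F · (μ ⊗ μ)`, and a smooth function `a` is the distribution
`F ↦ ∫ a F |μ| ⊗ |μ|`. Continuity: on test functions supported in a compact subset of a chart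
domain, `|u F|` is bounded by a multiple of the sup norms of finitely many derivatives. -/
@[ext] structure Distribution₂ where
  toLin : TestFunctions₂ d M →ₗ[ℂ] ℂ
  continuous : ∀ κ ∈ IsManifold.maximalAtlas ((𝓡 d).prod (𝓡 d)) ∞ (M × M),
    ∀ K ⊆ κ.source, IsCompact K → ∃ (C : ℝ) (m : ℕ), ∀ (F : TestFunctions₂ d M) (B : ℝ),
      tsupport F.1 ⊆ K →
      (∀ j ≤ m, ∀ y ∈ κ.target, ‖iteratedFDeriv ℝ j
        (fun z : EuclideanSpace ℝ (Fin d) × EuclideanSpace ℝ (Fin d) => F.1 (κ.symm z)) y‖ ≤ B) →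
      ‖toLin F‖ ≤ C * B

theorem tensor_mem [T2Space M] {f g : M → ℂ} (hf : f ∈ testFunctions (𝓡 d) M)
    (hg : g ∈ testFunctions (𝓡 d) M) :
    (fun p : M × M => (starRingEnd ℂ) (f p.1) * g p.2) ∈ TestFunctions₂ d M := by
  have h1 : ContMDiff ((𝓡 d).prod (𝓡 d)) 𝓘(ℝ, ℂ) ∞
      (fun p : M × M => (starRingEnd ℂ) (f p.1)) :=
    Complex.conjCLE.contDiff.contMDiff.comp (hf.1.comp contMDiff_fst)
  have h2 : ContMDiff ((𝓡 d).prod (𝓡 d)) 𝓘(ℝ, ℂ) ∞ (fun p : M × M => g p.2) :=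
    hg.1.comp contMDiff_snd
  refine show _ ∧ _ from ⟨(contDiff_mul (𝕜 := ℝ) (𝔸 := ℂ)).contMDiff.comp (h1.prodMk_space h2), ?_⟩
  refine HasCompactSupport.intro (hf.2.isCompact.prod hg.2.isCompact) fun p hp => ?_
  rw [Set.mem_prod, not_and_or] at hp
  rcases hp with hp | hp <;> simp [image_eq_zero_of_notMem_tsupport hp]

/-- `u` is of positive type: `u(f̄ ⊗ f) ≥ 0` for all test functions `f` on `M`. In terms of test
densities this is the value of `u` on `μ f̄ ⊗ μ f`, by the identification made above. -/
def Distribution₂.IsPositiveType [T2Space M] (u : Distribution₂ d M) : Prop :=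
  ∀ (f : M → ℂ) (hf : f ∈ testFunctions (𝓡 d) M),
    0 ≤ (u.toLin ⟨_, tensor_mem hf hf⟩).re ∧ (u.toLin ⟨_, tensor_mem hf hf⟩).im = 0

/-! ### Sobolev wave front sets -/

/-- The Euclidean inner product on `ℝᵈ × ℝᵈ = ℝ²ᵈ`. -/
def pairing₂ (k x : EuclideanSpace ℝ (Fin d) × EuclideanSpace ℝ (Fin d)) : ℝ :=
  inner ℝ k.1 x.1 + inner ℝ k.2 x.2

theorem planeWave_mem {κ : OpenPartialHomeomorph (M × M)
      (ModelProd (EuclideanSpace ℝ (Fin d)) (EuclideanSpace ℝ (Fin d)))}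
    (hκ : κ ∈ IsManifold.maximalAtlas ((𝓡 d).prod (𝓡 d)) ∞ (M × M))
    {φ : M × M → ℂ} (hφ : φ ∈ TestFunctions₂ d M) (hs : tsupport φ ⊆ κ.source)
    (k : EuclideanSpace ℝ (Fin d) × EuclideanSpace ℝ (Fin d)) :
    (fun p => φ p * Complex.exp (-Complex.I * (pairing₂ k (κ p) : ℝ))) ∈ TestFunctions₂ d M := by
  refine mul_mem_testFunctions hφ κ.open_source hs ?_
  have h : ContDiff ℝ ∞ (fun x : EuclideanSpace ℝ (Fin d) × EuclideanSpace ℝ (Fin d) =>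
      Complex.exp (-Complex.I * (pairing₂ k x : ℝ))) := by
    unfold pairing₂
    exact (contDiff_const.mul (Complex.ofRealCLM.contDiff.comp
      ((contDiff_const.inner ℝ contDiff_fst).add (contDiff_const.inner ℝ contDiff_snd)))).cexp
  have h' := h.contMDiff
  rw [modelWithCornersSelf_prod] at h'
  exact h'.comp_contMDiffOn (contMDiffOn_of_mem_maximalAtlas hκ)

/-- The Fourier transform `k ↦ u(φ e^{-i k·κ})` of the push-forward along the chart `κ` of the
localised distribution `φ u`, where `φ` is a test function supported in the domain of `κ`.
If `u` is a smooth function, this is the Fourier transform of `((φ u) ∘ κ⁻¹) · m`, with `m` the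
(smooth, positive) density of `|μ| ⊗ |μ|` in the chart `κ`. -/
def Distribution₂.localFourier (u : Distribution₂ d M) {κ : OpenPartialHomeomorph (M × M)
      (ModelProd (EuclideanSpace ℝ (Fin d)) (EuclideanSpace ℝ (Fin d)))}
    (hκ : κ ∈ IsManifold.maximalAtlas ((𝓡 d).prod (𝓡 d)) ∞ (M × M))
    {φ : M × M → ℂ} (hφ : φ ∈ TestFunctions₂ d M) (hs : tsupport φ ⊆ κ.source)
    (k : EuclideanSpace ℝ (Fin d) × EuclideanSpace ℝ (Fin d)) : ℂ :=
  u.toLin ⟨_, planeWave_mem hκ hφ hs k⟩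

/-- `u ∈ H^{(s)}(p, ξ)`: in some chart `κ` around `p`, for some test function `φ` supported in the
chart domain with `φ p ≠ 0` and some open convex cone `Γ` containing the coordinate vector `η` of
`ξ` (so `ξ = (D κ)ᵗ η`, that is, `η = (D κ⁻¹)ᵗ ξ`), the integral of `(1 + |k|²)^s |(φ u)^(k)|²`
over `Γ` is finite. (The choice of the density by which the
push-forward of `φ u` is represented is immaterial, since it can be absorbed into `φ`.) -/
def Distribution₂.SobolevRegularAt (u : Distribution₂ d M) (s : ℝ) (p : M × M)
    (ξ : TangentSpace ((𝓡 d).prod (𝓡 d)) p →L[ℝ] ℝ) : Prop :=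
  ∃ (κ : OpenPartialHomeomorph (M × M)
      (ModelProd (EuclideanSpace ℝ (Fin d)) (EuclideanSpace ℝ (Fin d))))
    (hκ : κ ∈ IsManifold.maximalAtlas ((𝓡 d).prod (𝓡 d)) ∞ (M × M))
    (φ : M × M → ℂ) (hφ : φ ∈ TestFunctions₂ d M) (hs : tsupport φ ⊆ κ.source)
    (Γ : Set (EuclideanSpace ℝ (Fin d) × EuclideanSpace ℝ (Fin d)))
    (η : EuclideanSpace ℝ (Fin d) × EuclideanSpace ℝ (Fin d)),
    p ∈ κ.source ∧ φ p ≠ 0 ∧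
    IsOpen Γ ∧ Convex ℝ Γ ∧ (∀ c : ℝ, 0 < c → ∀ k ∈ Γ, c • k ∈ Γ) ∧
    η ∈ Γ ∧
    (∀ v : TangentSpace ((𝓡 d).prod (𝓡 d)) p,
      ξ v = pairing₂ η (mfderiv ((𝓡 d).prod (𝓡 d)) ((𝓡 d).prod (𝓡 d)) κ p v)) ∧
    ∫⁻ k in Γ, ENNReal.ofReal
      ((1 + pairing₂ k k) ^ s * ‖u.localFourier hκ hφ hs k‖ ^ 2) < ⊤

/-- The Sobolev wave front set `WF^{(s)}(u)`, as a subset of the cotangent bundle of `M × M`. -/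
def Distribution₂.sobolevWF (u : Distribution₂ d M) (s : ℝ) :
    Set (Σ p : M × M, TangentSpace ((𝓡 d).prod (𝓡 d)) p →L[ℝ] ℝ) :=
  {q | q.2 ≠ 0 ∧ ¬ u.SobolevRegularAt s q.1 q.2}

/-! ### Products of distributions -/

theorem mul_density_mem [IsManifold (𝓡 d) ∞ M] (μ : VolumeForm d M)
    {κ κ' : OpenPartialHomeomorph M (EuclideanSpace ℝ (Fin d))}
    (hκ : κ ∈ IsManifold.maximalAtlas (𝓡 d) ∞ M) (hκ' : κ' ∈ IsManifold.maximalAtlas (𝓡 d) ∞ M)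
    {φ ψ : M × M → ℂ} (hφ : φ ∈ TestFunctions₂ d M) (hψ : ψ ∈ TestFunctions₂ d M)
    (hs : tsupport φ ⊆ (κ.prod κ').source) :
    (fun p => φ p * (ψ p * (μ.density κ κ' p : ℝ))) ∈ TestFunctions₂ d M := by
  refine mul_mem_testFunctions hφ (κ.prod κ').open_source hs ?_
  have key : ∀ {κ : OpenPartialHomeomorph M (EuclideanSpace ℝ (Fin d))},
      κ ∈ IsManifold.maximalAtlas (𝓡 d) ∞ M →
      ContMDiffOn (𝓡 d) 𝓘(ℝ, ℝ) ∞ (fun x => |formComponent μ.form κ (κ x)|) κ.source := by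
    intro κ hκ
    have h : ContDiffOn ℝ ∞ (fun y => |formComponent μ.form κ y|) κ.target :=
      (μ.smooth κ hκ).abs fun y hy => μ.formComponent_ne_zero hκ hy
    exact h.contMDiffOn.comp (contMDiffOn_of_mem_maximalAtlas hκ) κ.mapsTo
  have h1 : ContMDiffOn ((𝓡 d).prod (𝓡 d)) 𝓘(ℝ, ℝ) ∞
      (fun p : M × M => |formComponent μ.form κ (κ p.1)|) (κ.prod κ').source :=
    (key hκ).comp contMDiff_fst.contMDiffOn fun p hp => hp.1
  have h2 : ContMDiffOn ((𝓡 d).prod (𝓡 d)) 𝓘(ℝ, ℝ) ∞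
      (fun p : M × M => |formComponent μ.form κ' (κ' p.2)|) (κ.prod κ').source :=
    (key hκ').comp contMDiff_snd.contMDiffOn fun p hp => hp.2
  have h3 : ContMDiffOn ((𝓡 d).prod (𝓡 d)) 𝓘(ℝ, ℂ) ∞
      (fun p : M × M => ((μ.density κ κ' p : ℝ) : ℂ)) (κ.prod κ').source :=
    Complex.ofRealCLM.contDiff.contMDiff.comp_contMDiffOn
      ((contDiff_mul (𝕜 := ℝ) (𝔸 := ℝ)).contMDiff.comp_contMDiffOn (h1.prodMk_space h2))
  exact (contDiff_mul (𝕜 := ℝ) (𝔸 := ℂ)).contMDiff.comp_contMDiffOn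
    (hψ.1.contMDiffOn.prodMk_space h3)

/-- `w` is the product `u₁ · u₂` (localised Fourier product, in the sense of Ambrose, in the charts
`κ × κ'` of `M × M`): every point of the chart domain has a neighbourhood `V` such that for all
test functions `φ`, `ψ` supported in `V` the function `k ↦ (φ u₁)^(k) (ψ u₂)^(-k)` is integrable
and `φ ψ w` has total mass `(2π)^{-2d} ∫ (φ u₁)^(k) (ψ u₂)^(-k) dk` in the chart. The factor
`μ.density` accounts for the identification of test functions with test densities: for smooth
`u₁`, `u₂` the integral equals `(2π)^{2d} ∫ φ u₁ ψ u₂ m² dx` by Parseval's formula, where `m` is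
the density of `|μ| ⊗ |μ|` in the chart, and `w (φ ψ m) = ∫ w φ ψ m² dx`. -/
def Distribution₂.IsProduct [IsManifold (𝓡 d) ∞ M] (μ : VolumeForm d M)
    (u₁ u₂ w : Distribution₂ d M) : Prop :=
  ∀ (κ κ' : OpenPartialHomeomorph M (EuclideanSpace ℝ (Fin d)))
    (hκ : κ ∈ IsManifold.maximalAtlas (𝓡 d) ∞ M) (hκ' : κ' ∈ IsManifold.maximalAtlas (𝓡 d) ∞ M),
    ∀ p ∈ (κ.prod κ').source, ∃ V : Set (M × M), IsOpen V ∧ p ∈ V ∧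
      ∃ hV : V ⊆ (κ.prod κ').source,
      ∀ (φ ψ : M × M → ℂ) (hφ : φ ∈ TestFunctions₂ d M) (hψ : ψ ∈ TestFunctions₂ d M)
        (hφV : tsupport φ ⊆ V) (hψV : tsupport ψ ⊆ V),
        MeasureTheory.Integrable (fun k =>
          u₁.localFourier (IsManifold.mem_maximalAtlas_prod hκ hκ') hφ (hφV.trans hV) k *
          u₂.localFourier (IsManifold.mem_maximalAtlas_prod hκ hκ') hψ (hψV.trans hV) (-k)) ∧
        w.toLin ⟨_, mul_density_mem μ hκ hκ' hφ hψ (hφV.trans hV)⟩ =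
          ((2 * Real.pi : ℝ) : ℂ)⁻¹ ^ (2 * d) * ∫ k,
          u₁.localFourier (IsManifold.mem_maximalAtlas_prod hκ hκ') hφ (hφV.trans hV) k *
          u₂.localFourier (IsManifold.mem_maximalAtlas_prod hκ hκ') hψ (hψV.trans hV) (-k)

end Manifold

end

noncomputable section

open scoped ContDiff Manifold SchwartzMap FourierTransform ENNReal InnerProductSpace Topology
open MeasureTheory Filter

set_option linter.unusedSectionVars false


/-! ### Fourier representation of functionals of finite order -/

section Euclidean

variable {W : Type*} [NormedAddCommGroup W] [InnerProductSpace ℝ W] [FiniteDimensional ℝ W]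
  [MeasurableSpace W] [BorelSpace W]

/-! A product of distributions is a local matter, so it is studied near a point of `M × M` in a
chart. There a localised distribution is represented by its Fourier transform, a continuous function
of polynomial growth (`fourier_representation`). If, over a cone of frequencies, the transform of
`u₁` lies in a weighted `L²` space of order `s` and the reflected transform of `u₂` in one of order
`t`, with `s + t ≥ 0`, then the Cauchy-Schwarz inequality makes their product integrable over that
cone. Compactness of the unit sphere reduces all directions to finitely many such cones
(`exists_pairData`).

The hypothesis, however, provides a separate chart, cutoff and cone for every covector, so
microlocal Sobolev regularity has to be carried from chart to chart, with constants
(`exists_sobolevSq_changeOfVariables`). On the Fourier side a change of chart and cutoff is an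
integral operator whose kernel `oscKernel` is an oscillatory integral. Where its phase is not
stationary the kernel decays rapidly in both frequencies. The remaining pairs `(k, l)` have `k` in
the given cone and `k`, `l` of comparable size; on a dyadic shell the Sobolev weights are then
constant up to a factor, and the `L²` bound supplied by Plancherel's theorem is enough.

For existence, the Fourier transform of the localised `u₁` is truncated to large balls. This gives
smooth functions, which a partition of unity glues to global smooth functions `A R`
(`exists_global_approximation`). The pairing is continuous in the Sobolev norms, in which the tails
of the truncation tend to zero. Hence `u₂ (F · A R)` converges for every test function `F`; the
limit is linear and of finite order, and locally it is the Fourier integral. Since `A R` does not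
refer to the chart in which the pairing is computed, the local integrals fit together. Uniqueness
holds because each test function is a finite sum of functions `φ ψ m` with small supports.

Positivity is proved on the frequency side. A test function `f` is cut into pieces `a i` such that
all pairs of pieces are admissible for the local product formula. Then `w (f̄ ⊗ f)` is an integral
over pairs of frequencies of a kernel which, evaluated at finitely many frequencies, gives a sum of
products of entries of two positive semidefinite matrices, one from `u₁` and one from `u₂`. By the
Schur product theorem this kernel is of positive type (`sum_sesq_mul_sesq_nonneg`). The double
integral of such a kernel is nonnegative, as averaging over independent random points shows
(`integral_prod_nonneg_of_sum_nonneg`). -/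

theorem SchwartzMap.norm_iteratedFDeriv_le_integral_fourierInv (F : 𝓢(W, ℂ)) (j : ℕ) (x : W) :
    ‖iteratedFDeriv ℝ j F x‖ ≤
      (2 * Real.pi) ^ j * (j + 1) * ∫ k, (1 + ‖k‖) ^ j * ‖(𝓕⁻ F) k‖ := by
  have hF : (F : W → ℂ) = 𝓕 ((𝓕⁻ F : 𝓢(W, ℂ)) : W → ℂ) := by
    rw [← SchwartzMap.fourier_coe, FourierTransform.fourier_fourierInv_eq]
  set G : 𝓢(W, ℂ) := 𝓕⁻ F
  have hint : ∀ k n : ℕ, Integrable (fun v => ‖v‖ ^ k * ‖iteratedFDeriv ℝ n G v‖) volume :=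
    fun k n => G.integrable_pow_mul_iteratedFDeriv volume k n
  have h := Real.pow_mul_norm_iteratedFDeriv_fourier_le (f := (G : W → ℂ)) (K := ⊤) (N := 0)
    (G.smooth 0) (fun k n _ _ => hint k n) (k := j) (n := 0) le_top le_rfl x
  rw [hF]
  have hj : Integrable (fun k => (1 + ‖k‖) ^ j * ‖G k‖) volume := by
    have : ∀ k, (1 + ‖k‖) ^ j * ‖G k‖ = ∑ i ∈ Finset.range (j + 1),
        (‖k‖ ^ i * ‖iteratedFDeriv ℝ 0 G k‖) * (j.choose i) := by
      intro k
      rw [add_comm, add_pow, Finset.sum_mul]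
      simp only [one_pow, mul_one, norm_iteratedFDeriv_zero]
      exact Finset.sum_congr rfl fun i _ => by ring
    simp_rw [this]
    exact integrable_finsetSum _ fun i _ => (hint i 0).mul_const _
  simp only [pow_zero, one_mul, mul_one, zero_add, Finset.range_one, Finset.product_singleton,
    Finset.sum_map, Function.Embedding.coeFn_mk, norm_iteratedFDeriv_zero] at h
  refine h.trans ?_
  rw [mul_assoc]
  gcongr
  -- All moments of order at most `j` are dominated by the same integral, whence the factor `j + 1`.
  calc ∑ i ∈ Finset.range (j + 1), ∫ v, ‖v‖ ^ i * ‖G v‖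
      ≤ ∑ i ∈ Finset.range (j + 1), ∫ v, (1 + ‖v‖) ^ j * ‖G v‖ := by
        refine Finset.sum_le_sum fun i hi => integral_mono ?_ hj fun v => ?_
        · simpa using hint i 0
        · have h1 : ‖v‖ ^ i ≤ (1 + ‖v‖) ^ j :=
            (pow_le_pow_left₀ (norm_nonneg _) (by linarith) i).trans
              (pow_le_pow_right₀ (by linarith [norm_nonneg v])
                (by simpa [Nat.lt_succ_iff] using hi))
          exact mul_le_mul_of_nonneg_right h1 (norm_nonneg _)
    _ = _ := by simp

/-- The weight `(1 + ‖k‖²)ⁿ`. -/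
def japaneseWeight (n : ℕ) (k : W) : ℂ := ((1 + ‖k‖ ^ 2 : ℝ) : ℂ) ^ n

theorem norm_japaneseWeight (n : ℕ) (k : W) :
    ‖japaneseWeight n k‖ = (1 + ‖k‖ ^ 2) ^ n := by
  unfold japaneseWeight
  rw [norm_pow, Complex.norm_real, Real.norm_of_nonneg (by positivity)]

theorem hasTemperateGrowth_japaneseWeight (n : ℕ) :
    (japaneseWeight n : W → ℂ).HasTemperateGrowth := by
  unfold japaneseWeight
  fun_prop

variable (W) in
/-- The map `F ↦ (1 + ‖k‖²)ⁿ 𝓕⁻ F` from Schwartz functions to `L²`. -/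
def weightedFourierInvL2 (n : ℕ) : 𝓢(W, ℂ) →L[ℂ] Lp ℂ 2 (volume : Measure W) :=
  SchwartzMap.toLpCLM ℂ ℂ 2 volume ∘L SchwartzMap.smulLeftCLM ℂ (japaneseWeight n) ∘L
    FourierTransform.fourierInvCLM ℂ 𝓢(W, ℂ)

theorem weightedFourierInvL2_ae (n : ℕ) (F : 𝓢(W, ℂ)) :
    weightedFourierInvL2 W n F =ᵐ[volume] fun k => japaneseWeight n k * (𝓕⁻ F) k := by
  refine (SchwartzMap.coeFn_toLp _ 2 volume).trans (ae_of_all _ fun k => ?_)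
  simp [SchwartzMap.smulLeftCLM_apply_apply (hasTemperateGrowth_japaneseWeight n)]

theorem one_add_norm_le_two_mul (k : W) : 1 + ‖k‖ ≤ 2 * (1 + ‖k‖ ^ 2) := by
  nlinarith [sq_nonneg (‖k‖ - 1), sq_nonneg ‖k‖]

variable (W) in
-- Sobolev embedding by Cauchy-Schwarz on the Fourier side. Of the `n = m + r` powers of the weight,
-- `m` absorb the derivatives, and the other `r = dim + 1` leave an inverse weight that is square
-- integrable.
theorem exists_norm_iteratedFDeriv_le_weightedL2 (m : ℕ) :
    ∃ (C : ℝ) (n : ℕ), 0 ≤ C ∧ ∀ F : 𝓢(W, ℂ), ∀ j ≤ m, ∀ x,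
      ‖iteratedFDeriv ℝ j F x‖ ≤ C * ‖weightedFourierInvL2 W n F‖ := by
  set r := Module.finrank ℝ W + 1
  set n := m + r
  set v : W → ℝ := fun k => ((1 + ‖k‖ ^ 2) ^ r)⁻¹
  have hv0 : ∀ k, 0 ≤ v k := fun k => by positivity
  have hvint : Integrable (fun k => v k ^ 2) (volume : Measure W) := by
    have h := integrable_rpow_neg_one_add_norm_sq (E := W) (μ := volume) (r := (2 * r : ℕ))
      (by push_cast [r]; linarith [(Nat.cast_nonneg (Module.finrank ℝ W) : (0 : ℝ) ≤ _)])
    refine h.mono' ?_ (ae_of_all _ fun k => ?_)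
    · exact (by fun_prop : Measurable _).aestronglyMeasurable
    · have h1 : (1 : ℝ) ≤ 1 + ‖k‖ ^ 2 := by nlinarith [sq_nonneg ‖k‖]
      rw [Real.norm_of_nonneg (by positivity)]
      have : (1 + ‖k‖ ^ 2) ^ (-((2 * r : ℕ) : ℝ) / 2) = v k := by
        rw [show (-((2 * r : ℕ) : ℝ) / 2) = -(r : ℝ) by push_cast; ring,
          Real.rpow_neg (by positivity), Real.rpow_natCast]
      rw [this]
      have h2 : v k ≤ 1 := inv_le_one_of_one_le₀ (one_le_pow₀ h1)
      nlinarith [hv0 k]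
  have hvm : MemLp v (ENNReal.ofReal 2) volume := by
    rw [ENNReal.ofReal_ofNat, memLp_two_iff_integrable_sq]
    · exact hvint
    · exact (by fun_prop : Measurable v).aestronglyMeasurable
  set K := (∫ k, v k ^ (2 : ℝ)) ^ (1 / (2 : ℝ))
  refine ⟨(2 * Real.pi) ^ m * (m + 1) * (2 ^ m * K), n, by positivity, fun F j hj x => ?_⟩
  refine (F.norm_iteratedFDeriv_le_integral_fourierInv j x).trans ?_
  set G : 𝓢(W, ℂ) := 𝓕⁻ F
  set A := weightedFourierInvL2 W n F
  have hA : MemLp (fun k => ‖A k‖) (ENNReal.ofReal 2) volume := by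
    rw [ENNReal.ofReal_ofNat]; exact (Lp.memLp A).norm
  have hA2 : (∫ k, ‖A k‖ ^ (2 : ℝ)) ^ (1 / (2 : ℝ)) = ‖A‖ := by
    rw [Lp.norm_def, (Lp.memLp A).eLpNorm_eq_integral_rpow_norm (by norm_num) (by norm_num),
      ENNReal.toReal_ofReal (by positivity)]
    simp
  have hle : ∀ᵐ k, (1 + ‖k‖) ^ j * ‖G k‖ ≤ 2 ^ m * (v k * ‖A k‖) := by
    filter_upwards [weightedFourierInvL2_ae n F] with k hk
    have h1 : (1 : ℝ) ≤ 1 + ‖k‖ := by linarith [norm_nonneg k]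
    have h2 : (1 + ‖k‖) ^ j ≤ 2 ^ m * (1 + ‖k‖ ^ 2) ^ m := by
      rw [← mul_pow]
      exact (pow_le_pow_right₀ h1 hj).trans
        (pow_le_pow_left₀ (by positivity) (one_add_norm_le_two_mul k) m)
    have h3 : v k * ‖A k‖ = (1 + ‖k‖ ^ 2) ^ m * ‖G k‖ := by
      rw [show A k = _ from hk, norm_mul, norm_japaneseWeight]
      simp only [v, n, pow_add]
      field_simp
      rfl
    rw [h3, ← mul_assoc]
    exact mul_le_mul_of_nonneg_right h2 (norm_nonneg _)
  have hint : Integrable (fun k => v k * ‖A k‖) volume := by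
    rw [ENNReal.ofReal_ofNat] at hvm hA
    exact hvm.integrable_mul hA
  have key : ∫ k, (1 + ‖k‖) ^ j * ‖G k‖ ≤ 2 ^ m * (K * ‖A‖) := by
    calc ∫ k, (1 + ‖k‖) ^ j * ‖G k‖ ≤ ∫ k, 2 ^ m * (v k * ‖A k‖) :=
          integral_mono_of_nonneg (ae_of_all _ fun k => by positivity) (hint.const_mul _) hle
      _ = 2 ^ m * ∫ k, v k * ‖A k‖ := integral_const_mul _ _
      _ ≤ _ := by
        gcongr
        have := integral_mul_le_Lp_mul_Lq_of_nonneg (μ := (volume : Measure W))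
          Real.HolderConjugate.two_two
          (ae_of_all _ hv0) (ae_of_all _ fun k => norm_nonneg (A k)) hvm hA
        rwa [hA2] at this
  calc (2 * Real.pi) ^ j * (j + 1) * ∫ k, (1 + ‖k‖) ^ j * ‖G k‖
      ≤ (2 * Real.pi) ^ m * (m + 1) * (2 ^ m * (K * ‖A‖)) := by
        have h2 : (1 : ℝ) ≤ 2 * Real.pi := by linarith [Real.pi_gt_three]
        have h3 : (2 * Real.pi) ^ j ≤ (2 * Real.pi) ^ m := pow_le_pow_right₀ h2 hj
        have h4 : (j : ℝ) ≤ m := by exact_mod_cast hj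
        have h0 : 0 ≤ ∫ k, (1 + ‖k‖) ^ j * ‖G k‖ := integral_nonneg fun k => by positivity
        exact mul_le_mul (mul_le_mul h3 (by linarith) (by positivity) (by positivity)) key h0
          (by positivity)
    _ = _ := by ring

/-- A linear functional on Schwartz functions of finite order without growth is represented by a
function of polynomially bounded `L²` norm on the Fourier side. -/
theorem exists_representation_of_order {L : 𝓢(W, ℂ) →ₗ[ℂ] ℂ} {C : ℝ} {m : ℕ}
    (hL : ∀ (F : 𝓢(W, ℂ)) (B : ℝ), (∀ j ≤ m, ∀ x, ‖iteratedFDeriv ℝ j F x‖ ≤ B) →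
      ‖L F‖ ≤ C * B) :
    ∃ (n : ℕ) (g : Lp ℂ 2 (volume : Measure W)), ∀ F,
      L F = ∫ k, inner ℂ (g k) (japaneseWeight n k * (𝓕⁻ F) k) := by
  obtain ⟨C', n, hC', h⟩ := exists_norm_iteratedFDeriv_le_weightedL2 W m
  set A : 𝓢(W, ℂ) →ₗ[ℂ] Lp ℂ 2 (volume : Measure W) := (weightedFourierInvL2 W n).toLinearMap
  have hLA : ∀ F, ‖L F‖ ≤ C * C' * ‖A F‖ := fun F => by
    rw [mul_assoc]; exact hL F _ fun j hj x => h F j hj x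
  -- A linear section of `A` over its range lets `L` descend to that range: by `hLA`, `L` vanishes
  -- on the kernel of `A`, so the choice of the section is immaterial. The theorems of Hahn-Banach
  -- and Riesz then produce `g`.
  obtain ⟨s, hs⟩ := A.rangeRestrict.exists_rightInverse_of_surjective
    (LinearMap.range_eq_top.2 A.surjective_rangeRestrict)
  have hs' : ∀ y : LinearMap.range A, A (s y) = y := fun y => by
    have := congrArg (fun f => (f y : Lp ℂ 2 (volume : Measure W))) hs
    simpa using this
  let ℓ : StrongDual ℂ (LinearMap.range A) := (L ∘ₗ s).mkContinuous (C * C') fun y => by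
    have := hLA (s y)
    rwa [hs' y] at this
  obtain ⟨ℓ', hℓ', -⟩ := exists_extension_norm_eq (LinearMap.range A) ℓ
  set g := (InnerProductSpace.toDual ℂ (Lp ℂ 2 (volume : Measure W))).symm ℓ'
  refine ⟨n, g, fun F => ?_⟩
  have h1 : L F = ℓ' (A F) := by
    rw [show A F = ((⟨A F, F, rfl⟩ : LinearMap.range A) : Lp ℂ 2 (volume : Measure W)) from rfl,
      hℓ']
    change L F = L (s _)
    rw [← sub_eq_zero, ← map_sub]
    have h2 := hLA (F - s ⟨A F, F, rfl⟩)
    rw [map_sub A, hs', sub_self, norm_zero, mul_zero] at h2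
    exact norm_le_zero_iff.1 h2
  have h2 : ℓ' (A F) = inner ℂ g (A F) :=
    (InnerProductSpace.toDual_symm_apply (𝕜 := ℂ) (x := A F) (y := ℓ')).symm
  rw [h1, h2, L2.inner_def]
  refine integral_congr_ae ?_
  filter_upwards [weightedFourierInvL2_ae n F] with k hk
  rw [show (A F) k = _ from hk]

/-- Peetre's inequality: growth in `l` is exchanged for growth in `k`, at the expense of the decay
of a function of `l - k`. -/
theorem one_add_norm_sq_le_mul_sub (k l : W) :
    1 + ‖l‖ ^ 2 ≤ 2 * (1 + ‖k‖ ^ 2) * (1 + ‖l - k‖ ^ 2) := by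
  have h : ‖l‖ ≤ ‖k‖ + ‖l - k‖ := by
    simpa using norm_add_le k (l - k)
  nlinarith [sq_nonneg (‖k‖ - ‖l - k‖), mul_nonneg (sq_nonneg ‖k‖) (sq_nonneg ‖l - k‖),
    mul_self_le_mul_self (norm_nonneg l) h, sq_nonneg ‖k‖, sq_nonneg ‖l - k‖]

theorem SchwartzMap.exists_norm_le_weight (Θ : 𝓢(W, ℂ)) (M : ℕ) :
    ∃ C, 0 ≤ C ∧ ∀ y, ‖Θ y‖ * (1 + ‖y‖ ^ 2) ^ M ≤ C := by
  refine ⟨SchwartzMap.seminorm ℝ 0 0 (SchwartzMap.smulLeftCLM ℂ (japaneseWeight M) Θ),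
    apply_nonneg _ _, fun y => ?_⟩
  have := SchwartzMap.norm_le_seminorm ℝ (SchwartzMap.smulLeftCLM ℂ (japaneseWeight M) Θ) y
  rwa [SchwartzMap.smulLeftCLM_apply_apply (hasTemperateGrowth_japaneseWeight M), norm_smul,
    norm_japaneseWeight, mul_comm] at this

variable (W) in
theorem integrable_inv_weight {r : ℕ} (hr : Module.finrank ℝ W < r) :
    Integrable (fun k : W => ((1 + ‖k‖ ^ 2) ^ r)⁻¹) (volume : Measure W) := by
  have h := integrable_rpow_neg_one_add_norm_sq (E := W) (μ := volume) (r := (2 * r : ℕ))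
    (by push_cast; linarith [(Nat.cast_lt (α := ℝ)).2 hr, (Nat.cast_nonneg r : (0 : ℝ) ≤ _)])
  refine h.congr (ae_of_all _ fun k => ?_)
  dsimp only
  rw [show (-((2 * r : ℕ) : ℝ) / 2) = -(r : ℝ) by push_cast; ring,
    Real.rpow_neg (by positivity), Real.rpow_natCast]

variable (W) in
theorem memLp_inv_weight {r : ℕ} (hr : Module.finrank ℝ W < r) :
    MemLp (fun k : W => ((1 + ‖k‖ ^ 2) ^ r)⁻¹) 2 (volume : Measure W) := by
  rw [memLp_two_iff_integrable_sq (by fun_prop : Measurable _).aestronglyMeasurable]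
  refine (integrable_inv_weight W hr).mono' (by fun_prop : Measurable _).aestronglyMeasurable
    (ae_of_all _ fun k => ?_)
  have h1 : (1 : ℝ) ≤ 1 + ‖k‖ ^ 2 := by nlinarith [sq_nonneg ‖k‖]
  have h2 : ((1 + ‖k‖ ^ 2) ^ r)⁻¹ ≤ 1 := inv_le_one_of_one_le₀ (one_le_pow₀ h1)
  have h3 : 0 ≤ ((1 + ‖k‖ ^ 2) ^ r)⁻¹ := by positivity
  rw [Real.norm_of_nonneg (by positivity)]
  nlinarith

/-- The character `x ↦ e^{-2πi⟨k, x⟩}`. -/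
def planeWave (k x : W) : ℂ := (Real.fourierChar (-(inner ℝ k x)) : ℂ)

@[simp] theorem norm_planeWave (k x : W) : ‖planeWave k x‖ = 1 := Circle.norm_coe _

theorem contDiff_planeWave : ContDiff ℝ ∞ (fun p : W × W => planeWave p.1 p.2) := by
  unfold planeWave
  simp only [Real.fourierChar_apply]
  have h : ContDiff ℝ ∞ (fun p : W × W => -(inner ℝ p.1 p.2)) :=
    (contDiff_fst.inner ℝ contDiff_snd).neg
  exact ((Complex.ofRealCLM.contDiff.comp (contDiff_const.mul h)).mul contDiff_const).cexp

theorem continuous_planeWave : Continuous (fun p : W × W => planeWave p.1 p.2) :=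
  contDiff_planeWave.continuous

/-- The Fourier transform `k ↦ L (θ e^{-2πi⟨k, ·⟩})` of a functional `L` of finite order with
compact support is continuous and of polynomial growth, and it represents `L`. -/
theorem fourier_representation {L : 𝓢(W, ℂ) →ₗ[ℂ] ℂ} {C : ℝ} {m : ℕ}
    (hL : ∀ (F : 𝓢(W, ℂ)) (B : ℝ), (∀ j ≤ m, ∀ x, ‖iteratedFDeriv ℝ j F x‖ ≤ B) →
      ‖L F‖ ≤ C * B) {θ : 𝓢(W, ℂ)}
    (hθ : ∀ F G : 𝓢(W, ℂ), (∀ x, G x = θ x * F x) → L G = L F) {U : W → ℂ}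
    (hU : ∀ k (G : 𝓢(W, ℂ)), (∀ x, G x = θ x * planeWave k x) → U k = L G)
    (hE : ∀ k, ∃ G : 𝓢(W, ℂ), ∀ x, G x = θ x * planeWave k x) :
    Continuous U ∧ (∃ (n : ℕ) (D : ℝ), ∀ k, ‖U k‖ ≤ D * (1 + ‖k‖ ^ 2) ^ n) ∧
      ∀ F : 𝓢(W, ℂ), L F = ∫ k, U k * (𝓕⁻ F) k := by
  obtain ⟨n, g, hg⟩ := exists_representation_of_order hL
  set Θ : 𝓢(W, ℂ) := 𝓕⁻ θ
  -- Multiplication of `θ` by the plane wave of frequency `k` translates its inverse Fourier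
  -- transform by `k`.
  have hUint : ∀ k, U k = ∫ l, inner ℂ (g l) (japaneseWeight n l * Θ (l - k)) := by
    intro k
    obtain ⟨G, hG⟩ := hE k
    rw [hU k G hG, hg]
    congr 1; ext l; congr 2
    rw [SchwartzMap.fourierInv_coe, SchwartzMap.fourierInv_coe, Real.fourierInv_eq,
      Real.fourierInv_eq]
    congr 1; ext x
    rw [hG, Circle.smul_def, Circle.smul_def, inner_sub_right, sub_eq_add_neg,
      AddChar.map_add_eq_mul, planeWave, real_inner_comm k x]
    simp only [smul_eq_mul, Circle.coe_mul]
    ring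
  set r := Module.finrank ℝ W + 1
  obtain ⟨K, hK0, hK⟩ := Θ.exists_norm_le_weight (n + r)
  -- A product of two `L²` functions, hence an integrable majorant in `l`. The price is `r` further
  -- powers of the weight in `k`, by Peetre's inequality.
  set D : W → ℝ := fun l => ((1 + ‖l‖ ^ 2) ^ r)⁻¹ * ‖g l‖
  have hD : Integrable D volume :=
    (memLp_inv_weight W (Nat.lt_succ_self _)).integrable_mul (Lp.memLp g).norm
  have hbound : ∀ k l, ‖inner ℂ (g l) (japaneseWeight n l * Θ (l - k))‖ ≤
      (2 ^ (n + r) * K) * (1 + ‖k‖ ^ 2) ^ (n + r) * D l := by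
    intro k l
    refine (norm_inner_le_norm _ _).trans ?_
    rw [norm_mul, norm_japaneseWeight]
    have h1 := pow_le_pow_left₀ (by positivity) (one_add_norm_sq_le_mul_sub k l) (n + r)
    have h2 := hK (l - k)
    have h3 : (1 + ‖l‖ ^ 2) ^ n * ‖Θ (l - k)‖ ≤
        2 ^ (n + r) * K * (1 + ‖k‖ ^ 2) ^ (n + r) * ((1 + ‖l‖ ^ 2) ^ r)⁻¹ := by
      rw [← div_eq_mul_inv, le_div_iff₀ (by positivity)]
      calc (1 + ‖l‖ ^ 2) ^ n * ‖Θ (l - k)‖ * (1 + ‖l‖ ^ 2) ^ r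
          = ‖Θ (l - k)‖ * (1 + ‖l‖ ^ 2) ^ (n + r) := by rw [pow_add]; ring
        _ ≤ ‖Θ (l - k)‖ * (2 * (1 + ‖k‖ ^ 2) * (1 + ‖l - k‖ ^ 2)) ^ (n + r) := by gcongr
        _ = (2 ^ (n + r) * (1 + ‖k‖ ^ 2) ^ (n + r)) *
              (‖Θ (l - k)‖ * (1 + ‖l - k‖ ^ 2) ^ (n + r)) := by rw [mul_pow, mul_pow]; ring
        _ ≤ (2 ^ (n + r) * (1 + ‖k‖ ^ 2) ^ (n + r)) * K := by gcongr
        _ = _ := by ring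
    calc ‖g l‖ * ((1 + ‖l‖ ^ 2) ^ n * ‖Θ (l - k)‖)
        ≤ ‖g l‖ * (2 ^ (n + r) * K * (1 + ‖k‖ ^ 2) ^ (n + r) * ((1 + ‖l‖ ^ 2) ^ r)⁻¹) := by
          gcongr
      _ = _ := by simp only [D]; ring
  have hcw : Continuous (japaneseWeight n : W → ℂ) := (hasTemperateGrowth_japaneseWeight n).1.continuous
  have hmeas : ∀ k, AEStronglyMeasurable
      (fun l => inner ℂ (g l) (japaneseWeight n l * Θ (l - k))) volume := fun k =>
    (Lp.aestronglyMeasurable g).inner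
      (hcw.mul (Θ.continuous.comp (continuous_id.sub continuous_const))).aestronglyMeasurable
  refine ⟨?_, ⟨n + r, (2 ^ (n + r) * K) * ∫ l, D l, fun k => ?_⟩, fun F => ?_⟩
  · rw [show U = fun k => ∫ l, inner ℂ (g l) (japaneseWeight n l * Θ (l - k)) from funext hUint,
      continuous_iff_continuousAt]
    intro k₀
    have hev : ∀ᶠ k in 𝓝 k₀, (1 + ‖k‖ ^ 2) ^ (n + r) < (1 + ‖k₀‖ ^ 2) ^ (n + r) + 1 :=
      (by fun_prop : Continuous fun k : W => (1 + ‖k‖ ^ 2) ^ (n + r)).continuousAt.eventually_lt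
        continuousAt_const (lt_add_one _)
    refine continuousAt_of_dominated (Eventually.of_forall hmeas)
      (bound := fun l => (2 ^ (n + r) * K) * ((1 + ‖k₀‖ ^ 2) ^ (n + r) + 1) * D l)
      (hev.mono fun k hk => ae_of_all _ fun l => (hbound k l).trans ?_)
      (hD.const_mul _) (ae_of_all _ fun l => ?_)
    · have : 0 ≤ D l := by positivity
      gcongr
    · exact (continuous_const.inner (continuous_const.mul
        (Θ.continuous.comp (continuous_const.sub continuous_id)))).continuousAt
  · rw [hUint]
    refine (norm_integral_le_of_norm_le (hD.const_mul _) (ae_of_all _ (hbound k))).trans ?_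
    rw [integral_const_mul]
    exact le_of_eq (by ring)
  -- By `hθ`, `F` may be replaced by `F θ`. The inverse transform of this product is the convolution
  -- of `Fi` with `Θ`, and Fubini's theorem then reassembles `U`.
  · set Fi : 𝓢(W, ℂ) := 𝓕⁻ F
    set G : 𝓢(W, ℂ) := SchwartzMap.pairing (ContinuousLinearMap.mul ℂ ℂ) F θ
    have hG : ∀ l, (𝓕⁻ G) l = ∫ k, Fi k * Θ (l - k) := by
      intro l
      have h1 : G = 𝓕 (SchwartzMap.convolution (ContinuousLinearMap.mul ℂ ℂ) Fi Θ) := by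
        rw [SchwartzMap.fourier_convolution]
        simp only [Fi, Θ, FourierTransform.fourier_fourierInv_eq]
        rfl
      rw [h1, FourierTransform.fourierInv_fourier_eq, SchwartzMap.convolution_apply]
      rfl
    rw [← hθ F G fun x => by
      simp only [G, SchwartzMap.pairing_apply_apply, ContinuousLinearMap.mul_apply']; ring, hg]
    have hstep : ∀ l, inner ℂ (g l) (japaneseWeight n l * (𝓕⁻ G) l) =
        ∫ k, Fi k * inner ℂ (g l) (japaneseWeight n l * Θ (l - k)) := by
      intro l
      rw [hG]
      simp only [RCLike.inner_apply]
      rw [← integral_const_mul, ← integral_mul_const]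
      congr 1; ext k; ring
    simp_rw [hstep]
    rw [integral_integral_swap]
    · congr 1; ext k
      rw [hUint, integral_const_mul, mul_comm]
    · have hFi : Integrable (fun k => (2 ^ (n + r) * K) * (1 + ‖k‖ ^ 2) ^ (n + r) * ‖Fi k‖)
          volume := by
        have := (SchwartzMap.smulLeftCLM ℂ (japaneseWeight (n + r)) Fi).integrable
          (μ := (volume : Measure W))
        refine (this.norm.const_mul (2 ^ (n + r) * K)).congr (ae_of_all _ fun k => ?_)
        dsimp only
        rw [SchwartzMap.smulLeftCLM_apply_apply (hasTemperateGrowth_japaneseWeight _), norm_smul,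
          norm_japaneseWeight]
        ring
      refine (hD.mul_prod hFi).mono' ?_ (ae_of_all _ fun p => ?_)
      · refine AEStronglyMeasurable.mul
          (Fi.continuous.comp continuous_snd).aestronglyMeasurable ?_
        exact ((Lp.aestronglyMeasurable g).comp_fst).inner ((hcw.comp continuous_fst).mul
          (Θ.continuous.comp (continuous_fst.sub continuous_snd))).aestronglyMeasurable
      · dsimp only [Function.uncurry]
        rw [norm_mul]
        calc ‖Fi p.2‖ * _ ≤ ‖Fi p.2‖ * _ :=
              mul_le_mul_of_nonneg_left (hbound p.2 p.1) (norm_nonneg _)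
          _ = _ := by ring

end Euclidean

/-! ### Plancherel's theorem and `L²` bounds for changes of variables in Fourier space -/

section Euclidean

variable {W : Type*} [NormedAddCommGroup W] [InnerProductSpace ℝ W] [FiniteDimensional ℝ W]
  [MeasurableSpace W] [BorelSpace W]

/-- On `L¹ ∩ L²` the Fourier integral agrees with the `L²` Fourier transform. -/
theorem fourier_toLp_ae_eq {f : W → ℂ} (hf : Integrable f) (hf2 : MemLp f 2) :
    (𝓕 (hf2.toLp f) : Lp ℂ 2 (volume : Measure W)) =ᵐ[volume] 𝓕 f := by
  have hcont : Continuous (𝓕 f) :=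
    VectorFourier.fourierIntegral_continuous Real.continuous_fourierChar
      (continuous_inner : Continuous fun p : W × W => innerₗ W p.1 p.2) hf
  refine ae_eq_of_integral_contDiff_smul_eq ?_ hcont.locallyIntegrable fun g hg hgc => ?_
  · exact (Lp.memLp _).locallyIntegrable (by norm_num)
  · set φ : 𝓢(W, ℂ) := (hgc.comp_left Complex.ofReal_zero).toSchwartzMap
      (Complex.ofRealCLM.contDiff.comp hg : ContDiff ℝ ∞ fun x => (g x : ℂ)) with hφ
    have h1 := congrArg (fun T => T φ) (Lp.fourier_toTemperedDistribution_eq (hf2.toLp f))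
    simp only [Lp.toTemperedDistribution_apply, TemperedDistribution.fourier_apply] at h1
    have hφx : ∀ x, φ x = (g x : ℂ) := fun x => rfl
    calc ∫ x, g x • (𝓕 (hf2.toLp f) : Lp ℂ 2 (volume : Measure W)) x
        = ∫ x, φ x • (𝓕 (hf2.toLp f) : Lp ℂ 2 (volume : Measure W)) x := by
          congr 1
      _ = ∫ x, (𝓕 φ) x • (hf2.toLp f) x := h1.symm
      _ = ∫ x, (𝓕 (φ : W → ℂ)) x • f x := by
          refine integral_congr_ae ?_
          filter_upwards [hf2.coeFn_toLp] with x hx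
          rw [hx, SchwartzMap.fourier_coe]
      _ = ∫ x, φ x • 𝓕 f x := by
          have := VectorFourier.integral_fourierIntegral_smul_eq_flip (μ := volume)
            (ν := (volume : Measure W)) (L := innerₗ W) Real.continuous_fourierChar
            (continuous_inner : Continuous fun p : W × W => innerₗ W p.1 p.2)
            (f := (φ : W → ℂ)) (g := f) φ.integrable hf
          rw [flip_innerₗ] at this
          exact this
      _ = _ := by congr 1

theorem lintegral_enorm_sq_fourier {f : W → ℂ} (hf : Integrable f) (hf2 : MemLp f 2) :
    ∫⁻ x, ‖𝓕 f x‖ₑ ^ 2 = ∫⁻ x, ‖f x‖ₑ ^ 2 := by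
  have key : ∀ g : Lp ℂ 2 (volume : Measure W), ∫⁻ x, ‖g x‖ₑ ^ 2 = ‖g‖ₑ ^ 2 := by
    intro g
    rw [Lp.enorm_def, eLpNorm_eq_lintegral_rpow_enorm_toReal (by norm_num) (by norm_num)]
    rw [← ENNReal.rpow_natCast, ← ENNReal.rpow_mul]
    simp
  calc ∫⁻ x, ‖𝓕 f x‖ₑ ^ 2 = ∫⁻ x, ‖(𝓕 (hf2.toLp f) : Lp ℂ 2 (volume : Measure W)) x‖ₑ ^ 2 := by
        refine lintegral_congr_ae ?_
        filter_upwards [fourier_toLp_ae_eq hf hf2] with x hx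
        rw [hx]
    _ = ∫⁻ x, ‖hf2.toLp f x‖ₑ ^ 2 := by
        rw [key, key, ← ofReal_norm, ← ofReal_norm, Lp.norm_fourier_eq]
    _ = _ := by
        refine lintegral_congr_ae ?_
        filter_upwards [hf2.coeFn_toLp] with x hx
        rw [hx]

theorem memLp_two_of_lintegral_enorm_sq {f : W → ℂ} {μ : Measure W}
    (hf : AEStronglyMeasurable f μ) (h : ∫⁻ x, ‖f x‖ₑ ^ 2 ∂μ < ⊤) : MemLp f 2 μ := by
  refine ⟨hf, ?_⟩
  rw [eLpNorm_lt_top_iff_lintegral_rpow_enorm_lt_top (by norm_num) (by norm_num)]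
  simpa using h

theorem MeasureTheory.MemLp.lintegral_enorm_sq_lt_top {f : W → ℂ} {μ : Measure W}
    (hf : MemLp f 2 μ) : ∫⁻ x, ‖f x‖ₑ ^ 2 ∂μ < ⊤ := by
  have := hf.2
  rw [eLpNorm_lt_top_iff_lintegral_rpow_enorm_lt_top (by norm_num) (by norm_num)] at this
  simpa using this

theorem planeWave_neg_left (k x : W) : planeWave (-k) x = (Real.fourierChar (inner ℝ k x) : ℂ) := by
  simp [planeWave]

theorem fourier_eq_integral_planeWave (f : W → ℂ) (l : W) :
    𝓕 f l = ∫ x, planeWave l x * f x := by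
  rw [Real.fourier_eq]
  congr 1; ext x
  rw [Circle.smul_def, smul_eq_mul, planeWave, real_inner_comm]

theorem fourierInv_eq_integral_planeWave (f : W → ℂ) (l : W) :
    𝓕⁻ f l = ∫ x, planeWave (-l) x * f x := by
  rw [Real.fourierInv_eq]
  congr 1; ext x
  rw [Circle.smul_def, smul_eq_mul, planeWave_neg_left, real_inner_comm]

/-- The kernel `∫ a(x) e^{2πi(⟨k, x⟩ - ⟨l, χ x⟩)} dx` of a change of variables `χ` in Fourier
space. -/
def oscKernel (χ : W → W) (a : W → ℂ) (k l : W) : ℂ :=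
  ∫ x, planeWave (-k) x * (a x * planeWave l (χ x))

/-- By Fubini, the operator with this kernel is a composition: inverse Fourier transform,
multiplication by `a`, then a Fourier integral with `χ x` in place of `x`. Both the `L²` bound and
the comparison of approximations in two charts start from this form. -/
theorem integral_mul_oscKernel {χ : W → W} (hχ : Continuous χ) {a : W → ℂ} (ha : Integrable a)
    {h : W → ℂ} (hh : Integrable h) (l : W) :
    ∫ k, h k * oscKernel χ a k l = ∫ x, a x * 𝓕⁻ h x * planeWave l (χ x) := by
  unfold oscKernel
  simp_rw [← integral_const_mul]
  rw [integral_integral_swap]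
  · congr 1; ext x
    rw [fourierInv_eq_integral_planeWave, ← integral_const_mul, ← integral_mul_const]
    congr 1; ext k
    rw [planeWave_neg_left, planeWave_neg_left, real_inner_comm]
    ring
  · refine (hh.mul_prod ha).mono ?_ (ae_of_all _ fun p => ?_)
    · refine hh.1.comp_fst.mul (AEStronglyMeasurable.mul ?_ (ha.1.comp_snd.mul ?_))
      · exact (continuous_planeWave.comp
          (continuous_fst.neg.prodMk continuous_snd)).aestronglyMeasurable
      · exact (continuous_planeWave.comp
          (continuous_const.prodMk (hχ.comp continuous_snd))).aestronglyMeasurable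
    · simp [Function.uncurry]

/-- A smooth map is injective with derivative bounded from below near a point where its
derivative is invertible. -/
theorem exists_open_injOn_det_lower_bound {χ : W → W} (hχ : ContDiff ℝ ∞ χ) {x₀ : W}
    (hdet : (fderiv ℝ χ x₀).det ≠ 0) :
    ∃ U : Set W, IsOpen U ∧ x₀ ∈ U ∧ Set.InjOn χ U ∧ volume U < ⊤ ∧
      ∃ δ > 0, ∀ x ∈ U, δ ≤ |(fderiv ℝ χ x).det| := by
  let e := ContinuousLinearMap.toContinuousLinearEquivOfDetNeZero (fderiv ℝ χ x₀) hdet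
  have hs : HasStrictFDerivAt χ (e : W →L[ℝ] W) x₀ := by
    have := hχ.contDiffAt.hasStrictFDerivAt (x := x₀) (by norm_num)
    convert this
    ext; rfl
  have hc : Continuous fun x => |(fderiv ℝ χ x).det| :=
    (ContinuousLinearMap.continuous_det.comp (hχ.continuous_fderiv (by norm_num))).abs
  set P := hs.toOpenPartialHomeomorph χ
  refine ⟨P.source ∩ {x | |(fderiv ℝ χ x₀).det| / 2 < |(fderiv ℝ χ x).det|} ∩ Metric.ball x₀ 1,
    (P.open_source.inter (isOpen_lt continuous_const hc)).inter Metric.isOpen_ball,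
    ⟨⟨hs.mem_toOpenPartialHomeomorph_source, ?_⟩, by simp⟩, ?_, ?_,
    |(fderiv ℝ χ x₀).det| / 2, by positivity, fun x hx => hx.1.2.le⟩
  · have := abs_pos.2 hdet
    simp only [Set.mem_ofPred_eq]; linarith
  · exact P.injOn.mono fun x hx => hx.1.1
  · exact (measure_mono Set.inter_subset_right).trans_lt measure_ball_lt_top

/-- The substitution `y = χ x` turns the integral into an honest Fourier transform, of `b ∘ χ⁻¹`
divided by the Jacobian. Plancherel's theorem and the inverse substitution leave `|det|⁻¹ |b|²`,
since two Jacobians are divided out and only one is restored; this is where `δ⁻¹` comes from. -/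
theorem lintegral_enorm_sq_changeOfVariables {χ : W → W} (hχ : ContDiff ℝ ∞ χ) {U : Set W}
    (hU : IsOpen U) (hinj : Set.InjOn χ U) {δ : ℝ} (hδ : 0 < δ)
    (hdet : ∀ x ∈ U, δ ≤ |(fderiv ℝ χ x).det|) {b : W → ℂ} (hb : Integrable b)
    (hb2 : MemLp b 2) (hbU : ∀ x ∉ U, b x = 0) :
    ∫⁻ l, ‖∫ x, b x * planeWave l (χ x)‖ₑ ^ 2 ≤ ENNReal.ofReal δ⁻¹ * ∫⁻ x, ‖b x‖ₑ ^ 2 := by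
  set ψ := Function.invFunOn χ U
  have hψ : ∀ x ∈ U, ψ (χ x) = x := fun x hx => hinj.leftInvOn_invFunOn hx
  set G : W → ℂ := fun y => (|(fderiv ℝ χ (ψ y)).det|⁻¹ : ℝ) * b (ψ y)
  have hd : ∀ x ∈ U, HasFDerivWithinAt χ (fderiv ℝ χ x) U x := fun x _ =>
    ((hχ.differentiable (by norm_num)) x).hasFDerivAt.hasFDerivWithinAt
  have hpos : ∀ x ∈ U, 0 < |(fderiv ℝ χ x).det| := fun x hx => hδ.trans_le (hdet x hx)
  have himg : MeasurableSet (χ '' U) :=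
    measurable_image_of_fderivWithin hU.measurableSet hd hinj
  have hGint : IntegrableOn G (χ '' U) volume := by
    rw [integrableOn_image_iff_integrableOn_abs_det_fderiv_smul volume hU.measurableSet hd hinj]
    refine hb.integrableOn.congr_fun (fun x hx => ?_) hU.measurableSet
    have := (hpos x hx).ne'
    simp only [G, hψ x hx, Complex.real_smul, ← mul_assoc, ← Complex.ofReal_mul]
    rw [mul_inv_cancel₀ this]; simp
  have hG2 : ∫⁻ y in χ '' U, ‖G y‖ₑ ^ 2 ≤ ENNReal.ofReal δ⁻¹ * ∫⁻ x, ‖b x‖ₑ ^ 2 := by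
    rw [lintegral_image_eq_lintegral_abs_det_fderiv_mul volume hU.measurableSet hd hinj,
      ← lintegral_const_mul' _ _ ENNReal.ofReal_ne_top]
    refine (setLIntegral_mono' hU.measurableSet fun x hx => ?_).trans
      (setLIntegral_le_lintegral U _)
    have h0 := hpos x hx
    simp only [G, hψ x hx]
    rw [enorm_mul, mul_pow, ← mul_assoc]
    gcongr
    rw [← ofReal_norm, Complex.norm_real, ← ENNReal.ofReal_pow (norm_nonneg _),
      ← ENNReal.ofReal_mul h0.le]
    refine ENNReal.ofReal_le_ofReal ?_
    rw [Real.norm_of_nonneg (by positivity)]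
    calc |(fderiv ℝ χ x).det| * |(fderiv ℝ χ x).det|⁻¹ ^ 2 = |(fderiv ℝ χ x).det|⁻¹ := by
          field_simp
      _ ≤ δ⁻¹ := inv_anti₀ hδ (hdet x hx)
  have hI : Integrable ((χ '' U).indicator G) volume := (integrable_indicator_iff himg).2 hGint
  have hind : ∀ y, ‖(χ '' U).indicator G y‖ₑ ^ 2 = (χ '' U).indicator (fun y => ‖G y‖ₑ ^ 2) y := by
    intro y
    by_cases hy : y ∈ χ '' U <;> simp [hy]
  have hl2 : ∫⁻ y, ‖(χ '' U).indicator G y‖ₑ ^ 2 = ∫⁻ y in χ '' U, ‖G y‖ₑ ^ 2 := by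
    simp_rw [hind]
    rw [lintegral_indicator himg]
  have hfin : ∫⁻ y, ‖(χ '' U).indicator G y‖ₑ ^ 2 < ⊤ := by
    rw [hl2]
    exact hG2.trans_lt (ENNReal.mul_lt_top ENNReal.ofReal_lt_top hb2.lintegral_enorm_sq_lt_top)
  have hI2 : MemLp ((χ '' U).indicator G) 2 volume := memLp_two_of_lintegral_enorm_sq hI.1 hfin
  have hF : ∀ l, ∫ x, b x * planeWave l (χ x) = 𝓕 ((χ '' U).indicator G) l := by
    intro l
    rw [fourier_eq_integral_planeWave]
    have h1 : ∀ y, planeWave l y * (χ '' U).indicator G y =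
        (χ '' U).indicator (fun y => planeWave l y * G y) y := by
      intro y
      by_cases hy : y ∈ χ '' U <;> simp [hy]
    simp_rw [h1]
    rw [integral_indicator himg,
      integral_image_eq_integral_abs_det_fderiv_smul volume hU.measurableSet hd hinj,
      ← setIntegral_eq_integral_of_forall_compl_eq_zero (s := U) fun x hx => by simp [hbU x hx]]
    refine setIntegral_congr_fun hU.measurableSet fun x hx => ?_
    have := (hpos x hx).ne'
    simp only [G, hψ x hx, Complex.real_smul]
    rw [mul_comm (planeWave l (χ x)), ← mul_assoc, ← mul_assoc, ← Complex.ofReal_mul,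
      mul_inv_cancel₀ this]; simp
  simp_rw [hF]
  rw [lintegral_enorm_sq_fourier hI hI2, hl2]
  exact hG2

theorem integrable_mul_fourierInv {a h : W → ℂ} (ha : Integrable a)
    (hh : Integrable h) : Integrable (fun x => a x * 𝓕⁻ h x) := by
  have hc : Continuous (𝓕⁻ h) := by
    have : 𝓕⁻ h = fun x => 𝓕 h (-x) := funext fun x => Real.fourierInv_eq_fourier_neg h x
    rw [this]
    exact (VectorFourier.fourierIntegral_continuous Real.continuous_fourierChar
      (continuous_inner : Continuous fun p : W × W => innerₗ W p.1 p.2) hh).comp continuous_neg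
  refine ha.mul_bdd (c := ∫ k, ‖h k‖) hc.aestronglyMeasurable (ae_of_all _ fun x => ?_)
  rw [fourierInv_eq_integral_planeWave]
  exact (norm_integral_le_integral_norm _).trans (le_of_eq (by simp))

theorem lintegral_enorm_sq_fourierInv {f : W → ℂ} (hf : Integrable f) (hf2 : MemLp f 2) :
    ∫⁻ x, ‖𝓕⁻ f x‖ₑ ^ 2 = ∫⁻ x, ‖f x‖ₑ ^ 2 := by
  simp_rw [Real.fourierInv_eq_fourier_neg]
  rw [← lintegral_enorm_sq_fourier hf hf2]
  exact (Measure.measurePreserving_neg volume).lintegral_comp_emb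
    (Homeomorph.neg W).measurableEmbedding (fun x => ‖𝓕 f x‖ₑ ^ 2)

/-- The operator with kernel `oscKernel χ a` is bounded on `L²` for `a` supported near a point
where `χ` is a local diffeomorphism. -/
theorem exists_oscKernel_L2_bound {χ : W → W} (hχ : ContDiff ℝ ∞ χ) {x₀ : W}
    (hdet : (fderiv ℝ χ x₀).det ≠ 0) :
    ∃ U ∈ 𝓝 x₀, ∃ C : ℝ≥0∞, C < ⊤ ∧ ∀ a : W → ℂ, Continuous a → (∀ x ∉ U, a x = 0) →
      ∀ B : ℝ, (∀ x, ‖a x‖ ≤ B) → ∀ h : W → ℂ, Integrable h → MemLp h 2 →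
      ∫⁻ l, ‖∫ k, h k * oscKernel χ a k l‖ₑ ^ 2 ≤
        C * ENNReal.ofReal B ^ 2 * ∫⁻ k, ‖h k‖ₑ ^ 2 := by
  obtain ⟨U, hU, hx₀, hinj, hvol, δ, hδ, hd⟩ := exists_open_injOn_det_lower_bound hχ hdet
  refine ⟨U, hU.mem_nhds hx₀, ENNReal.ofReal δ⁻¹, ENNReal.ofReal_lt_top,
    fun a ha haU B hB h hh hh2 => ?_⟩
  have haint : Integrable a := by
    have h1 : IntegrableOn a U volume :=
      Measure.integrableOn_of_bounded hvol.ne ha.aestronglyMeasurable (ae_of_all _ hB)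
    exact h1.integrable_of_forall_notMem_eq_zero haU
  have hbint := integrable_mul_fourierInv haint hh
  have hble : ∫⁻ x, ‖a x * 𝓕⁻ h x‖ₑ ^ 2 ≤ ENNReal.ofReal B ^ 2 * ∫⁻ k, ‖h k‖ₑ ^ 2 := by
    rw [← lintegral_enorm_sq_fourierInv hh hh2, ← lintegral_const_mul' _ _ (by finiteness)]
    refine lintegral_mono fun x => ?_
    rw [enorm_mul, mul_pow]
    gcongr
    rw [← ofReal_norm]
    exact ENNReal.ofReal_le_ofReal (hB x)
  have hb2 : MemLp (fun x => a x * 𝓕⁻ h x) 2 :=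
    memLp_two_of_lintegral_enorm_sq hbint.1 (hble.trans_lt
      (ENNReal.mul_lt_top (by finiteness) hh2.lintegral_enorm_sq_lt_top))
  simp_rw [integral_mul_oscKernel hχ.continuous haint hh]
  refine (lintegral_enorm_sq_changeOfVariables hχ hU hinj hδ hd hbint hb2
    fun x hx => by simp [haU x hx]).trans ?_
  rw [mul_assoc]
  gcongr

end Euclidean

/-! ### The method of non-stationary phase -/

section Euclidean

variable {W : Type*} [NormedAddCommGroup W] [InnerProductSpace ℝ W] [FiniteDimensional ℝ W]
  [MeasurableSpace W] [BorelSpace W]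

/-- The oscillating factor `e^{2πi(⟨k, x⟩ - ⟨l, χ x⟩)}`. -/
def oscPhase (χ : W → W) (p : W × W) (x : W) : ℂ := planeWave (-p.1) x * planeWave p.2 (χ x)

/-- Up to sign, the derivative of the phase `⟨k, x⟩ - ⟨l, χ x⟩` in the direction `e`. -/
def phaseDeriv (χ : W → W) (e : W) (q : (W × W) × W) : ℝ :=
  inner ℝ q.1.2 (fderiv ℝ χ q.2 e) - inner ℝ q.1.1 e

@[simp] theorem norm_oscPhase (χ : W → W) (p : W × W) (x : W) : ‖oscPhase χ p x‖ = 1 := by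
  simp [oscPhase]

theorem oscKernel_eq_integral_oscPhase (χ : W → W) (a : W → ℂ) (p : W × W) :
    oscKernel χ a p.1 p.2 = ∫ x, a x * oscPhase χ p x := by
  unfold oscKernel oscPhase
  congr 1; ext x; ring

theorem contDiff_phaseDeriv {χ : W → W} (hχ : ContDiff ℝ ∞ χ) (e : W) :
    ContDiff ℝ ∞ (phaseDeriv χ e) := by
  unfold phaseDeriv
  have h1 : ContDiff ℝ ∞ (fun q : (W × W) × W => fderiv ℝ χ q.2 e) :=
    ((hχ.fderiv_right (m := ∞) (by simp)).comp contDiff_snd).clm_apply contDiff_const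
  exact ((contDiff_snd.comp contDiff_fst).inner ℝ h1).sub
    ((contDiff_fst.comp contDiff_fst).inner ℝ contDiff_const)

theorem contDiff_oscPhase {χ : W → W} (hχ : ContDiff ℝ ∞ χ) (p : W × W) :
    ContDiff ℝ ∞ (oscPhase χ p) :=
  (contDiff_planeWave.comp (contDiff_const.prodMk contDiff_id)).mul
    (contDiff_planeWave.comp (contDiff_const.prodMk hχ))

theorem fderiv_oscPhase {χ : W → W} (hχ : ContDiff ℝ ∞ χ) (p : W × W) (x e : W) :
    fderiv ℝ (oscPhase χ p) x e =
      -(2 * Real.pi * Complex.I) * (phaseDeriv χ e (p, x) : ℝ) * oscPhase χ p x := by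
  have hE : oscPhase χ p = fun x => Complex.exp
      (((2 * Real.pi * (inner ℝ p.1 x - inner ℝ p.2 (χ x)) : ℝ) : ℂ) * Complex.I) := by
    ext y
    simp only [oscPhase, planeWave, Real.fourierChar_apply, ← Complex.exp_add, inner_neg_left]
    congr 1; push_cast; ring
  have hd : HasFDerivAt χ (fderiv ℝ χ x) x := ((hχ.differentiable (by norm_num)) x).hasFDerivAt
  have hr : HasFDerivAt (fun x => 2 * Real.pi * (inner ℝ p.1 x - inner ℝ p.2 (χ x)))
      ((2 * Real.pi) • (innerSL ℝ p.1 - (innerSL ℝ p.2).comp (fderiv ℝ χ x))) x :=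
    (((innerSL ℝ p.1).hasFDerivAt).sub ((innerSL ℝ p.2).hasFDerivAt.comp x hd)).const_mul _
  have h := ((Complex.ofRealCLM.hasFDerivAt.comp x hr).mul_const Complex.I).cexp
  rw [hE]
  rw [HasFDerivAt.fderiv (f := fun x => Complex.exp
      (((2 * Real.pi * (inner ℝ p.1 x - inner ℝ p.2 (χ x)) : ℝ) : ℂ) * Complex.I)) h]
  simp [phaseDeriv]
  ring

theorem contDiff_div_phaseDeriv {χ : W → W} (hχ : ContDiff ℝ ∞ χ) {e : W} {p : W × W}
    {b : W → ℂ} (hb : ContDiff ℝ ∞ b) (hbS : ∀ x ∈ tsupport b, phaseDeriv χ e (p, x) ≠ 0) :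
    ContDiff ℝ ∞ (fun x => b x * ((phaseDeriv χ e (p, x) : ℝ) : ℂ)⁻¹) := by
  rw [contDiff_iff_contDiffAt]
  intro x
  by_cases hx : x ∈ tsupport b
  · refine hb.contDiffAt.mul (ContDiffAt.inv ?_ (by exact_mod_cast hbS x hx))
    exact (Complex.ofRealCLM.contDiff.comp
      ((contDiff_phaseDeriv hχ e).comp (contDiff_const.prodMk contDiff_id))).contDiffAt
  · refine (contDiffAt_const (c := (0 : ℂ))).congr_of_eventuallyEq ?_
    filter_upwards [(isClosed_tsupport b).isOpen_compl.mem_nhds hx] with y hy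
    simp [image_eq_zero_of_notMem_tsupport hy]

/-- The phase is linear in the pair of frequencies, so at `r • p` a derivative along `e` brings down
`r` times the phase derivative at `p`. Dividing `b` by the latter and moving the derivative onto the
quotient therefore gains exactly one power of `r`. -/
theorem oscPhase_integral_by_parts {χ : W → W} (hχ : ContDiff ℝ ∞ χ) {e : W} {p : W × W}
    {b : W → ℂ} (hb : ContDiff ℝ ∞ b) (hbc : HasCompactSupport b)
    (hbS : ∀ x ∈ tsupport b, phaseDeriv χ e (p, x) ≠ 0) (r : ℝ) :
    (r : ℂ) * ∫ x, b x * oscPhase χ (r • p) x = ∫ x, (2 * Real.pi * Complex.I)⁻¹ *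
      fderiv ℝ (fun x => b x * ((phaseDeriv χ e (p, x) : ℝ) : ℂ)⁻¹) x e *
        oscPhase χ (r • p) x := by
  set f : W → ℂ := fun x => b x * ((phaseDeriv χ e (p, x) : ℝ) : ℂ)⁻¹
  have hf : ContDiff ℝ ∞ f := contDiff_div_phaseDeriv hχ hb hbS
  have hfc : HasCompactSupport f := hbc.mul_right
  set E := oscPhase χ (r • p)
  have hE : ContDiff ℝ ∞ E := contDiff_oscPhase hχ _
  have hdf : Continuous fun x => fderiv ℝ f x e := (hf.continuous_fderiv (by norm_num)).clm_apply
    continuous_const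
  have hdE : Continuous fun x => fderiv ℝ E x e := (hE.continuous_fderiv (by norm_num)).clm_apply
    continuous_const
  have hdfc : HasCompactSupport fun x => fderiv ℝ f x e :=
    (hfc.fderiv (𝕜 := ℝ)).comp_left (g := fun T : W →L[ℝ] ℂ => T e) rfl
  have h := integral_mul_fderiv_eq_neg_fderiv_mul_of_integrable (μ := (volume : Measure W))
    (f := f) (g := E) (v := e)
    ((hdf.mul hE.continuous).integrable_of_hasCompactSupport hdfc.mul_right)
    ((hf.continuous.mul hdE).integrable_of_hasCompactSupport hfc.mul_right)
    ((hf.continuous.mul hE.continuous).integrable_of_hasCompactSupport hfc.mul_right)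
    (fun x _ => (hf.differentiable (by norm_num)) x)
    (fun x _ => (hE.differentiable (by norm_num)) x)
  have h1 : ∀ x, f x * fderiv ℝ E x e = -(2 * Real.pi * Complex.I) * r * (b x * E x) := by
    intro x
    simp only [E, f]
    rw [fderiv_oscPhase hχ]
    have h2 : phaseDeriv χ e (r • p, x) = r * phaseDeriv χ e (p, x) := by
      simp [phaseDeriv, inner_smul_left]; ring
    rw [h2]
    by_cases hx : x ∈ tsupport b
    · have : ((phaseDeriv χ e (p, x) : ℝ) : ℂ) ≠ 0 := by exact_mod_cast hbS x hx
      push_cast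
      field_simp
    · simp [image_eq_zero_of_notMem_tsupport hx]
  simp_rw [h1] at h
  rw [integral_const_mul] at h
  have hpi : (2 * Real.pi * Complex.I : ℂ) ≠ 0 := Complex.two_pi_I_ne_zero
  simp_rw [mul_assoc ((2 * Real.pi * Complex.I : ℂ)⁻¹)]
  rw [integral_const_mul, eq_inv_mul_iff_mul_eq₀ hpi]
  linear_combination -h

/-- Repeated integration by parts, with coefficients depending smoothly on the parameters. -/
theorem exists_coeff_integral_by_parts {χ : W → W} (hχ : ContDiff ℝ ∞ χ) (e : W) (M : ℕ) :
    ∃ c : ℕ → (W × W) × W → ℂ, (∀ j, ContDiffOn ℝ ∞ (c j) {q | phaseDeriv χ e q ≠ 0}) ∧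
      ∀ (p : W × W) (a : W → ℂ), ContDiff ℝ ∞ a → HasCompactSupport a →
        (∀ x ∈ tsupport a, phaseDeriv χ e (p, x) ≠ 0) → ∀ r : ℝ,
        (r : ℂ) ^ M * ∫ x, a x * oscPhase χ (r • p) x = ∫ x,
          (∑ j ∈ Finset.range (M + 1), c j (p, x) * iteratedFDeriv ℝ j a x fun _ => e) *
            oscPhase χ (r • p) x := by
  have hSo : IsOpen {q | phaseDeriv χ e q ≠ 0} :=
    isOpen_ne_fun (contDiff_phaseDeriv hχ e).continuous continuous_const
  induction M with
  | zero => exact ⟨fun _ _ => 1, fun _ => contDiffOn_const, by simp⟩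
  | succ M ih =>
    obtain ⟨c, hc, hM⟩ := ih
    set d : ℕ → (W × W) × W → ℂ := fun j q => c j q * ((phaseDeriv χ e q : ℝ) : ℂ)⁻¹
    have hd : ∀ j, ContDiffOn ℝ ∞ (d j) {q | phaseDeriv χ e q ≠ 0} := fun j =>
      (hc j).mul ((Complex.ofRealCLM.contDiff.comp (contDiff_phaseDeriv hχ e)).contDiffOn.inv
        fun q hq => Complex.ofReal_ne_zero.2 hq)
    set π₀ : ℂ := (2 * Real.pi * Complex.I)⁻¹
    -- In one more integration by parts the derivative falls either on the coefficient `d j`, or on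
    -- the `j`-th derivative of `a`, which raises the index by one. The two conditionals discard
    -- indices outside the range of the previous sum.
    set c' : ℕ → (W × W) × W → ℂ := fun j q =>
      π₀ * ((if j ≤ M then fderiv ℝ (d j) q ((0 : W × W), e) else 0) +
        if j = 0 then 0 else d (j - 1) q)
    refine ⟨c', fun j => ?_, fun p a ha hac haS r => ?_⟩
    · refine contDiffOn_const.mul (ContDiffOn.add ?_ ?_)
      · split_ifs
        · exact ((hd j).fderiv_of_isOpen hSo (by simp)).clm_apply contDiffOn_const
        · exact contDiffOn_const
      · split_ifs
        · exact contDiffOn_const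
        · exact hd _
    · set D : ℕ → W → ℂ := fun j x => iteratedFDeriv ℝ j a x fun _ => e
      have hD : ∀ j, ContDiff ℝ ∞ (D j) := fun j =>
        (ContinuousMultilinearMap.apply ℝ (fun _ : Fin j => W) ℂ fun _ => e).contDiff.comp
          (ha.iteratedFDeriv_right (m := ∞) (i := j) (by norm_cast))
      have hDsupp : ∀ j, ∀ x ∉ tsupport a, D j x = 0 := fun j x hx => by
        have := image_eq_zero_of_notMem_tsupport
          (fun h => hx (tsupport_iteratedFDeriv_subset (𝕜 := ℝ) j h))
        simp [D, this]
      have hDsucc : ∀ j x, fderiv ℝ (D j) x e = D (j + 1) x := by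
        intro j x
        have h1 : DifferentiableAt ℝ (iteratedFDeriv ℝ j a) x :=
          (ha.differentiable_iteratedFDeriv (m := j)
            (by exact_mod_cast WithTop.coe_lt_top _)) x
        have h2 : HasFDerivAt (D j) _ x := (ContinuousMultilinearMap.apply ℝ
          (fun _ : Fin j => W) ℂ fun _ => e).hasFDerivAt.comp x h1.hasFDerivAt
        rw [h2.fderiv]
        simp only [D]
        rw [iteratedFDeriv_succ_apply_left]
        rfl
      set b : W → ℂ := fun x => ∑ j ∈ Finset.range (M + 1), c j (p, x) * D j x
      have hbsupp : Function.support b ⊆ tsupport a := by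
        intro x hx
        by_contra h
        exact hx (Finset.sum_eq_zero fun j _ => by simp [hDsupp j x h])
      have hbt : tsupport b ⊆ tsupport a := closure_minimal hbsupp (isClosed_tsupport a)
      have hpair : ContDiff ℝ ∞ (fun y : W => (p, y)) := contDiff_const.prodMk contDiff_id
      have hcat : ∀ (f : (W × W) × W → ℂ), ContDiffOn ℝ ∞ f {q | phaseDeriv χ e q ≠ 0} →
          ∀ x ∈ tsupport a, ContDiffAt ℝ ∞ (fun y => f (p, y)) x := fun f hf x hx =>
        ContDiffAt.comp x (hf.contDiffAt (hSo.mem_nhds (haS x hx))) hpair.contDiffAt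
      have hb : ContDiff ℝ ∞ b := by
        rw [contDiff_iff_contDiffAt]
        intro x
        by_cases hx : x ∈ tsupport a
        · exact ContDiffAt.sum fun j _ => (hcat _ (hc j) x hx).mul (hD j).contDiffAt
        · refine (contDiffAt_const (c := (0 : ℂ))).congr_of_eventuallyEq ?_
          filter_upwards [(isClosed_tsupport a).isOpen_compl.mem_nhds hx] with y hy
          exact Finset.sum_eq_zero fun j _ => by simp [hDsupp j y hy]
      have hbc : HasCompactSupport b := hac.mono' hbsupp
      rw [pow_succ, mul_comm ((r : ℂ) ^ M), mul_assoc, hM p a ha hac haS r]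
      rw [oscPhase_integral_by_parts hχ hb hbc (fun x hx => haS x (hbt hx)) r]
      congr 1; ext x; congr 1
      by_cases hx : x ∈ tsupport a
      · have h1 : (fun x => b x * ((phaseDeriv χ e (p, x) : ℝ) : ℂ)⁻¹) =
            fun x => ∑ j ∈ Finset.range (M + 1), d j (p, x) * D j x := by
          ext y; simp only [b, d]; rw [Finset.sum_mul]
          exact Finset.sum_congr rfl fun j _ => by ring
        have h2 : ∀ j, DifferentiableAt ℝ (fun y => d j (p, y)) x := fun j =>
          (hcat _ (hd j) x hx).differentiableAt (by norm_num)
        have h3 : ∀ j, DifferentiableAt ℝ (D j) x := fun j =>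
          (hD j).differentiable (by norm_num) x
        have h4 : ∀ j, fderiv ℝ (fun y => d j (p, y)) x e = fderiv ℝ (d j) (p, x) (0, e) := by
          intro j
          have h5 : DifferentiableAt ℝ (d j) (p, x) :=
            ((hd j).contDiffAt (hSo.mem_nhds (haS x hx))).differentiableAt (by norm_num)
          have h6 : HasFDerivAt (fun y : W => (p, y)) (ContinuousLinearMap.inr ℝ (W × W) W) x :=
            hasFDerivAt_prodMk_right p x
          have := (h5.hasFDerivAt.comp x h6).fderiv
          change fderiv ℝ (d j ∘ fun y => (p, y)) x e = _
          rw [this]; simp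
        rw [h1, fderiv_fun_sum fun j _ => (h2 j).fun_mul (h3 j), sum_apply]
        have h7 : ∀ j ∈ Finset.range (M + 1), fderiv ℝ (fun y => d j (p, y) * D j y) x e =
            fderiv ℝ (d j) (p, x) (0, e) * D j x + d j (p, x) * D (j + 1) x := by
          intro j _
          rw [fderiv_fun_mul (h2 j) (h3 j)]
          simp only [add_apply, smul_apply, smul_eq_mul,
            h4, hDsucc]
          ring
        rw [Finset.sum_congr rfl h7, Finset.sum_add_distrib]
        simp only [c', mul_add, add_mul, Finset.sum_add_distrib]
        congr 1
        · rw [Finset.sum_range_succ (n := M + 1), if_neg (by omega), mul_zero, zero_mul, add_zero,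
            Finset.mul_sum]
          refine Finset.sum_congr rfl fun j hj => ?_
          rw [if_pos (by simpa [Nat.lt_succ_iff] using hj)]; ring
        · rw [Finset.sum_range_succ' (n := M + 1), if_pos rfl, mul_zero, zero_mul, add_zero,
            Finset.mul_sum]
          refine Finset.sum_congr rfl fun j _ => ?_
          rw [if_neg (by omega), Nat.add_sub_cancel]; ring
      · rw [Finset.sum_eq_zero fun j _ => by rw [show (iteratedFDeriv ℝ j a x fun _ => e) = 0 from
          hDsupp j x hx, mul_zero]]
        have : fderiv ℝ (fun x => b x * ((phaseDeriv χ e (p, x) : ℝ) : ℂ)⁻¹) x = 0 := by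
          have h0 : (fun x => b x * ((phaseDeriv χ e (p, x) : ℝ) : ℂ)⁻¹) =ᶠ[𝓝 x] fun _ => 0 := by
            filter_upwards [(isClosed_tsupport a).isOpen_compl.mem_nhds hx] with y hy
            rw [show b y = 0 by by_contra h; exact hy (hbsupp h), zero_mul]
          rw [h0.fderiv_eq]; simp
        rw [this]; simp

/-- The phase derivative stays nonzero on a compact product of balls, where the coefficients of the
repeated integration by parts are bounded. The balls are fixed before `M` is chosen, so one
neighbourhood serves all orders of decay. -/
theorem exists_oscKernel_decay_at {χ : W → W} (hχ : ContDiff ℝ ∞ χ) {x₀ e : W} {p₀ : W × W}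
    (hne : phaseDeriv χ e (p₀, x₀) ≠ 0) :
    ∃ Q ∈ 𝓝 p₀, ∃ V ∈ 𝓝 x₀, ∀ M : ℕ, ∃ C, 0 ≤ C ∧ ∀ a : W → ℂ, ContDiff ℝ ∞ a →
      HasCompactSupport a → tsupport a ⊆ V → ∀ B : ℝ,
      (∀ j ≤ M, ∀ x, ‖iteratedFDeriv ℝ j a x‖ ≤ B) → ∀ p ∈ Q, ∀ r : ℝ, 0 ≤ r →
      r ^ M * ‖oscKernel χ a (r • p.1) (r • p.2)‖ ≤ C * B := by
  have hSo : IsOpen {q | phaseDeriv χ e q ≠ 0} :=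
    isOpen_ne_fun (contDiff_phaseDeriv hχ e).continuous continuous_const
  obtain ⟨ρ, hρ, hball⟩ := Metric.nhds_basis_closedBall.mem_iff.1 (hSo.mem_nhds hne)
  rw [← closedBall_prod_same] at hball
  refine ⟨_, Metric.closedBall_mem_nhds p₀ hρ, _, Metric.closedBall_mem_nhds x₀ hρ, fun M => ?_⟩
  obtain ⟨c, hc, hM⟩ := exists_coeff_integral_by_parts hχ e M
  have hcpt : IsCompact (Metric.closedBall p₀ ρ ×ˢ Metric.closedBall x₀ ρ) :=
    (isCompact_closedBall _ _).prod (isCompact_closedBall _ _)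
  have hK : ∀ j, ∃ K, ∀ q ∈ Metric.closedBall p₀ ρ ×ˢ Metric.closedBall x₀ ρ, ‖c j q‖ ≤ K :=
    fun j => hcpt.exists_bound_of_continuousOn ((hc j).continuousOn.mono hball)
  choose K hK using hK
  have hK0 : ∀ j, 0 ≤ K j := fun j => (norm_nonneg _).trans
    (hK j (p₀, x₀) ⟨Metric.mem_closedBall_self hρ.le, Metric.mem_closedBall_self hρ.le⟩)
  refine ⟨(∑ j ∈ Finset.range (M + 1), K j * ‖e‖ ^ j) * volume.real (Metric.closedBall x₀ ρ),
    mul_nonneg (Finset.sum_nonneg fun j _ => mul_nonneg (hK0 j) (by positivity))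
      measureReal_nonneg, fun a ha hac haV B hB p hp r hr => ?_⟩
  have h1 := hM p a ha hac (fun x hx => hball ⟨hp, haV hx⟩) r
  have h2 := oscKernel_eq_integral_oscPhase χ a (r • p)
  simp only [Prod.smul_fst, Prod.smul_snd] at h2
  rw [h2]
  have h3 : r ^ M * ‖∫ x, a x * oscPhase χ (r • p) x‖ =
      ‖(r : ℂ) ^ M * ∫ x, a x * oscPhase χ (r • p) x‖ := by
    rw [norm_mul, norm_pow, Complex.norm_real, Real.norm_of_nonneg hr]
  have hsupp : ∀ x ∉ Metric.closedBall x₀ ρ,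
      (∑ j ∈ Finset.range (M + 1), c j (p, x) * iteratedFDeriv ℝ j a x fun _ => e) *
            oscPhase χ (r • p) x = 0 := by
    intro x hx
    rw [Finset.sum_eq_zero, zero_mul]
    intro j _
    have := image_eq_zero_of_notMem_tsupport
      (fun h => hx (haV (tsupport_iteratedFDeriv_subset (𝕜 := ℝ) j h)))
    simp [this]
  rw [h3, h1, ← setIntegral_eq_integral_of_forall_compl_eq_zero hsupp]
  refine (norm_setIntegral_le_of_norm_le_const (C := (∑ j ∈ Finset.range (M + 1),
    K j * ‖e‖ ^ j) * B) ((isCompact_closedBall _ _).measure_lt_top) fun x hx => ?_).trans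
    (le_of_eq (by ring))
  rw [norm_mul, norm_oscPhase, mul_one, Finset.sum_mul]
  refine (norm_sum_le _ _).trans (Finset.sum_le_sum fun j hj => ?_)
  rw [norm_mul, mul_assoc]
  refine mul_le_mul (hK j _ ⟨hp, hx⟩) ?_ (norm_nonneg _) (hK0 j)
  refine (ContinuousMultilinearMap.le_opNorm _ _).trans ?_
  simp only [Finset.prod_const, Finset.card_univ, Fintype.card_fin]
  rw [mul_comm]
  exact mul_le_mul_of_nonneg_left (hB j (by simpa [Nat.lt_succ_iff] using hj) x) (by positivity)

/-- Non-stationary phase, uniformly on a compact set of parameters. -/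
theorem exists_oscKernel_decay {χ : W → W} (hχ : ContDiff ℝ ∞ χ) {x₀ : W} {Z : Set (W × W)}
    (hZ : IsCompact Z)
    (hne : ∀ p ∈ Z, ∃ e, (inner ℝ p.2 (fderiv ℝ χ x₀ e) : ℝ) ≠ inner ℝ p.1 e) :
    ∃ V ∈ 𝓝 x₀, ∀ M : ℕ, ∃ C, 0 ≤ C ∧ ∀ a : W → ℂ, ContDiff ℝ ∞ a →
      HasCompactSupport a → tsupport a ⊆ V → ∀ B : ℝ,
      (∀ j ≤ M, ∀ x, ‖iteratedFDeriv ℝ j a x‖ ≤ B) → ∀ p ∈ Z, ∀ r : ℝ, 0 ≤ r →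
      r ^ M * ‖oscKernel χ a (r • p.1) (r • p.2)‖ ≤ C * B := by
  refine hZ.induction_on (p := fun Z => ∃ V ∈ 𝓝 x₀, ∀ M : ℕ, ∃ C, 0 ≤ C ∧ ∀ a : W → ℂ,
      ContDiff ℝ ∞ a → HasCompactSupport a → tsupport a ⊆ V → ∀ B : ℝ,
      (∀ j ≤ M, ∀ x, ‖iteratedFDeriv ℝ j a x‖ ≤ B) → ∀ p ∈ Z, ∀ r : ℝ, 0 ≤ r →
      r ^ M * ‖oscKernel χ a (r • p.1) (r • p.2)‖ ≤ C * B) ?_ ?_ ?_ ?_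
  · exact ⟨Set.univ, univ_mem, fun M => ⟨0, le_rfl, by simp⟩⟩
  · rintro s t hst ⟨V, hV, h⟩
    refine ⟨V, hV, fun M => ?_⟩
    obtain ⟨C, hC, h⟩ := h M
    exact ⟨C, hC, fun a h1 h2 h3 B hB p hp => h a h1 h2 h3 B hB p (hst hp)⟩
  · rintro s t ⟨V, hV, h⟩ ⟨V', hV', h'⟩
    refine ⟨V ∩ V', inter_mem hV hV', fun M => ?_⟩
    obtain ⟨C, hC, h⟩ := h M
    obtain ⟨C', hC', h'⟩ := h' M
    refine ⟨C + C', by positivity, fun a h1 h2 h3 B hB p hp r hr => ?_⟩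
    have hB0 : 0 ≤ B := (norm_nonneg _).trans (hB 0 (Nat.zero_le _) 0)
    rcases hp with hp | hp
    · refine (h a h1 h2 (h3.trans Set.inter_subset_left) B hB p hp r hr).trans ?_
      nlinarith
    · refine (h' a h1 h2 (h3.trans Set.inter_subset_right) B hB p hp r hr).trans ?_
      nlinarith
  · intro p hp
    obtain ⟨e, he⟩ := hne p hp
    obtain ⟨Q, hQ, V, hV, h⟩ := exists_oscKernel_decay_at hχ (e := e) (p₀ := p) (x₀ := x₀)
      (sub_ne_zero.2 he)
    exact ⟨Q, mem_nhdsWithin_of_mem_nhds hQ, V, hV, h⟩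

end Euclidean

/-! ### Coordinate invariance of microlocal Sobolev regularity -/

section Euclidean

variable {W : Type*} [NormedAddCommGroup W] [InnerProductSpace ℝ W] [FiniteDimensional ℝ W]
  [MeasurableSpace W] [BorelSpace W]

/-- A set invariant under multiplication by positive scalars. -/
def IsConic (Γ : Set W) : Prop := ∀ c : ℝ, 0 < c → ∀ k ∈ Γ, c • k ∈ Γ

/-- The square of the Sobolev norm of order `s`, on the Fourier side and restricted to `Γ`. -/
def sobolevSq (s : ℝ) (Γ : Set W) (h : W → ℂ) : ℝ≥0∞ :=
  ∫⁻ k in Γ, ENNReal.ofReal ((1 + ‖k‖ ^ 2) ^ s) * ‖h k‖ₑ ^ 2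

theorem lintegral_mul_sq_le {α : Type*} [MeasurableSpace α] {μ : Measure α} {f g : α → ℝ≥0∞}
    (hf : AEMeasurable f μ) (hg : AEMeasurable g μ) :
    (∫⁻ x, f x * g x ∂μ) ^ 2 ≤ (∫⁻ x, f x ^ 2 ∂μ) * ∫⁻ x, g x ^ 2 ∂μ := by
  have h := ENNReal.lintegral_mul_le_Lp_mul_Lq μ Real.HolderConjugate.two_two hf hg
  have h2 := pow_le_pow_left₀ (zero_le) h 2
  refine h2.trans (le_of_eq ?_)
  rw [mul_pow, ← ENNReal.rpow_natCast, ← ENNReal.rpow_natCast, ← ENNReal.rpow_mul,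
    ← ENNReal.rpow_mul]
  norm_num

theorem enorm_add_sq_le (a b : ℂ) : ‖a + b‖ₑ ^ 2 ≤ 2 * (‖a‖ₑ ^ 2 + ‖b‖ₑ ^ 2) := by
  have h : ‖a + b‖ ^ 2 ≤ 2 * (‖a‖ ^ 2 + ‖b‖ ^ 2) := by
    have h1 := norm_add_le a b
    nlinarith [norm_nonneg (a + b), sq_nonneg (‖a‖ - ‖b‖)]
  have h2 := ENNReal.ofReal_le_ofReal h
  rwa [ENNReal.ofReal_pow (norm_nonneg _), ENNReal.ofReal_mul (by norm_num),
    ENNReal.ofReal_add (by positivity) (by positivity), ENNReal.ofReal_pow (norm_nonneg _),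
    ENNReal.ofReal_pow (norm_nonneg _), ofReal_norm, ofReal_norm, ofReal_norm,
    ENNReal.ofReal_ofNat] at h2

/-- The pairs `(k, l)` with `l` in `G` for which the kernel of a change of variables is rapidly
decreasing. -/
def farSet (G Γ : Set W) (K : ℝ) : Set (W × W) :=
  {p | p.2 ∈ G ∧ (p.1 ∉ Γ ∨ K * ‖p.2‖ ^ 2 ≤ ‖p.1‖ ^ 2 ∨ K * ‖p.1‖ ^ 2 ≤ ‖p.2‖ ^ 2)}

theorem isClosed_farSet {G Γ : Set W} (hG : IsClosed G) (hΓ : IsOpen Γ) (K : ℝ) :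
    IsClosed (farSet G Γ K) := by
  refine (hG.preimage continuous_snd).inter (IsClosed.union ?_ (IsClosed.union ?_ ?_))
  · exact hΓ.isClosed_compl.preimage continuous_fst
  · exact isClosed_le (f := fun p : W × W => K * ‖p.2‖ ^ 2) (g := fun p => ‖p.1‖ ^ 2)
      (by fun_prop) (by fun_prop)
  · exact isClosed_le (f := fun p : W × W => K * ‖p.1‖ ^ 2) (g := fun p => ‖p.2‖ ^ 2)
      (by fun_prop) (by fun_prop)

theorem IsConic.smul_mem_iff {Γ : Set W} (hΓ : IsConic Γ) {c : ℝ} (hc : 0 < c) {k : W} :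
    c • k ∈ Γ ↔ k ∈ Γ := by
  refine ⟨fun h => ?_, hΓ c hc k⟩
  have := hΓ c⁻¹ (inv_pos.2 hc) _ h
  rwa [smul_smul, inv_mul_cancel₀ hc.ne', one_smul] at this

theorem smul_mem_farSet {G Γ : Set W} (hG : IsConic G) (hΓ : IsConic Γ) {K c : ℝ} (hc : 0 < c)
    {p : W × W} (hp : p ∈ farSet G Γ K) : c • p ∈ farSet G Γ K := by
  obtain ⟨h1, h2⟩ := hp
  refine ⟨hG c hc _ h1, ?_⟩
  have hc2 : (0 : ℝ) ≤ c ^ 2 := by positivity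
  rcases h2 with h2 | h2 | h2
  · exact Or.inl fun h => h2 ((hΓ.smul_mem_iff hc).1 h)
  · refine Or.inr (Or.inl ?_)
    simp only [Prod.smul_fst, Prod.smul_snd, norm_smul, mul_pow, Real.norm_of_nonneg hc.le]
    nlinarith
  · refine Or.inr (Or.inr ?_)
    simp only [Prod.smul_fst, Prod.smul_snd, norm_smul, mul_pow, Real.norm_of_nonneg hc.le]
    nlinarith

/-- At a stationary pair `k` is the adjoint image of `l`. Hence `k` lies in `Γ`, and the norms of
`k` and `l` control each other through the norms of the adjoint and of the inverse of `A`. A `K`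
exceeding both squared norms excludes all three alternatives in `farSet`. -/
theorem exists_nonstationary_farSet {A : W →L[ℝ] W} (hdet : A.det ≠ 0) {G Γ : Set W}
    (hGΓ : ∀ l ∈ G, l ≠ 0 → A.adjoint l ∈ Γ) :
    ∃ K : ℝ, 1 ≤ K ∧ ∀ p ∈ farSet G Γ K, p ≠ 0 → ∃ e, (inner ℝ p.2 (A e) : ℝ) ≠ inner ℝ p.1 e := by
  let E := ContinuousLinearMap.toContinuousLinearEquivOfDetNeZero A hdet
  have hE : ∀ x, A (E.symm x) = x := fun x => E.apply_symm_apply x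
  refine ⟨1 + ‖A.adjoint‖ ^ 2 + ‖(E.symm : W →L[ℝ] W)‖ ^ 2, by nlinarith, fun p hp hp0 => ?_⟩
  by_contra! hcon
  obtain ⟨k, l⟩ := p
  simp only at hcon
  have hk : A.adjoint l = k := ext_inner_right ℝ fun e => by
    rw [ContinuousLinearMap.adjoint_inner_left]; exact hcon e
  have hkl : ‖k‖ ≤ ‖A.adjoint‖ * ‖l‖ := hk ▸ A.adjoint.le_opNorm l
  have hl0 : l ≠ 0 := by
    rintro rfl
    exact hp0 (by simp [← hk])
  have hlpos : 0 < ‖l‖ := norm_pos_iff.2 hl0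
  have hlk : ‖l‖ ≤ ‖(E.symm : W →L[ℝ] W)‖ * ‖k‖ := by
    have h1 : ‖l‖ * ‖l‖ ≤ ‖k‖ * (‖(E.symm : W →L[ℝ] W)‖ * ‖l‖) := by
      rw [← real_inner_self_eq_norm_mul_norm]
      nth_rewrite 2 [← hE l]
      rw [hcon]
      exact (real_inner_le_norm _ _).trans (mul_le_mul_of_nonneg_left
        ((E.symm : W →L[ℝ] W).le_opNorm l) (norm_nonneg _))
    nlinarith
  rcases hp.2 with h | h | h
  · exact h (hk ▸ hGΓ l hp.1 hl0)
  · simp only at h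
    have := mul_self_le_mul_self (norm_nonneg _) hkl
    nlinarith [sq_nonneg (‖(E.symm : W →L[ℝ] W)‖ * ‖l‖)]
  · simp only at h
    have h2 := mul_self_le_mul_self (norm_nonneg _) hlk
    have h3 : 0 < ‖k‖ := by
      by_contra h4
      have : ‖k‖ = 0 := le_antisymm (not_lt.1 h4) (norm_nonneg _)
      rw [this, mul_zero] at hlk; linarith
    nlinarith [sq_nonneg (‖A.adjoint‖ * ‖k‖), mul_pos h3 h3]

/-- `farSet` is a closed cone, so its unit vectors form a compact set, on which non-stationary phase
is uniform; scaling covers the rest. The `4 * N` powers of the size of the pair are shared out as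
`N` powers of the quadratic weight for each frequency. Small frequencies are covered by the trivial
bound of the integral by volume times supremum, for which the support is kept in a unit ball. -/
theorem exists_oscKernel_decay_farSet {χ : W → W} (hχ : ContDiff ℝ ∞ χ) {x₀ : W}
    {G Γ : Set W} (hG : IsClosed G) (hGc : IsConic G) (hΓ : IsOpen Γ) (hΓc : IsConic Γ) {K : ℝ}
    (hne : ∀ p ∈ farSet G Γ K, p ≠ 0 →
      ∃ e, (inner ℝ p.2 (fderiv ℝ χ x₀ e) : ℝ) ≠ inner ℝ p.1 e) (N : ℕ) :
    ∃ V ∈ 𝓝 x₀, ∃ C, 0 ≤ C ∧ ∀ a : W → ℂ, ContDiff ℝ ∞ a →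
      HasCompactSupport a → tsupport a ⊆ V → ∀ B : ℝ,
      (∀ j ≤ 4 * N, ∀ x, ‖iteratedFDeriv ℝ j a x‖ ≤ B) → ∀ p ∈ farSet G Γ K,
      ‖oscKernel χ a p.1 p.2‖ ≤ C * B * (((1 + ‖p.1‖ ^ 2) ^ N)⁻¹ * ((1 + ‖p.2‖ ^ 2) ^ N)⁻¹) := by
  have hZ : IsCompact (farSet G Γ K ∩ Metric.sphere 0 1) :=
    (isCompact_sphere _ _).inter_left (isClosed_farSet hG hΓ K)
  obtain ⟨V, hV, h⟩ := exists_oscKernel_decay hχ (x₀ := x₀) hZ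
    fun p hp => hne p hp.1 (by rintro rfl; simpa using hp.2)
  obtain ⟨C, hC, h⟩ := h (4 * N)
  refine ⟨V ∩ Metric.closedBall x₀ 1, inter_mem hV (Metric.closedBall_mem_nhds _ one_pos),
    2 ^ (2 * N) * (2 * volume.real (Metric.closedBall x₀ 1) + C), by positivity,
    fun a ha hac haV B hB p hp => ?_⟩
  have hB0 : 0 ≤ B := (norm_nonneg _).trans (hB 0 (Nat.zero_le _) 0)
  have htriv : ‖oscKernel χ a p.1 p.2‖ ≤ volume.real (Metric.closedBall x₀ 1) * B := by
    rw [oscKernel_eq_integral_oscPhase, ← setIntegral_eq_integral_of_forall_compl_eq_zero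
      (s := Metric.closedBall x₀ 1) fun x hx => by
        rw [image_eq_zero_of_notMem_tsupport fun h => hx (haV h).2, zero_mul]]
    refine (norm_setIntegral_le_of_norm_le_const (C := B)
      ((isCompact_closedBall _ _).measure_lt_top) fun x _ => ?_).trans (le_of_eq (by ring))
    rw [norm_mul, norm_oscPhase, mul_one]
    simpa using hB 0 (Nat.zero_le _) x
  have hdec : ‖p‖ ^ (4 * N) * ‖oscKernel χ a p.1 p.2‖ ≤
      (volume.real (Metric.closedBall x₀ 1) + C) * B := by
    by_cases hp0 : p = 0
    · have h1 : ‖p‖ ^ (4 * N) ≤ 1 := pow_le_one₀ (norm_nonneg _) (by simp [hp0])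
      exact (mul_le_of_le_one_left (norm_nonneg _) h1).trans
        (htriv.trans (mul_le_mul_of_nonneg_right (by linarith) hB0))
    · have hn := norm_pos_iff.2 hp0
      have := h a ha hac (haV.trans Set.inter_subset_left) B hB (‖p‖⁻¹ • p)
        ⟨smul_mem_farSet hGc hΓc (inv_pos.2 hn) hp, by simp [norm_smul, hn.ne']⟩ ‖p‖ hn.le
      have h2 : ‖p‖ ^ (4 * N) * ‖oscKernel χ a p.1 p.2‖ ≤ C * B := by
        simpa [smul_smul, hn.ne'] using this
      refine h2.trans (mul_le_mul_of_nonneg_right ?_ hB0)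
      linarith [measureReal_nonneg (μ := (volume : Measure W)) (s := Metric.closedBall x₀ 1)]
  have h1 : 1 + ‖p.1‖ ^ 2 ≤ 1 + ‖p‖ ^ 2 := by have := norm_fst_le p; gcongr
  have h2 : 1 + ‖p.2‖ ^ 2 ≤ 1 + ‖p‖ ^ 2 := by have := norm_snd_le p; gcongr
  have h3 : (1 + ‖p‖ ^ 2) ^ (2 * N) ≤ 2 ^ (2 * N) * (1 + ‖p‖ ^ (4 * N)) := by
    have h4 : (1 + ‖p‖ ^ 2) ^ (2 * N) ≤ (2 * max 1 (‖p‖ ^ 2)) ^ (2 * N) := by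
      gcongr
      linarith [le_max_left 1 (‖p‖ ^ 2), le_max_right 1 (‖p‖ ^ 2)]
    refine h4.trans ?_
    rw [mul_pow]
    gcongr
    rcases le_total 1 (‖p‖ ^ 2) with h5 | h5
    · rw [max_eq_right h5, ← pow_mul, show 2 * (2 * N) = 4 * N by ring]
      linarith
    · rw [max_eq_left h5, one_pow]
      linarith [pow_nonneg (norm_nonneg p) (4 * N)]
  rw [← mul_inv, ← div_eq_mul_inv, le_div_iff₀ (by positivity)]
  calc ‖oscKernel χ a p.1 p.2‖ * ((1 + ‖p.1‖ ^ 2) ^ N * (1 + ‖p.2‖ ^ 2) ^ N)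
      ≤ ‖oscKernel χ a p.1 p.2‖ * ((1 + ‖p‖ ^ 2) ^ N * (1 + ‖p‖ ^ 2) ^ N) := by gcongr
    _ = ‖oscKernel χ a p.1 p.2‖ * (1 + ‖p‖ ^ 2) ^ (2 * N) := by
      rw [← pow_add]; congr 2; ring
    _ ≤ ‖oscKernel χ a p.1 p.2‖ * (2 ^ (2 * N) * (1 + ‖p‖ ^ (4 * N))) := by gcongr
    _ = 2 ^ (2 * N) * (‖oscKernel χ a p.1 p.2‖ + ‖p‖ ^ (4 * N) * ‖oscKernel χ a p.1 p.2‖) := by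
      ring
    _ ≤ 2 ^ (2 * N) * (volume.real (Metric.closedBall x₀ 1) * B +
          (volume.real (Metric.closedBall x₀ 1) + C) * B) := by gcongr
    _ = _ := by ring

/-- The index of the dyadic shell `2ⁱ ≤ 1 + ‖k‖² < 2ⁱ⁺¹` containing `k`. -/
def shellIndex (k : W) : ℕ := Nat.log 2 ⌊1 + ‖k‖ ^ 2⌋₊

theorem two_pow_shellIndex_le (k : W) : (2 : ℝ) ^ shellIndex k ≤ 1 + ‖k‖ ^ 2 := by
  have h1 : 1 ≤ ⌊1 + ‖k‖ ^ 2⌋₊ := (Nat.one_le_floor_iff _).2 (by nlinarith [sq_nonneg ‖k‖])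
  have h2 : 2 ^ shellIndex k ≤ ⌊1 + ‖k‖ ^ 2⌋₊ := Nat.pow_log_le_self 2 (by omega)
  calc (2 : ℝ) ^ shellIndex k ≤ (⌊1 + ‖k‖ ^ 2⌋₊ : ℝ) := by exact_mod_cast h2
    _ ≤ _ := Nat.floor_le (by positivity)

theorem lt_two_pow_shellIndex_succ (k : W) : 1 + ‖k‖ ^ 2 < (2 : ℝ) ^ (shellIndex k + 1) := by
  have h2 : ⌊1 + ‖k‖ ^ 2⌋₊ < 2 ^ (shellIndex k + 1) := Nat.lt_pow_succ_log_self (by norm_num) _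
  have h3 : ⌊1 + ‖k‖ ^ 2⌋₊ + 1 ≤ 2 ^ (shellIndex k + 1) := h2
  calc 1 + ‖k‖ ^ 2 < (⌊1 + ‖k‖ ^ 2⌋₊ : ℝ) + 1 := Nat.lt_floor_add_one _
    _ ≤ _ := by exact_mod_cast h3

theorem measurable_shellIndex : Measurable (shellIndex : W → ℕ) :=
  (measurable_from_nat (f := Nat.log 2)).comp
    (Nat.measurable_floor.comp (by fun_prop : Measurable fun k : W => 1 + ‖k‖ ^ 2))

/-- The part of `Γ` in the dyadic shells with index at distance at most `c` from `i`. -/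
def nearShell (Γ : Set W) (c i : ℕ) : Set W :=
  {k | k ∈ Γ ∧ shellIndex k ≤ i + c ∧ i ≤ shellIndex k + c}

theorem measurableSet_nearShell {Γ : Set W} (hΓ : MeasurableSet Γ) (c i : ℕ) :
    MeasurableSet (nearShell Γ c i) :=
  hΓ.inter ((measurableSet_le measurable_shellIndex measurable_const).inter
    (measurableSet_le measurable_const (measurable_shellIndex.add_const c)))

/-- If the shell indices differ by more than `c`, the squared norms differ by a factor of at least
`2 ^ c`; otherwise only the direction of `k` can be at fault. -/
theorem mem_farSet_of_notMem_nearShell {G Γ : Set W} {c : ℕ} {k l : W} (hl : l ∈ G)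
    (hk : k ∉ nearShell Γ c (shellIndex l)) : (k, l) ∈ farSet G Γ (2 ^ c) := by
  refine ⟨hl, ?_⟩
  have key : ∀ x y : W, shellIndex x + c < shellIndex y → 2 ^ c * ‖x‖ ^ 2 ≤ ‖y‖ ^ 2 := by
    intro x y hxy
    have h1 : (2 : ℝ) ^ (shellIndex x + 1) * 2 ^ c ≤ 2 ^ shellIndex y := by
      rw [← pow_add]
      exact pow_le_pow_right₀ (by norm_num) (by omega)
    have h2 := two_pow_shellIndex_le y
    have h3 := lt_two_pow_shellIndex_succ x
    have h4 : (1 : ℝ) ≤ 2 ^ c := one_le_pow₀ (by norm_num)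
    nlinarith
  by_cases hΓ : k ∈ Γ
  · by_cases h1 : shellIndex k ≤ shellIndex l + c
    · have h2 : shellIndex k + c < shellIndex l := by
        by_contra h; exact hk ⟨hΓ, h1, not_lt.1 h⟩
      exact Or.inr (Or.inr (key k l h2))
    · exact Or.inr (Or.inl (key l k (not_le.1 h1)))
  · exact Or.inl hΓ

/-- Comparability in both directions survives every real power. For negative exponents the two
inequalities exchange their roles, hence `|s|`. -/
theorem rpow_le_rpow_abs_mul {x y K : ℝ} (hx : 0 < x) (hy : 0 < y) (hxy : x ≤ K * y)
    (hyx : y ≤ K * x) (s : ℝ) : x ^ s ≤ K ^ |s| * y ^ s := by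
  have hK : 0 < K := by
    by_contra h
    nlinarith [mul_nonneg (neg_nonneg.2 (not_lt.1 h)) hy.le]
  rcases le_total 0 s with hs | hs
  · rw [abs_of_nonneg hs, ← Real.mul_rpow hK.le hy.le]
    exact Real.rpow_le_rpow hx.le hxy hs
  · rw [abs_of_nonpos hs, Real.rpow_neg hK.le, ← Real.inv_rpow hK.le,
      ← Real.mul_rpow (inv_nonneg.2 hK.le) hy.le]
    refine Real.rpow_le_rpow_of_nonpos (by positivity) ?_ hs
    rw [inv_mul_le_iff₀ hK]; exact hyx

theorem weight_le_of_shellIndex {l : W} {i : ℕ} (hl : shellIndex l = i) (s : ℝ) :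
    (1 + ‖l‖ ^ 2) ^ s ≤ (2 : ℝ) ^ |s| * ((2 : ℝ) ^ i) ^ s := by
  have h1 := two_pow_shellIndex_le l
  have h2 := lt_two_pow_shellIndex_succ l
  rw [hl] at h1 h2
  rw [pow_succ (2 : ℝ) i] at h2
  exact rpow_le_rpow_abs_mul (by positivity) (by positivity) (by linarith)
    (by nlinarith [sq_nonneg ‖l‖]) s

theorem le_weight_of_mem_nearShell {Γ : Set W} {c i : ℕ} {k : W}
    (hk : k ∈ nearShell Γ c i) (s : ℝ) :
    ((2 : ℝ) ^ i) ^ s ≤ ((2 : ℝ) ^ (c + 1)) ^ |s| * (1 + ‖k‖ ^ 2) ^ s := by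
  refine rpow_le_rpow_abs_mul (by positivity) (by positivity) ?_ ?_ s
  · calc (2 : ℝ) ^ i ≤ 2 ^ (c + 1 + shellIndex k) :=
          pow_le_pow_right₀ (by norm_num) (by have := hk.2.2; omega)
      _ = 2 ^ (c + 1) * 2 ^ shellIndex k := pow_add _ _ _
      _ ≤ _ := by gcongr; exact two_pow_shellIndex_le k
  · calc 1 + ‖k‖ ^ 2 ≤ 2 ^ (shellIndex k + 1) := (lt_two_pow_shellIndex_succ k).le
      _ ≤ 2 ^ (c + 1 + i) := pow_le_pow_right₀ (by norm_num) (by have := hk.2.1; omega)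
      _ = _ := pow_add _ _ _

/-- Finite overlap: a given `k` belongs only to the near shells whose index is within `c` of its
own, and there are at most `2 * c + 1` of these. -/
theorem tsum_indicator_nearShell_le (Γ : Set W) (c : ℕ) (f : W → ℝ≥0∞) (k : W) :
    ∑' i, (nearShell Γ c i).indicator f k ≤ (2 * c + 1 : ℕ) * Γ.indicator f k := by
  by_cases hk : k ∈ Γ
  · rw [Set.indicator_of_mem hk, tsum_eq_sum
      (s := Finset.Icc (shellIndex k - c) (shellIndex k + c)) fun i hi => by
        refine Set.indicator_of_notMem (fun h => hi ?_) _
        rw [Finset.mem_Icc]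
        have := h.2; omega]
    refine (Finset.sum_le_card_nsmul _ _ (f k) fun i _ => Set.indicator_le_self _ _ _).trans ?_
    rw [nsmul_eq_mul]
    gcongr
    rw [Nat.card_Icc]; omega
  · have : ∀ i, (nearShell Γ c i).indicator f k = 0 := fun i =>
      Set.indicator_of_notMem (fun h => hk h.1) _
    simp [this]

theorem tsum_setLIntegral_nearShell_le {Γ : Set W} (hΓ : MeasurableSet Γ) (c : ℕ)
    {f : W → ℝ≥0∞} (hf : AEMeasurable f volume) :
    ∑' i, ∫⁻ k in nearShell Γ c i, f k ≤ (2 * c + 1 : ℕ) * ∫⁻ k in Γ, f k := by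
  have h1 : ∀ i, ∫⁻ k in nearShell Γ c i, f k = ∫⁻ k, (nearShell Γ c i).indicator f k := fun i =>
    (lintegral_indicator (measurableSet_nearShell hΓ c i) f).symm
  simp_rw [h1]
  rw [← lintegral_tsum fun i => hf.indicator (measurableSet_nearShell hΓ c i),
    ← lintegral_indicator hΓ, ← lintegral_const_mul' _ _ (ENNReal.natCast_ne_top _)]
  exact lintegral_mono fun k => tsum_indicator_nearShell_le Γ c f k

theorem continuous_oscKernel_left {χ : W → W} (hχ : Continuous χ) {a : W → ℂ} (ha : Integrable a)
    (l : W) : Continuous fun k => oscKernel χ a k l := by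
  have hb : Integrable fun x => a x * planeWave l (χ x) := by
    refine ha.mono (ha.1.mul (continuous_planeWave.comp
      (continuous_const.prodMk hχ)).aestronglyMeasurable) (ae_of_all _ fun x => by simp)
  have h : (fun k => oscKernel χ a k l) = fun k => 𝓕 (fun x => a x * planeWave l (χ x)) (-k) := by
    ext k
    rw [fourier_eq_integral_planeWave]; rfl
  rw [h]
  exact (VectorFourier.fourierIntegral_continuous Real.continuous_fourierChar
      (continuous_inner : Continuous fun p : W × W => innerₗ W p.1 p.2) hb).comp continuous_neg

theorem norm_oscKernel_le (χ : W → W) (a : W → ℂ) (k l : W) :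
    ‖oscKernel χ a k l‖ ≤ ∫ x, ‖a x‖ :=
  (norm_integral_le_integral_norm _).trans (le_of_eq (by simp))

theorem sobolevSq_neg_natCast (N : ℕ) (h : W → ℂ) :
    sobolevSq (-(N : ℝ)) Set.univ h =
      ∫⁻ k, ENNReal.ofReal (((1 + ‖k‖ ^ 2) ^ N)⁻¹) * ‖h k‖ₑ ^ 2 := by
  unfold sobolevSq
  rw [Measure.restrict_univ]
  congr 1; ext k
  rw [Real.rpow_neg (by positivity), Real.rpow_natCast]

theorem lintegral_enorm_sq_nearShell_lt_top {Γ : Set W} {N : ℕ} {h : W → ℂ}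
    (hΓ : MeasurableSet Γ) (hN : sobolevSq (-(N : ℝ)) Set.univ h < ⊤) (c i : ℕ) :
    ∫⁻ k in nearShell Γ c i, ‖h k‖ₑ ^ 2 < ⊤ := by
  rw [sobolevSq_neg_natCast] at hN
  have hle : ∫⁻ k in nearShell Γ c i, ‖h k‖ₑ ^ 2 ≤ ENNReal.ofReal ((2 ^ (i + c + 1)) ^ N) *
      ∫⁻ k, ENNReal.ofReal (((1 + ‖k‖ ^ 2) ^ N)⁻¹) * ‖h k‖ₑ ^ 2 := by
    rw [← lintegral_const_mul' _ _ ENNReal.ofReal_ne_top]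
    refine (setLIntegral_mono' (measurableSet_nearShell hΓ c i) fun k hk => ?_).trans
      (setLIntegral_le_lintegral _ _)
    rw [← mul_assoc, ← ENNReal.ofReal_mul (by positivity)]
    refine le_mul_of_one_le_left zero_le ?_
    rw [← ENNReal.ofReal_one]
    refine ENNReal.ofReal_le_ofReal ?_
    rw [← div_eq_mul_inv, one_le_div (by positivity)]
    refine pow_le_pow_left₀ (by positivity) ((lt_two_pow_shellIndex_succ k).le.trans ?_) N
    exact pow_le_pow_right₀ (by norm_num) (by have := hk.2.1; omega)
  exact hle.trans_lt (ENNReal.mul_lt_top ENNReal.ofReal_lt_top hN)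

theorem volume_nearShell_lt_top (Γ : Set W) (c i : ℕ) : volume (nearShell Γ c i) < ⊤ := by
  refine (measure_mono (t := Metric.closedBall (0 : W) (2 ^ (i + c + 1))) fun k hk => ?_).trans_lt
    measure_closedBall_lt_top
  rw [mem_closedBall_zero_iff]
  have h1 := lt_two_pow_shellIndex_succ k
  have h2 : (2 : ℝ) ^ (shellIndex k + 1) ≤ 2 ^ (i + c + 1) :=
    pow_le_pow_right₀ (by norm_num) (by have := hk.2.1; omega)
  nlinarith [sq_nonneg (‖k‖ - 1)]

theorem lintegral_ofReal_weight_lt_top {s : ℝ} {N : ℕ}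
    (hN : |s| + Module.finrank ℝ W + 1 ≤ N) :
    ∫⁻ k : W, ENNReal.ofReal ((1 + ‖k‖ ^ 2) ^ s * ((1 + ‖k‖ ^ 2) ^ N)⁻¹) < ⊤ := by
  have h := (integrable_inv_weight W (Nat.lt_succ_self _)).lintegral_lt_top
  refine (lintegral_mono fun k => ENNReal.ofReal_le_ofReal ?_).trans_lt h
  have h1 : (1 : ℝ) ≤ 1 + ‖k‖ ^ 2 := by nlinarith [sq_nonneg ‖k‖]
  generalize 1 + ‖k‖ ^ 2 = w at h1 ⊢
  rw [← Real.rpow_natCast, ← Real.rpow_natCast, ← Real.rpow_neg (by positivity),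
    ← Real.rpow_neg (by positivity), ← Real.rpow_add (by positivity)]
  refine Real.rpow_le_rpow_of_exponent_le h1 ?_
  push_cast
  linarith [le_abs_self s]

/-- The near-diagonal part of a change of variables, in one dyadic shell. -/
theorem lintegral_shell_nearShell_le {χ : W → W} {a : W → ℂ} {Γ : Set W} (hΓ : MeasurableSet Γ)
    {h : W → ℂ} {c i : ℕ} {s : ℝ} {C : ℝ≥0∞}
    (hL2 : ∫⁻ l, ‖∫ k, (nearShell Γ c i).indicator h k * oscKernel χ a k l‖ₑ ^ 2 ≤
      C * ∫⁻ k, ‖(nearShell Γ c i).indicator h k‖ₑ ^ 2) :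
    ∫⁻ l in {l | shellIndex l = i}, ENNReal.ofReal ((1 + ‖l‖ ^ 2) ^ s) *
        ‖∫ k, (nearShell Γ c i).indicator h k * oscKernel χ a k l‖ₑ ^ 2 ≤
      ENNReal.ofReal ((2 : ℝ) ^ |s| * ((2 : ℝ) ^ (c + 1)) ^ |s|) * C *
        ∫⁻ k in nearShell Γ c i, ENNReal.ofReal ((1 + ‖k‖ ^ 2) ^ s) * ‖h k‖ₑ ^ 2 := by
  have hm : MeasurableSet {l : W | shellIndex l = i} := measurable_shellIndex (measurableSet_singleton i)
  have hind : ∀ k, ‖(nearShell Γ c i).indicator h k‖ₑ ^ 2 =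
      (nearShell Γ c i).indicator (fun k => ‖h k‖ₑ ^ 2) k := fun k => by
    by_cases hk : k ∈ nearShell Γ c i <;> simp [hk]
  simp_rw [hind] at hL2
  rw [lintegral_indicator (measurableSet_nearShell hΓ c i)] at hL2
  calc _ ≤ ∫⁻ l in {l | shellIndex l = i}, ENNReal.ofReal ((2 : ℝ) ^ |s| * ((2 : ℝ) ^ i) ^ s) *
        ‖∫ k, (nearShell Γ c i).indicator h k * oscKernel χ a k l‖ₑ ^ 2 :=
        setLIntegral_mono' hm fun l hl => by gcongr; exact weight_le_of_shellIndex hl s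
    _ ≤ ENNReal.ofReal ((2 : ℝ) ^ |s| * ((2 : ℝ) ^ i) ^ s) *
        (C * ∫⁻ k in nearShell Γ c i, ‖h k‖ₑ ^ 2) := by
      rw [lintegral_const_mul' _ _ ENNReal.ofReal_ne_top]
      gcongr
      exact (setLIntegral_le_lintegral _ _).trans hL2
    _ = ENNReal.ofReal ((2 : ℝ) ^ |s|) * C *
        ∫⁻ k in nearShell Γ c i, ENNReal.ofReal (((2 : ℝ) ^ i) ^ s) * ‖h k‖ₑ ^ 2 := by
      rw [lintegral_const_mul' _ _ ENNReal.ofReal_ne_top, ENNReal.ofReal_mul (by positivity)]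
      ring
    _ ≤ ENNReal.ofReal ((2 : ℝ) ^ |s|) * C * ∫⁻ k in nearShell Γ c i,
        ENNReal.ofReal (((2 : ℝ) ^ (c + 1)) ^ |s|) *
          (ENNReal.ofReal ((1 + ‖k‖ ^ 2) ^ s) * ‖h k‖ₑ ^ 2) := by
      refine mul_le_mul_right (setLIntegral_mono' (measurableSet_nearShell hΓ c i)
        fun k hk => ?_) _
      rw [← mul_assoc, ← ENNReal.ofReal_mul (by positivity)]
      gcongr
      exact le_weight_of_mem_nearShell hk s
    _ = _ := by
      rw [lintegral_const_mul' _ _ ENNReal.ofReal_ne_top, ENNReal.ofReal_mul (by positivity)]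
      ring

/-- **Coordinate invariance of microlocal Sobolev regularity**, with constants. -/
theorem exists_sobolevSq_changeOfVariables {χ : W → W} (hχ : ContDiff ℝ ∞ χ) {x₀ : W}
    (hdet : (fderiv ℝ χ x₀).det ≠ 0) {G Γ : Set W} (hG : IsClosed G) (hGc : IsConic G)
    (hΓ : IsOpen Γ) (hΓc : IsConic Γ) (hGΓ : ∀ l ∈ G, l ≠ 0 → (fderiv ℝ χ x₀).adjoint l ∈ Γ)
    (s : ℝ) (N : ℕ) :
    ∃ V ∈ 𝓝 x₀, ∃ (m : ℕ) (C : ℝ≥0∞), C < ⊤ ∧ ∀ a : W → ℂ, ContDiff ℝ ∞ a →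
      HasCompactSupport a → tsupport a ⊆ V → ∀ B : ℝ,
      (∀ j ≤ m, ∀ x, ‖iteratedFDeriv ℝ j a x‖ ≤ B) → ∀ h : W → ℂ,
      AEStronglyMeasurable h volume → sobolevSq (-(N : ℝ)) Set.univ h < ⊤ →
      sobolevSq s G (fun l => ∫ k, h k * oscKernel χ a k l) ≤
        C * ENNReal.ofReal B ^ 2 * (sobolevSq s Γ h + sobolevSq (-(N : ℝ)) Set.univ h) := by
  obtain ⟨K, hK, hne⟩ := exists_nonstationary_farSet hdet hGΓ
  -- Frequencies more than `c` dyadic shells apart are too different in size for the phase to be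
  -- stationary.
  obtain ⟨c, hc⟩ := pow_unbounded_of_one_lt K (one_lt_two (α := ℝ))
  have hfar : farSet G Γ (2 ^ c) ⊆ farSet G Γ K := by
    rintro p ⟨h1, h2⟩
    refine ⟨h1, h2.imp_right fun h3 => h3.imp (fun h => ?_) fun h => ?_⟩
    · exact (mul_le_mul_of_nonneg_right hc.le (sq_nonneg _)).trans h
    · exact (mul_le_mul_of_nonneg_right hc.le (sq_nonneg _)).trans h
  -- Enough decay to make both `J₁` and `J₂` finite: in `l` against the weight of order `s`, and in
  -- `k` against the weight dual to the a priori order `-N` of `h`.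
  set N' := N + Module.finrank ℝ W + 1 + ⌈|s|⌉₊
  obtain ⟨V₁, hV₁, Cf, hCf, hdec⟩ := exists_oscKernel_decay_farSet hχ hG hGc hΓ hΓc hne N'
  obtain ⟨V₂, hV₂, C₂, hC₂, hL2⟩ := exists_oscKernel_L2_bound hχ hdet
  set J₁ := ∫⁻ l : W, ENNReal.ofReal ((1 + ‖l‖ ^ 2) ^ s * ((1 + ‖l‖ ^ 2) ^ (2 * N'))⁻¹)
  set J₂ := ∫⁻ l : W, ENNReal.ofReal ((1 + ‖l‖ ^ 2) ^ (N : ℝ) * ((1 + ‖l‖ ^ 2) ^ (2 * N'))⁻¹)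
  have hN' : (N' : ℝ) = N + Module.finrank ℝ W + 1 + ⌈|s|⌉₊ := by push_cast [N']; ring
  have hceil := Nat.le_ceil |s|
  have hJ₁ : J₁ < ⊤ := by
    refine lintegral_ofReal_weight_lt_top ?_
    push_cast [hN']
    linarith [(Nat.cast_nonneg N : (0 : ℝ) ≤ N),
      (Nat.cast_nonneg (Module.finrank ℝ W) : (0 : ℝ) ≤ _), abs_nonneg s]
  have hJ₂ : J₂ < ⊤ := by
    refine lintegral_ofReal_weight_lt_top ?_
    rw [abs_of_nonneg (Nat.cast_nonneg N)]
    push_cast [hN']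
    linarith [(Nat.cast_nonneg N : (0 : ℝ) ≤ N),
      (Nat.cast_nonneg (Module.finrank ℝ W) : (0 : ℝ) ≤ _), abs_nonneg s]
  set E := ENNReal.ofReal ((2 : ℝ) ^ |s| * ((2 : ℝ) ^ (c + 1)) ^ |s|)
  refine ⟨V₁ ∩ V₂, inter_mem hV₁ hV₂, 4 * N',
    2 * (E * C₂ * (2 * c + 1 : ℕ) + ENNReal.ofReal Cf ^ 2 * J₁ * J₂), ?_,
    fun a ha hac haV B hB h hh hN => ?_⟩
  · have : E < ⊤ := ENNReal.ofReal_lt_top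
    finiteness
  have hB0 : 0 ≤ B := (norm_nonneg _).trans (hB 0 (Nat.zero_le _) 0)
  have haint : Integrable a := ha.continuous.integrable_of_hasCompactSupport hac
  have hΓm := hΓ.measurableSet
  set I := ∫⁻ k, ‖h k‖ₑ * ENNReal.ofReal (((1 + ‖k‖ ^ 2) ^ N')⁻¹)
  have hI : I ^ 2 ≤ sobolevSq (-(N : ℝ)) Set.univ h * J₂ := by
    have hw : ∀ (n : ℝ), Measurable fun k : W => (1 + ‖k‖ ^ 2) ^ n := fun n => by fun_prop
    have h1 := lintegral_mul_sq_le (μ := (volume : Measure W))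
      (f := fun k => ENNReal.ofReal ((1 + ‖k‖ ^ 2) ^ (-(N : ℝ) / 2)) * ‖h k‖ₑ)
      (g := fun k => ENNReal.ofReal ((1 + ‖k‖ ^ 2) ^ ((N : ℝ) / 2) * ((1 + ‖k‖ ^ 2) ^ N')⁻¹))
      ((hw _).ennreal_ofReal.aemeasurable.mul hh.enorm)
      (by fun_prop)
    have e1 : ∀ k : W, ENNReal.ofReal ((1 + ‖k‖ ^ 2) ^ (-(N : ℝ) / 2)) * ‖h k‖ₑ *
        ENNReal.ofReal ((1 + ‖k‖ ^ 2) ^ ((N : ℝ) / 2) * ((1 + ‖k‖ ^ 2) ^ N')⁻¹) =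
        ‖h k‖ₑ * ENNReal.ofReal (((1 + ‖k‖ ^ 2) ^ N')⁻¹) := by
      intro k
      rw [mul_comm (ENNReal.ofReal _) ‖h k‖ₑ, mul_assoc, ← ENNReal.ofReal_mul (by positivity),
        ← mul_assoc ((1 + ‖k‖ ^ 2) ^ (-(N : ℝ) / 2)), ← Real.rpow_add (by positivity)]
      ring_nf
      simp
    have e2 : ∀ k : W, (ENNReal.ofReal ((1 + ‖k‖ ^ 2) ^ (-(N : ℝ) / 2)) * ‖h k‖ₑ) ^ 2 =
        ENNReal.ofReal ((1 + ‖k‖ ^ 2) ^ (-(N : ℝ))) * ‖h k‖ₑ ^ 2 := by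
      intro k
      rw [mul_pow, ← ENNReal.ofReal_pow (by positivity), ← Real.rpow_natCast,
        ← Real.rpow_mul (by positivity)]
      norm_num
    have e3 : ∀ k : W, ENNReal.ofReal ((1 + ‖k‖ ^ 2) ^ ((N : ℝ) / 2) *
        ((1 + ‖k‖ ^ 2) ^ N')⁻¹) ^ 2 =
        ENNReal.ofReal ((1 + ‖k‖ ^ 2) ^ (N : ℝ) * ((1 + ‖k‖ ^ 2) ^ (2 * N'))⁻¹) := by
      intro k
      rw [← ENNReal.ofReal_pow (by positivity), mul_pow, ← Real.rpow_natCast _ 2,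
        ← Real.rpow_mul (by positivity), inv_pow, ← pow_mul, mul_comm N' 2]
      norm_num
    simp_rw [e1, e2, e3] at h1
    refine h1.trans (le_of_eq ?_)
    rw [sobolevSq, Measure.restrict_univ]
  have hIfin : I < ⊤ := by
    have : I ^ 2 < ⊤ := hI.trans_lt (ENNReal.mul_lt_top hN hJ₂)
    exact (ENNReal.pow_lt_top_iff.1 this).resolve_right two_ne_zero
  have hnear2 : ∀ i, MemLp ((nearShell Γ c i).indicator h) 2 volume := fun i => by
    rw [memLp_indicator_iff_restrict (measurableSet_nearShell hΓm c i)]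
    exact memLp_two_of_lintegral_enorm_sq hh.restrict
      (lintegral_enorm_sq_nearShell_lt_top hΓm hN c i)
  have hnear1 : ∀ i, Integrable ((nearShell Γ c i).indicator h) volume := fun i => by
    rw [integrable_indicator_iff (measurableSet_nearShell hΓm c i)]
    have := hnear2 i
    rw [memLp_indicator_iff_restrict (measurableSet_nearShell hΓm c i)] at this
    have hfm : IsFiniteMeasure (volume.restrict (nearShell Γ c i)) :=
      ⟨by rw [Measure.restrict_apply_univ]; exact volume_nearShell_lt_top Γ c i⟩
    exact this.integrable one_le_two
  have hT : ∀ l, Continuous fun k => oscKernel χ a k l :=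
    continuous_oscKernel_left hχ.continuous haint
  -- For each `l`, the function `h` is split into its part on the shells near that of `l`, inside
  -- `Γ`, and the rest. On the rest the kernel decays rapidly, and the a priori order of `h` is all
  -- that is needed.
  have hptwise : ∀ l ∈ G, ‖∫ k, h k * oscKernel χ a k l‖ₑ ^ 2 ≤
      2 * (‖∫ k, (nearShell Γ c (shellIndex l)).indicator h k * oscKernel χ a k l‖ₑ ^ 2 +
        (ENNReal.ofReal (Cf * B * ((1 + ‖l‖ ^ 2) ^ N')⁻¹) * I) ^ 2) := by
    intro l hl
    set S := nearShell Γ c (shellIndex l)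
    have hSm : MeasurableSet S := measurableSet_nearShell hΓm _ _
    have hbd : ∀ k, ‖Sᶜ.indicator h k * oscKernel χ a k l‖ₑ ≤
        ENNReal.ofReal (Cf * B * ((1 + ‖l‖ ^ 2) ^ N')⁻¹) *
          (‖h k‖ₑ * ENNReal.ofReal (((1 + ‖k‖ ^ 2) ^ N')⁻¹)) := by
      intro k
      by_cases hk : k ∈ S
      · simp [hk]
      · rw [Set.indicator_of_mem (Set.mem_compl hk), enorm_mul, mul_left_comm,
          ← ENNReal.ofReal_mul (by positivity)]
        gcongr
        rw [← ofReal_norm]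
        refine ENNReal.ofReal_le_ofReal ?_
        have := hdec a ha hac (haV.trans Set.inter_subset_left) B hB (k, l)
          (hfar (mem_farSet_of_notMem_nearShell hl hk))
        refine this.trans (le_of_eq (by ring))
    have hlint : ∫⁻ k, ‖Sᶜ.indicator h k * oscKernel χ a k l‖ₑ ≤
        ENNReal.ofReal (Cf * B * ((1 + ‖l‖ ^ 2) ^ N')⁻¹) * I := by
      rw [← lintegral_const_mul' _ _ ENNReal.ofReal_ne_top]
      exact lintegral_mono hbd
    have hint1 : Integrable (fun k => S.indicator h k * oscKernel χ a k l) volume :=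
      (hnear1 _).mul_bdd (c := ∫ x, ‖a x‖) (hT l).aestronglyMeasurable
        (ae_of_all _ fun k => norm_oscKernel_le χ a k l)
    have hint2 : Integrable (fun k => Sᶜ.indicator h k * oscKernel χ a k l) volume :=
      ⟨(hh.indicator hSm.compl).mul (hT l).aestronglyMeasurable,
        hlint.trans_lt (ENNReal.mul_lt_top ENNReal.ofReal_lt_top hIfin)⟩
    have hsplit : ∫ k, h k * oscKernel χ a k l =
        (∫ k, S.indicator h k * oscKernel χ a k l) +
          ∫ k, Sᶜ.indicator h k * oscKernel χ a k l := by
      rw [← integral_add hint1 hint2]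
      congr 1; ext k
      rw [← add_mul]
      congr 1
      exact (congrFun (Set.indicator_self_add_compl S h) k).symm
    rw [hsplit]
    refine (enorm_add_sq_le _ _).trans ?_
    gcongr
    exact (enorm_integral_le_lintegral_enorm _).trans hlint
  have hfarterm : ∫⁻ l : W, ENNReal.ofReal ((1 + ‖l‖ ^ 2) ^ s) *
      (ENNReal.ofReal (Cf * B * ((1 + ‖l‖ ^ 2) ^ N')⁻¹) * I) ^ 2 =
      ENNReal.ofReal Cf ^ 2 * ENNReal.ofReal B ^ 2 * I ^ 2 * J₁ := by
    rw [← lintegral_const_mul' _ _ (by finiteness)]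
    congr 1; ext l
    rw [mul_pow, ENNReal.ofReal_mul (by positivity), ENNReal.ofReal_mul hCf, mul_pow, mul_pow,
      ENNReal.ofReal_mul (by positivity),
      ← ENNReal.ofReal_pow (p := ((1 + ‖l‖ ^ 2) ^ N')⁻¹) (by positivity) 2, inv_pow,
      ← pow_mul, mul_comm N' 2]
    ring
  -- The near part is estimated shell by shell: there the weight is essentially constant on both
  -- sides, so the unweighted `L²` bound applies. Finite overlap permits summation over the shells.
  have hnearterm : ∫⁻ l in G, ENNReal.ofReal ((1 + ‖l‖ ^ 2) ^ s) *
      ‖∫ k, (nearShell Γ c (shellIndex l)).indicator h k * oscKernel χ a k l‖ₑ ^ 2 ≤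
      E * (C₂ * ENNReal.ofReal B ^ 2) * ((2 * c + 1 : ℕ) * sobolevSq s Γ h) := by
    have hcover : (⋃ i : ℕ, {l : W | shellIndex l = i}) = Set.univ :=
      Set.eq_univ_of_forall fun l => Set.mem_iUnion.2 ⟨shellIndex l, rfl⟩
    calc _ ≤ ∫⁻ l in ⋃ i : ℕ, {l : W | shellIndex l = i}, ENNReal.ofReal ((1 + ‖l‖ ^ 2) ^ s) *
          ‖∫ k, (nearShell Γ c (shellIndex l)).indicator h k * oscKernel χ a k l‖ₑ ^ 2 := by
          rw [hcover, Measure.restrict_univ]; exact setLIntegral_le_lintegral _ _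
      _ ≤ ∑' i : ℕ, ∫⁻ l in {l : W | shellIndex l = i}, ENNReal.ofReal ((1 + ‖l‖ ^ 2) ^ s) *
          ‖∫ k, (nearShell Γ c (shellIndex l)).indicator h k * oscKernel χ a k l‖ₑ ^ 2 :=
          lintegral_iUnion_le _ _
      _ ≤ ∑' i : ℕ, E * (C₂ * ENNReal.ofReal B ^ 2) *
          ∫⁻ k in nearShell Γ c i, ENNReal.ofReal ((1 + ‖k‖ ^ 2) ^ s) * ‖h k‖ₑ ^ 2 := by
          refine ENNReal.tsum_le_tsum fun i => ?_
          refine le_trans (le_of_eq ?_) (lintegral_shell_nearShell_le (χ := χ) (a := a) hΓm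
            (h := h) (c := c) (i := i) (s := s) (C := C₂ * ENNReal.ofReal B ^ 2)
            (hL2 a ha.continuous (fun x hx => image_eq_zero_of_notMem_tsupport
              fun h => hx (haV h).2 : ∀ x ∉ V₂, a x = 0) B (fun x => by simpa using hB 0 (Nat.zero_le _) x) _
              (hnear1 i) (hnear2 i)))
          refine setLIntegral_congr_fun (measurable_shellIndex (measurableSet_singleton i))
            fun l hl => ?_
          have hl' : shellIndex l = i := hl
          simp only [hl']
      _ ≤ _ := by
          rw [ENNReal.tsum_mul_left]
          gcongr
          exact tsum_setLIntegral_nearShell_le hΓm c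
            (by have := hh.enorm; fun_prop)
  calc sobolevSq s G (fun l => ∫ k, h k * oscKernel χ a k l)
      ≤ ∫⁻ l in G, 2 * (ENNReal.ofReal ((1 + ‖l‖ ^ 2) ^ s) *
          ‖∫ k, (nearShell Γ c (shellIndex l)).indicator h k * oscKernel χ a k l‖ₑ ^ 2 +
          ENNReal.ofReal ((1 + ‖l‖ ^ 2) ^ s) *
            (ENNReal.ofReal (Cf * B * ((1 + ‖l‖ ^ 2) ^ N')⁻¹) * I) ^ 2) := by
        refine setLIntegral_mono' hG.measurableSet fun l hl => ?_
        calc _ ≤ ENNReal.ofReal ((1 + ‖l‖ ^ 2) ^ s) * _ :=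
              mul_le_mul_right (hptwise l hl) _
          _ = _ := by ring
    _ ≤ 2 * (E * (C₂ * ENNReal.ofReal B ^ 2) * ((2 * c + 1 : ℕ) * sobolevSq s Γ h) +
          ENNReal.ofReal Cf ^ 2 * ENNReal.ofReal B ^ 2 * I ^ 2 * J₁) := by
        rw [lintegral_const_mul' _ _ (by norm_num), lintegral_add_right _ (by fun_prop)]
        gcongr
        exact (setLIntegral_le_lintegral _ _).trans hfarterm.le
    _ ≤ 2 * (E * (C₂ * ENNReal.ofReal B ^ 2) * ((2 * c + 1 : ℕ) * sobolevSq s Γ h) +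
          ENNReal.ofReal Cf ^ 2 * ENNReal.ofReal B ^ 2 *
            (sobolevSq (-(N : ℝ)) Set.univ h * J₂) * J₁) := by gcongr
    _ = 2 * (E * C₂ * (2 * c + 1 : ℕ)) * ENNReal.ofReal B ^ 2 * sobolevSq s Γ h +
          2 * (ENNReal.ofReal Cf ^ 2 * J₁ * J₂) * ENNReal.ofReal B ^ 2 *
            sobolevSq (-(N : ℝ)) Set.univ h := by ring
    _ ≤ 2 * (E * C₂ * (2 * c + 1 : ℕ) + ENNReal.ofReal Cf ^ 2 * J₁ * J₂) *
          ENNReal.ofReal B ^ 2 * sobolevSq s Γ h +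
        2 * (E * C₂ * (2 * c + 1 : ℕ) + ENNReal.ofReal Cf ^ 2 * J₁ * J₂) *
          ENNReal.ofReal B ^ 2 * sobolevSq (-(N : ℝ)) Set.univ h := by
        gcongr
        · exact le_self_add
        · exact le_add_self
    _ = _ := by ring

end Euclidean

/-! ### Cones, duality of Sobolev weights, and truncation -/

section Euclidean

variable {W : Type*} [NormedAddCommGroup W] [InnerProductSpace ℝ W] [FiniteDimensional ℝ W]
  [MeasurableSpace W] [BorelSpace W]

/-- The closed cone of aperture `δ` around a unit vector `η`. -/
def coneAround (η : W) (δ : ℝ) : Set W := {l | (1 - δ) * ‖l‖ ≤ inner ℝ l η}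

theorem isClosed_coneAround (η : W) (δ : ℝ) : IsClosed (coneAround η δ) :=
  isClosed_le (by fun_prop) (by fun_prop)

theorem isConic_coneAround (η : W) (δ : ℝ) : IsConic (coneAround η δ) := by
  intro c hc k hk
  have hk' : (1 - δ) * ‖k‖ ≤ inner ℝ k η := hk
  change (1 - δ) * ‖c • k‖ ≤ inner ℝ (c • k) η
  rw [norm_smul, Real.norm_of_nonneg hc.le, inner_smul_left]
  simp only [conj_trivial]
  nlinarith

theorem coneAround_mono (η : W) {δ δ' : ℝ} (h : δ ≤ δ') : coneAround η δ ⊆ coneAround η δ' := by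
  intro l hl
  have hl' : (1 - δ) * ‖l‖ ≤ inner ℝ l η := hl
  change (1 - δ') * ‖l‖ ≤ inner ℝ l η
  nlinarith [norm_nonneg l]

/-- For unit vectors the squared distance is twice one minus the inner product. Aperture `ε ^ 2 / 4`
thus keeps the normalised `l` within `ε` of `η`, and conicity of `Γ` removes the normalisation. -/
theorem exists_coneAround_mapsTo {η : W} (hη : ‖η‖ = 1) (A : W →L[ℝ] W) {Γ : Set W}
    (hΓ : IsOpen Γ) (hΓc : IsConic Γ) (hA : A η ∈ Γ) :
    ∃ δ > 0, ∀ l ∈ coneAround η δ, l ≠ 0 → A l ∈ Γ := by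
  obtain ⟨ε, hε, hball⟩ := Metric.isOpen_iff.1 (hΓ.preimage A.continuous) η hA
  refine ⟨ε ^ 2 / 4, by positivity, fun l hl hl0 => ?_⟩
  have hn : 0 < ‖l‖ := norm_pos_iff.2 hl0
  have hl' : (1 - ε ^ 2 / 4) * ‖l‖ ≤ inner ℝ l η := hl
  have h1 : ‖‖l‖⁻¹ • l‖ = 1 := by rw [norm_smul, norm_inv, norm_norm, inv_mul_cancel₀ hn.ne']
  have h2 : 1 - ε ^ 2 / 4 ≤ inner ℝ (‖l‖⁻¹ • l) η := by
    rw [inner_smul_left]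
    simp only [conj_trivial]
    rw [inv_mul_eq_div, le_div_iff₀ hn]; exact hl'
  have h3 : ‖‖l‖⁻¹ • l - η‖ ^ 2 < ε ^ 2 := by
    rw [@norm_sub_sq ℝ, h1, hη]
    simp only [RCLike.re_to_real]
    nlinarith
  have h4 : A (‖l‖⁻¹ • l) ∈ Γ := by
    refine hball ?_
    rw [Metric.mem_ball, dist_eq_norm]
    exact lt_of_pow_lt_pow_left₀ 2 hε.le h3
  rw [map_smul] at h4
  exact (hΓc.smul_mem_iff (inv_pos.2 hn)).1 h4

/-- Covering of Euclidean space by finitely many cones with a given property. -/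
theorem exists_finite_cone_cover {X : Type*} {Q : X → Set W → Prop}
    (h : ∀ η : W, ‖η‖ = 1 → ∃ δ > 0, ∃ x, Q x (coneAround η δ))
    (h0 : Subsingleton W → ∃ x, Q x Set.univ) :
    ∃ (n : ℕ) (x : Fin n → X) (G O : Fin n → Set W),
      (∀ i, IsClosed (G i) ∧ IsConic (G i) ∧ IsOpen (O i) ∧ IsConic (O i) ∧ O i ⊆ G i ∧
        Q (x i) (G i)) ∧ (∀ l, ∃ i, l ∈ G i) ∧ ∀ l, l ≠ 0 → ∃ i, l ∈ O i := by
  -- In dimension zero there are no directions from which to build cones, and the whole space is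
  -- taken as the only cone.
  rcases subsingleton_or_nontrivial W with hW | hW
  · obtain ⟨x, hx⟩ := h0 hW
    exact ⟨1, fun _ => x, fun _ => Set.univ, fun _ => Set.univ,
      fun _ => ⟨isClosed_univ, fun _ _ _ _ => trivial, isOpen_univ, fun _ _ _ _ => trivial,
        subset_rfl, hx⟩, fun l => ⟨0, trivial⟩, fun l _ => ⟨0, trivial⟩⟩
  · have h' : ∀ η : Metric.sphere (0 : W) 1, ∃ δ > 0, ∃ x, Q x (coneAround (η : W) δ) :=
      fun η => h η (by simp)
    choose δ hδ x hQ using h'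
    set O' : Metric.sphere (0 : W) 1 → Set W :=
      fun η => {l | (1 - δ η) * ‖l‖ < inner ℝ l (η : W)}
    have hO : ∀ η, IsOpen (O' η) := fun η => isOpen_lt (by fun_prop) (by fun_prop)
    obtain ⟨t, ht⟩ := (isCompact_sphere (0 : W) 1).elim_finite_subcover O' hO fun l hl => by
      refine Set.mem_iUnion.2 ⟨⟨l, hl⟩, ?_⟩
      have hl1 : ‖l‖ = 1 := by simpa using hl
      change (1 - δ ⟨l, hl⟩) * ‖l‖ < inner ℝ l l
      rw [real_inner_self_eq_norm_sq, hl1]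
      linarith [hδ ⟨l, hl⟩]
    have hOc : ∀ η, IsConic (O' η) := fun η c hc k hk => by
      have hk' : (1 - δ η) * ‖k‖ < inner ℝ k (η : W) := hk
      change (1 - δ η) * ‖c • k‖ < inner ℝ (c • k) (η : W)
      rw [norm_smul, Real.norm_of_nonneg hc.le, inner_smul_left]
      simp only [conj_trivial]
      nlinarith
    have hOG : ∀ η, O' η ⊆ coneAround (η : W) (δ η) := fun η l hl =>
      le_of_lt (show (1 - δ η) * ‖l‖ < inner ℝ l (η : W) from hl)
    have hcov : ∀ l, l ≠ 0 → ∃ i : Fin t.card, l ∈ O' (t.equivFin.symm i) := by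
      intro l hl
      have hn : 0 < ‖l‖ := norm_pos_iff.2 hl
      have := ht (show ‖l‖⁻¹ • l ∈ Metric.sphere (0 : W) 1 by simp [norm_smul, hn.ne'])
      obtain ⟨η, hη, hl'⟩ := Set.mem_iUnion₂.1 this
      refine ⟨t.equivFin ⟨η, hη⟩, ?_⟩
      rw [Equiv.symm_apply_apply]
      exact ((hOc η).smul_mem_iff (inv_pos.2 hn)).1 hl'
    refine ⟨t.card, fun i => x (t.equivFin.symm i), fun i => coneAround
      ((t.equivFin.symm i : Metric.sphere (0 : W) 1) : W) (δ (t.equivFin.symm i)),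
      fun i => O' (t.equivFin.symm i), fun i => ⟨isClosed_coneAround _ _, isConic_coneAround _ _,
        hO _, hOc _, hOG _, hQ _⟩, fun l => ?_, hcov⟩
    -- The origin lies in each of the closed cones; nontriviality of `W` guarantees that the family
    -- is not empty.
    rcases eq_or_ne l 0 with rfl | hl
    · obtain ⟨v, hv⟩ := exists_ne (0 : W)
      obtain ⟨i, -⟩ := hcov v hv
      exact ⟨i, by simp [coneAround]⟩
    · obtain ⟨i, hi⟩ := hcov l hl
      exact ⟨i, hOG _ hi⟩

/-- This is where the condition on the orders acts: the two weights of orders `s / 2` and `t / 2`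
have product at least `1` precisely because `s + t ≥ 0`, so they may be inserted before
Cauchy-Schwarz. -/
theorem lintegral_enorm_mul_sq_le_sobolevSq {s t : ℝ} (hst : 0 ≤ s + t) (G : Set W)
    {f g : W → ℂ} (hf : AEStronglyMeasurable f volume) (hg : AEStronglyMeasurable g volume) :
    (∫⁻ l in G, ‖f l * g l‖ₑ) ^ 2 ≤ sobolevSq s G f * sobolevSq t G g := by
  have h1 := lintegral_mul_sq_le (μ := (volume : Measure W).restrict G)
    (f := fun k => ENNReal.ofReal ((1 + ‖k‖ ^ 2) ^ (s / 2)) * ‖f k‖ₑ)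
    (g := fun k => ENNReal.ofReal ((1 + ‖k‖ ^ 2) ^ (t / 2)) * ‖g k‖ₑ)
    ((by fun_prop : Measurable fun k : W => (1 + ‖k‖ ^ 2) ^ (s / 2)).ennreal_ofReal.aemeasurable.mul
      hf.restrict.enorm)
    ((by fun_prop : Measurable fun k : W => (1 + ‖k‖ ^ 2) ^ (t / 2)).ennreal_ofReal.aemeasurable.mul
      hg.restrict.enorm)
  have e : ∀ (r : ℝ) (f : W → ℂ) (k : W),
      (ENNReal.ofReal ((1 + ‖k‖ ^ 2) ^ (r / 2)) * ‖f k‖ₑ) ^ 2 =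
        ENNReal.ofReal ((1 + ‖k‖ ^ 2) ^ r) * ‖f k‖ₑ ^ 2 := by
    intro r f k
    rw [mul_pow, ← ENNReal.ofReal_pow (by positivity), ← Real.rpow_natCast,
      ← Real.rpow_mul (by positivity)]
    norm_num
  simp_rw [e] at h1
  refine le_trans (pow_le_pow_left₀ zero_le (lintegral_mono fun k => ?_) 2) h1
  have h2 : ENNReal.ofReal ((1 + ‖k‖ ^ 2) ^ (s / 2)) * ‖f k‖ₑ *
      (ENNReal.ofReal ((1 + ‖k‖ ^ 2) ^ (t / 2)) * ‖g k‖ₑ) =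
      ENNReal.ofReal ((1 + ‖k‖ ^ 2) ^ ((s + t) / 2)) * (‖f k‖ₑ * ‖g k‖ₑ) := by
    rw [add_div, Real.rpow_add (by positivity), ENNReal.ofReal_mul (by positivity)]; ring
  rw [h2, enorm_mul]
  refine le_mul_of_one_le_left zero_le ?_
  rw [← ENNReal.ofReal_one]
  exact ENNReal.ofReal_le_ofReal (Real.one_le_rpow (by nlinarith [sq_nonneg ‖k‖]) (by linarith))

theorem lintegral_enorm_mul_le_sum_sobolevSq {n : ℕ} {s t : Fin n → ℝ} {G : Fin n → Set W}
    (hst : ∀ i, 0 ≤ s i + t i) (hG : ∀ l, ∃ i, l ∈ G i)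
    {f g : W → ℂ} (hf : AEStronglyMeasurable f volume) (hg : AEStronglyMeasurable g volume) :
    ∫⁻ l, ‖f l * g l‖ₑ ≤
      ∑ i, (sobolevSq (s i) (G i) f * sobolevSq (t i) (G i) g) ^ (1 / 2 : ℝ) := by
  have hcover : (⋃ i, G i) = Set.univ :=
    Set.eq_univ_of_forall fun l => Set.mem_iUnion.2 (hG l)
  calc ∫⁻ l, ‖f l * g l‖ₑ = ∫⁻ l in ⋃ i, G i, ‖f l * g l‖ₑ := by
        rw [hcover, Measure.restrict_univ]
    _ ≤ ∑' i, ∫⁻ l in G i, ‖f l * g l‖ₑ := lintegral_iUnion_le _ _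
    _ = ∑ i, ∫⁻ l in G i, ‖f l * g l‖ₑ := tsum_fintype _
    _ ≤ _ := by
      refine Finset.sum_le_sum fun i _ => ?_
      rw [one_div, ENNReal.le_rpow_inv_iff two_pos, ENNReal.rpow_ofNat]
      exact lintegral_enorm_mul_sq_le_sobolevSq (hst i) (G i) hf hg

theorem sobolevSq_comp_neg (s : ℝ) {G : Set W} (hG : MeasurableSet G) (f : W → ℂ) :
    sobolevSq s G (fun l => f (-l)) = sobolevSq s {l | -l ∈ G} f := by
  have hG' : MeasurableSet {l : W | -l ∈ G} := measurable_neg hG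
  unfold sobolevSq
  rw [← lintegral_indicator hG, ← lintegral_indicator hG',
    ← (Measure.measurePreserving_neg volume).lintegral_comp_emb
    (Homeomorph.neg W).measurableEmbedding]
  congr 1; ext l
  simp [Set.indicator]

theorem sobolevSq_mono (s : ℝ) {G G' : Set W} (h : G ⊆ G') (f : W → ℂ) :
    sobolevSq s G f ≤ sobolevSq s G' f := lintegral_mono_set h

theorem sobolevSq_indicator_le (s : ℝ) (G S : Set W) (f : W → ℂ) :
    sobolevSq s G (S.indicator f) ≤ sobolevSq s G f := by
  refine lintegral_mono fun k => ?_
  gcongr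
  by_cases hk : k ∈ S <;> simp [hk]

/-- Truncations outside of large balls tend to zero in Sobolev norm. -/
theorem tendsto_sobolevSq_indicator_compl_closedBall {s : ℝ} {G : Set W} {f : W → ℂ}
    (hf : AEStronglyMeasurable f volume) (hfin : sobolevSq s G f < ⊤) :
    Tendsto (fun R : ℕ => sobolevSq s G ((Metric.closedBall (0 : W) R)ᶜ.indicator f)) atTop
      (𝓝 0) := by
  unfold sobolevSq at hfin ⊢
  rw [← lintegral_zero (μ := (volume : Measure W).restrict G)]
  refine tendsto_lintegral_of_dominated_convergence' _ (fun R => ?_) (fun R =>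
    ae_of_all _ fun k => ?_) hfin.ne (ae_of_all _ fun k => ?_)
  · have := (hf.indicator (measurableSet_closedBall (x := (0 : W)) (ε := R)).compl).restrict
      (s := G)
    exact (by fun_prop : Measurable fun k : W => (1 + ‖k‖ ^ 2) ^ s).ennreal_ofReal.aemeasurable.mul
      (this.enorm.pow_const 2)
  · dsimp only
    gcongr
    by_cases hk : k ∈ (Metric.closedBall (0 : W) R)ᶜ
    · rw [Set.indicator_of_mem hk]
    · rw [Set.indicator_of_notMem hk]; simp
  · refine tendsto_const_nhds.congr' ?_
    obtain ⟨R, hR⟩ := exists_nat_ge ‖k‖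
    filter_upwards [eventually_ge_atTop R] with n hn
    have : k ∉ (Metric.closedBall (0 : W) n)ᶜ := by
      simp only [Set.mem_compl_iff, not_not, mem_closedBall_zero_iff]
      exact hR.trans (by exact_mod_cast hn)
    rw [Set.indicator_of_notMem this]; simp

end Euclidean

/-! ### Charts, and transport of test functions to Euclidean space -/

section Charts

variable {E H : Type*} [NormedAddCommGroup E] [NormedSpace ℝ E] [TopologicalSpace H]
  {I : ModelWithCorners ℝ E H} {N : Type*} [TopologicalSpace N] [ChartedSpace H N]
  {W : Type*} [NormedAddCommGroup W] [InnerProductSpace ℝ W]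

variable (I N W) in
/-- A smooth chart of the manifold `N` with values in the Euclidean space `W`. -/
structure SmoothChart extends OpenPartialHomeomorph N W where
  smooth : ContMDiffOn I 𝓘(ℝ, W) ∞ toOpenPartialHomeomorph toOpenPartialHomeomorph.source
  smooth_symm : ContMDiffOn 𝓘(ℝ, W) I ∞ toOpenPartialHomeomorph.symm
    toOpenPartialHomeomorph.target

namespace SmoothChart

instance : CoeFun (SmoothChart I N W) fun _ => N → W := ⟨fun Y => Y.toOpenPartialHomeomorph⟩

variable (Y Y' : SmoothChart I N W)

theorem isOpen_overlap : IsOpen (Y.target ∩ Y.symm ⁻¹' Y'.source) :=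
  Y.symm.isOpen_inter_preimage Y'.open_source

theorem contDiffOn_transition :
    ContDiffOn ℝ ∞ (fun y => Y' (Y.symm y)) (Y.target ∩ Y.symm ⁻¹' Y'.source) := by
  rw [← contMDiffOn_iff_contDiffOn]
  exact Y'.smooth.comp (Y.smooth_symm.mono Set.inter_subset_left) fun y hy => hy.2

/-- The representation in the chart `Y` of a function supported in the domain of `Y`. -/
def push (φ : N → ℂ) : W → ℂ := Y.target.indicator fun y => φ (Y.symm y)

theorem push_of_mem {φ : N → ℂ} {y : W} (hy : y ∈ Y.target) : Y.push φ y = φ (Y.symm y) :=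
  Set.indicator_of_mem hy _

theorem push_of_notMem {φ : N → ℂ} {y : W} (hy : y ∉ Y.target) : Y.push φ y = 0 :=
  Set.indicator_of_notMem hy _

theorem push_apply {φ : N → ℂ} {p : N} (hp : p ∈ Y.source) : Y.push φ (Y p) = φ p := by
  rw [push_of_mem _ (Y.map_source hp), Y.left_inv hp]

theorem push_mul (φ ψ : N → ℂ) : Y.push (fun p => φ p * ψ p) = fun y => Y.push φ y * Y.push ψ y := by
  ext y
  by_cases hy : y ∈ Y.target
  · simp only [push_of_mem _ hy]
  · simp only [push_of_notMem _ hy, mul_zero]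

theorem push_mul_comp (φ : N → ℂ) (F : W → ℂ) :
    Y.push (fun p => φ p * F (Y p)) = fun y => Y.push φ y * F y := by
  ext y
  by_cases hy : y ∈ Y.target
  · simp only [push_of_mem _ hy, Y.right_inv hy]
  · simp only [push_of_notMem _ hy, zero_mul]

theorem tsupport_push_subset {φ : N → ℂ} (hc : HasCompactSupport φ) (hs : tsupport φ ⊆ Y.source) :
    tsupport (Y.push φ) ⊆ Y '' tsupport φ := by
  refine closure_minimal (fun y hy => ?_)
    (hc.isCompact.image_of_continuousOn (Y.continuousOn.mono hs)).isClosed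
  by_cases hyt : y ∈ Y.target
  · rw [Function.mem_support, push_of_mem _ hyt] at hy
    exact ⟨_, subset_tsupport _ hy, Y.right_inv hyt⟩
  · exact absurd (push_of_notMem _ hyt) hy

theorem hasCompactSupport_push {φ : N → ℂ} (hc : HasCompactSupport φ)
    (hs : tsupport φ ⊆ Y.source) : HasCompactSupport (Y.push φ) :=
  HasCompactSupport.of_support_subset_isCompact
    (hc.isCompact.image_of_continuousOn (Y.continuousOn.mono hs))
    ((subset_tsupport _).trans (Y.tsupport_push_subset hc hs))

theorem contDiff_push {φ : N → ℂ} (hφ : φ ∈ testFunctions I N) (hs : tsupport φ ⊆ Y.source) :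
    ContDiff ℝ ∞ (Y.push φ) := by
  rw [contDiff_iff_contDiffAt]
  intro y
  by_cases hy : y ∈ Y.target
  · have h1 : ContDiffOn ℝ ∞ (fun y => φ (Y.symm y)) Y.target := by
      rw [← contMDiffOn_iff_contDiffOn]
      exact hφ.1.comp_contMDiffOn Y.smooth_symm
    refine (h1.contDiffAt (Y.open_target.mem_nhds hy)).congr_of_eventuallyEq ?_
    filter_upwards [Y.open_target.mem_nhds hy] with z hz using push_of_mem _ hz
  · have : y ∉ tsupport (Y.push φ) := fun h => by
      obtain ⟨p, hp, rfl⟩ := Y.tsupport_push_subset hφ.2 hs h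
      exact hy (Y.map_source (hs hp))
    refine (contDiffAt_const (c := (0 : ℂ))).congr_of_eventuallyEq ?_
    filter_upwards [(isClosed_tsupport (Y.push φ)).isOpen_compl.mem_nhds this] with z hz
    exact image_eq_zero_of_notMem_tsupport hz

/-- The function on `N` represented in the chart `Y` by a function supported in its range. -/
def pull (F : W → ℂ) : N → ℂ := Y.source.indicator fun p => F (Y p)

theorem pull_of_mem {F : W → ℂ} {p : N} (hp : p ∈ Y.source) : Y.pull F p = F (Y p) :=
  Set.indicator_of_mem hp _

theorem tsupport_pull_subset [T2Space N] {F : W → ℂ} (hc : HasCompactSupport F)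
    (hs : tsupport F ⊆ Y.target) : tsupport (Y.pull F) ⊆ Y.symm '' tsupport F := by
  refine closure_minimal (fun p hp => ?_)
    (hc.isCompact.image_of_continuousOn (Y.symm.continuousOn.mono hs)).isClosed
  by_cases hps : p ∈ Y.source
  · rw [Function.mem_support, pull_of_mem _ hps] at hp
    exact ⟨_, subset_tsupport _ hp, Y.left_inv hps⟩
  · exact absurd (Set.indicator_of_notMem hps _) hp

theorem pull_mem [T2Space N] {F : W → ℂ} (hF : ContDiff ℝ ∞ F) (hc : HasCompactSupport F)
    (hs : tsupport F ⊆ Y.target) :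
    Y.pull F ∈ testFunctions I N ∧ tsupport (Y.pull F) ⊆ Y.source := by
  have hsub := Y.tsupport_pull_subset hc hs
  have himg : Y.symm '' tsupport F ⊆ Y.source := by
    rintro _ ⟨y, hy, rfl⟩; exact Y.map_target (hs hy)
  refine ⟨⟨fun p => ?_, ?_⟩, hsub.trans himg⟩
  · by_cases hp : p ∈ Y.source
    · have h1 : ContMDiffOn I 𝓘(ℝ, ℂ) ∞ (fun p => F (Y p)) Y.source :=
        hF.contMDiff.comp_contMDiffOn Y.smooth
      refine (h1.contMDiffAt (Y.open_source.mem_nhds hp)).congr_of_eventuallyEq ?_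
      filter_upwards [Y.open_source.mem_nhds hp] with z hz using pull_of_mem _ hz
    · have : p ∉ tsupport (Y.pull F) := fun h => hp (himg (hsub h))
      refine (contMDiffAt_const (c := (0 : ℂ))).congr_of_eventuallyEq ?_
      filter_upwards [(isClosed_tsupport (Y.pull F)).isOpen_compl.mem_nhds this] with z hz
      exact image_eq_zero_of_notMem_tsupport hz
  · exact HasCompactSupport.of_support_subset_isCompact
      (hc.isCompact.image_of_continuousOn (Y.symm.continuousOn.mono hs))
      ((subset_tsupport _).trans hsub)

theorem mul_comp_mem {φ : N → ℂ} (hφ : φ ∈ testFunctions I N) (hs : tsupport φ ⊆ Y.source)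
    {F : W → ℂ} (hF : ContDiff ℝ ∞ F) : (fun p => φ p * F (Y p)) ∈ testFunctions I N :=
  mul_mem_testFunctions hφ Y.open_source hs (hF.contMDiff.comp_contMDiffOn Y.smooth)

end SmoothChart

theorem testFunctions_mul_mem {φ ψ : N → ℂ} (hφ : φ ∈ testFunctions I N)
    (hψ : ψ ∈ testFunctions I N) : (fun p => φ p * ψ p) ∈ testFunctions I N :=
  mul_mem_testFunctions hφ isOpen_univ (Set.subset_univ _) hψ.1.contMDiffOn

theorem tsupport_mul_left_subset (φ ψ : N → ℂ) : tsupport (fun p => φ p * ψ p) ⊆ tsupport φ :=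
  closure_mono fun p hp h => hp (by simp [h])

/-- Existence of cut-off functions at a point. -/
theorem exists_testFunction_eq_one [FiniteDimensional ℝ W] [T2Space N] (Y : SmoothChart I N W)
    {p : N} (hp : p ∈ Y.source) {V : Set N} (hV : V ∈ 𝓝 p) :
    ∃ φ ∈ testFunctions I N, tsupport φ ⊆ V ∧ tsupport φ ⊆ Y.source ∧ ∀ᶠ q in 𝓝 p, φ q = 1 := by
  have h1 : Y.target ∩ Y.symm ⁻¹' (interior V) ∈ 𝓝 (Y p) := by
    refine (Y.symm.isOpen_inter_preimage isOpen_interior).mem_nhds ⟨Y.map_source hp, ?_⟩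
    rw [Set.mem_preimage, Y.left_inv hp]
    exact mem_interior_iff_mem_nhds.2 hV
  obtain ⟨ε, hε, hball⟩ := Metric.nhds_basis_closedBall.mem_iff.1 h1
  let b : ContDiffBump (Y p) := ⟨ε / 2, ε, by positivity, by linarith⟩
  have hbs : ContDiff ℝ ∞ (fun x => ((b x : ℝ) : ℂ)) := Complex.ofRealCLM.contDiff.comp b.contDiff
  have hbc : HasCompactSupport (fun x => ((b x : ℝ) : ℂ)) :=
    b.hasCompactSupport.comp_left (g := fun x : ℝ => (x : ℂ)) (by simp)
  have hsub : tsupport (fun x => ((b x : ℝ) : ℂ)) ⊆ Metric.closedBall (Y p) ε := by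
    rw [← b.tsupport_eq]
    exact closure_mono fun x hx h => hx (by simp [h])
  have hst : tsupport (fun x => ((b x : ℝ) : ℂ)) ⊆ Y.target := fun x hx => (hball (hsub hx)).1
  obtain ⟨hm, hms⟩ := Y.pull_mem hbs hbc hst
  refine ⟨_, hm, ?_, hms, ?_⟩
  · refine (Y.tsupport_pull_subset hbc hst).trans ?_
    rintro _ ⟨y, hy, rfl⟩
    exact interior_subset (hball (hsub hy)).2
  · filter_upwards [Y.open_source.mem_nhds hp,
      (Y.continuousOn.continuousAt (Y.open_source.mem_nhds hp)).preimage_mem_nhds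
        b.eventuallyEq_one] with q hq hq1
    rw [Y.pull_of_mem hq]
    have : b (Y q) = 1 := hq1
    simp [this]

end Charts

/-! ### Functionals on test functions and their localised Fourier transforms -/

section Functionals

variable {E H : Type*} [NormedAddCommGroup E] [NormedSpace ℝ E] [TopologicalSpace H]
  {I : ModelWithCorners ℝ E H} {N : Type*} [TopologicalSpace N] [ChartedSpace H N]
  {W : Type*} [NormedAddCommGroup W] [InnerProductSpace ℝ W]

open Classical in
/-- The value of a functional on test functions, extended by zero to all functions. -/
def evalTest (u : testFunctions I N →ₗ[ℂ] ℂ) (f : N → ℂ) : ℂ :=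
  if h : f ∈ testFunctions I N then u ⟨f, h⟩ else 0

theorem evalTest_of_mem (u : testFunctions I N →ₗ[ℂ] ℂ) {f : N → ℂ} (h : f ∈ testFunctions I N) :
    evalTest u f = u ⟨f, h⟩ := dif_pos h

theorem evalTest_add (u : testFunctions I N →ₗ[ℂ] ℂ) {f g : N → ℂ} (hf : f ∈ testFunctions I N)
    (hg : g ∈ testFunctions I N) :
    evalTest u (fun p => f p + g p) = evalTest u f + evalTest u g := by
  have h : (fun p => f p + g p) ∈ testFunctions I N := (testFunctions I N).add_mem hf hg
  rw [evalTest_of_mem u hf, evalTest_of_mem u hg, evalTest_of_mem u h, ← map_add]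
  rfl

theorem evalTest_smul (u : testFunctions I N →ₗ[ℂ] ℂ) {f : N → ℂ} (hf : f ∈ testFunctions I N)
    (c : ℂ) : evalTest u (fun p => c * f p) = c * evalTest u f := by
  have h : (fun p => c * f p) ∈ testFunctions I N := (testFunctions I N).smul_mem c hf
  rw [evalTest_of_mem u hf, evalTest_of_mem u h, ← smul_eq_mul, ← map_smul]
  rfl

theorem evalTest_sum (u : testFunctions I N →ₗ[ℂ] ℂ) {ι : Type*} (t : Finset ι) {f : ι → N → ℂ}
    (hf : ∀ i ∈ t, f i ∈ testFunctions I N) :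
    evalTest u (fun p => ∑ i ∈ t, f i p) = ∑ i ∈ t, evalTest u (f i) := by
  classical
  induction t using Finset.induction_on with
  | empty =>
    have h : (fun _ : N => (0 : ℂ)) ∈ testFunctions I N := (testFunctions I N).zero_mem
    simp only [Finset.sum_empty]
    rw [evalTest_of_mem u h]
    exact map_zero u
  | insert i t hi ih =>
    simp only [Finset.sum_insert hi]
    have hmem : (fun p => ∑ i ∈ t, f i p) ∈ testFunctions I N := by
      have := (testFunctions I N).sum_mem fun j hj => hf j (Finset.mem_insert_of_mem hj)
      convert this using 1
      ext p; simp
    rw [evalTest_add u (hf i (Finset.mem_insert_self i t)) hmem,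
      ih fun j hj => hf j (Finset.mem_insert_of_mem hj)]

variable (W) in
/-- A functional on test functions is a distribution if, in every chart, it is of finite order on
compact sets. -/
def IsDistribution (u : testFunctions I N →ₗ[ℂ] ℂ) : Prop :=
  ∀ (Y : SmoothChart I N W), ∀ K ⊆ Y.source, IsCompact K → ∃ (C : ℝ) (m : ℕ), ∀ F ∈ testFunctions I N,
    ∀ B : ℝ, tsupport F ⊆ K → (∀ j ≤ m, ∀ y, ‖iteratedFDeriv ℝ j (Y.push F) y‖ ≤ B) →
      ‖evalTest u F‖ ≤ C * B

/-- The Fourier transform of the localised distribution `φ u` in the chart `Y`. -/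
def chartFourier (u : testFunctions I N →ₗ[ℂ] ℂ) (Y : SmoothChart I N W) (φ : N → ℂ) (k : W) : ℂ :=
  evalTest u fun p => φ p * planeWave k (Y p)

/-- Products with a fixed compactly supported smooth function do not increase `C^m` norms by
more than a constant. -/
theorem exists_iteratedFDeriv_mul_le {a : W → ℂ} (ha : ContDiff ℝ ∞ a) (hc : HasCompactSupport a)
    (m : ℕ) : ∃ C : ℝ, 0 ≤ C ∧ ∀ f : W → ℂ, ContDiff ℝ ∞ f → ∀ B, (∀ j ≤ m, ∀ y, ‖iteratedFDeriv ℝ j f y‖ ≤ B) →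
      ∀ j ≤ m, ∀ y, ‖iteratedFDeriv ℝ j (fun x => a x * f x) y‖ ≤ C * B := by
  have h1 : ∀ j : ℕ, ∃ D : ℝ, ∀ y, ‖iteratedFDeriv ℝ j a y‖ ≤ D := fun j =>
    (ha.continuous_iteratedFDeriv (by exact_mod_cast le_top)).norm.bddAbove_range_of_hasCompactSupport
      (hc.iteratedFDeriv j).norm |>.imp fun D hD y => hD ⟨y, rfl⟩
  choose D hD using h1
  have hD0 : ∀ j, 0 ≤ D j := fun j => (norm_nonneg _).trans (hD j 0)
  refine ⟨∑ j ∈ Finset.range (m + 1), ∑ i ∈ Finset.range (j + 1), (j.choose i : ℝ) * D i,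
    Finset.sum_nonneg fun j _ => Finset.sum_nonneg fun i _ => mul_nonneg (by positivity) (hD0 i),
    fun f hf B hB j hj y => ?_⟩
  have hB0 : 0 ≤ B := (norm_nonneg _).trans (hB 0 (zero_le) 0)
  refine (norm_iteratedFDeriv_mul_le (n := j) ha hf y (by exact_mod_cast le_top)).trans ?_
  calc ∑ i ∈ Finset.range (j + 1), (j.choose i : ℝ) * ‖iteratedFDeriv ℝ i a y‖ *
        ‖iteratedFDeriv ℝ (j - i) f y‖
      ≤ ∑ i ∈ Finset.range (j + 1), (j.choose i : ℝ) * D i * B := by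
        refine Finset.sum_le_sum fun i _ => ?_
        have h0 := hD0 i
        gcongr
        · exact hD i y
        · exact hB _ (by omega) y
    _ = (∑ i ∈ Finset.range (j + 1), (j.choose i : ℝ) * D i) * B := by rw [Finset.sum_mul]
    _ ≤ _ := by
      gcongr
      exact Finset.single_le_sum (f := fun j => ∑ i ∈ Finset.range (j + 1), (j.choose i : ℝ) * D i)
        (fun j _ => Finset.sum_nonneg fun i _ => mul_nonneg (by positivity) (hD0 i))
        (Finset.mem_range.2 (by omega))

variable [FiniteDimensional ℝ W] [MeasurableSpace W] [BorelSpace W]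

theorem planeWave_contDiff (k : W) : ContDiff ℝ ∞ (planeWave k : W → ℂ) :=
  contDiff_planeWave.comp (contDiff_const.prodMk contDiff_id)

/-- Fourier representation of localised distributions. -/
theorem chartFourier_representation {u : testFunctions I N →ₗ[ℂ] ℂ} (hu : IsDistribution W u)
    (Y : SmoothChart I N W) {φ : N → ℂ} (hφ : φ ∈ testFunctions I N) (hs : tsupport φ ⊆ Y.source) :
    Continuous (chartFourier u Y φ) ∧
      (∃ (n : ℕ) (D : ℝ), ∀ k, ‖chartFourier u Y φ k‖ ≤ D * (1 + ‖k‖ ^ 2) ^ n) ∧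
      ∀ F : 𝓢(W, ℂ), evalTest u (fun p => φ p * F (Y p)) =
        ∫ k, chartFourier u Y φ k * (𝓕⁻ F) k := by
  obtain ⟨C, m, hCm⟩ := hu Y (tsupport φ) hs hφ.2
  have hmem : ∀ F : 𝓢(W, ℂ), (fun p => φ p * F (Y p)) ∈ testFunctions I N := fun F =>
    Y.mul_comp_mem hφ hs (F.smooth ⊤)
  let L : 𝓢(W, ℂ) →ₗ[ℂ] ℂ :=
    { toFun := fun F => evalTest u (fun p => φ p * F (Y p))
      map_add' := fun F G => by
        rw [← evalTest_add u (hmem F) (hmem G)]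
        congr 1; ext p; simp [mul_add]
      map_smul' := fun c F => by
        simp only [RingHom.id_apply, smul_eq_mul]
        rw [← evalTest_smul u (hmem F) c]
        congr 1; ext p; simp; ring }
  obtain ⟨A, hA0, hA⟩ := exists_iteratedFDeriv_mul_le (Y.contDiff_push hφ hs)
    (Y.hasCompactSupport_push hφ.2 hs) m
  obtain ⟨r, hr⟩ := (hφ.2.isCompact.image_of_continuousOn
    (Y.continuousOn.mono hs)).isBounded.subset_closedBall 0
  -- This bump is `1` on the image of the support of `φ`, so it can be inserted after `φ` at no
  -- cost; it plays the role of `θ` in `fourier_representation`. The maximum with `1` keeps the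
  -- radius positive.
  let b : ContDiffBump (0 : W) := ⟨max r 1, max r 1 + 1, by positivity, by linarith⟩
  have hbs : ContDiff ℝ ∞ (fun x => ((b x : ℝ) : ℂ)) := Complex.ofRealCLM.contDiff.comp b.contDiff
  have hbc : HasCompactSupport (fun x => ((b x : ℝ) : ℂ)) :=
    b.hasCompactSupport.comp_left (g := fun x : ℝ => (x : ℂ)) (by simp)
  have hb1 : ∀ p, φ p ≠ 0 → b (Y p) = 1 := fun p hp => b.one_of_mem_closedBall
    (Metric.closedBall_subset_closedBall (le_max_left _ _) (hr ⟨p, subset_tsupport _ hp, rfl⟩))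
  have hcut : ∀ G : W → ℂ, (fun p => φ p * ((b (Y p) : ℝ) * G (Y p))) = fun p => φ p * G (Y p) := by
    intro G; ext p
    by_cases hp : φ p = 0
    · simp [hp]
    · rw [hb1 p hp]; simp
  refine fourier_representation (L := L) (C := C * A) (m := m) (fun F B hB => ?_)
    (θ := hbc.toSchwartzMap hbs) (fun F G hG => ?_) (fun k G hG => ?_) (fun k => ?_)
  · rw [mul_assoc]
    refine hCm _ (hmem F) (A * B) (tsupport_mul_left_subset _ _) ?_
    rw [Y.push_mul_comp]
    exact hA F (F.smooth ⊤) B hB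
  · change evalTest u _ = evalTest u _
    congr 1
    simp only [hG]
    exact hcut F
  · change evalTest u _ = evalTest u _
    congr 1
    simp only [hG]
    exact (hcut _).symm
  · exact ⟨(hbc.mul_right (f' := planeWave k)).toSchwartzMap (hbs.mul (planeWave_contDiff k)), fun x => rfl⟩

theorem aestronglyMeasurable_chartFourier {u : testFunctions I N →ₗ[ℂ] ℂ} (hu : IsDistribution W u)
    (Y : SmoothChart I N W) {φ : N → ℂ} (hφ : φ ∈ testFunctions I N) (hs : tsupport φ ⊆ Y.source) :
    AEStronglyMeasurable (chartFourier u Y φ) volume :=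
  (chartFourier_representation hu Y hφ hs).1.aestronglyMeasurable

/-- Squaring doubles the degree of growth, and `dim + 1` further powers of the weight make the
integral converge. This provides the a priori order under which the kernel operators are estimated.
-/
theorem exists_sobolevSq_lt_top {h : W → ℂ} {n : ℕ} {D : ℝ}
    (hD : ∀ k, ‖h k‖ ≤ D * (1 + ‖k‖ ^ 2) ^ n) :
    ∃ N : ℕ, sobolevSq (-(N : ℝ)) Set.univ h < ⊤ := by
  obtain ⟨N, hN⟩ := exists_nat_ge (|((2 * n : ℕ) : ℝ)| + Module.finrank ℝ W + 1)
  refine ⟨N, ?_⟩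
  rw [sobolevSq_neg_natCast]
  have h1 := lintegral_ofReal_weight_lt_top (W := W) hN
  have h2 : ∫⁻ k : W, ENNReal.ofReal (((1 + ‖k‖ ^ 2) ^ N)⁻¹) * ‖h k‖ₑ ^ 2 ≤
      ∫⁻ k : W, ENNReal.ofReal (D ^ 2) * ENNReal.ofReal ((1 + ‖k‖ ^ 2) ^ ((2 * n : ℕ) : ℝ) *
        ((1 + ‖k‖ ^ 2) ^ N)⁻¹) := by
    refine lintegral_mono fun k => ?_
    rw [← ofReal_norm, ← ENNReal.ofReal_pow (norm_nonneg _),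
      ← ENNReal.ofReal_mul (by positivity), ← ENNReal.ofReal_mul (by positivity)]
    refine ENNReal.ofReal_le_ofReal ?_
    have h3 := pow_le_pow_left₀ (norm_nonneg _) (hD k) 2
    rw [Real.rpow_natCast, pow_mul', mul_comm (_⁻¹), ← mul_assoc]
    rw [mul_pow] at h3
    gcongr
  refine h2.trans_lt ?_
  rw [lintegral_const_mul' _ _ ENNReal.ofReal_ne_top]
  exact ENNReal.mul_lt_top ENNReal.ofReal_lt_top h1

theorem sobolevSq_neg_antitone {N N' : ℕ} (h : N ≤ N') (f : W → ℂ) :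
    sobolevSq (-(N' : ℝ)) Set.univ f ≤ sobolevSq (-(N : ℝ)) Set.univ f := by
  refine lintegral_mono fun k => ?_
  gcongr
  nlinarith [sq_nonneg ‖k‖]

end Functionals

/-! ### Transition maps and the change of charts on the Fourier side -/

section Transition

variable {E H : Type*} [NormedAddCommGroup E] [NormedSpace ℝ E] [TopologicalSpace H]
  {I : ModelWithCorners ℝ E H} {N : Type*} [TopologicalSpace N] [ChartedSpace H N]
  {W : Type*} [NormedAddCommGroup W] [InnerProductSpace ℝ W]
  [FiniteDimensional ℝ W] [MeasurableSpace W] [BorelSpace W]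

/-- A globally defined smooth map that agrees with the transition map from `Y` to `Y'` near the
image of `p`. -/
def transMap (Y Y' : SmoothChart I N W) (p : N) : W → W :=
  Classical.epsilon fun χ => ContDiff ℝ ∞ χ ∧ χ =ᶠ[𝓝 (Y p)] fun y => Y' (Y.symm y)

theorem transMap_spec {Y Y' : SmoothChart I N W} {p : N} (hp : p ∈ Y.source)
    (hp' : p ∈ Y'.source) :
    ContDiff ℝ ∞ (transMap Y Y' p) ∧ transMap Y Y' p =ᶠ[𝓝 (Y p)] fun y => Y' (Y.symm y) := by
  have hmem : Y p ∈ Y.target ∩ Y.symm ⁻¹' Y'.source :=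
    ⟨Y.map_source hp, by rwa [Set.mem_preimage, Y.left_inv hp]⟩
  have hnhds := (Y.isOpen_overlap Y').mem_nhds hmem
  obtain ⟨ε, hε, hball⟩ := Metric.nhds_basis_closedBall.mem_iff.1 hnhds
  let b : ContDiffBump (Y p) := ⟨ε / 2, ε, by positivity, by linarith⟩
  refine Classical.epsilon_spec
    (p := fun χ : W → W => ContDiff ℝ ∞ χ ∧ χ =ᶠ[𝓝 (Y p)] fun y => Y' (Y.symm y))
    -- The support of `b` is a closed ball inside the domain of the transition map, so the extension
    -- by zero is smooth on the whole space.
    ⟨fun y => b y • Y' (Y.symm y), ?_, ?_⟩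
  · rw [contDiff_iff_contDiffAt]
    intro y
    by_cases hy : y ∈ Metric.closedBall (Y p) ε
    · exact b.contDiff.contDiffAt.smul ((Y.contDiffOn_transition Y').contDiffAt
        ((Y.isOpen_overlap Y').mem_nhds (hball hy)))
    · refine (contDiffAt_const (c := (0 : W))).congr_of_eventuallyEq ?_
      filter_upwards [Metric.isClosed_closedBall.isOpen_compl.mem_nhds hy] with z hz
      have : z ∉ tsupport b := by rwa [b.tsupport_eq]
      rw [image_eq_zero_of_notMem_tsupport this, zero_smul]
  · filter_upwards [b.eventuallyEq_one] with y hy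
    have : b y = 1 := hy
    simp [this]

theorem contDiff_transMap {Y Y' : SmoothChart I N W} {p : N} (hp : p ∈ Y.source)
    (hp' : p ∈ Y'.source) : ContDiff ℝ ∞ (transMap Y Y' p) := (transMap_spec hp hp').1

theorem eventually_transMap {Y Y' : SmoothChart I N W} {p : N} (hp : p ∈ Y.source)
    (hp' : p ∈ Y'.source) : ∀ᶠ q in 𝓝 p, transMap Y Y' p (Y q) = Y' q := by
  filter_upwards [Y.open_source.mem_nhds hp,
    (Y.continuousOn.continuousAt (Y.open_source.mem_nhds hp)).eventually (transMap_spec hp hp').2]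
    with q hq hq'
  rw [hq', Y.left_inv hq]

theorem fderiv_transMap {Y Y' : SmoothChart I N W} {p : N} (hp : p ∈ Y.source)
    (hp' : p ∈ Y'.source) :
    fderiv ℝ (transMap Y Y' p) (Y p) = fderiv ℝ (fun y => Y' (Y.symm y)) (Y p) :=
  (transMap_spec hp hp').2.fderiv_eq

/-- Cocycle property of the derivatives of the transition maps. -/
theorem fderiv_transMap_comp {Y Y' Y'' : SmoothChart I N W} {p : N} (hp : p ∈ Y.source)
    (hp' : p ∈ Y'.source) (hp'' : p ∈ Y''.source) :
    (fderiv ℝ (transMap Y' Y'' p) (Y' p)).comp (fderiv ℝ (transMap Y Y' p) (Y p)) =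
      fderiv ℝ (transMap Y Y'' p) (Y p) := by
  have h1 : transMap Y Y' p (Y p) = Y' p := (eventually_transMap hp hp').self_of_nhds
  have hd1 := ((contDiff_transMap hp hp').differentiable (by simp)) (Y p)
  have hd2 := ((contDiff_transMap hp' hp'').differentiable (by simp)) (Y' p)
  have h2 : transMap Y Y'' p =ᶠ[𝓝 (Y p)] transMap Y' Y'' p ∘ transMap Y Y' p := by
    have h3 : ∀ᶠ y in 𝓝 (Y p), Y.symm y ∈ Y.source ∩ Y'.source ∧
        transMap Y Y'' p (Y (Y.symm y)) = Y'' (Y.symm y) ∧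
        transMap Y Y' p (Y (Y.symm y)) = Y' (Y.symm y) ∧
        transMap Y' Y'' p (Y' (Y.symm y)) = Y'' (Y.symm y) := by
      have hc : Tendsto Y.symm (𝓝 (Y p)) (𝓝 p) := by
        have := (Y.symm.continuousOn.continuousAt (Y.open_target.mem_nhds (Y.map_source hp)))
        rw [ContinuousAt] at this
        rwa [Y.left_inv hp] at this
      have hov : ∀ᶠ q in 𝓝 p, q ∈ Y.source ∩ Y'.source :=
        (Y.open_source.inter Y'.open_source).mem_nhds ⟨hp, hp'⟩
      exact hc.eventually (hov.and ((eventually_transMap hp hp'').and ((eventually_transMap hp hp').and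
          (eventually_transMap hp' hp''))))
    filter_upwards [h3, Y.open_target.mem_nhds (Y.map_source hp)] with y ⟨_, h4, h5, h6⟩ hy
    rw [Y.right_inv hy] at h4 h5
    rw [Function.comp_apply, h4, h5, h6]
  rw [h2.fderiv_eq, fderiv_comp _ (by rw [h1]; exact hd2) hd1, h1]

theorem fderiv_transMap_self {Y : SmoothChart I N W} {p : N} (hp : p ∈ Y.source) :
    fderiv ℝ (transMap Y Y p) (Y p) = ContinuousLinearMap.id ℝ W := by
  rw [fderiv_transMap hp hp]
  have : (fun y => Y (Y.symm y)) =ᶠ[𝓝 (Y p)] id := by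
    filter_upwards [Y.open_target.mem_nhds (Y.map_source hp)] with y hy using Y.right_inv hy
  rw [this.fderiv_eq, fderiv_id]

theorem det_fderiv_transMap_mul {Y Y' : SmoothChart I N W} {p : N} (hp : p ∈ Y.source)
    (hp' : p ∈ Y'.source) :
    (fderiv ℝ (transMap Y' Y p) (Y' p)).det * (fderiv ℝ (transMap Y Y' p) (Y p)).det = 1 := by
  have h := congrArg (fun A : W →L[ℝ] W => LinearMap.det (A : W →ₗ[ℝ] W))
    ((fderiv_transMap_comp hp hp' hp).trans (fderiv_transMap_self hp))
  have h2 : LinearMap.det ((ContinuousLinearMap.id ℝ W : W →L[ℝ] W) : W →ₗ[ℝ] W) = 1 :=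
    LinearMap.det_id
  rw [← h2, ← h, ContinuousLinearMap.det, ContinuousLinearMap.det, ← LinearMap.det_comp]
  rfl

theorem det_fderiv_transMap_ne_zero {Y Y' : SmoothChart I N W} {p : N} (hp : p ∈ Y.source)
    (hp' : p ∈ Y'.source) : (fderiv ℝ (transMap Y Y' p) (Y p)).det ≠ 0 :=
  right_ne_zero_of_mul_eq_one (det_fderiv_transMap_mul hp hp')

/-- The transition back composes with the transition forth to the identity, so the adjoint has a
left inverse. Nonzero covectors therefore always land in one of the cones of a cover. -/
theorem adjoint_fderiv_transMap_ne_zero {Y Y' : SmoothChart I N W} {p : N} (hp : p ∈ Y.source)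
    (hp' : p ∈ Y'.source) {l : W} (hl : l ≠ 0) :
    (fderiv ℝ (transMap Y Y' p) (Y p)).adjoint l ≠ 0 := by
  intro h
  have h1 := congrArg ContinuousLinearMap.adjoint
    ((fderiv_transMap_comp hp' hp hp').trans (fderiv_transMap_self hp'))
  rw [ContinuousLinearMap.adjoint_comp] at h1
  have h2 := DFunLike.congr_fun h1 l
  rw [ContinuousLinearMap.comp_apply, h, map_zero] at h2
  apply hl
  have h3 : ContinuousLinearMap.adjoint (ContinuousLinearMap.id ℝ W) = ContinuousLinearMap.id ℝ W := by
    exact (ContinuousLinearMap.eq_adjoint_iff _ _).2 (fun x y => rfl) |>.symm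
  rw [h3] at h2
  exact h2.symm

theorem mul_inv_mem {φ φ' : N → ℂ} (hφ : φ ∈ testFunctions I N) (hφ' : φ' ∈ testFunctions I N)
    (h : ∀ q ∈ tsupport φ', φ q ≠ 0) : (fun q => φ' q * (φ q)⁻¹) ∈ testFunctions I N := by
  refine mul_mem_testFunctions (O := {q | φ q ≠ 0}) hφ' (isOpen_ne_fun hφ.1.continuous
    continuous_const) h fun q hq => ?_
  exact ((contDiffAt_inv ℝ hq).contMDiffAt.comp q (hφ.1 q)).contMDiffWithinAt

/-- Change of charts for localised Fourier transforms. -/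
theorem chartFourier_eq_integral_oscKernel {u : testFunctions I N →ₗ[ℂ] ℂ}
    (hu : IsDistribution W u) {Y Y' : SmoothChart I N W} {p : N} (hp : p ∈ Y.source)
    (hp' : p ∈ Y'.source) {φ φ' : N → ℂ} (hφ : φ ∈ testFunctions I N)
    (hs : tsupport φ ⊆ Y.source) (hφ' : φ' ∈ testFunctions I N)
    (h0 : ∀ q ∈ tsupport φ', φ q ≠ 0) (hχ : ∀ q ∈ tsupport φ', transMap Y Y' p (Y q) = Y' q)
    (l : W) :
    chartFourier u Y' φ' l = ∫ k, chartFourier u Y φ k *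
      oscKernel (transMap Y Y' p) (Y.push fun q => φ' q * (φ q)⁻¹) k l := by
  have hs' : tsupport φ' ⊆ Y.source := fun q hq => hs (subset_tsupport _ (h0 q hq))
  have hm := mul_inv_mem hφ hφ' h0
  have hms : tsupport (fun q => φ' q * (φ q)⁻¹) ⊆ Y.source :=
    (tsupport_mul_left_subset φ' fun q => (φ q)⁻¹).trans hs'
  set a := Y.push fun q => φ' q * (φ q)⁻¹
  have ha : ContDiff ℝ ∞ a := Y.contDiff_push hm hms
  have hac : HasCompactSupport a := Y.hasCompactSupport_push hm.2 hms
  -- Write `φ'` as `φ` times the quotient `φ' / φ`. In the chart `Y` the plane wave of `Y'` becomes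
  -- an oscillating test function, and its inverse Fourier transform at `k` is the kernel
  -- `oscKernel`.
  have hF : ContDiff ℝ ∞ fun x => a x * planeWave l (transMap Y Y' p x) :=
    ha.mul ((planeWave_contDiff l).comp (contDiff_transMap hp hp'))
  have hFc : HasCompactSupport fun x => a x * planeWave l (transMap Y Y' p x) := hac.mul_right
  have h1 := (chartFourier_representation hu Y hφ hs).2.2 (hFc.toSchwartzMap hF)
  have h2 : evalTest u (fun q => φ q * (hFc.toSchwartzMap hF) (Y q)) = chartFourier u Y' φ' l := by
    unfold chartFourier
    congr 1; ext q
    change φ q * (a (Y q) * planeWave l (transMap Y Y' p (Y q))) = _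
    by_cases hq : φ' q = 0
    · rw [hq, zero_mul]
      by_cases hqs : q ∈ Y.source
      · rw [show a (Y q) = _ from Y.push_apply hqs, hq]; simp
      · rw [image_eq_zero_of_notMem_tsupport fun h => hqs (hs h), zero_mul]
    · have hqt := subset_tsupport _ hq
      rw [show a (Y q) = _ from Y.push_apply (hs' hqt), hχ q hqt]
      field_simp [h0 q hqt]
  rw [← h2, h1]
  congr 1; ext k
  congr 1
  rw [SchwartzMap.fourierInv_coe, fourierInv_eq_integral_planeWave]
  rfl

/-- Microlocal Sobolev bounds under a change of charts. -/
theorem exists_sobolevSq_oscKernel_le {Y Y' : SmoothChart I N W} [T2Space N] {p : N}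
    (hp : p ∈ Y.source) (hp' : p ∈ Y'.source) {φ : N → ℂ} (hφ : φ ∈ testFunctions I N)
    (hφp : φ p ≠ 0) {G Γ : Set W} (hG : IsClosed G)
    (hGc : IsConic G) (hΓ : IsOpen Γ) (hΓc : IsConic Γ)
    (hGΓ : ∀ l ∈ G, l ≠ 0 → (fderiv ℝ (transMap Y Y' p) (Y p)).adjoint l ∈ Γ) (s : ℝ) (n : ℕ) :
    ∃ V ∈ 𝓝 p, ∃ (m : ℕ) (C : ℝ≥0∞), C < ⊤ ∧ ∀ φ' ∈ testFunctions I N, tsupport φ' ⊆ V →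
      ∀ B : ℝ, (∀ j ≤ m, ∀ x, ‖iteratedFDeriv ℝ j (Y.push φ') x‖ ≤ B) → ∀ h : W → ℂ,
      AEStronglyMeasurable h volume → sobolevSq (-(n : ℝ)) Set.univ h < ⊤ →
      sobolevSq s G (fun l => ∫ k, h k *
        oscKernel (transMap Y Y' p) (Y.push fun q => φ' q * (φ q)⁻¹) k l) ≤
      C * ENNReal.ofReal B ^ 2 * (sobolevSq s Γ h + sobolevSq (-(n : ℝ)) Set.univ h) := by
  obtain ⟨V₀, hV₀, m, C, hC, hinv⟩ := exists_sobolevSq_changeOfVariables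
    (contDiff_transMap hp hp') (det_fderiv_transMap_ne_zero hp hp') hG hGc hΓ hΓc hGΓ s n
  have hne : {q | φ q ≠ 0} ∩ Y.source ∈ 𝓝 p := Filter.inter_mem
    ((isOpen_ne_fun hφ.1.continuous continuous_const).mem_nhds hφp) (Y.open_source.mem_nhds hp)
  -- Where `ζ = 1`, the quotient `φ' / φ` equals `(ζ / φ) φ'`, with a factor that does not depend on
  -- `φ'`. Derivative bounds for `φ'` thus pass to the quotient with the fixed constant `A`.
  obtain ⟨ζ, hζ, hζs, -, hζ1⟩ := exists_testFunction_eq_one Y hp hne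
  have hζm := mul_inv_mem hφ hζ fun q hq => (hζs hq).1
  have hζms : tsupport (fun q => ζ q * (φ q)⁻¹) ⊆ Y.source :=
    (tsupport_mul_left_subset ζ fun q => (φ q)⁻¹).trans fun q hq => (hζs hq).2
  obtain ⟨A, hA0, hA⟩ := exists_iteratedFDeriv_mul_le (Y.contDiff_push hζm hζms)
    (Y.hasCompactSupport_push hζm.2 hζms) m
  refine ⟨{q | ζ q = 1} ∩ Y.source ∩ Y ⁻¹' V₀ ∩ {q | φ q ≠ 0},
    Filter.inter_mem (Filter.inter_mem (Filter.inter_mem hζ1 (Y.open_source.mem_nhds hp))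
    ((Y.continuousOn.continuousAt (Y.open_source.mem_nhds hp)).preimage_mem_nhds hV₀))
    (Filter.mem_of_superset hne Set.inter_subset_left), m,
    C * ENNReal.ofReal A ^ 2, ENNReal.mul_lt_top hC (by finiteness), ?_⟩
  intro φ' hφ' hsV B hB h hh hhn
  have hs' : tsupport φ' ⊆ Y.source := fun q hq => (hsV hq).1.1.2
  have hm := mul_inv_mem hφ hφ' fun q hq => (hsV hq).2
  have hms : tsupport (fun q => φ' q * (φ q)⁻¹) ⊆ Y.source :=
    (tsupport_mul_left_subset φ' fun q => (φ q)⁻¹).trans hs'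
  have heq : (fun q => φ' q * (φ q)⁻¹) = fun q => (ζ q * (φ q)⁻¹) * φ' q := by
    ext q
    by_cases hq : φ' q = 0
    · simp [hq]
    · have : ζ q = 1 := (hsV (subset_tsupport _ hq)).1.1.1
      rw [this]; ring
  have h1 := hinv (Y.push fun q => φ' q * (φ q)⁻¹) (Y.contDiff_push hm hms)
    (Y.hasCompactSupport_push hm.2 hms) ((Y.tsupport_push_subset hm.2 hms).trans ?_) (A * B) ?_
    h hh hhn
  · refine h1.trans (le_of_eq ?_)
    rw [ENNReal.ofReal_mul hA0]; ring
  · rintro _ ⟨q, hq, rfl⟩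
    exact (hsV (tsupport_mul_left_subset φ' (fun q => (φ q)⁻¹) hq)).1.2
  · rw [heq, Y.push_mul]
    exact hA _ (Y.contDiff_push hφ' hs') B hB

end Transition

/-! ### The pairing of distributions with complementary microlocal regularity -/

section Pairing

variable {E H : Type*} [NormedAddCommGroup E] [NormedSpace ℝ E] [TopologicalSpace H]
  {I : ModelWithCorners ℝ E H} {N : Type*} [TopologicalSpace N] [ChartedSpace H N]
  {W : Type*} [NormedAddCommGroup W] [InnerProductSpace ℝ W]
  [FiniteDimensional ℝ W] [MeasurableSpace W] [BorelSpace W]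

theorem exists_iteratedFDeriv_le {f : W → ℂ} (hf : ContDiff ℝ ∞ f) (hc : HasCompactSupport f)
    (m : ℕ) : ∃ B : ℝ, ∀ j ≤ m, ∀ x, ‖iteratedFDeriv ℝ j f x‖ ≤ B := by
  have h1 : ∀ j : ℕ, ∃ D : ℝ, ∀ y, ‖iteratedFDeriv ℝ j f y‖ ≤ D := fun j =>
    (hf.continuous_iteratedFDeriv (by exact_mod_cast le_top)).norm.bddAbove_range_of_hasCompactSupport
      (hc.iteratedFDeriv j).norm |>.imp fun D hD y => hD ⟨y, rfl⟩
  choose D hD using h1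
  refine ⟨∑ j ∈ Finset.range (m + 1), D j, fun j hj x => (hD j x).trans ?_⟩
  exact Finset.single_le_sum (f := D) (fun j _ => (norm_nonneg _).trans (hD j 0))
    (Finset.mem_range.2 (by omega))

/-- Microlocal Sobolev regularity of order `s` at the covector with coordinates `η` in the chart
`Y` at the point `p`. -/
def IsSobolevRegular (u : testFunctions I N →ₗ[ℂ] ℂ) (s : ℝ) (Y : SmoothChart I N W) (p : N)
    (η : W) : Prop :=
  ∃ (Y₁ : SmoothChart I N W) (φ : N → ℂ) (Γ : Set W), p ∈ Y₁.source ∧ φ ∈ testFunctions I N ∧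
    tsupport φ ⊆ Y₁.source ∧ φ p ≠ 0 ∧ IsOpen Γ ∧ IsConic Γ ∧
    (fderiv ℝ (transMap Y₁ Y p) (Y₁ p)).adjoint η ∈ Γ ∧
    sobolevSq s Γ (chartFourier u Y₁ φ) < ⊤

/-- Regularity is witnessed by one chart, one cutoff and one cone of unknown origin. Coordinate
invariance converts this into a statement about the given chart and all cutoffs with small support;
only then can finitely many directions, and both distributions, share a single cutoff. -/
theorem IsSobolevRegular.exists_coneAround [T2Space N] {u : testFunctions I N →ₗ[ℂ] ℂ}
    (hu : IsDistribution W u) {s : ℝ} {Y : SmoothChart I N W} {p : N} (hp : p ∈ Y.source) {η : W}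
    (hη : ‖η‖ = 1) (h : IsSobolevRegular u s Y p η) :
    ∃ δ > 0, ∃ V ∈ 𝓝 p, ∀ φ ∈ testFunctions I N, tsupport φ ⊆ V →
      sobolevSq s (coneAround η δ) (chartFourier u Y φ) < ⊤ := by
  obtain ⟨Y₁, φ₁, Γ, hp₁, hφ₁, hs₁, hφp, hΓ, hΓc, hA, hfin⟩ := h
  obtain ⟨δ, hδ, hmaps⟩ := exists_coneAround_mapsTo hη _ hΓ hΓc hA
  obtain ⟨n, D, hD⟩ := (chartFourier_representation hu Y₁ hφ₁ hs₁).2.1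
  obtain ⟨M, hM⟩ := exists_sobolevSq_lt_top hD
  obtain ⟨V, hV, m, C, hC, hest⟩ := exists_sobolevSq_oscKernel_le hp₁ hp hφ₁ hφp
    (isClosed_coneAround η δ) (isConic_coneAround η δ) hΓ hΓc hmaps s M
  refine ⟨δ, hδ, V ∩ {q | φ₁ q ≠ 0} ∩ {q | transMap Y₁ Y p (Y₁ q) = Y q}, inter_mem (inter_mem hV
    ((isOpen_ne_fun hφ₁.1.continuous continuous_const).mem_nhds hφp)) (eventually_transMap hp₁ hp),
    fun φ hφ hφV => ?_⟩
  have hφs : tsupport φ ⊆ Y₁.source := fun q hq => hs₁ (subset_tsupport _ (hφV hq).1.2)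
  obtain ⟨B, hB⟩ := exists_iteratedFDeriv_le (Y₁.contDiff_push hφ hφs)
    (Y₁.hasCompactSupport_push hφ.2 hφs) m
  have h1 := hest φ hφ (fun q hq => (hφV hq).1.1) B hB _
    (aestronglyMeasurable_chartFourier hu Y₁ hφ₁ hs₁) hM
  have h2 : chartFourier u Y φ = fun l => ∫ k, chartFourier u Y₁ φ₁ k *
      oscKernel (transMap Y₁ Y p) (Y₁.push fun q => φ q * (φ₁ q)⁻¹) k l :=
    funext (chartFourier_eq_integral_oscKernel hu hp₁ hp hφ₁ hs₁ hφ (fun q hq => (hφV hq).1.2)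
      fun q hq => (hφV hq).2)
  rw [h2]
  exact h1.trans_lt (ENNReal.mul_lt_top (ENNReal.mul_lt_top hC (by finiteness))
    (ENNReal.add_lt_top.2 ⟨hfin, hM⟩))

/-- A localisation near which two distributions have complementary microlocal regularity, with
finitely many open cones covering all directions. -/
structure PairData (u₁ u₂ : testFunctions I N →ₗ[ℂ] ℂ) (Y : SmoothChart I N W) where
  φ : N → ℂ
  mem : φ ∈ testFunctions I N
  supp : tsupport φ ⊆ Y.source
  n : ℕ
  pos : 0 < n
  s : Fin n → ℝ
  t : Fin n → ℝ
  O : Fin n → Set W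
  order : ℕ
  isOpen : ∀ i, IsOpen (O i)
  isConic : ∀ i, IsConic (O i)
  nonneg : ∀ i, 0 ≤ s i + t i
  cover : ∀ l, l ≠ 0 → ∃ i, l ∈ O i
  fst_lt : ∀ i, sobolevSq (s i) (O i) (chartFourier u₁ Y φ) < ⊤
  snd_lt : ∀ i, sobolevSq (t i) (O i) (fun k => chartFourier u₂ Y φ (-k)) < ⊤
  fst_order : sobolevSq (-(order : ℝ)) Set.univ (chartFourier u₁ Y φ) < ⊤
  snd_order : sobolevSq (-(order : ℝ)) Set.univ (fun k => chartFourier u₂ Y φ (-k)) < ⊤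

theorem sobolevSq_eq_of_subsingleton [Subsingleton W] (s t : ℝ) (G : Set W) (f : W → ℂ) :
    sobolevSq s G f = sobolevSq t G f := by
  unfold sobolevSq
  congr 1; ext k
  rw [Subsingleton.elim k 0]; simp

/-- Each unit covector has a cone and a neighbourhood of `p` that work for both distributions.
Finitely many cones cover all directions, and a cutoff supported in the intersection of the
corresponding neighbourhoods serves them all. In dimension zero all Sobolev norms coincide, so the a
priori orders suffice. -/
theorem exists_pairData [T2Space N] {u₁ u₂ : testFunctions I N →ₗ[ℂ] ℂ}
    (hu₁ : IsDistribution W u₁) (hu₂ : IsDistribution W u₂) {Y : SmoothChart I N W} {p : N}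
    (hp : p ∈ Y.source)
    (hreg : ∀ η : W, η ≠ 0 → ∃ s t : ℝ, 0 ≤ s + t ∧ IsSobolevRegular u₁ s Y p η ∧
      IsSobolevRegular u₂ t Y p (-η)) :
    ∃ D : PairData u₁ u₂ Y, D.φ p ≠ 0 := by
  have hord : ∀ {u : testFunctions I N →ₗ[ℂ] ℂ}, IsDistribution W u → ∀ φ ∈ testFunctions I N,
      tsupport φ ⊆ Y.source → ∃ M : ℕ,
        sobolevSq (-(M : ℝ)) Set.univ (chartFourier u Y φ) < ⊤ := fun hu φ hφ hs => by
    obtain ⟨n, D, hD⟩ := (chartFourier_representation hu Y hφ hs).2.1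
    exact exists_sobolevSq_lt_top hD
  have hneg : ∀ (M : ℕ) (f : W → ℂ), sobolevSq (-(M : ℝ)) Set.univ (fun k => f (-k)) =
      sobolevSq (-(M : ℝ)) Set.univ f := fun M f => by
    rw [sobolevSq_comp_neg _ MeasurableSet.univ]; rfl
  have hcone := exists_finite_cone_cover (W := W) (X := ℝ × ℝ × Set N)
    (Q := fun x G => 0 ≤ x.1 + x.2.1 ∧ x.2.2 ∈ 𝓝 p ∧ ∀ φ ∈ testFunctions I N,
      tsupport φ ⊆ x.2.2 → tsupport φ ⊆ Y.source → sobolevSq x.1 G (chartFourier u₁ Y φ) < ⊤ ∧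
      sobolevSq x.2.1 G (fun k => chartFourier u₂ Y φ (-k)) < ⊤) ?_ ?_
  · obtain ⟨n, x, G, O, hGO, hcovG, hcov⟩ := hcone
    have hV : (⋂ i, (x i).2.2) ∈ 𝓝 p := iInter_mem.2 fun i => (hGO i).2.2.2.2.2.2.1
    obtain ⟨φ, hφ, hφV, hφs, hφ1⟩ := exists_testFunction_eq_one Y hp hV
    obtain ⟨M₁, hM₁⟩ := hord hu₁ φ hφ hφs
    obtain ⟨M₂, hM₂⟩ := hord hu₂ φ hφ hφs
    have hfin := fun i => (hGO i).2.2.2.2.2.2.2 φ hφ (hφV.trans (Set.iInter_subset _ i)) hφs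
    refine ⟨⟨φ, hφ, hφs, n, ?_, fun i => (x i).1, fun i => (x i).2.1, O, max M₁ M₂,
      fun i => (hGO i).2.2.1, fun i => (hGO i).2.2.2.1, fun i => (hGO i).2.2.2.2.2.1, hcov,
      fun i => (sobolevSq_mono _ (hGO i).2.2.2.2.1 _).trans_lt (hfin i).1,
      fun i => (sobolevSq_mono _ (hGO i).2.2.2.2.1 _).trans_lt (hfin i).2,
      (sobolevSq_neg_antitone (le_max_left _ _) _).trans_lt hM₁, ?_⟩, ?_⟩
    · obtain ⟨i, -⟩ := hcovG 0
      exact i.pos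
    · rw [hneg]
      exact (sobolevSq_neg_antitone (le_max_right _ _) _).trans_lt hM₂
    · change φ p ≠ 0
      rw [hφ1.self_of_nhds]; exact one_ne_zero
  · intro η hη
    have hη' : ‖-η‖ = 1 := by rwa [norm_neg]
    obtain ⟨s, t, hst, h1, h2⟩ := hreg η (by rintro rfl; simp at hη)
    obtain ⟨δ₁, hδ₁, V₁, hV₁, hb₁⟩ := h1.exists_coneAround hu₁ hp hη
    obtain ⟨δ₂, hδ₂, V₂, hV₂, hb₂⟩ := h2.exists_coneAround hu₂ hp hη'
    refine ⟨min δ₁ δ₂, lt_min hδ₁ hδ₂, (s, t, V₁ ∩ V₂), hst, inter_mem hV₁ hV₂,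
      fun φ hφ hφV _ => ⟨?_, ?_⟩⟩
    · exact (sobolevSq_mono _ (coneAround_mono η (min_le_left _ _)) _).trans_lt
        (hb₁ φ hφ (hφV.trans Set.inter_subset_left))
    · rw [sobolevSq_comp_neg _ (isClosed_coneAround _ _).measurableSet]
      refine (sobolevSq_mono _ (fun l hl => ?_) _).trans_lt
        (hb₂ φ hφ (hφV.trans Set.inter_subset_right))
      refine coneAround_mono _ (min_le_right δ₁ δ₂) ?_
      have hl' : (1 - min δ₁ δ₂) * ‖-l‖ ≤ inner ℝ (-l) η := hl
      change (1 - min δ₁ δ₂) * ‖l‖ ≤ inner ℝ l (-η)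
      rwa [norm_neg, inner_neg_left, ← inner_neg_right] at hl'
  · intro hW
    refine ⟨(0, 0, Set.univ), by simp, univ_mem, fun φ hφ _ hφs => ?_⟩
    obtain ⟨M₁, hM₁⟩ := hord hu₁ φ hφ hφs
    obtain ⟨M₂, hM₂⟩ := hord hu₂ φ hφ hφs
    rw [← hneg] at hM₂
    exact ⟨by rwa [sobolevSq_eq_of_subsingleton _ (-(M₁ : ℝ))],
      by rwa [sobolevSq_eq_of_subsingleton _ (-(M₂ : ℝ))]⟩

/-- The square of the norm in which the pairing of localised distributions is continuous. -/
def PairData.normSq {u₁ u₂ : testFunctions I N →ₗ[ℂ] ℂ} {Y : SmoothChart I N W}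
    (D : PairData u₁ u₂ Y) (h : W → ℂ) : ℝ≥0∞ :=
  ∑ i, sobolevSq (D.s i) (D.O i) h + sobolevSq (-(D.order : ℝ)) Set.univ h

theorem PairData.normSq_fst_lt {u₁ u₂ : testFunctions I N →ₗ[ℂ] ℂ} {Y : SmoothChart I N W}
    (D : PairData u₁ u₂ Y) : D.normSq (chartFourier u₁ Y D.φ) < ⊤ :=
  ENNReal.add_lt_top.2 ⟨ENNReal.sum_lt_top.2 fun i _ => D.fst_lt i, D.fst_order⟩

theorem PairData.tendsto_normSq {u₁ u₂ : testFunctions I N →ₗ[ℂ] ℂ} {Y : SmoothChart I N W}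
    (hu₁ : IsDistribution W u₁) (D : PairData u₁ u₂ Y) :
    Tendsto (fun R : ℕ => D.normSq ((Metric.closedBall (0 : W) R)ᶜ.indicator
      (chartFourier u₁ Y D.φ))) atTop (𝓝 0) := by
  have hm := aestronglyMeasurable_chartFourier hu₁ Y D.mem D.supp
  have h1 := tendsto_finsetSum (Finset.univ : Finset (Fin D.n)) fun i _ =>
    tendsto_sobolevSq_indicator_compl_closedBall hm (D.fst_lt i)
  simpa [PairData.normSq] using
    h1.add (tendsto_sobolevSq_indicator_compl_closedBall hm D.fst_order)

/-- Continuity of the pairing of localised Fourier transforms. -/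
theorem PairData.exists_pairing_bound [T2Space N] {u₁ u₂ : testFunctions I N →ₗ[ℂ] ℂ}
    (hu₂ : IsDistribution W u₂) {Y Y' : SmoothChart I N W}
    (D : PairData u₁ u₂ Y) {q : N} (hφq : D.φ q ≠ 0) (hq' : q ∈ Y'.source) :
    ∃ V ∈ 𝓝 q, ∃ m : ℕ, ∀ ψ ∈ testFunctions I N, tsupport ψ ⊆ V → ∃ C < (⊤ : ℝ≥0∞),
      ∀ φ ∈ testFunctions I N, tsupport φ ⊆ V → ∀ B : ℝ,
      (∀ j ≤ m, ∀ x, ‖iteratedFDeriv ℝ j (Y.push φ) x‖ ≤ B) →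
      ∀ h : W → ℂ, AEStronglyMeasurable h volume →
      sobolevSq (-(D.order : ℝ)) Set.univ h < ⊤ →
      AEStronglyMeasurable (fun l => ∫ k, h k *
        oscKernel (transMap Y Y' q) (Y.push fun p => φ p * (D.φ p)⁻¹) k l) volume →
      ∫⁻ l, ‖(∫ k, h k * oscKernel (transMap Y Y' q) (Y.push fun p => φ p * (D.φ p)⁻¹) k l) *
        chartFourier u₂ Y' ψ (-l)‖ₑ ≤ C * ENNReal.ofReal B * D.normSq h ^ (1 / 2 : ℝ) := by
  have hq : q ∈ Y.source := D.supp (subset_tsupport _ hφq)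
  set A := (fderiv ℝ (transMap Y Y' q) (Y q)).adjoint with hAdef
  -- The cones of `D` live in the chart `Y`. In the chart `Y'` a new closed cover `G` is chosen so
  -- that the adjoint of the transition carries the nonzero vectors of each member into some cone
  -- `D.O (x i)`.
  obtain ⟨n, x, G, O, hG, hcov, -⟩ := exists_finite_cone_cover (W := W) (X := Fin D.n)
    (Q := fun i G => ∀ l ∈ G, l ≠ 0 → A l ∈ D.O i)
    (fun η hη => by
      have hη0 : η ≠ 0 := by rintro rfl; simp at hη
      obtain ⟨i, hi⟩ := D.cover (A η) (adjoint_fderiv_transMap_ne_zero hq hq' hη0)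
      obtain ⟨δ, hδ, h⟩ := exists_coneAround_mapsTo hη A (D.isOpen i) (D.isConic i) hi
      exact ⟨δ, hδ, i, h⟩)
    (fun hW => ⟨⟨0, D.pos⟩, fun l _ hl => absurd (Subsingleton.elim l 0) hl⟩)
  have hex1 := fun i => exists_sobolevSq_oscKernel_le hq hq' D.mem hφq (hG i).1 (hG i).2.1
    (D.isOpen (x i)) (D.isConic (x i)) (hG i).2.2.2.2.2 (D.s (x i)) D.order
  -- The second distribution is evaluated at `-l`, so its estimates are needed on the reflected
  -- cones; linearity of `A` makes the reflected inclusion follow from the original one.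
  have hex2 := fun i => exists_sobolevSq_oscKernel_le (G := {l | -l ∈ G i})
    (Γ := {l | -l ∈ D.O (x i)}) hq hq' D.mem hφq
    ((hG i).1.preimage continuous_neg)
    (fun c hc k hk => by
      change -(c • k) ∈ G i
      rw [← smul_neg]; exact (hG i).2.1 c hc _ hk)
    ((D.isOpen (x i)).preimage continuous_neg)
    (fun c hc k hk => by
      change -(c • k) ∈ D.O (x i)
      rw [← smul_neg]; exact D.isConic (x i) c hc _ hk)
    (fun l hl hl0 => by
      change -(A l) ∈ D.O (x i)
      rw [← map_neg]
      exact (hG i).2.2.2.2.2 _ hl (neg_ne_zero.2 hl0)) (D.t (x i)) D.order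
  choose V₁ hV₁ m₁ C₁ hC₁ he₁ using hex1
  choose V₂ hV₂ m₂ C₂ hC₂ he₂ using hex2
  refine ⟨(⋂ i, V₁ i) ∩ (⋂ i, V₂ i) ∩ {p | D.φ p ≠ 0} ∩
      ({p | transMap Y Y' q (Y p) = Y' p} ∩ Y'.source),
    inter_mem (inter_mem (inter_mem (iInter_mem.2 hV₁) (iInter_mem.2 hV₂))
      ((isOpen_ne_fun D.mem.1.continuous continuous_const).mem_nhds hφq))
      (inter_mem (eventually_transMap hq hq') (Y'.open_source.mem_nhds hq')), ∑ i, m₁ i, fun ψ hψ hψV => ?_⟩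
  have hψs : tsupport ψ ⊆ Y.source := fun p hp => D.supp (subset_tsupport _ (hψV hp).1.2)
  have hT : ∀ i, sobolevSq (D.t (x i)) (G i) (fun l => chartFourier u₂ Y' ψ (-l)) < ⊤ := by
    intro i
    obtain ⟨B, hB⟩ := exists_iteratedFDeriv_le (Y.contDiff_push hψ hψs)
      (Y.hasCompactSupport_push hψ.2 hψs) (m₂ i)
    have hne : ∀ (s : ℝ) {S : Set W}, MeasurableSet S → sobolevSq s {l | -l ∈ S}
        (chartFourier u₂ Y D.φ) = sobolevSq s S (fun k => chartFourier u₂ Y D.φ (-k)) :=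
      fun s S hS => (sobolevSq_comp_neg s hS _).symm
    have h3 := D.snd_order
    rw [← hne _ MeasurableSet.univ] at h3
    have h4 := D.snd_lt (x i)
    rw [← hne _ (D.isOpen _).measurableSet] at h4
    rw [sobolevSq_comp_neg _ (hG i).1.measurableSet,
      show chartFourier u₂ Y' ψ = _ from funext (chartFourier_eq_integral_oscKernel hu₂ hq hq'
        D.mem D.supp hψ (fun p hp => (hψV hp).1.2) fun p hp => (hψV hp).2.1)]
    exact (he₂ i ψ hψ (fun p hp => Set.mem_iInter.1 (hψV hp).1.1.2 i) B hB _
      (aestronglyMeasurable_chartFourier hu₂ Y D.mem D.supp) h3).trans_lt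
      (ENNReal.mul_lt_top (ENNReal.mul_lt_top (hC₂ i) (by finiteness))
        (ENNReal.add_lt_top.2 ⟨h4, h3⟩))
  refine ⟨∑ i, (C₁ i * sobolevSq (D.t (x i)) (G i)
    (fun l => chartFourier u₂ Y' ψ (-l))) ^ (1 / 2 : ℝ), ENNReal.sum_lt_top.2 fun i _ =>
      ENNReal.rpow_lt_top_of_nonneg (by norm_num) (ENNReal.mul_lt_top (hC₁ i) (hT i)).ne, ?_⟩
  intro φ hφ hφV B hB h hh hord hmeas
  have hψs' : tsupport ψ ⊆ Y'.source := fun p hp => (hψV hp).2.2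
  have hU := ((chartFourier_representation hu₂ Y' hψ hψs').1.comp
    continuous_neg).aestronglyMeasurable (μ := (volume : Measure W))
  refine (lintegral_enorm_mul_le_sum_sobolevSq (G := G) (s := fun i => D.s (x i))
    (t := fun i => D.t (x i)) (fun i => D.nonneg _) hcov hmeas hU).trans ?_
  rw [Finset.sum_mul, Finset.sum_mul]
  refine Finset.sum_le_sum fun i _ => ?_
  -- The Sobolev estimates are quadratic in `B`; after the square root from Cauchy-Schwarz the bound
  -- is linear in `B`, as finite order requires.
  have hone : ENNReal.ofReal B = (ENNReal.ofReal B ^ 2) ^ (1 / 2 : ℝ) := by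
    rw [← ENNReal.rpow_natCast, ← ENNReal.rpow_mul]; norm_num
  rw [hone, ← ENNReal.mul_rpow_of_nonneg _ _ (by norm_num),
    ← ENNReal.mul_rpow_of_nonneg _ _ (by norm_num)]
  refine ENNReal.rpow_le_rpow ?_ (by norm_num)
  have h5 := he₁ i φ hφ (fun p hp => Set.mem_iInter.1 (hφV hp).1.1.1 i) B (fun j hj => hB j
    (hj.trans (Finset.single_le_sum (f := m₁) (fun _ _ => Nat.zero_le _) (Finset.mem_univ i))))
    h hh hord
  have h6 : sobolevSq (D.s (x i)) (D.O (x i)) h + sobolevSq (-(D.order : ℝ)) Set.univ h ≤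
      D.normSq h := by
    unfold PairData.normSq
    gcongr
    exact Finset.single_le_sum (f := fun i => sobolevSq (D.s i) (D.O i) h)
      (fun _ _ => zero_le) (Finset.mem_univ (x i))
  calc _ ≤ (C₁ i * ENNReal.ofReal B ^ 2 * D.normSq h) * _ := by
        gcongr; exact h5.trans (by gcongr)
    _ = _ := by
      change _ * sobolevSq (D.t (x i)) (G i) (fun l => chartFourier u₂ Y' ψ (-l)) = _
      ring

end Pairing

/-! ### Smooth approximation by truncation of the Fourier transform -/

section Approximation

variable {E H : Type*} [NormedAddCommGroup E] [NormedSpace ℝ E] [TopologicalSpace H]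
  {I : ModelWithCorners ℝ E H} {N : Type*} [TopologicalSpace N] [ChartedSpace H N]
  {W : Type*} [NormedAddCommGroup W] [InnerProductSpace ℝ W]
  [FiniteDimensional ℝ W] [MeasurableSpace W] [BorelSpace W]

variable (I N W) in
/-- A smooth positive density, given by its representations with respect to a family of charts
that covers the manifold. -/
structure SmoothDensity where
  charts : Set (SmoothChart I N W)
  val : SmoothChart I N W → N → ℝ
  smooth : ∀ Y ∈ charts, ContMDiffOn I 𝓘(ℝ, ℝ) ∞ (val Y) Y.source
  pos : ∀ Y ∈ charts, ∀ q ∈ Y.source, 0 < val Y q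
  cover : ∀ p, ∃ Y ∈ charts, p ∈ Y.source
  transform : ∀ Y ∈ charts, ∀ Y' ∈ charts, ∀ q ∈ Y.source, q ∈ Y'.source →
    val Y' q * |(fderiv ℝ (transMap Y Y' q) (Y q)).det| = val Y q

variable {u₁ u₂ : testFunctions I N →ₗ[ℂ] ℂ} {Y Y' : SmoothChart I N W}

/-- The localised Fourier transform, truncated to the ball of radius `R`. -/
def PairData.trunc (D : PairData u₁ u₂ Y) (R : ℕ) : W → ℂ :=
  (Metric.closedBall (0 : W) R).indicator (chartFourier u₁ Y D.φ)

/-- A smooth approximation of the first distribution near the points where `D.φ` does not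
vanish. -/
def PairData.approx (D : PairData u₁ u₂ Y) (ρ : SmoothDensity I N W) (R : ℕ) (p : N) : ℂ :=
  𝓕⁻ (D.trunc R) (Y p) * (D.φ p * (ρ.val Y p : ℂ))⁻¹

theorem PairData.integrable_trunc (hu₁ : IsDistribution W u₁) (D : PairData u₁ u₂ Y) (R n : ℕ) :
    Integrable (fun k => ‖k‖ ^ n * ‖D.trunc R k‖) ∧ Integrable (D.trunc R) := by
  have hc := (chartFourier_representation hu₁ Y D.mem D.supp).1
  have h1 : (fun k : W => ‖k‖ ^ n * ‖D.trunc R k‖) = (Metric.closedBall (0 : W) R).indicator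
      fun k => ‖k‖ ^ n * ‖chartFourier u₁ Y D.φ k‖ := by
    ext k
    by_cases hk : k ∈ Metric.closedBall (0 : W) R
    · simp [PairData.trunc, Set.indicator_of_mem hk]
    · simp [PairData.trunc, Set.indicator_of_notMem hk]
  constructor
  · rw [h1, integrable_indicator_iff measurableSet_closedBall]
    exact (Continuous.continuousOn (by fun_prop)).integrableOn_compact
      (isCompact_closedBall _ _)
  · unfold PairData.trunc
    rw [integrable_indicator_iff measurableSet_closedBall]
    exact hc.continuousOn.integrableOn_compact (isCompact_closedBall _ _)

theorem PairData.contDiff_fourierInv_trunc (hu₁ : IsDistribution W u₁) (D : PairData u₁ u₂ Y)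
    (R : ℕ) : ContDiff ℝ ∞ (𝓕⁻ (D.trunc R)) := by
  have h1 : ContDiff ℝ ∞ (𝓕 (D.trunc R)) :=
    Real.contDiff_fourier (N := ⊤) fun n _ => (D.integrable_trunc hu₁ R n).1
  have h2 : 𝓕⁻ (D.trunc R) = fun x => 𝓕 (D.trunc R) (-x) :=
    funext fun x => Real.fourierInv_eq_fourier_neg _ x
  rw [h2]
  exact h1.comp contDiff_neg

theorem PairData.contMDiffOn_approx (hu₁ : IsDistribution W u₁) (D : PairData u₁ u₂ Y)
    (ρ : SmoothDensity I N W) (hY : Y ∈ ρ.charts) (R : ℕ) :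
    ContMDiffOn I 𝓘(ℝ, ℂ) ∞ (D.approx ρ R) {p | D.φ p ≠ 0} := by
  have hsub : {p | D.φ p ≠ 0} ⊆ Y.source := fun p hp => D.supp (subset_tsupport _ hp)
  have h1 : ContMDiffOn I 𝓘(ℝ, ℂ) ∞ (fun p => 𝓕⁻ (D.trunc R) (Y p)) {p | D.φ p ≠ 0} :=
    (D.contDiff_fourierInv_trunc hu₁ R).contMDiff.comp_contMDiffOn (Y.smooth.mono hsub)
  have h2 : ContMDiffOn I 𝓘(ℝ, ℂ) ∞ (fun p => ((ρ.val Y p : ℝ) : ℂ)) {p | D.φ p ≠ 0} :=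
    Complex.ofRealCLM.contDiff.contMDiff.comp_contMDiffOn ((ρ.smooth Y hY).mono hsub)
  have h3 : ContMDiffOn I 𝓘(ℝ, ℂ) ∞ (fun p => D.φ p * ((ρ.val Y p : ℝ) : ℂ)) {p | D.φ p ≠ 0} :=
    (contDiff_mul (𝕜 := ℝ) (𝔸 := ℂ)).contMDiff.comp_contMDiffOn
      (D.mem.1.contMDiffOn.prodMk_space h2)
  have h4 : ContMDiffOn I 𝓘(ℝ, ℂ) ∞ (fun p => (D.φ p * ((ρ.val Y p : ℝ) : ℂ))⁻¹)
      {p | D.φ p ≠ 0} := fun p hp => by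
    have hne : D.φ p * ((ρ.val Y p : ℝ) : ℂ) ≠ 0 :=
      mul_ne_zero hp (by exact_mod_cast (ρ.pos Y hY p (hsub hp)).ne')
    exact (contDiffAt_inv ℝ hne).contMDiffAt.comp_contMDiffWithinAt p (h3 p hp)
  exact (contDiff_mul (𝕜 := ℝ) (𝔸 := ℂ)).contMDiff.comp_contMDiffOn (h1.prodMk_space h4)

/-- Integrability against oscillatory kernels. -/
theorem integrable_mul_oscKernel {χ : W → W} (hχ : ContDiff ℝ ∞ χ) {a : W → ℂ}
    (ha : ContDiff ℝ ∞ a) (hac : HasCompactSupport a) {h : W → ℂ}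
    (hm : AEStronglyMeasurable h volume) {n : ℕ} {D : ℝ}
    (hD : ∀ k, ‖h k‖ ≤ D * (1 + ‖k‖ ^ 2) ^ n) (l : W) :
    Integrable fun k => h k * oscKernel χ a k l := by
  have hF : ContDiff ℝ ∞ fun x => a x * planeWave l (χ x) :=
    ha.mul ((planeWave_contDiff l).comp hχ)
  have hFc : HasCompactSupport fun x => a x * planeWave l (χ x) := hac.mul_right
  have h1 : ∀ k, oscKernel χ a k l = (𝓕⁻ (hFc.toSchwartzMap hF)) k := fun k => by
    rw [SchwartzMap.fourierInv_coe, fourierInv_eq_integral_planeWave]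
    rfl
  obtain ⟨C, hC0, hC⟩ := SchwartzMap.exists_norm_le_weight (𝓕⁻ (hFc.toSchwartzMap hF))
    (n + (Module.finrank ℝ W + 1))
  have h2 := (integrable_inv_weight W (Nat.lt_succ_self (Module.finrank ℝ W))).const_mul (D * C)
  refine h2.mono (hm.mul (continuous_oscKernel_left hχ.continuous
    (ha.continuous.integrable_of_hasCompactSupport hac) l).aestronglyMeasurable)
    (ae_of_all _ fun k => ?_)
  have hD0 : 0 ≤ D := by
    have := (norm_nonneg _).trans (hD 0)
    simpa using this
  have h3 := hC k
  rw [pow_add, ← mul_assoc] at h3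
  have hw : (0 : ℝ) < (1 + ‖k‖ ^ 2) ^ (Module.finrank ℝ W + 1) := by positivity
  rw [norm_mul, h1, Real.norm_of_nonneg (by positivity), Nat.succ_eq_add_one, ← div_eq_mul_inv,
    le_div_iff₀ hw]
  calc ‖h k‖ * ‖(𝓕⁻ (hFc.toSchwartzMap hF)) k‖ * (1 + ‖k‖ ^ 2) ^ (Module.finrank ℝ W + 1)
      ≤ (D * (1 + ‖k‖ ^ 2) ^ n) * ‖(𝓕⁻ (hFc.toSchwartzMap hF)) k‖ *
        (1 + ‖k‖ ^ 2) ^ (Module.finrank ℝ W + 1) := by gcongr; exact hD k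
    _ = D * (‖(𝓕⁻ (hFc.toSchwartzMap hF)) k‖ * (1 + ‖k‖ ^ 2) ^ n *
        (1 + ‖k‖ ^ 2) ^ (Module.finrank ℝ W + 1)) := by ring
    _ ≤ D * C := by gcongr

theorem PairData.mul_approx_mem (hu₁ : IsDistribution W u₁) (D : PairData u₁ u₂ Y)
    (ρ : SmoothDensity I N W) (hY : Y ∈ ρ.charts) (hY' : Y' ∈ ρ.charts) (R : ℕ) {φ : N → ℂ}
    (hφ : φ ∈ testFunctions I N) (h0 : ∀ p ∈ tsupport φ, D.φ p ≠ 0)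
    (hs' : tsupport φ ⊆ Y'.source) :
    (fun p => φ p * (D.approx ρ R p * (ρ.val Y' p : ℂ))) ∈ testFunctions I N := by
  have h2 : ContMDiffOn I 𝓘(ℝ, ℂ) ∞ (fun p => ((ρ.val Y' p : ℝ) : ℂ)) Y'.source :=
    Complex.ofRealCLM.contDiff.contMDiff.comp_contMDiffOn (ρ.smooth Y' hY')
  exact mul_mem_testFunctions (O := {p | D.φ p ≠ 0} ∩ Y'.source) hφ
    ((isOpen_ne_fun D.mem.1.continuous continuous_const).inter Y'.open_source)
    (fun p hp => ⟨h0 p hp, hs' hp⟩)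
    ((contDiff_mul (𝕜 := ℝ) (𝔸 := ℂ)).contMDiff.comp_contMDiffOn
      (((D.contMDiffOn_approx hu₁ ρ hY R).mono Set.inter_subset_left).prodMk_space
        (h2.mono Set.inter_subset_right)))

/-- Change of variables between charts for the localised approximations. -/
theorem PairData.integral_trunc_mul_oscKernel (hu₁ : IsDistribution W u₁) (D : PairData u₁ u₂ Y)
    (ρ : SmoothDensity I N W) (hY : Y ∈ ρ.charts) (hY' : Y' ∈ ρ.charts) (R : ℕ) {q : N}
    (hq : q ∈ Y.source) (hq' : q ∈ Y'.source) {φ : N → ℂ}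
    (hφ : φ ∈ testFunctions I N) (h0 : ∀ p ∈ tsupport φ, D.φ p ≠ 0)
    (hs' : tsupport φ ⊆ Y'.source) (hχ : ∀ p ∈ tsupport φ, transMap Y Y' q (Y p) = Y' p) (l : W) :
    ∫ k, D.trunc R k * oscKernel (transMap Y Y' q) (Y.push fun p => φ p * (D.φ p)⁻¹) k l =
      𝓕 (Y'.push fun p => φ p * (D.approx ρ R p * (ρ.val Y' p : ℂ))) l := by
  have hs : tsupport φ ⊆ Y.source := fun p hp => D.supp (subset_tsupport _ (h0 p hp))
  have hm := mul_inv_mem D.mem hφ h0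
  have hms : tsupport (fun p => φ p * (D.φ p)⁻¹) ⊆ Y.source :=
    (tsupport_mul_left_subset φ fun p => (D.φ p)⁻¹).trans hs
  have ha := (Y.contDiff_push hm hms).continuous.integrable_of_hasCompactSupport
    (μ := (volume : Measure W)) (Y.hasCompactSupport_push hm.2 hms)
  rw [integral_mul_oscKernel (contDiff_transMap hq hq').continuous ha
    (D.integrable_trunc hu₁ R 0).2, fourier_eq_integral_planeWave]
  set F := Y'.push fun p => φ p * (D.approx ρ R p * (ρ.val Y' p : ℂ)) with hF
  set S := Y.target ∩ Y.symm ⁻¹' Y'.source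
  set τ : W → W := fun y => Y' (Y.symm y)
  have hSo : IsOpen S := Y.isOpen_overlap Y'
  have hτd : ∀ y ∈ S, HasFDerivWithinAt τ (fderiv ℝ τ y) S y := fun y hy =>
    (((Y.contDiffOn_transition Y').contDiffAt (hSo.mem_nhds hy)).differentiableAt
      (by simp)).hasFDerivAt.hasFDerivWithinAt
  have hinj : Set.InjOn τ S := fun y hy z hz h => by
    have h1 := Y'.injOn hy.2 hz.2 h
    exact Y.symm.injOn hy.1 hz.1 h1
  -- The Fourier integral in the chart `Y'` is pulled back along the transition map `τ`. Both
  -- integrands vanish off the overlap, because the support of `φ` lies in both chart domains.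
  have hcv := integral_image_eq_integral_abs_det_fderiv_smul volume hSo.measurableSet hτd hinj
    fun y => planeWave l y * F y
  rw [setIntegral_eq_integral_of_forall_compl_eq_zero] at hcv
  · rw [hcv, ← setIntegral_eq_integral_of_forall_compl_eq_zero (s := S)]
    · refine setIntegral_congr_fun hSo.measurableSet fun y hy => ?_
      obtain ⟨hyt, hys⟩ := hy
      have hys' : Y.symm y ∈ Y'.source := hys
      set p := Y.symm y
      have hps : p ∈ Y.source := Y.map_target hyt
      have hyp : Y p = y := Y.right_inv hyt
      have hFp : F (Y' p) = φ p * (D.approx ρ R p * (ρ.val Y' p : ℂ)) := Y'.push_apply hys'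
      change Y.push (fun p => φ p * (D.φ p)⁻¹) y * 𝓕⁻ (D.trunc R) y *
        planeWave l (transMap Y Y' q y) =
        |(fderiv ℝ τ y).det| • (planeWave l (Y' p) * F (Y' p))
      rw [hFp, ← hyp, Y.push_apply hps]
      by_cases hp : φ p = 0
      · simp [hp]
      · have hpt := subset_tsupport _ hp
        have hne := h0 p hpt
        -- The transformation law of the density cancels the Jacobian. This is why `approx` divides
        -- by `ρ.val Y`: the resulting function on the manifold does not depend on the chart in
        -- which it is tested.
        have htr := ρ.transform Y hY Y' hY' p hps hys'
        rw [fderiv_transMap hps hys'] at htr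
        have hpos : ((ρ.val Y p : ℝ) : ℂ) ≠ 0 := by exact_mod_cast (ρ.pos Y hY p hps).ne'
        rw [hχ p hpt, PairData.approx, Complex.real_smul]
        have htr' : ((ρ.val Y' p : ℝ) : ℂ) * ((|(fderiv ℝ τ (Y p)).det| : ℝ) : ℂ) =
          ((ρ.val Y p : ℝ) : ℂ) := by exact_mod_cast htr
        field_simp
        rw [← htr']; ring
    · intro y hy
      by_cases hyt : y ∈ Y.target
      · have : φ (Y.symm y) = 0 := by
          by_contra hne
          exact hy ⟨hyt, hs' (subset_tsupport _ hne)⟩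
        rw [Y.push_of_mem hyt, this]; simp
      · rw [Y.push_of_notMem hyt]; simp
  · intro y hy
    by_cases hyt : y ∈ Y'.target
    · have : φ (Y'.symm y) = 0 := by
        by_contra hne
        have hps := hs (subset_tsupport _ hne)
        refine hy ⟨Y (Y'.symm y), ⟨Y.map_source hps, ?_⟩, ?_⟩
        · rw [Set.mem_preimage, Y.left_inv hps]; exact Y'.map_target hyt
        · change Y' (Y.symm (Y (Y'.symm y))) = y
          rw [Y.left_inv hps, Y'.right_inv hyt]
      rw [hF, Y'.push_of_mem hyt, this]; simp
    · rw [hF, Y'.push_of_notMem hyt]; simp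

/-- The values of the second distribution on localised approximations of the first one. -/
theorem PairData.evalTest_approx (hu₁ : IsDistribution W u₁) (hu₂ : IsDistribution W u₂)
    (D : PairData u₁ u₂ Y)
    (ρ : SmoothDensity I N W) (hY : Y ∈ ρ.charts) (hY' : Y' ∈ ρ.charts) (R : ℕ) {φ ψ : N → ℂ}
    (hφ : φ ∈ testFunctions I N) (h0 : ∀ p ∈ tsupport φ, D.φ p ≠ 0)
    (hs' : tsupport φ ⊆ Y'.source) (hψ : ψ ∈ testFunctions I N) (hψs : tsupport ψ ⊆ Y'.source) :
    evalTest u₂ (fun p => φ p * (ψ p * (ρ.val Y' p : ℂ)) * D.approx ρ R p) =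
      ∫ l, 𝓕 (Y'.push fun p => φ p * (D.approx ρ R p * (ρ.val Y' p : ℂ))) l *
        chartFourier u₂ Y' ψ (-l) := by
  have hm := D.mul_approx_mem hu₁ ρ hY hY' R hφ h0 hs'
  have hms : tsupport (fun p => φ p * (D.approx ρ R p * (ρ.val Y' p : ℂ))) ⊆ Y'.source :=
    (tsupport_mul_left_subset φ fun p => (D.approx ρ R p * (ρ.val Y' p : ℂ))).trans hs'
  set f := fun p => φ p * (D.approx ρ R p * (ρ.val Y' p : ℂ)) with hf
  have h1 := (chartFourier_representation hu₂ Y' hψ hψs).2.2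
    ((Y'.hasCompactSupport_push hm.2 hms).toSchwartzMap (Y'.contDiff_push hm hms))
  have h2 : (fun p => ψ p * ((Y'.hasCompactSupport_push hm.2 hms).toSchwartzMap
      (Y'.contDiff_push hm hms)) (Y' p)) =
      fun p => φ p * (ψ p * (ρ.val Y' p : ℂ)) * D.approx ρ R p := by
    ext p
    change ψ p * Y'.push f (Y' p) = _
    by_cases hp : p ∈ Y'.source
    · rw [Y'.push_apply hp, hf]; ring
    · rw [image_eq_zero_of_notMem_tsupport fun h => hp (hψs h)]; ring
  -- The representation of `u₂` involves an inverse transform, that is, the Fourier transform at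
  -- `-l`. Reflecting the integral moves the sign to the factor of `u₂`.
  rw [← h2, h1, ← integral_neg_eq_self]
  congr 1; ext l
  rw [SchwartzMap.fourierInv_coe, Real.fourierInv_eq_fourier_neg, neg_neg, mul_comm]
  rfl

/-- The local existence theorem for products: approximations converge to the Fourier pairing. -/
theorem PairData.exists_local [T2Space N] (hu₁ : IsDistribution W u₁) (hu₂ : IsDistribution W u₂)
    (D : PairData u₁ u₂ Y) (ρ : SmoothDensity I N W) (hY : Y ∈ ρ.charts) (hY' : Y' ∈ ρ.charts)
    {q : N} (hφq : D.φ q ≠ 0) (hq' : q ∈ Y'.source) :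
    ∃ V ∈ 𝓝 q, V ⊆ Y'.source ∩ {p | D.φ p ≠ 0} ∧ ∃ m : ℕ,
      ∀ ψ ∈ testFunctions I N, tsupport ψ ⊆ V →
      (∀ φ ∈ testFunctions I N, tsupport φ ⊆ V →
        Integrable (fun l => chartFourier u₁ Y' φ l * chartFourier u₂ Y' ψ (-l)) ∧
        Tendsto (fun R : ℕ => evalTest u₂ fun p =>
          φ p * (ψ p * (ρ.val Y' p : ℂ)) * D.approx ρ R p) atTop
          (𝓝 (∫ l, chartFourier u₁ Y' φ l * chartFourier u₂ Y' ψ (-l)))) ∧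
      ∃ C : ℝ, ∀ φ ∈ testFunctions I N, tsupport φ ⊆ V → ∀ B : ℝ,
        (∀ j ≤ m, ∀ x, ‖iteratedFDeriv ℝ j (Y.push φ) x‖ ≤ B) →
        ‖∫ l, chartFourier u₁ Y' φ l * chartFourier u₂ Y' ψ (-l)‖ ≤ C * B := by
  have hq : q ∈ Y.source := D.supp (subset_tsupport _ hφq)
  obtain ⟨V, hV, m, hVm⟩ := D.exists_pairing_bound hu₂ hφq hq'
  refine ⟨V ∩ (Y'.source ∩ {p | D.φ p ≠ 0}) ∩ {p | transMap Y Y' q (Y p) = Y' p},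
    inter_mem (inter_mem hV (inter_mem (Y'.open_source.mem_nhds hq')
      ((isOpen_ne_fun D.mem.1.continuous continuous_const).mem_nhds hφq)))
      (eventually_transMap hq hq'), fun p hp => hp.1.2, m, fun ψ hψ hψV => ?_⟩
  obtain ⟨C, hC, hest⟩ := hVm ψ hψ fun p hp => (hψV hp).1.1
  have hψs' : tsupport ψ ⊆ Y'.source := fun p hp => (hψV hp).1.2.1
  have hU₂ : Continuous fun l => chartFourier u₂ Y' ψ (-l) :=
    (chartFourier_representation hu₂ Y' hψ hψs').1.comp continuous_neg
  have hh := aestronglyMeasurable_chartFourier hu₁ Y D.mem D.supp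
  obtain ⟨n, A, hA⟩ := (chartFourier_representation hu₁ Y D.mem D.supp).2.1
  have key : ∀ φ ∈ testFunctions I N,
      tsupport φ ⊆ V ∩ (Y'.source ∩ {p | D.φ p ≠ 0}) ∩ {p | transMap Y Y' q (Y p) = Y' p} →
      chartFourier u₁ Y' φ = (fun l => ∫ k, chartFourier u₁ Y D.φ k *
        oscKernel (transMap Y Y' q) (Y.push fun p => φ p * (D.φ p)⁻¹) k l) := fun φ hφ hφV =>
    funext (chartFourier_eq_integral_oscKernel hu₁ hq hq' D.mem D.supp hφ
      (fun p hp => (hφV hp).1.2.2) fun p hp => (hφV hp).2)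
  have bound : ∀ φ ∈ testFunctions I N,
      tsupport φ ⊆ V ∩ (Y'.source ∩ {p | D.φ p ≠ 0}) ∩ {p | transMap Y Y' q (Y p) = Y' p} →
      ∀ B : ℝ, (∀ j ≤ m, ∀ x, ‖iteratedFDeriv ℝ j (Y.push φ) x‖ ≤ B) →
      ∫⁻ l, ‖chartFourier u₁ Y' φ l * chartFourier u₂ Y' ψ (-l)‖ₑ ≤ C * ENNReal.ofReal B *
        D.normSq (chartFourier u₁ Y D.φ) ^ (1 / 2 : ℝ) := by
    intro φ hφ hφV B hB
    have hm' := aestronglyMeasurable_chartFourier hu₁ Y' hφ fun p hp => (hφV hp).1.2.1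
    rw [key φ hφ hφV] at hm' ⊢
    exact hest φ hφ (fun p hp => (hφV hp).1.1) B hB _ hh D.fst_order hm'
  have hint : ∀ φ ∈ testFunctions I N,
      tsupport φ ⊆ V ∩ (Y'.source ∩ {p | D.φ p ≠ 0}) ∩ {p | transMap Y Y' q (Y p) = Y' p} →
      Integrable (fun l => chartFourier u₁ Y' φ l * chartFourier u₂ Y' ψ (-l)) := by
    intro φ hφ hφV
    have hφs : tsupport φ ⊆ Y.source := fun p hp => D.supp (subset_tsupport _ (hφV hp).1.2.2)
    obtain ⟨B, hB⟩ := exists_iteratedFDeriv_le (Y.contDiff_push hφ hφs)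
      (Y.hasCompactSupport_push hφ.2 hφs) m
    refine ⟨(aestronglyMeasurable_chartFourier hu₁ Y' hφ fun p hp => (hφV hp).1.2.1).mul
      hU₂.aestronglyMeasurable, (bound φ hφ hφV B hB).trans_lt ?_⟩
    exact ENNReal.mul_lt_top (ENNReal.mul_lt_top hC ENNReal.ofReal_lt_top)
      (ENNReal.rpow_lt_top_of_nonneg (by norm_num) D.normSq_fst_lt.ne)
  refine ⟨fun φ hφ hφV => ⟨hint φ hφ hφV, ?_⟩,
    (C * D.normSq (chartFourier u₁ Y D.φ) ^ (1 / 2 : ℝ)).toReal, fun φ hφ hφV B hB => ?_⟩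
  · have hφs : tsupport φ ⊆ Y.source := fun p hp => D.supp (subset_tsupport _ (hφV hp).1.2.2)
    have hφs' : tsupport φ ⊆ Y'.source := fun p hp => (hφV hp).1.2.1
    have h0 : ∀ p ∈ tsupport φ, D.φ p ≠ 0 := fun p hp => (hφV hp).1.2.2
    have hχ : ∀ p ∈ tsupport φ, transMap Y Y' q (Y p) = Y' p := fun p hp => (hφV hp).2
    obtain ⟨B, hB⟩ := exists_iteratedFDeriv_le (Y.contDiff_push hφ hφs)
      (Y.hasCompactSupport_push hφ.2 hφs) m
    have hm := mul_inv_mem D.mem hφ h0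
    have hms : tsupport (fun p => φ p * (D.φ p)⁻¹) ⊆ Y.source :=
      (tsupport_mul_left_subset φ fun p => (D.φ p)⁻¹).trans hφs
    set T : ℕ → W → ℂ := fun R l => ∫ k, D.trunc R k *
      oscKernel (transMap Y Y' q) (Y.push fun p => φ p * (D.φ p)⁻¹) k l with hT
    have hTF : ∀ R, T R = 𝓕 (Y'.push fun p => φ p * (D.approx ρ R p * (ρ.val Y' p : ℂ))) :=
      fun R => funext (D.integral_trunc_mul_oscKernel hu₁ ρ hY hY' R hq hq' hφ h0 hφs' hχ)
    have hTc : ∀ R, Continuous (T R) := fun R => by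
      have hm2 := D.mul_approx_mem hu₁ ρ hY hY' R hφ h0 hφs'
      have hms2 : tsupport (fun p => φ p * (D.approx ρ R p * (ρ.val Y' p : ℂ))) ⊆ Y'.source :=
        (tsupport_mul_left_subset φ fun p => (D.approx ρ R p * (ρ.val Y' p : ℂ))).trans hφs'
      have h5 := (𝓕 ((Y'.hasCompactSupport_push hm2.2 hms2).toSchwartzMap
        (Y'.contDiff_push hm2 hms2))).continuous
      rw [SchwartzMap.fourier_coe] at h5
      rw [hTF]; exact h5
    -- The error of the approximation is the same kernel operator applied to the tail of the Fourier
    -- transform. Hence the pairing bound controls it by the norm of the tail, which tends to zero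
    -- by dominated convergence.
    have htail : ∀ R l, chartFourier u₁ Y' φ l - T R l =
        ∫ k, (Metric.closedBall (0 : W) R)ᶜ.indicator (chartFourier u₁ Y D.φ) k *
          oscKernel (transMap Y Y' q) (Y.push fun p => φ p * (D.φ p)⁻¹) k l := by
      intro R l
      rw [key φ hφ hφV, hT]
      dsimp only
      have hi := integrable_mul_oscKernel (contDiff_transMap hq hq') (Y.contDiff_push hm hms)
        (Y.hasCompactSupport_push hm.2 hms) hh hA l
      have hi2 : Integrable fun k => D.trunc R k * oscKernel (transMap Y Y' q)
          (Y.push fun p => φ p * (D.φ p)⁻¹) k l := by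
        have := hi.indicator (measurableSet_closedBall (x := (0 : W)) (ε := R))
        refine this.congr (ae_of_all _ fun k => ?_)
        by_cases hk : k ∈ Metric.closedBall (0 : W) R
        · simp [PairData.trunc, Set.indicator_of_mem hk]
        · simp [PairData.trunc, Set.indicator_of_notMem hk]
      rw [← integral_sub hi hi2]
      congr 1; ext k
      rw [← sub_mul, PairData.trunc, Set.indicator_compl]; rfl
    have hdiff : ∀ R : ℕ, ∫⁻ l, ‖(chartFourier u₁ Y' φ l - T R l) *
        chartFourier u₂ Y' ψ (-l)‖ₑ ≤ C * ENNReal.ofReal B *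
        D.normSq ((Metric.closedBall (0 : W) R)ᶜ.indicator (chartFourier u₁ Y D.φ)) ^
          (1 / 2 : ℝ) := by
      intro R
      have hm' : AEStronglyMeasurable (fun l => chartFourier u₁ Y' φ l - T R l) volume :=
        (aestronglyMeasurable_chartFourier hu₁ Y' hφ hφs').sub (hTc R).aestronglyMeasurable
      have hord := (sobolevSq_indicator_le (-(D.order : ℝ)) Set.univ
        (Metric.closedBall (0 : W) R)ᶜ (chartFourier u₁ Y D.φ)).trans_lt D.fst_order
      simp_rw [htail] at hm' ⊢
      exact hest φ hφ (fun p hp => (hφV hp).1.1) B hB _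
        (hh.indicator measurableSet_closedBall.compl) hord hm'
    have hlim : Tendsto (fun R : ℕ => ∫⁻ l, ‖(chartFourier u₁ Y' φ l - T R l) *
        chartFourier u₂ Y' ψ (-l)‖ₑ) atTop (𝓝 0) := by
      refine tendsto_of_tendsto_of_tendsto_of_le_of_le tendsto_const_nhds ?_
        (fun R => zero_le) hdiff
      have h6 := (ENNReal.continuous_rpow_const (y := (1 / 2 : ℝ))).continuousAt.tendsto.comp
        (D.tendsto_normSq hu₁)
      rw [ENNReal.zero_rpow_of_pos (by norm_num)] at h6
      have h7 := ENNReal.Tendsto.const_mul (a := C * ENNReal.ofReal B) h6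
        (Or.inr (ENNReal.mul_lt_top hC ENNReal.ofReal_lt_top).ne)
      rwa [mul_zero] at h7
    have heval : ∀ R, evalTest u₂ (fun p => φ p * (ψ p * (ρ.val Y' p : ℂ)) * D.approx ρ R p) =
        ∫ l, T R l * chartFourier u₂ Y' ψ (-l) := fun R => by
      rw [hTF]
      exact D.evalTest_approx hu₁ hu₂ ρ hY hY' R hφ h0 hφs' hψ hψs'
    simp_rw [heval]
    rw [tendsto_iff_norm_sub_tendsto_zero]
    have hfin : ∀ R, ∫⁻ l, ‖(chartFourier u₁ Y' φ l - T R l) * chartFourier u₂ Y' ψ (-l)‖ₑ ≠ ⊤ :=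
      fun R => ((hdiff R).trans_lt (ENNReal.mul_lt_top (ENNReal.mul_lt_top hC
        ENNReal.ofReal_lt_top) (ENNReal.rpow_lt_top_of_nonneg (by norm_num)
          ((ENNReal.add_lt_top.2 ⟨ENNReal.sum_lt_top.2 fun i _ =>
            (sobolevSq_indicator_le _ _ _ _).trans_lt (D.fst_lt i),
            (sobolevSq_indicator_le _ _ _ _).trans_lt D.fst_order⟩).ne)))).ne
    have hlim' := (ENNReal.tendsto_toReal ENNReal.zero_ne_top).comp hlim
    rw [ENNReal.toReal_zero] at hlim'
    refine squeeze_zero (fun R => norm_nonneg _) (fun R => ?_) hlim'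
    have hi := hint φ hφ hφV
    have hi3 : Integrable fun l => (chartFourier u₁ Y' φ l - T R l) * chartFourier u₂ Y' ψ (-l) :=
      ⟨((aestronglyMeasurable_chartFourier hu₁ Y' hφ hφs').sub
        (hTc R).aestronglyMeasurable).mul hU₂.aestronglyMeasurable, (hfin R).lt_top⟩
    have hi4 : Integrable fun l => T R l * chartFourier u₂ Y' ψ (-l) := by
      refine (hi.sub hi3).congr (ae_of_all _ fun l => ?_)
      simp only [Pi.sub_apply]; ring
    rw [← integral_sub hi4 hi]
    refine (norm_integral_le_integral_norm _).trans_eq ?_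
    refine (integral_norm_eq_lintegral_enorm (hi4.sub hi).1).trans ?_
    rw [Function.comp_apply]
    congr 2; ext l
    rw [Pi.sub_apply, ← sub_mul, ← neg_sub, neg_mul, enorm_neg]
  · have h1 := bound φ hφ hφV B hB
    have hB0 : 0 ≤ B := (norm_nonneg _).trans (hB 0 (Nat.zero_le _) 0)
    have hfin : C * ENNReal.ofReal B * D.normSq (chartFourier u₁ Y D.φ) ^ (1 / 2 : ℝ) ≠ ⊤ :=
      (ENNReal.mul_lt_top (ENNReal.mul_lt_top hC ENNReal.ofReal_lt_top)
      (ENNReal.rpow_lt_top_of_nonneg (by norm_num) D.normSq_fst_lt.ne)).ne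
    have h2 := (norm_integral_le_integral_norm _).trans_eq
      (integral_norm_eq_lintegral_enorm (hint φ hφ hφV).1)
    refine h2.trans ((ENNReal.toReal_mono hfin h1).trans_eq ?_)
    rw [mul_right_comm, ENNReal.toReal_mul, ENNReal.toReal_ofReal hB0]

end Approximation

/-! ### Partitions of unity and globally defined approximations -/

section Global

variable {E H : Type*} [NormedAddCommGroup E] [NormedSpace ℝ E] [TopologicalSpace H]
  {I : ModelWithCorners ℝ E H} {N : Type*} [TopologicalSpace N] [ChartedSpace H N]
  {W : Type*} [NormedAddCommGroup W] [InnerProductSpace ℝ W]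
  [FiniteDimensional ℝ W] [MeasurableSpace W] [BorelSpace W]

/-- Bounds for derivatives under a change of charts. -/
theorem exists_iteratedFDeriv_push_le {Y Y' : SmoothChart I N W} {q : N} (hq : q ∈ Y.source)
    (hq' : q ∈ Y'.source) (m : ℕ) :
    ∃ V ∈ 𝓝 q, ∃ C : ℝ, 0 ≤ C ∧ ∀ φ ∈ testFunctions I N, tsupport φ ⊆ V → ∀ B : ℝ,
      (∀ j ≤ m, ∀ x, ‖iteratedFDeriv ℝ j (Y.push φ) x‖ ≤ B) →
      ∀ j ≤ m, ∀ x, ‖iteratedFDeriv ℝ j (Y'.push φ) x‖ ≤ C * B := by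
  have hχ := contDiff_transMap hq' hq
  have h1 : ∀ᶠ y in 𝓝 (Y' q), y ∈ Y'.target ∩ Y'.symm ⁻¹' Y.source ∧
      transMap Y' Y q y = Y (Y'.symm y) := by
    have hov : ∀ᶠ y in 𝓝 (Y' q), y ∈ Y'.target ∩ Y'.symm ⁻¹' Y.source :=
      (Y'.isOpen_overlap Y).mem_nhds ⟨Y'.map_source hq', by
        rwa [Set.mem_preimage, Y'.left_inv hq']⟩
    exact hov.and (transMap_spec hq' hq).2
  obtain ⟨r, hr, hball⟩ := Metric.eventually_nhds_iff_ball.1 h1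
  have h2 : ∀ i : ℕ, ∃ D : ℝ, ∀ y ∈ Metric.closedBall (Y' q) r,
      ‖iteratedFDeriv ℝ i (transMap Y' Y q) y‖ ≤ D := fun i =>
    (isCompact_closedBall _ _).exists_bound_of_continuousOn
      (hχ.continuous_iteratedFDeriv (by exact_mod_cast le_top)).continuousOn
  choose D hD using h2
  have hD0 : ∀ i, 0 ≤ D i := fun i =>
    (norm_nonneg _).trans (hD i (Y' q) (Metric.mem_closedBall_self hr.le))
  -- The chain rule estimate asks for the `i`-th derivative to be bounded by `A ^ i`; with `A ≥ 1`
  -- it is enough to dominate each `D i`.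
  set A : ℝ := 1 + ∑ i ∈ Finset.range (m + 1), D i
  have hA1 : 1 ≤ A := le_add_of_nonneg_right (Finset.sum_nonneg fun i _ => hD0 i)
  refine ⟨Y'.source ∩ Y' ⁻¹' Metric.ball (Y' q) r,
    inter_mem (Y'.open_source.mem_nhds hq')
    ((Y'.continuousOn.continuousAt (Y'.open_source.mem_nhds hq')).preimage_mem_nhds
      (Metric.ball_mem_nhds _ hr)), m.factorial * A ^ m, by positivity, ?_⟩
  intro φ hφ hφV B hB j hj x
  have hB0 : 0 ≤ B := (norm_nonneg _).trans (hB 0 (Nat.zero_le _) 0)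
  have hs' : tsupport φ ⊆ Y'.source := fun p hp => (hφV hp).1
  by_cases hx : x ∈ tsupport (Y'.push φ)
  · obtain ⟨p, hp, rfl⟩ := Y'.tsupport_push_subset hφ.2 hs' hx
    have hxb : Y' p ∈ Metric.ball (Y' q) r := (hφV hp).2
    have hs : tsupport φ ⊆ Y.source := fun z hz => by
      have := (hball (Y' z) (hφV hz).2).1.2
      rwa [Set.mem_preimage, Y'.left_inv (hs' hz)] at this
    have heq : Y'.push φ =ᶠ[𝓝 (Y' p)] Y.push φ ∘ transMap Y' Y q := by
      filter_upwards [Metric.isOpen_ball.mem_nhds hxb] with y hy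
      obtain ⟨⟨hyt, hys⟩, hy2⟩ := hball y hy
      rw [Function.comp_apply, hy2, Y.push_apply hys, Y'.push_of_mem hyt]
    rw [(heq.iteratedFDeriv ℝ j).eq_of_nhds]
    refine (norm_iteratedFDeriv_comp_le (N := ∞) (Y.contDiff_push hφ hs) hχ
      (by exact_mod_cast le_top) (Y' p) (C := B) (D := A)
      (fun i hi => hB i (hi.trans hj) _) (fun i hi1 hi => ?_)).trans ?_
    · refine (hD i _ (Metric.ball_subset_closedBall hxb)).trans ?_
      have h3 : D i ≤ ∑ i ∈ Finset.range (m + 1), D i :=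
        Finset.single_le_sum (f := D) (fun i _ => hD0 i) (Finset.mem_range.2 (by omega))
      calc D i ≤ A := by linarith
        _ ≤ A ^ i := le_self_pow₀ hA1 (by omega)
    · have h4 : (j.factorial : ℝ) ≤ m.factorial := by exact_mod_cast Nat.factorial_le hj
      have h5 : A ^ j ≤ A ^ m := pow_le_pow_right₀ hA1 hj
      calc (j.factorial : ℝ) * B * A ^ j ≤ m.factorial * B * A ^ m := by gcongr
        _ = _ := by ring
  · have : Y'.push φ =ᶠ[𝓝 x] fun _ => 0 := by
      filter_upwards [(isClosed_tsupport (Y'.push φ)).isOpen_compl.mem_nhds hx] with y hy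
      exact image_eq_zero_of_notMem_tsupport hy
    rw [(this.iteratedFDeriv ℝ j).eq_of_nhds]
    have h0 : iteratedFDeriv ℝ j (fun _ : W => (0 : ℂ)) x = 0 := by
      rw [iteratedFDeriv_fun_zero]; rfl
    rw [h0, norm_zero]; positivity

/-- Partitions of unity on compact sets by test functions with small supports. -/
theorem exists_finite_partition [T2Space N] {K : Set N} (hK : IsCompact K) (V : N → Set N)
    (hV : ∀ q ∈ K, V q ∈ 𝓝 q) (hchart : ∀ q, ∃ Y : SmoothChart I N W, q ∈ Y.source) :
    ∃ (ι : Type) (_ : Fintype ι) (c : ι → N) (ζ : ι → N → ℂ), (∀ i, c i ∈ K ∧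
      ζ i ∈ testFunctions I N ∧ tsupport (ζ i) ⊆ V (c i)) ∧ ∀ q ∈ K, ∑ i, ζ i q = 1 := by
  refine hK.induction_on (p := fun t => ∃ (ι : Type) (_ : Fintype ι) (c : ι → N) (ζ : ι → N → ℂ),
    (∀ i, c i ∈ K ∧ ζ i ∈ testFunctions I N ∧ tsupport (ζ i) ⊆ V (c i)) ∧
      ∀ q ∈ t, ∑ i, ζ i q = 1) ?_ ?_ ?_ ?_
  · exact ⟨Empty, inferInstance, Empty.elim, Empty.elim, fun i => i.elim, by simp⟩
  · rintro s t hst ⟨ι, hι, c, ζ, h1, h2⟩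
    exact ⟨ι, hι, c, ζ, h1, fun q hq => h2 q (hst hq)⟩
  · rintro s t ⟨ι, hι, c, ζ, h1, h2⟩ ⟨ι', hι', c', ζ', h1', h2'⟩
    refine ⟨ι ⊕ ι', inferInstance, Sum.elim c c',
      -- The total is one minus the product of the defects of the two families, so it equals one as
      -- soon as either family sums to one.
      Sum.elim ζ fun j q => ζ' j q * (1 - ∑ i, ζ i q), ?_, ?_⟩
    · rintro (i | j)
      · exact h1 i
      · refine ⟨(h1' j).1, mul_mem_testFunctions (h1' j).2.1 isOpen_univ (Set.subset_univ _) ?_,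
          (tsupport_mul_left_subset _ _).trans (h1' j).2.2⟩
        have h3 : ContMDiff I 𝓘(ℝ, ℂ) ∞ fun q => ∑ i, ζ i q :=
          contMDiff_finsetSum fun i _ => (h1 i).2.1.1
        exact (contMDiff_const.sub h3).contMDiffOn
    · intro q hq
      simp only [Fintype.sum_sum_type, Sum.elim_inl, Sum.elim_inr]
      rw [← Finset.sum_mul]
      rcases hq with hq | hq
      · rw [h2 q hq]; ring
      · rw [h2' q hq]; ring
  · intro q hq
    obtain ⟨Y, hY⟩ := hchart q
    obtain ⟨φ, hφ, hφV, -, hφ1⟩ := exists_testFunction_eq_one Y hY (hV q hq)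
    exact ⟨_, mem_nhdsWithin_of_mem_nhds hφ1, Unit, inferInstance, fun _ => q, fun _ => φ,
      fun _ => ⟨hq, hφ, hφV⟩, fun p hp => by simpa using hp⟩

theorem chartFourier_sum (u : testFunctions I N →ₗ[ℂ] ℂ) (Y : SmoothChart I N W) {ι : Type*}
    (t : Finset ι) {φ : ι → N → ℂ} (hφ : ∀ i ∈ t, φ i ∈ testFunctions I N)
    (hs : ∀ i ∈ t, tsupport (φ i) ⊆ Y.source) (k : W) :
    chartFourier u Y (fun p => ∑ i ∈ t, φ i p) k = ∑ i ∈ t, chartFourier u Y (φ i) k := by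
  unfold chartFourier
  rw [← evalTest_sum u t fun i hi => Y.mul_comp_mem (hφ i hi) (hs i hi) (planeWave_contDiff k)]
  simp_rw [Finset.sum_mul]

variable [T2Space N] [SigmaCompactSpace N] [FiniteDimensional ℝ E] [IsManifold I ∞ N]
variable {u₁ u₂ : testFunctions I N →ₗ[ℂ] ℂ}

/-- The data `u₁`, `u₂` have a Fourier product near every point, which is the limit of the
values of `u₂` on localisations of smooth approximations of `u₁`. -/
theorem exists_global_approximation (hu₁ : IsDistribution W u₁) (hu₂ : IsDistribution W u₂)
    (ρ : SmoothDensity I N W)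
    (hreg : ∀ Y ∈ ρ.charts, ∀ p ∈ Y.source, ∀ η : W, η ≠ 0 → ∃ s t : ℝ, 0 ≤ s + t ∧
      IsSobolevRegular u₁ s Y p η ∧ IsSobolevRegular u₂ t Y p (-η)) :
    ∃ A : ℕ → N → ℂ, (∀ R, ContMDiff I 𝓘(ℝ, ℂ) ∞ (A R)) ∧
      ∀ Y' ∈ ρ.charts, ∀ q ∈ Y'.source, ∃ V ∈ 𝓝 q, V ⊆ Y'.source ∧
      ∃ Y : SmoothChart I N W, q ∈ Y.source ∧ V ⊆ Y.source ∧ ∃ m : ℕ,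
      ∀ ψ ∈ testFunctions I N, tsupport ψ ⊆ V →
      (∀ φ ∈ testFunctions I N, tsupport φ ⊆ V →
        Integrable (fun l => chartFourier u₁ Y' φ l * chartFourier u₂ Y' ψ (-l)) ∧
        Tendsto (fun R : ℕ => evalTest u₂ fun p =>
          φ p * (ψ p * (ρ.val Y' p : ℂ)) * A R p) atTop
          (𝓝 (∫ l, chartFourier u₁ Y' φ l * chartFourier u₂ Y' ψ (-l)))) ∧
      ∃ C : ℝ, ∀ φ ∈ testFunctions I N, tsupport φ ⊆ V → ∀ B : ℝ,
        (∀ j ≤ m, ∀ x, ‖iteratedFDeriv ℝ j (Y.push φ) x‖ ≤ B) →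
        ‖∫ l, chartFourier u₁ Y' φ l * chartFourier u₂ Y' ψ (-l)‖ ≤ C * B := by
  choose Yc hYc hYs using ρ.cover
  choose D hD using fun p => exists_pairData hu₁ hu₂ (hYs p) (hreg (Yc p) (hYc p) p (hYs p))
  -- The approximation attached to `D p` is smooth only where its cutoff does not vanish. A
  -- partition of unity subordinate to these sets glues the local approximations to a smooth
  -- function on all of `N`.
  obtain ⟨f, hf⟩ := SmoothPartitionOfUnity.exists_isSubordinate I (isClosed_univ (X := N))
    (fun p => {q | (D p).φ q ≠ 0})
    (fun p => isOpen_ne_fun (D p).mem.1.continuous continuous_const)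
    (fun p _ => Set.mem_iUnion.2 ⟨p, hD p⟩)
  refine ⟨fun R q => ∑ᶠ i, f i q • (D i).approx ρ R q, fun R => ?_, fun Y' hY' q hq => ?_⟩
  · refine f.contMDiff_finsum_smul (n := ⊤) fun i x hx => ?_
    exact ((D i).contMDiffOn_approx hu₁ ρ (hYc i) R).contMDiffAt
      ((isOpen_ne_fun (D i).mem.1.continuous continuous_const).mem_nhds (hf i hx))
  · have hloc : ∀ i : f.fintsupport q, _ := fun i => (D i).exists_local hu₁ hu₂ ρ (hYc i) hY'
      (hf i ((f.mem_fintsupport_iff q i).1 i.2)) hq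
    choose V hV hVs m hVm using hloc
    -- The datum centred at `q` supplies integrability and the finite order bound. Convergence comes
    -- from the finitely many members of the partition with `q` in their closed support, the only
    -- ones that contribute near `q`.
    obtain ⟨V₀, hV₀, hV₀s, m₀, hV₀m⟩ := (D q).exists_local hu₁ hu₂ ρ (hYc q) hY' (hD q) hq
    refine ⟨V₀ ∩ (⋂ i, V i) ∩ {y | f.finsupport y ⊆ f.fintsupport q},
      inter_mem (inter_mem hV₀ (iInter_mem.2 hV)) (f.eventually_finsupport_subset q),
      fun p hp => (hV₀s hp.1.1).1, Yc q, hYs q,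
      fun p hp => (D q).supp (subset_tsupport _ (hV₀s hp.1.1).2), m₀, fun ψ hψ hψV => ?_⟩
    have h₀ := hV₀m ψ hψ fun p hp => (hψV hp).1.1
    refine ⟨fun φ hφ hφV => ⟨(h₀.1 φ hφ fun p hp => (hφV hp).1.1).1, ?_⟩, ?_⟩
    · have hfs : ∀ i, ContMDiff I 𝓘(ℝ, ℂ) ∞ fun p => ((f i p : ℝ) : ℂ) := fun i =>
        Complex.ofRealCLM.contDiff.contMDiff.comp (f i).contMDiff
      have hφi : ∀ i : f.fintsupport q, (fun p => φ p * ((f i p : ℝ) : ℂ)) ∈ testFunctions I N :=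
        fun i => mul_mem_testFunctions hφ isOpen_univ (Set.subset_univ _) (hfs i).contMDiffOn
      have hφis : ∀ i : f.fintsupport q, tsupport (fun p => φ p * ((f i p : ℝ) : ℂ)) ⊆ V i :=
        fun i p hp => Set.mem_iInter.1 (hφV (tsupport_mul_left_subset φ _ hp)).1.2 i
      have hloc := fun i => (hVm i ψ hψ fun p hp => Set.mem_iInter.1 (hψV hp).1.2 i).1 _ (hφi i)
        (hφis i)
      have hsum := tendsto_finsetSum Finset.univ fun i _ => (hloc i).2
      have hs1 : ∀ p ∈ tsupport φ, ∑ i : f.fintsupport q, f i p = 1 := fun p hp => by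
        rw [Finset.sum_coe_sort (f.fintsupport q) fun i => f i p]
        exact f.sum_finsupport' p (Set.mem_univ p) (hφV hp).2
      -- Each piece converges to the pairing with `φ` replaced by `φ · f i`; since the `f i` sum to
      -- one on the support of `φ`, the limits add up to the desired pairing.
      have e1 : ∑ i : f.fintsupport q, ∫ l, chartFourier u₁ Y' (fun p => φ p * ((f i p : ℝ) : ℂ)) l *
          chartFourier u₂ Y' ψ (-l) = ∫ l, chartFourier u₁ Y' φ l * chartFourier u₂ Y' ψ (-l) := by
        rw [← integral_finsetSum _ fun i _ => (hloc i).1]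
        congr 1; ext l
        rw [← Finset.sum_mul, ← chartFourier_sum u₁ Y' Finset.univ (fun i _ => hφi i)
          fun i _ => (hφis i).trans fun p hp => (hVs i hp).1]
        congr 2; ext p
        by_cases hp : φ p = 0
        · simp [hp]
        · rw [← Finset.mul_sum, ← Complex.ofReal_sum, hs1 p (subset_tsupport _ hp)]; simp
      rw [e1] at hsum
      refine hsum.congr fun R => ?_
      have hterm : ∀ i : f.fintsupport q, (fun p => φ p * ((f i p : ℝ) : ℂ) *
          (ψ p * (ρ.val Y' p : ℂ)) * (D i).approx ρ R p) ∈ testFunctions I N := fun i => by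
        have h1 := (D i).mul_approx_mem hu₁ ρ (hYc i) hY' R (hφi i)
          (fun p hp => (hVs i (hφis i hp)).2) (fun p hp => (hVs i (hφis i hp)).1)
        convert testFunctions_mul_mem h1 hψ using 1
        ext p; ring
      rw [← evalTest_sum u₂ Finset.univ fun i _ => hterm i]
      congr 1; ext p
      by_cases hp : φ p = 0
      · simp [hp]
      · have h2 : ∑ᶠ i, f i p • (D i).approx ρ R p =
            ∑ i : f.fintsupport q, f i p • (D i).approx ρ R p := by
          rw [Finset.sum_coe_sort (f.fintsupport q) fun i => f i p • (D i).approx ρ R p]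
          refine finsum_eq_sum_of_support_subset _ fun i hi => ?_
          refine (hφV (subset_tsupport _ hp)).2 ((f.mem_finsupport p).2 ?_)
          exact left_ne_zero_of_smul hi
        beta_reduce
        rw [h2, Finset.mul_sum]
        refine Finset.sum_congr rfl fun i _ => ?_
        rw [Complex.real_smul]; ring
    · obtain ⟨C, hC⟩ := h₀.2
      exact ⟨C, fun φ hφ hφV B hB => hC φ hφ (fun p hp => (hφV hp).1.1) B hB⟩

end Global

/-! ### Existence and uniqueness of the localised Fourier product -/

section Product

variable {E H : Type*} [NormedAddCommGroup E] [NormedSpace ℝ E] [TopologicalSpace H]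
  {I : ModelWithCorners ℝ E H} {N : Type*} [TopologicalSpace N] [ChartedSpace H N]
  {W : Type*} [NormedAddCommGroup W] [InnerProductSpace ℝ W]
  [FiniteDimensional ℝ W] [MeasurableSpace W] [BorelSpace W] [T2Space N]
  {u₁ u₂ : testFunctions I N →ₗ[ℂ] ℂ}

/-- `w` is the localised Fourier product of `u₁` and `u₂` in the charts of the density `ρ`. -/
def IsFourierProduct (ρ : SmoothDensity I N W) (u₁ u₂ w : testFunctions I N →ₗ[ℂ] ℂ) : Prop :=
  ∀ Y ∈ ρ.charts, ∀ q ∈ Y.source, ∃ V ∈ 𝓝 q, V ⊆ Y.source ∧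
    ∀ φ ∈ testFunctions I N, ∀ ψ ∈ testFunctions I N, tsupport φ ⊆ V → tsupport ψ ⊆ V →
      Integrable (fun l => chartFourier u₁ Y φ l * chartFourier u₂ Y ψ (-l)) ∧
      evalTest w (fun p => φ p * (ψ p * (ρ.val Y p : ℂ))) =
        ∫ l, chartFourier u₁ Y φ l * chartFourier u₂ Y ψ (-l)

theorem SmoothDensity.mul_inv_val_mem (ρ : SmoothDensity I N W) {Y : SmoothChart I N W}
    (hY : Y ∈ ρ.charts) {ψ : N → ℂ} (hψ : ψ ∈ testFunctions I N) (hs : tsupport ψ ⊆ Y.source) :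
    (fun p => ψ p * ((ρ.val Y p : ℝ) : ℂ)⁻¹) ∈ testFunctions I N := by
  refine mul_mem_testFunctions hψ Y.open_source hs fun p hp => ?_
  have hne : ((ρ.val Y p : ℝ) : ℂ) ≠ 0 := by exact_mod_cast (ρ.pos Y hY p hp).ne'
  exact (contDiffAt_inv ℝ hne).contMDiffAt.comp_contMDiffWithinAt p
    ((Complex.ofRealCLM.contDiff.contMDiff.comp_contMDiffOn (ρ.smooth Y hY)) p hp)

/-- Every test function with support close to `q` is of the form `φ ψ m`. -/
theorem SmoothDensity.exists_factorization (ρ : SmoothDensity I N W) {Y : SmoothChart I N W}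
    (hY : Y ∈ ρ.charts) {q : N} (hq : q ∈ Y.source) {V : Set N} (hV : V ∈ 𝓝 q) :
    ∃ ψ ∈ testFunctions I N, tsupport ψ ⊆ V ∧ ∃ g ∈ testFunctions I N, tsupport g ⊆ V ∧
      ∃ V' ∈ 𝓝 q, V' ⊆ V ∧ ∀ F : N → ℂ, tsupport F ⊆ V' →
        F = fun p => g p * F p * (ψ p * (ρ.val Y p : ℂ)) := by
  obtain ⟨ψ, hψ, hψV, hψs, hψ1⟩ := exists_testFunction_eq_one Y hq hV
  refine ⟨ψ, hψ, hψV, _, ρ.mul_inv_val_mem hY hψ hψs, (tsupport_mul_left_subset ψ _).trans hψV,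
    V ∩ {p | ψ p = 1} ∩ Y.source, inter_mem (inter_mem hV hψ1) (Y.open_source.mem_nhds hq),
    fun p hp => hp.1.1, fun F hF => ?_⟩
  ext p
  by_cases hp : F p = 0
  · simp [hp]
  · have h1 := hF (subset_tsupport _ hp)
    have hne : ((ρ.val Y p : ℝ) : ℂ) ≠ 0 := by exact_mod_cast (ρ.pos Y hY p h1.2).ne'
    have h2 : ψ p = 1 := h1.1.2
    rw [h2]; field_simp

theorem evalTest_eq_sum_of_partition (w : testFunctions I N →ₗ[ℂ] ℂ) {F : N → ℂ}
    (hF : F ∈ testFunctions I N) {ι : Type} [Fintype ι] {ζ : ι → N → ℂ}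
    (hζ : ∀ i, ζ i ∈ testFunctions I N) (hsum : ∀ q ∈ tsupport F, ∑ i, ζ i q = 1) :
    evalTest w F = ∑ i, evalTest w (fun p => ζ i p * F p) := by
  rw [← evalTest_sum w Finset.univ fun i _ => testFunctions_mul_mem (hζ i) hF]
  congr 1; ext p
  by_cases hp : F p = 0
  · simp [hp]
  · rw [← Finset.sum_mul, hsum p (subset_tsupport _ hp), one_mul]

/-- Uniqueness of the localised Fourier product. -/
theorem IsFourierProduct.unique {ρ : SmoothDensity I N W} {w w' : testFunctions I N →ₗ[ℂ] ℂ}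
    (h : IsFourierProduct ρ u₁ u₂ w) (h' : IsFourierProduct ρ u₁ u₂ w') : w = w' := by
  choose Y hY hYs using ρ.cover
  choose V hV hVs hw using fun q => h (Y q) (hY q) q (hYs q)
  choose V' hV' hVs' hw' using fun q => h' (Y q) (hY q) q (hYs q)
  choose ψ hψ hψV g hg hgV V₁ hV₁ hVs₁ hfac using fun q =>
    ρ.exists_factorization (hY q) (hYs q) (inter_mem (hV q) (hV' q))
  ext ⟨F, hF⟩
  rw [← evalTest_of_mem w hF, ← evalTest_of_mem w' hF]
  obtain ⟨ι, _, c, ζ, hζ, hsum⟩ := exists_finite_partition (W := W) (I := I) hF.2.isCompact V₁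
    (fun q _ => hV₁ q) fun q => ⟨Y q, hYs q⟩
  rw [evalTest_eq_sum_of_partition w hF (fun i => (hζ i).2.1) hsum,
    evalTest_eq_sum_of_partition w' hF (fun i => (hζ i).2.1) hsum]
  refine Finset.sum_congr rfl fun i _ => ?_
  have hm := testFunctions_mul_mem (hζ i).2.1 hF
  have hms : tsupport (fun p => ζ i p * F p) ⊆ V₁ (c i) :=
    (tsupport_mul_left_subset _ _).trans (hζ i).2.2
  have hm2 := testFunctions_mul_mem (hg (c i)) hm
  have hm2s := (tsupport_mul_left_subset (g (c i)) (fun p => ζ i p * F p)).trans (hgV (c i))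
  rw [hfac (c i) _ hms, (hw (c i) _ hm2 _ (hψ _) (fun p hp => (hm2s hp).1)
    fun p hp => (hψV _ hp).1).2, (hw' (c i) _ hm2 _ (hψ _) (fun p hp => (hm2s hp).2)
    fun p hp => (hψV _ hp).2).2]

variable [SigmaCompactSpace N] [FiniteDimensional ℝ E] [IsManifold I ∞ N]

/-- Existence of the localised Fourier product. -/
theorem exists_isFourierProduct (hu₁ : IsDistribution W u₁) (hu₂ : IsDistribution W u₂)
    (ρ : SmoothDensity I N W)
    (hreg : ∀ Y ∈ ρ.charts, ∀ p ∈ Y.source, ∀ η : W, η ≠ 0 → ∃ s t : ℝ, 0 ≤ s + t ∧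
      IsSobolevRegular u₁ s Y p η ∧ IsSobolevRegular u₂ t Y p (-η)) :
    ∃ w : testFunctions I N →ₗ[ℂ] ℂ, IsDistribution W w ∧ IsFourierProduct ρ u₁ u₂ w := by
  obtain ⟨A, hA, hloc⟩ := exists_global_approximation hu₁ hu₂ ρ hreg
  have hmemA : ∀ F ∈ testFunctions I N, ∀ R, (fun p => F p * A R p) ∈ testFunctions I N :=
    fun F hF R => mul_mem_testFunctions hF isOpen_univ (Set.subset_univ _) (hA R).contMDiffOn
  -- Near `q` every test function factors as `(g F) ψ m`, so the limits of `hloc` apply with `φ = g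
  -- F`. Bounds on `F` in an arbitrary chart `Yb` are first carried to the chart `Y` of the estimate
  -- and then through multiplication by `g`.
  have hlocal : ∀ (Yb : SmoothChart I N W), ∀ q ∈ Yb.source, ∃ V ∈ 𝓝 q, V ⊆ Yb.source ∧
      ∃ (m : ℕ) (C : ℝ), ∀ F ∈ testFunctions I N, tsupport F ⊆ V → ∃ z : ℂ,
        Tendsto (fun R => evalTest u₂ fun p => F p * A R p) atTop (𝓝 z) ∧
        ∀ B, (∀ j ≤ m, ∀ x, ‖iteratedFDeriv ℝ j (Yb.push F) x‖ ≤ B) → ‖z‖ ≤ C * B := by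
    intro Yb q hq
    obtain ⟨Y', hY', hq'⟩ := ρ.cover q
    obtain ⟨V, hV, hVs, Y, hqY, hVY, m, hVm⟩ := hloc Y' hY' q hq'
    obtain ⟨ψ, hψ, hψV, g, hg, hgV, V₁, hV₁, hV₁V, hfac⟩ := ρ.exists_factorization hY' hq' hV
    obtain ⟨V₂, hV₂, C₂, hC₂, hb₂⟩ := exists_iteratedFDeriv_push_le hq hqY m
    obtain ⟨C₃, hC₃, hb₃⟩ := exists_iteratedFDeriv_mul_le (Y.contDiff_push hg (hgV.trans hVY))
      (Y.hasCompactSupport_push hg.2 (hgV.trans hVY)) m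
    obtain ⟨hlim, C, hC⟩ := hVm ψ hψ hψV
    refine ⟨V₁ ∩ V₂ ∩ Yb.source, inter_mem (inter_mem hV₁ hV₂) (Yb.open_source.mem_nhds hq),
      fun p hp => hp.2, m, C * (C₃ * C₂), fun F hF hFV => ?_⟩
    have hF1 : tsupport F ⊆ V₁ := fun p hp => (hFV hp).1.1
    have hm := testFunctions_mul_mem hg hF
    have hms := (tsupport_mul_left_subset g F).trans hgV
    refine ⟨∫ l, chartFourier u₁ Y' (fun p => g p * F p) l * chartFourier u₂ Y' ψ (-l), ?_,
      fun B hB => ?_⟩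
    · exact ((hlim _ hm hms).2).congr fun R => by
        conv_rhs => rw [hfac F hF1]
    · have h1 := hb₂ F hF (fun p hp => (hFV hp).1.2) B hB
      have h2 := hb₃ _ (Y.contDiff_push hF (hF1.trans (hV₁V.trans hVY))) _ h1
      have h3 := hC _ hm hms (C₃ * (C₂ * B)) (by rw [Y.push_mul]; exact h2)
      calc _ ≤ C * (C₃ * (C₂ * B)) := h3
        _ = _ := by ring
  choose Y₀ hY₀ hYs₀ using ρ.cover
  have hlim : ∀ F ∈ testFunctions I N,
      ∃ z, Tendsto (fun R => evalTest u₂ fun p => F p * A R p) atTop (𝓝 z) := by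
    intro F hF
    choose V hV hVs m C hVz using fun q => hlocal (Y₀ q) q (hYs₀ q)
    obtain ⟨ι, _, c, ζ, hζ, hsum⟩ := exists_finite_partition (W := W) (I := I) hF.2.isCompact V
      (fun q _ => hV q) fun q => ⟨Y₀ q, hYs₀ q⟩
    choose z hz _ using fun i => hVz (c i) _ (testFunctions_mul_mem (hζ i).2.1 hF)
      ((tsupport_mul_left_subset _ _).trans (hζ i).2.2)
    refine ⟨_, (tendsto_finsetSum Finset.univ fun i _ => hz i).congr fun R => ?_⟩
    rw [evalTest_eq_sum_of_partition u₂ (hmemA F hF R) (fun i => (hζ i).2.1) fun q hq =>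
      hsum q (tsupport_mul_left_subset F _ hq)]
    simp_rw [mul_assoc]
  choose! L hL using hlim
  -- The product is the pointwise limit of the functionals `F ↦ u₂ (F · A R)`; linearity passes to
  -- the limit by its uniqueness.
  let w : testFunctions I N →ₗ[ℂ] ℂ :=
    { toFun := fun F => L F.1
      map_add' := fun F G => by
        refine tendsto_nhds_unique (hL _ (F + G).2) (((hL _ F.2).add (hL _ G.2)).congr fun R => ?_)
        rw [← evalTest_add u₂ (hmemA _ F.2 R) (hmemA _ G.2 R)]
        congr 1; ext p
        change _ = (F.1 p + G.1 p) * A R p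
        ring
      map_smul' := fun a F => by
        refine tendsto_nhds_unique (hL _ (a • F).2) (((hL _ F.2).const_mul a).congr fun R => ?_)
        rw [← evalTest_smul u₂ (hmemA _ F.2 R) a]
        congr 1; ext p
        change _ = (a * F.1 p) * A R p
        ring }
  have hw : ∀ F ∈ testFunctions I N, evalTest w F = L F := fun F hF => evalTest_of_mem w hF
  refine ⟨w, fun Yb K hKs hK => ?_, fun Y hY q hq => ?_⟩
  · choose! V hV hVs m C hVz using hlocal Yb
    obtain ⟨ι, _, c, ζ, hζ, hsum⟩ := exists_finite_partition (W := W) (I := I) hK V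
      (fun q hq => hV q (hKs hq)) fun q => ⟨Y₀ q, hYs₀ q⟩
    have hζs : ∀ i, tsupport (ζ i) ⊆ Yb.source := fun i => (hζ i).2.2.trans (hVs _ (hKs (hζ i).1))
    choose a ha hab using fun i => exists_iteratedFDeriv_mul_le (Yb.contDiff_push (hζ i).2.1 (hζs i))
      (Yb.hasCompactSupport_push (hζ i).2.1.2 (hζs i)) (∑ j, m (c j))
    refine ⟨∑ i, C (c i) * a i, ∑ j, m (c j), fun F hF B hFK hB => ?_⟩
    rw [evalTest_eq_sum_of_partition w hF (fun i => (hζ i).2.1) fun q hq => hsum q (hFK hq),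
      Finset.sum_mul]
    refine (norm_sum_le _ _).trans (Finset.sum_le_sum fun i _ => ?_)
    have hm := testFunctions_mul_mem (hζ i).2.1 hF
    obtain ⟨z, hz, hzB⟩ := hVz (c i) (hKs (hζ i).1) _ hm
      ((tsupport_mul_left_subset _ _).trans (hζ i).2.2)
    rw [hw _ hm, tendsto_nhds_unique (hL _ hm) hz, mul_assoc]
    refine hzB _ fun j hj x => ?_
    rw [Yb.push_mul]
    exact hab i _ (Yb.contDiff_push hF (hFK.trans hKs)) B hB j (hj.trans
      (Finset.single_le_sum (f := fun j => m (c j)) (fun _ _ => Nat.zero_le _)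
        (Finset.mem_univ i))) x
  · obtain ⟨V, hV, hVs, _, _, _, _, hVm⟩ := hloc Y hY q hq
    refine ⟨V, hV, hVs, fun φ hφ ψ hψ hφV hψV => ?_⟩
    have h1 := (hVm ψ hψ hψV).1 φ hφ hφV
    refine ⟨h1.1, ?_⟩
    have hmem : (fun p => φ p * (ψ p * (ρ.val Y p : ℂ))) ∈ testFunctions I N := by
      have hs : tsupport (fun p => φ p * ψ p) ⊆ Y.source :=
        (tsupport_mul_left_subset φ ψ).trans (hφV.trans hVs)
      have := mul_mem_testFunctions (testFunctions_mul_mem hφ hψ) Y.open_source hs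
        (Complex.ofRealCLM.contDiff.contMDiff.comp_contMDiffOn (ρ.smooth Y hY))
      convert this using 1
      ext p
      exact (mul_assoc _ _ _).symm
    rw [hw _ hmem]
    exact tendsto_nhds_unique (hL _ hmem) h1.2

end Product

/-! ### Translation between `ℝᵈ × ℝᵈ` and the Euclidean space `ℝᵈ ⊕ ℝᵈ` -/

section Conversion

/-- The Euclidean space `ℝᵈ ⊕ ℝᵈ`. -/
abbrev EuclideanPair (d : ℕ) : Type :=
  WithLp 2 (EuclideanSpace ℝ (Fin d) × EuclideanSpace ℝ (Fin d))

/-- The identification of `ℝᵈ × ℝᵈ` with the Euclidean space `ℝᵈ ⊕ ℝᵈ`. -/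
def toPair (d : ℕ) : (EuclideanSpace ℝ (Fin d) × EuclideanSpace ℝ (Fin d)) ≃L[ℝ] EuclideanPair d :=
  (WithLp.prodContinuousLinearEquiv 2 ℝ _ _).symm

variable {d : ℕ} {M : Type*} [TopologicalSpace M] [ChartedSpace (EuclideanSpace ℝ (Fin d)) M]

theorem inner_toPair (k x : EuclideanSpace ℝ (Fin d) × EuclideanSpace ℝ (Fin d)) :
    inner ℝ (toPair d k) (toPair d x) = pairing₂ k x := by
  rw [WithLp.prod_inner_apply]; rfl

theorem norm_toPair_sq (k : EuclideanSpace ℝ (Fin d) × EuclideanSpace ℝ (Fin d)) :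
    ‖toPair d k‖ ^ 2 = pairing₂ k k := by
  rw [← inner_toPair, real_inner_self_eq_norm_sq]

theorem measurePreserving_toPair : MeasurePreserving (toPair d) :=
  WithLp.volume_preserving_toLp _ _

theorem measurableEmbedding_toPair : MeasurableEmbedding (toPair d) :=
  (toPair d).toHomeomorph.measurableEmbedding

/-- A chart of `M × M`, with values in the Euclidean space `ℝᵈ ⊕ ℝᵈ`. -/
def euclideanChart (κ : OpenPartialHomeomorph (M × M)
      (ModelProd (EuclideanSpace ℝ (Fin d)) (EuclideanSpace ℝ (Fin d))))
    (hκ : κ ∈ IsManifold.maximalAtlas ((𝓡 d).prod (𝓡 d)) ∞ (M × M)) :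
    SmoothChart ((𝓡 d).prod (𝓡 d)) (M × M) (EuclideanPair d) where
  toOpenPartialHomeomorph := κ.transHomeomorph (toPair d).toHomeomorph
  smooth := by
    have h := (toPair d).contDiff (n := ∞).contMDiff
    rw [modelWithCornersSelf_prod] at h
    exact h.comp_contMDiffOn (contMDiffOn_of_mem_maximalAtlas hκ)
  smooth_symm := by
    have h := (toPair d).symm.contDiff (n := ∞).contMDiff
    rw [modelWithCornersSelf_prod] at h
    exact (contMDiffOn_symm_of_mem_maximalAtlas hκ).comp h.contMDiffOn fun y hy => hy

variable {κ : OpenPartialHomeomorph (M × M)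
      (ModelProd (EuclideanSpace ℝ (Fin d)) (EuclideanSpace ℝ (Fin d)))}
    (hκ : κ ∈ IsManifold.maximalAtlas ((𝓡 d).prod (𝓡 d)) ∞ (M × M))

theorem euclideanChart_apply (p : M × M) : euclideanChart κ hκ p = toPair d (κ p) := rfl

theorem euclideanChart_symm_apply (y : EuclideanPair d) :
    (euclideanChart κ hκ).symm y = κ.symm ((toPair d).symm y) := rfl

theorem mem_euclideanChart_target (y : EuclideanPair d) :
    y ∈ (euclideanChart κ hκ).target ↔ (toPair d).symm y ∈ κ.target := Iff.rfl

/-- Every smooth chart of `M × M` with values in `ℝᵈ ⊕ ℝᵈ` arises in this way. -/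
theorem exists_euclideanChart_eq [IsManifold (𝓡 d) ∞ M]
    (Y : SmoothChart ((𝓡 d).prod (𝓡 d)) (M × M) (EuclideanPair d)) :
    ∃ (κ : OpenPartialHomeomorph (M × M)
      (ModelProd (EuclideanSpace ℝ (Fin d)) (EuclideanSpace ℝ (Fin d))))
      (hκ : κ ∈ IsManifold.maximalAtlas ((𝓡 d).prod (𝓡 d)) ∞ (M × M)), euclideanChart κ hκ = Y := by
  have h1 := (toPair d).contDiff (n := ∞).contMDiff
  rw [modelWithCornersSelf_prod] at h1
  have h2 := (toPair d).symm.contDiff (n := ∞).contMDiff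
  rw [modelWithCornersSelf_prod] at h2
  refine ⟨Y.transHomeomorph (toPair d).symm.toHomeomorph,
    OpenPartialHomeomorph.mem_maximalAtlas_of_contMDiffOn _ (h2.comp_contMDiffOn Y.smooth)
      (Y.smooth_symm.comp h1.contMDiffOn fun y hy => hy), ?_⟩
  obtain ⟨Y, hY, hY'⟩ := Y
  have : (Y.transHomeomorph (toPair d).symm.toHomeomorph).transHomeomorph
      (toPair d).toHomeomorph = Y := by
    refine OpenPartialHomeomorph.ext _ _ (fun p => (toPair d).apply_symm_apply _) (fun y => ?_) rfl
    change Y.symm ((toPair d) ((toPair d).symm y)) = _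
    rw [(toPair d).apply_symm_apply]
  unfold euclideanChart
  simp only [this]

/-- Distributions on `M × M` are transformed with `exp (-i k·x)`, whereas the Fourier analysis above
uses `exp (-2πi⟨k, x⟩)`. Division of the frequency by `2π` reconciles the two conventions. -/
theorem planeWave_toPair (k x : EuclideanSpace ℝ (Fin d) × EuclideanSpace ℝ (Fin d)) :
    planeWave (toPair d ((2 * Real.pi)⁻¹ • k)) (toPair d x) =
      Complex.exp (-Complex.I * (pairing₂ k x : ℝ)) := by
  have h : inner ℝ (toPair d ((2 * Real.pi)⁻¹ • k)) (toPair d x) =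
      (2 * Real.pi)⁻¹ * pairing₂ k x := by
    rw [map_smul, inner_smul_left, inner_toPair]; rfl
  unfold planeWave
  rw [Real.fourierChar_apply, h]
  congr 1
  push_cast
  have : (Real.pi : ℂ) ≠ 0 := by exact_mod_cast Real.pi_ne_zero
  field_simp

theorem localFourier_eq_chartFourier (u : Distribution₂ d M) {φ : M × M → ℂ}
    (hφ : φ ∈ TestFunctions₂ d M) (hs : tsupport φ ⊆ κ.source)
    (k : EuclideanSpace ℝ (Fin d) × EuclideanSpace ℝ (Fin d)) :
    u.localFourier hκ hφ hs k =
      chartFourier u.toLin (euclideanChart κ hκ) φ (toPair d ((2 * Real.pi)⁻¹ • k)) := by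
  unfold Distribution₂.localFourier chartFourier
  rw [← evalTest_of_mem u.toLin]
  congr 1; ext p
  rw [euclideanChart_apply, planeWave_toPair]

theorem ContinuousLinearEquiv.norm_iteratedFDeriv_comp_right_le {E₁ E₂ : Type*}
    [NormedAddCommGroup E₁] [NormedSpace ℝ E₁] [NormedAddCommGroup E₂] [NormedSpace ℝ E₂]
    (g : E₁ ≃L[ℝ] E₂) (f : E₂ → ℂ) (j : ℕ) (y : E₁) :
    ‖iteratedFDeriv ℝ j (f ∘ g) y‖ ≤
      ‖iteratedFDeriv ℝ j f (g y)‖ * ‖(g : E₁ →L[ℝ] E₂)‖ ^ j := by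
  have h := g.iteratedFDerivWithin_comp_right f uniqueDiffOn_univ (Set.mem_univ (g y)) j
  rw [Set.preimage_univ, iteratedFDerivWithin_univ, iteratedFDerivWithin_univ] at h
  rw [h]
  refine (ContinuousMultilinearMap.norm_compContinuousLinearMap_le _ _).trans_eq ?_
  rw [Finset.prod_const, Finset.card_univ, Fintype.card_fin]

theorem pow_norm_le_pow_one_add {E₁ : Type*} [SeminormedAddCommGroup E₁] (x : E₁) {j m : ℕ}
    (h : j ≤ m) : ‖x‖ ^ j ≤ (1 + ‖x‖) ^ m :=
  (pow_le_pow_left₀ (norm_nonneg _) (by linarith) j).trans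
    (pow_le_pow_right₀ (by linarith [norm_nonneg x]) h)

theorem Distribution₂.isDistribution [IsManifold (𝓡 d) ∞ M] (u : Distribution₂ d M) :
    IsDistribution (EuclideanPair d) u.toLin := by
  intro Y K hK hKc
  obtain ⟨κ, hκ, rfl⟩ := exists_euclideanChart_eq Y
  obtain ⟨C, m, h⟩ := u.continuous κ hκ K hK hKc
  refine ⟨C * (1 + ‖(toPair d).toContinuousLinearMap‖) ^ m, m,
    fun F hF B hFK hB => ?_⟩
  have hB0 : 0 ≤ B := (norm_nonneg _).trans (hB 0 (Nat.zero_le _) 0)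
  rw [evalTest_of_mem u.toLin hF, mul_assoc]
  refine h ⟨F, hF⟩ _ hFK fun j hj y hy => ?_
  have heq : (fun z => F (κ.symm z)) =ᶠ[𝓝 y] (euclideanChart κ hκ).push F ∘ toPair d := by
    filter_upwards [κ.open_target.mem_nhds hy] with z hz
    rw [Function.comp_apply, SmoothChart.push_of_mem, euclideanChart_symm_apply,
      (toPair d).symm_apply_apply]
    rwa [mem_euclideanChart_target, (toPair d).symm_apply_apply]
  rw [(heq.iteratedFDeriv ℝ j).eq_of_nhds]
  refine ((toPair d).norm_iteratedFDeriv_comp_right_le _ j y).trans ?_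
  rw [mul_comm]
  gcongr
  · exact pow_norm_le_pow_one_add _ hj
  · exact hB j hj _

/-- Functionals of finite order in all charts are distributions. -/
def IsDistribution.toDistribution₂ {w : TestFunctions₂ d M →ₗ[ℂ] ℂ}
    (hw : IsDistribution (EuclideanPair d) w) : Distribution₂ d M where
  toLin := w
  continuous := by
    intro κ hκ K hK hKc
    -- A point of the target is needed to see that `B` is nonnegative. For an empty chart the
    -- hypothesis on `B` is void, but then the test function is zero.
    rcases κ.target.eq_empty_or_nonempty with he | ⟨y₀, hy₀⟩
    · refine ⟨0, 0, fun F B hF _ => ?_⟩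
      have hs : κ.source = ∅ := by
        rw [← κ.symm_image_target_eq_source, he, Set.image_empty]
      have hF0 : F = 0 := by
        ext p
        refine image_eq_zero_of_notMem_tsupport fun hp => ?_
        have := hK (hF hp)
        rw [hs] at this
        exact this
      rw [hF0, map_zero, norm_zero, zero_mul]
    · obtain ⟨C, m, h⟩ := hw (euclideanChart κ hκ) K hK hKc
      refine ⟨C * (1 + ‖(toPair d).symm.toContinuousLinearMap‖) ^ m, m,
        fun F B hF hB => ?_⟩
      have hB0 : 0 ≤ B := (norm_nonneg _).trans (hB 0 (Nat.zero_le _) y₀ hy₀)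
      rw [← evalTest_of_mem w F.2, mul_assoc]
      refine h F.1 F.2 _ hF fun j hj y => ?_
      by_cases hy : y ∈ (euclideanChart κ hκ).target
      · have heq : (euclideanChart κ hκ).push F.1 =ᶠ[𝓝 y]
            (fun z => F.1 (κ.symm z)) ∘ (toPair d).symm := by
          filter_upwards [(euclideanChart κ hκ).open_target.mem_nhds hy] with z hz
          rw [Function.comp_apply, SmoothChart.push_of_mem _ hz, euclideanChart_symm_apply]
        rw [(heq.iteratedFDeriv ℝ j).eq_of_nhds]
        refine ((toPair d).symm.norm_iteratedFDeriv_comp_right_le _ j y).trans ?_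
        rw [mul_comm]
        gcongr
        · exact pow_norm_le_pow_one_add _ hj
        · exact hB j hj _ hy
      · have hy' : y ∉ tsupport ((euclideanChart κ hκ).push F.1) := fun h => hy <| by
          obtain ⟨p, hp, rfl⟩ := (euclideanChart κ hκ).tsupport_push_subset F.2.2 (hF.trans hK) h
          exact (euclideanChart κ hκ).map_source (hK (hF hp))
        have heq : (euclideanChart κ hκ).push F.1 =ᶠ[𝓝 y] fun _ => 0 := by
          filter_upwards [(isClosed_tsupport
            ((euclideanChart κ hκ).push F.1)).isOpen_compl.mem_nhds hy'] with z hz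
          exact image_eq_zero_of_notMem_tsupport hz
        rw [(heq.iteratedFDeriv ℝ j).eq_of_nhds]
        have h0 : iteratedFDeriv ℝ j (fun _ : EuclideanPair d => (0 : ℂ)) y = 0 := by
          rw [iteratedFDeriv_fun_zero]; rfl
        rw [h0, norm_zero]; positivity

end Conversion

/-! ### Regularity at covectors of `M × M` in Euclidean charts -/

section Regularity

variable {d : ℕ} {M : Type*} [TopologicalSpace M] [ChartedSpace (EuclideanSpace ℝ (Fin d)) M]
  [IsManifold (𝓡 d) ∞ M]

variable {κ κ₁ : OpenPartialHomeomorph (M × M)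
      (ModelProd (EuclideanSpace ℝ (Fin d)) (EuclideanSpace ℝ (Fin d)))}
    (hκ : κ ∈ IsManifold.maximalAtlas ((𝓡 d).prod (𝓡 d)) ∞ (M × M))
    (hκ₁ : κ₁ ∈ IsManifold.maximalAtlas ((𝓡 d).prod (𝓡 d)) ∞ (M × M))

theorem mdifferentiable_of_mem_maximalAtlas {E H N : Type*} [NormedAddCommGroup E]
    [NormedSpace ℝ E] [TopologicalSpace H] {I : ModelWithCorners ℝ E H} [TopologicalSpace N]
    [ChartedSpace H N] [IsManifold I ∞ N] {κ : OpenPartialHomeomorph N H}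
    (hκ : κ ∈ IsManifold.maximalAtlas I ∞ N) : κ.MDifferentiable I I := by
  have h1 : κ ∈ IsManifold.maximalAtlas I 1 N :=
    IsManifold.maximalAtlas_subset_of_le (by simp) hκ
  exact ⟨fun x hx => (mdifferentiableAt_of_mem_maximalAtlas h1 hx).mdifferentiableWithinAt,
      fun x hx => (mdifferentiableAt_symm_of_mem_maximalAtlas h1 hx).mdifferentiableWithinAt⟩

theorem hasMFDerivAt_euclideanChart {p : M × M} (hp : p ∈ κ.source) :
    HasMFDerivAt ((𝓡 d).prod (𝓡 d)) 𝓘(ℝ, EuclideanPair d) (euclideanChart κ hκ) p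
      ((toPair d).toContinuousLinearMap.comp
        (mfderiv ((𝓡 d).prod (𝓡 d)) ((𝓡 d).prod (𝓡 d)) κ p)) := by
  have h := (toPair d).toContinuousLinearMap.hasMFDerivAt (x := κ p)
  rw [modelWithCornersSelf_prod] at h
  exact HasMFDerivAt.comp (I' := (𝓡 d).prod (𝓡 d)) (g := toPair d) (f := κ) p h
    ((mdifferentiable_of_mem_maximalAtlas hκ).mdifferentiableAt hp).hasMFDerivAt

/-- The derivative of a transition map in terms of the differentials of the charts. -/
theorem fderiv_transMap_euclideanChart {p : M × M} (hp : p ∈ κ.source) (hp₁ : p ∈ κ₁.source)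
    (v : TangentSpace ((𝓡 d).prod (𝓡 d)) p) :
    fderiv ℝ (transMap (euclideanChart κ₁ hκ₁) (euclideanChart κ hκ) p) (euclideanChart κ₁ hκ₁ p)
      (toPair d (mfderiv ((𝓡 d).prod (𝓡 d)) ((𝓡 d).prod (𝓡 d)) κ₁ p v)) =
    toPair d (mfderiv ((𝓡 d).prod (𝓡 d)) ((𝓡 d).prod (𝓡 d)) κ p v) := by
  have hq : p ∈ (euclideanChart κ hκ).source := hp
  have hq₁ : p ∈ (euclideanChart κ₁ hκ₁).source := hp₁
  have hτ := ((contDiff_transMap hq₁ hq).differentiable (by simp)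
    (euclideanChart κ₁ hκ₁ p)).hasFDerivAt.hasMFDerivAt
  have h1 := HasMFDerivAt.comp p hτ (hasMFDerivAt_euclideanChart hκ₁ hp₁)
  have h2 := h1.congr_of_eventuallyEq ((eventually_transMap hq₁ hq).mono fun q hq => hq.symm)
  exact DFunLike.congr_fun (hasMFDerivAt_unique h2 (hasMFDerivAt_euclideanChart hκ hp)) v

theorem lintegral_comp_toPair_smul (f : EuclideanPair d → ℝ≥0∞) {c : ℝ} (hc : 0 < c) :
    ∃ a : ℝ≥0∞, a ≠ 0 ∧ a ≠ ⊤ ∧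
      ∫⁻ k, f (toPair d (c⁻¹ • k)) = a * ∫⁻ l, f l := by
  have h1 : ∫⁻ k, f (toPair d (c⁻¹ • k)) = ∫⁻ l, f (c⁻¹ • l) := by
    rw [← measurePreserving_toPair.lintegral_comp_emb measurableEmbedding_toPair]
    simp only [map_smul]
  have h2 : ∫⁻ l : EuclideanPair d, f (c⁻¹ • l) = ∫⁻ l, f l ∂(Measure.map (c⁻¹ • ·) volume) :=
    ((Homeomorph.smulOfNeZero c⁻¹ (inv_pos.2 hc).ne').measurableEmbedding.lintegral_map _).symm
  rw [Measure.map_addHaar_smul _ (inv_pos.2 hc).ne', lintegral_smul_measure] at h2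
  refine ⟨_, ?_, ?_, h1.trans h2⟩
  · rw [ENNReal.ofReal_ne_zero_iff]; positivity
  · exact ENNReal.ofReal_ne_top

/-- The regularity condition in terms of `localFourier` and `chartFourier`. -/
theorem sobolevSq_chartFourier_lt_top (u : Distribution₂ d M) {φ : M × M → ℂ}
    (hφ : φ ∈ TestFunctions₂ d M) (hs : tsupport φ ⊆ κ.source) (s : ℝ)
    {Γ : Set (EuclideanSpace ℝ (Fin d) × EuclideanSpace ℝ (Fin d))} (hΓ : IsOpen Γ)
    (hΓc : ∀ c : ℝ, 0 < c → ∀ k ∈ Γ, c • k ∈ Γ)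
    (h : ∫⁻ k in Γ, ENNReal.ofReal
      ((1 + pairing₂ k k) ^ s * ‖u.localFourier hκ hφ hs k‖ ^ 2) < ⊤) :
    sobolevSq s ((toPair d).symm ⁻¹' Γ) (chartFourier u.toLin (euclideanChart κ hκ) φ) < ⊤ := by
  set Γ' := (toPair d).symm ⁻¹' Γ with hΓ'
  set U := chartFourier u.toLin (euclideanChart κ hκ) φ
  have hΓ'm : MeasurableSet Γ' := (hΓ.preimage (toPair d).symm.continuous).measurableSet
  have hpi : (0 : ℝ) < 2 * Real.pi := by positivity
  set g : EuclideanPair d → ℝ≥0∞ := Γ'.indicator fun l =>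
    ENNReal.ofReal ((1 + (2 * Real.pi) ^ 2 * ‖l‖ ^ 2) ^ s) * ‖U l‖ₑ ^ 2 with hg
  have h1 : ∫⁻ k in Γ, ENNReal.ofReal ((1 + pairing₂ k k) ^ s * ‖u.localFourier hκ hφ hs k‖ ^ 2) =
      ∫⁻ k, g (toPair d ((2 * Real.pi)⁻¹ • k)) := by
    rw [← lintegral_indicator hΓ.measurableSet]
    congr 1; ext k
    have hmem : toPair d ((2 * Real.pi)⁻¹ • k) ∈ Γ' ↔ k ∈ Γ := by
      rw [hΓ', Set.mem_preimage, (toPair d).symm_apply_apply]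
      refine ⟨fun hk => ?_, hΓc _ (by positivity) k⟩
      have := hΓc (2 * Real.pi) hpi _ hk
      rwa [smul_inv_smul₀ hpi.ne'] at this
    by_cases hk : k ∈ Γ
    · rw [Set.indicator_of_mem hk, hg, Set.indicator_of_mem (hmem.2 hk),
        localFourier_eq_chartFourier, norm_toPair_sq]
      have h2 : (2 * Real.pi) ^ 2 * pairing₂ ((2 * Real.pi)⁻¹ • k) ((2 * Real.pi)⁻¹ • k) =
          pairing₂ k k := by
        rw [← norm_toPair_sq, map_smul, norm_smul, mul_pow ‖_‖, ← norm_toPair_sq, Real.norm_eq_abs,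
          sq_abs, ← mul_assoc, ← mul_pow, mul_inv_cancel₀ hpi.ne', one_pow, one_mul]
      have h0 : 0 ≤ pairing₂ k k := by rw [← norm_toPair_sq]; positivity
      rw [h2, ENNReal.ofReal_mul (by positivity), ENNReal.ofReal_pow (norm_nonneg _),
        ofReal_norm]
    · rw [Set.indicator_of_notMem hk, hg, Set.indicator_of_notMem (fun h => hk (hmem.1 h))]
  obtain ⟨a, ha0, hat, ha⟩ := lintegral_comp_toPair_smul g hpi
  rw [h1, ha] at h
  have h3 : ∫⁻ l, g l < ⊤ := by
    by_contra hc
    rw [not_lt, top_le_iff] at hc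
    rw [hc, ENNReal.mul_top ha0] at h
    exact lt_irrefl _ h
  rw [hg, lintegral_indicator hΓ'm] at h3
  -- Rescaling the frequency has turned the weight into one with `(2π)² ‖l‖²`, which is comparable
  -- to the standard weight with constant `(2π)²`.
  have h4 : sobolevSq s Γ' U ≤ ENNReal.ofReal (((2 * Real.pi) ^ 2) ^ |s|) * ∫⁻ l in Γ',
      ENNReal.ofReal ((1 + (2 * Real.pi) ^ 2 * ‖l‖ ^ 2) ^ s) * ‖U l‖ₑ ^ 2 := by
    unfold sobolevSq
    rw [← lintegral_const_mul' _ _ ENNReal.ofReal_ne_top]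
    refine lintegral_mono fun l => ?_
    rw [← mul_assoc, ← ENNReal.ofReal_mul (by positivity)]
    gcongr
    have hK : 1 ≤ (2 * Real.pi) ^ 2 := one_le_pow₀ (by nlinarith [Real.pi_gt_three])
    have h5 : 0 ≤ ‖l‖ ^ 2 := by positivity
    have h6 := mul_nonneg (sub_nonneg.2 hK) h5
    have h7 := mul_nonneg (sub_nonneg.2 hK) (mul_nonneg (sq_nonneg (2 * Real.pi)) h5)
    exact rpow_le_rpow_abs_mul (by positivity) (by positivity) (by nlinarith)
      (by nlinarith) s
  exact h4.trans_lt (ENNReal.mul_lt_top ENNReal.ofReal_lt_top h3)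

/-- The coordinates of one covector in two charts are related by the adjoint of the derivative of
the transition map. This is tested on tangent vectors, which the differential of the witnessing
chart maps onto all of `ℝᵈ × ℝᵈ`. -/
theorem Distribution₂.SobolevRegularAt.isSobolevRegular {u : Distribution₂ d M} {s : ℝ}
    {p : M × M} {ξ : TangentSpace ((𝓡 d).prod (𝓡 d)) p →L[ℝ] ℝ} (h : u.SobolevRegularAt s p ξ)
    (hp : p ∈ κ.source) {η : EuclideanPair d}
    (hη : ∀ v, ξ v = inner ℝ η
      (toPair d (mfderiv ((𝓡 d).prod (𝓡 d)) ((𝓡 d).prod (𝓡 d)) κ p v))) :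
    IsSobolevRegular u.toLin s (euclideanChart κ hκ) p η := by
  obtain ⟨κ₁, hκ₁, φ, hφ, hs, Γ, η₁, hp₁, hφp, hΓ, -, hΓc, hη₁, hξ, hfin⟩ := h
  refine ⟨euclideanChart κ₁ hκ₁, φ, (toPair d).symm ⁻¹' Γ, hp₁, hφ, hs, hφp,
    hΓ.preimage (toPair d).symm.continuous, fun c hc k hk => ?_, ?_,
    sobolevSq_chartFourier_lt_top hκ₁ u hφ hs s hΓ hΓc hfin⟩
  · rw [Set.mem_preimage, map_smul]
    exact hΓc c hc _ hk
  · suffices hA : (fderiv ℝ (transMap (euclideanChart κ₁ hκ₁) (euclideanChart κ hκ) p)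
        (euclideanChart κ₁ hκ₁ p)).adjoint η = toPair d η₁ by
      rw [Set.mem_preimage, hA, (toPair d).symm_apply_apply]
      exact hη₁
    refine ext_inner_right ℝ fun z => ?_
    obtain ⟨v, hv⟩ := ((mdifferentiable_of_mem_maximalAtlas hκ₁).mfderiv hp₁).surjective
      ((toPair d).symm z)
    have hz : z = toPair d (mfderiv ((𝓡 d).prod (𝓡 d)) ((𝓡 d).prod (𝓡 d)) κ₁ p v) :=
      ((toPair d).symm_apply_eq.1 hv.symm)
    rw [ContinuousLinearMap.adjoint_inner_left, hz]
    refine (congrArg (inner ℝ η) (fderiv_transMap_euclideanChart hκ hκ₁ hp hp₁ v)).trans ?_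
    exact ((hη v).symm.trans (hξ v)).trans (inner_toPair _ _).symm

end Regularity

/-! ### The density `|μ| ⊗ |μ|` and the product in the sense of charts -/

section Density

variable {d : ℕ} {M : Type*} [TopologicalSpace M] [ChartedSpace (EuclideanSpace ℝ (Fin d)) M]
  [IsManifold (𝓡 d) ∞ M]

variable {κ κ' κ₁ κ₁' : OpenPartialHomeomorph M (EuclideanSpace ℝ (Fin d))}

theorem contDiffOn_coordChange (hκ : κ ∈ IsManifold.maximalAtlas (𝓡 d) ∞ M)
    (hκ₁ : κ₁ ∈ IsManifold.maximalAtlas (𝓡 d) ∞ M) :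
    ContDiffOn ℝ ∞ (fun y => κ₁ (κ.symm y)) (κ.target ∩ κ.symm ⁻¹' κ₁.source) := by
  rw [← contMDiffOn_iff_contDiffOn]
  exact (contMDiffOn_of_mem_maximalAtlas hκ₁).comp
    ((contMDiffOn_symm_of_mem_maximalAtlas hκ).mono Set.inter_subset_left) fun y hy => hy.2

theorem hasFDerivAt_coordChange (hκ : κ ∈ IsManifold.maximalAtlas (𝓡 d) ∞ M)
    (hκ₁ : κ₁ ∈ IsManifold.maximalAtlas (𝓡 d) ∞ M) {x : M} (hx : x ∈ κ.source)
    (hx₁ : x ∈ κ₁.source) :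
    HasFDerivAt (fun y => κ₁ (κ.symm y)) (fderiv ℝ (fun y => κ₁ (κ.symm y)) (κ x)) (κ x) := by
  refine (((contDiffOn_coordChange hκ hκ₁).contDiffAt
    ((κ.symm.isOpen_inter_preimage κ₁.open_source).mem_nhds
      ⟨κ.map_source hx, ?_⟩)).differentiableAt (by simp)).hasFDerivAt
  rwa [Set.mem_preimage, κ.left_inv hx]

/-- Transformation law for the components of differential forms of top degree. -/
theorem formComponent_eq_det_mul (η : ∀ x : M, (TangentSpace (𝓡 d) x) [⋀^Fin d]→ₗ[ℝ] ℝ)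
    (hκ : κ ∈ IsManifold.maximalAtlas (𝓡 d) ∞ M)
    (hκ₁ : κ₁ ∈ IsManifold.maximalAtlas (𝓡 d) ∞ M) {x : M} (hx : x ∈ κ.source)
    (hx₁ : x ∈ κ₁.source) :
    formComponent η κ (κ x) =
      (fderiv ℝ (fun y => κ₁ (κ.symm y)) (κ x)).det * formComponent η κ₁ (κ₁ x) := by
  let η' : M → (EuclideanSpace ℝ (Fin d)) [⋀^Fin d]→ₗ[ℝ] ℝ := η
  let A : EuclideanSpace ℝ (Fin d) →L[ℝ] EuclideanSpace ℝ (Fin d) :=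
    mfderiv (𝓡 d) (𝓡 d) κ.symm (κ x)
  let B : EuclideanSpace ℝ (Fin d) →L[ℝ] EuclideanSpace ℝ (Fin d) :=
    mfderiv (𝓡 d) (𝓡 d) κ₁.symm (κ₁ x)
  set D := fderiv ℝ (fun y => κ₁ (κ.symm y)) (κ x) with hD
  have hAB : A = B.comp D := by
    have h1 : HasMFDerivAt (𝓡 d) (𝓡 d) (fun y => κ₁ (κ.symm y)) (κ x) D :=
      (hasFDerivAt_coordChange hκ hκ₁ hx hx₁).hasMFDerivAt
    have h2 : HasMFDerivAt (𝓡 d) (𝓡 d) κ₁.symm (κ₁ (κ.symm (κ x))) B := by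
      rw [κ.left_inv hx]
      exact ((mdifferentiable_of_mem_maximalAtlas hκ₁).mdifferentiableAt_symm
        (κ₁.map_source hx₁)).hasMFDerivAt
    have h3 := HasMFDerivAt.comp (κ x) h2 h1
    have h4 : κ.symm =ᶠ[𝓝 (κ x)] κ₁.symm ∘ fun y => κ₁ (κ.symm y) := by
      have hmem : κ x ∈ κ.target ∩ κ.symm ⁻¹' κ₁.source :=
        ⟨κ.map_source hx, by rwa [Set.mem_preimage, κ.left_inv hx]⟩
      filter_upwards [(κ.symm.isOpen_inter_preimage κ₁.open_source).mem_nhds hmem] with y hy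
      exact (κ₁.left_inv hy.2).symm
    exact hasMFDerivAt_unique ((mdifferentiable_of_mem_maximalAtlas hκ).mdifferentiableAt_symm
        (κ.map_source hx)).hasMFDerivAt (h3.congr_of_eventuallyEq h4)
  let e := (EuclideanSpace.basisFun (Fin d) ℝ).toBasis
  have e1 : formComponent η κ (κ x) = η' x fun i => A (e i) := by
    have : formComponent η κ (κ x) = η' (κ.symm (κ x)) fun i => A (e i) := by
      unfold formComponent
      simp only [e, OrthonormalBasis.coe_toBasis]
      rfl
    rw [this, κ.left_inv hx]
  have e2 : formComponent η κ₁ (κ₁ x) = η' x fun i => B (e i) := by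
    have : formComponent η κ₁ (κ₁ x) = η' (κ₁.symm (κ₁ x)) fun i => B (e i) := by
      unfold formComponent
      simp only [e, OrthonormalBasis.coe_toBasis]
      rfl
    rw [this, κ₁.left_inv hx₁]
  rw [e1, e2, hAB]
  -- Alternating forms of top degree are multiples of the determinant, so evaluating `f` on the
  -- image of the basis under `D` produces the factor `det D`.
  let f := (η' x).compLinearMap B.toLinearMap
  have h5 := DFunLike.congr_fun (f.eq_smul_basis_det e) (D ∘ e)
  have h6 : e.det (D ∘ e) = D.det := by
    have := e.det_comp D.toLinearMap e
    rw [e.det_self, mul_one] at this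
    exact this
  rw [AlternatingMap.smul_apply, h6, smul_eq_mul, mul_comm] at h5
  exact h5

/-- The chart `κ × κ'`, with values in the Euclidean space `ℝᵈ ⊕ ℝᵈ`. -/
def prodChart (hκ : κ ∈ IsManifold.maximalAtlas (𝓡 d) ∞ M)
    (hκ' : κ' ∈ IsManifold.maximalAtlas (𝓡 d) ∞ M) :
    SmoothChart ((𝓡 d).prod (𝓡 d)) (M × M) (EuclideanPair d) :=
  euclideanChart (κ.prod κ') (IsManifold.mem_maximalAtlas_prod hκ hκ')

theorem det_fderiv_conj_prodMap {E F : Type*} [NormedAddCommGroup E] [NormedSpace ℝ E]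
    [FiniteDimensional ℝ E] [NormedAddCommGroup F] [NormedSpace ℝ F] (e : (E × E) ≃L[ℝ] F)
    {f f' : E → E} {D D' : E →L[ℝ] E} {y : F} (hf : HasFDerivAt f D (e.symm y).1)
    (hf' : HasFDerivAt f' D' (e.symm y).2) :
    (fderiv ℝ (fun y => e (f (e.symm y).1, f' (e.symm y).2)) y).det = D.det * D'.det := by
  have h0 : HasFDerivAt e.symm (e.symm : F →L[ℝ] E × E) y := e.symm.hasFDerivAt
  have h1 : HasFDerivAt (fun y => (f (e.symm y).1, f' (e.symm y).2))
      ((D.prodMap D').comp (e.symm : F →L[ℝ] E × E)) y :=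
    (hf.comp y h0.fst).prodMk (hf'.comp y h0.snd)
  have h2 : HasFDerivAt (fun y => e (f (e.symm y).1, f' (e.symm y).2))
      ((e : E × E →L[ℝ] F).comp ((D.prodMap D').comp (e.symm : F →L[ℝ] E × E))) y :=
    e.hasFDerivAt.comp y h1
  rw [h2.fderiv, ContinuousLinearMap.det, ContinuousLinearMap.det, ContinuousLinearMap.det,
    ← LinearMap.det_prodMap]
  exact LinearMap.det_conj _ e.toLinearEquiv

theorem det_fderiv_transMap_prodChart (hκ : κ ∈ IsManifold.maximalAtlas (𝓡 d) ∞ M)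
    (hκ' : κ' ∈ IsManifold.maximalAtlas (𝓡 d) ∞ M)
    (hκ₁ : κ₁ ∈ IsManifold.maximalAtlas (𝓡 d) ∞ M)
    (hκ₁' : κ₁' ∈ IsManifold.maximalAtlas (𝓡 d) ∞ M) {p : M × M}
    (hp : p ∈ (κ.prod κ').source) (hp₁ : p ∈ (κ₁.prod κ₁').source) :
    (fderiv ℝ (transMap (prodChart hκ hκ') (prodChart hκ₁ hκ₁') p) (prodChart hκ hκ' p)).det =
      (fderiv ℝ (fun y => κ₁ (κ.symm y)) (κ p.1)).det *
      (fderiv ℝ (fun y => κ₁' (κ'.symm y)) (κ' p.2)).det := by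
  rw [fderiv_transMap (Y := prodChart hκ hκ') (Y' := prodChart hκ₁ hκ₁') hp hp₁]
  have hpt : (toPair d).symm (prodChart hκ hκ' p) = (κ p.1, κ' p.2) :=
    (toPair d).symm_apply_apply _
  have h1 : HasFDerivAt (fun y => κ₁ (κ.symm y)) (fderiv ℝ (fun y => κ₁ (κ.symm y)) (κ p.1))
      ((toPair d).symm (prodChart hκ hκ' p)).1 := by
    rw [hpt]; exact hasFDerivAt_coordChange hκ hκ₁ hp.1 hp₁.1
  have h2 : HasFDerivAt (fun y => κ₁' (κ'.symm y)) (fderiv ℝ (fun y => κ₁' (κ'.symm y)) (κ' p.2))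
      ((toPair d).symm (prodChart hκ hκ' p)).2 := by
    rw [hpt]; exact hasFDerivAt_coordChange hκ' hκ₁' hp.2 hp₁.2
  exact det_fderiv_conj_prodMap (toPair d) h1 h2

theorem density_eq_mul_det (μ : VolumeForm d M) (hκ : κ ∈ IsManifold.maximalAtlas (𝓡 d) ∞ M)
    (hκ' : κ' ∈ IsManifold.maximalAtlas (𝓡 d) ∞ M)
    (hκ₁ : κ₁ ∈ IsManifold.maximalAtlas (𝓡 d) ∞ M)
    (hκ₁' : κ₁' ∈ IsManifold.maximalAtlas (𝓡 d) ∞ M) {p : M × M}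
    (hp : p ∈ (κ.prod κ').source) (hp₁ : p ∈ (κ₁.prod κ₁').source) :
    μ.density κ κ' p = μ.density κ₁ κ₁' p *
      |(fderiv ℝ (transMap (prodChart hκ hκ') (prodChart hκ₁ hκ₁') p) (prodChart hκ hκ' p)).det| := by
  rw [det_fderiv_transMap_prodChart hκ hκ' hκ₁ hκ₁' hp hp₁]
  unfold VolumeForm.density
  rw [formComponent_eq_det_mul μ.form hκ hκ₁ hp.1 hp₁.1,
    formComponent_eq_det_mul μ.form hκ' hκ₁' hp.2 hp₁.2, abs_mul, abs_mul, abs_mul]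
  ring

theorem VolumeForm.contMDiffOn_density (μ : VolumeForm d M)
    (hκ : κ ∈ IsManifold.maximalAtlas (𝓡 d) ∞ M) (hκ' : κ' ∈ IsManifold.maximalAtlas (𝓡 d) ∞ M) :
    ContMDiffOn ((𝓡 d).prod (𝓡 d)) 𝓘(ℝ, ℝ) ∞ (μ.density κ κ') (κ.prod κ').source := by
  have key : ∀ {κ : OpenPartialHomeomorph M (EuclideanSpace ℝ (Fin d))},
      κ ∈ IsManifold.maximalAtlas (𝓡 d) ∞ M →
      ContMDiffOn (𝓡 d) 𝓘(ℝ, ℝ) ∞ (fun x => |formComponent μ.form κ (κ x)|) κ.source := by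
    intro κ hκ
    have h : ContDiffOn ℝ ∞ (fun y => |formComponent μ.form κ y|) κ.target :=
      (μ.smooth κ hκ).abs fun y hy => μ.formComponent_ne_zero hκ hy
    exact h.contMDiffOn.comp (contMDiffOn_of_mem_maximalAtlas hκ) κ.mapsTo
  have h1 : ContMDiffOn ((𝓡 d).prod (𝓡 d)) 𝓘(ℝ, ℝ) ∞
      (fun p : M × M => |formComponent μ.form κ (κ p.1)|) (κ.prod κ').source :=
    (key hκ).comp contMDiff_fst.contMDiffOn fun p hp => hp.1
  have h2 : ContMDiffOn ((𝓡 d).prod (𝓡 d)) 𝓘(ℝ, ℝ) ∞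
      (fun p : M × M => |formComponent μ.form κ' (κ' p.2)|) (κ.prod κ').source :=
    (key hκ').comp contMDiff_snd.contMDiffOn fun p hp => hp.2
  exact (contDiff_mul (𝕜 := ℝ) (𝔸 := ℝ)).contMDiff.comp_contMDiffOn (h1.prodMk_space h2)

theorem VolumeForm.density_pos (μ : VolumeForm d M)
    (hκ : κ ∈ IsManifold.maximalAtlas (𝓡 d) ∞ M) (hκ' : κ' ∈ IsManifold.maximalAtlas (𝓡 d) ∞ M)
    {p : M × M} (hp : p ∈ (κ.prod κ').source) : 0 < μ.density κ κ' p :=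
  mul_pos (abs_pos.2 (μ.formComponent_ne_zero hκ (κ.map_source hp.1)))
    (abs_pos.2 (μ.formComponent_ne_zero hκ' (κ'.map_source hp.2)))

theorem chartAt_mem_maximalAtlas (x : M) :
    chartAt (EuclideanSpace ℝ (Fin d)) x ∈ IsManifold.maximalAtlas (𝓡 d) ∞ M :=
  IsManifold.chart_mem_maximalAtlas x

/-- The chart of `M × M` at a point. -/
def chartPair (p : M × M) : SmoothChart ((𝓡 d).prod (𝓡 d)) (M × M) (EuclideanPair d) :=
  prodChart (chartAt_mem_maximalAtlas (d := d) p.1) (chartAt_mem_maximalAtlas (d := d) p.2)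

theorem mem_chartPair_source (p : M × M) : p ∈ (chartPair (d := d) p).source :=
  ⟨mem_chart_source _ p.1, mem_chart_source _ p.2⟩

/-- The representation of `|μ| ⊗ |μ|` in a chart of `M × M`. -/
def VolumeForm.densityVal (μ : VolumeForm d M)
    (Y : SmoothChart ((𝓡 d).prod (𝓡 d)) (M × M) (EuclideanPair d)) (p : M × M) : ℝ :=
  μ.density (chartAt _ p.1) (chartAt _ p.2) p * |(fderiv ℝ (transMap Y (chartPair p) p) (Y p)).det|

theorem VolumeForm.densityVal_prodChart (μ : VolumeForm d M)
    (hκ : κ ∈ IsManifold.maximalAtlas (𝓡 d) ∞ M) (hκ' : κ' ∈ IsManifold.maximalAtlas (𝓡 d) ∞ M)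
    {p : M × M} (hp : p ∈ (κ.prod κ').source) :
    μ.densityVal (prodChart hκ hκ') p = μ.density κ κ' p :=
  (density_eq_mul_det μ hκ hκ' (chartAt_mem_maximalAtlas p.1) (chartAt_mem_maximalAtlas p.2) hp
    (mem_chartPair_source p)).symm

/-- The smooth density `|μ| ⊗ |μ|` on `M × M`, in product charts. -/
def VolumeForm.prodDensity (μ : VolumeForm d M) :
    SmoothDensity ((𝓡 d).prod (𝓡 d)) (M × M) (EuclideanPair d) where
  charts := {Y | ∃ (κ κ' : OpenPartialHomeomorph M (EuclideanSpace ℝ (Fin d)))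
    (hκ : κ ∈ IsManifold.maximalAtlas (𝓡 d) ∞ M) (hκ' : κ' ∈ IsManifold.maximalAtlas (𝓡 d) ∞ M),
    Y = prodChart hκ hκ'}
  -- An abstract chart with values in `ℝᵈ ⊕ ℝᵈ` does not exhibit factors `κ`, `κ'`. The density is
  -- therefore read in the preferred product chart at the point and transported by the Jacobian; the
  -- cocycle rule gives the transformation law.
  val := μ.densityVal
  smooth := by
    rintro _ ⟨κ, κ', hκ, hκ', rfl⟩
    exact (μ.contMDiffOn_density hκ hκ').congr fun p hp => μ.densityVal_prodChart hκ hκ' hp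
  pos := by
    rintro _ ⟨κ, κ', hκ, hκ', rfl⟩ q hq
    rw [μ.densityVal_prodChart hκ hκ' hq]
    exact μ.density_pos hκ hκ' hq
  cover := fun p => ⟨chartPair p, ⟨_, _, _, _, rfl⟩, mem_chartPair_source p⟩
  transform := by
    rintro Y - Y' - q hq hq'
    unfold VolumeForm.densityVal
    rw [mul_assoc, ← abs_mul, ContinuousLinearMap.det, ContinuousLinearMap.det,
      ← LinearMap.det_comp]
    congr 2
    have := congrArg (fun A : EuclideanPair d →L[ℝ] EuclideanPair d =>
      LinearMap.det (A : EuclideanPair d →ₗ[ℝ] EuclideanPair d))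
      (fderiv_transMap_comp hq hq' (mem_chartPair_source q))
    exact this

/-- The rescaling of the frequencies has Jacobian `(2π) ^ (2 * d)`, which is exactly the constant in
the definition of the product. -/
theorem integral_comp_toPair_smul (f : EuclideanPair d → ℂ) :
    ((2 * Real.pi : ℝ) : ℂ)⁻¹ ^ (2 * d) * ∫ k, f (toPair d ((2 * Real.pi)⁻¹ • k)) = ∫ l, f l := by
  have h1 : ∫ k, f (toPair d ((2 * Real.pi)⁻¹ • k)) = ∫ l, f ((2 * Real.pi)⁻¹ • l) := by
    rw [← measurePreserving_toPair.integral_comp measurableEmbedding_toPair]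
    simp only [map_smul]
  have hpi : (0 : ℝ) < 2 * Real.pi := by positivity
  have hfin : Module.finrank ℝ (EuclideanPair d) = 2 * d := by
    rw [← (toPair d).toLinearEquiv.finrank_eq, Module.finrank_prod]
    simp [two_mul]
  have habs : |(((2 * Real.pi)⁻¹) ^ (2 * d))⁻¹| = (2 * Real.pi) ^ (2 * d) := by
    rw [inv_pow, inv_inv, abs_of_pos (by positivity)]
  rw [h1, Measure.integral_comp_smul, hfin, habs, Complex.real_smul, ← mul_assoc,
    Complex.ofReal_pow, ← mul_pow, inv_mul_cancel₀ (by exact_mod_cast hpi.ne'), one_pow, one_mul]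

theorem integrable_comp_toPair_smul {f : EuclideanPair d → ℂ} :
    Integrable (fun k => f (toPair d ((2 * Real.pi)⁻¹ • k))) ↔ Integrable f := by
  have hpi : (2 * Real.pi)⁻¹ ≠ 0 := by positivity
  have h1 : (fun k => f (toPair d ((2 * Real.pi)⁻¹ • k))) =
      (fun l => f ((2 * Real.pi)⁻¹ • l)) ∘ toPair d := by
    ext k; simp only [map_smul, Function.comp_apply]
  rw [h1, measurePreserving_toPair.integrable_comp_emb measurableEmbedding_toPair,
    integrable_comp_smul_iff _ _ hpi]

/-- The product of distributions in the sense of the definition by charts is the localised Fourier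
product with respect to the density `|μ| ⊗ |μ|`. -/
theorem isProduct_iff_isFourierProduct (μ : VolumeForm d M) (u₁ u₂ w : Distribution₂ d M) :
    Distribution₂.IsProduct μ u₁ u₂ w ↔
      IsFourierProduct μ.prodDensity u₁.toLin u₂.toLin w.toLin := by
  have key : ∀ {κ κ' : OpenPartialHomeomorph M (EuclideanSpace ℝ (Fin d))}
      (hκ : κ ∈ IsManifold.maximalAtlas (𝓡 d) ∞ M) (hκ' : κ' ∈ IsManifold.maximalAtlas (𝓡 d) ∞ M)
      {φ ψ : M × M → ℂ} (hφ : φ ∈ TestFunctions₂ d M) (hψ : ψ ∈ TestFunctions₂ d M)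
      (hφs : tsupport φ ⊆ (κ.prod κ').source) (hψs : tsupport ψ ⊆ (κ.prod κ').source),
      (MeasureTheory.Integrable (fun k =>
          u₁.localFourier (IsManifold.mem_maximalAtlas_prod hκ hκ') hφ hφs k *
          u₂.localFourier (IsManifold.mem_maximalAtlas_prod hκ hκ') hψ hψs (-k)) ∧
        w.toLin ⟨_, mul_density_mem μ hκ hκ' hφ hψ hφs⟩ =
          ((2 * Real.pi : ℝ) : ℂ)⁻¹ ^ (2 * d) * ∫ k,
          u₁.localFourier (IsManifold.mem_maximalAtlas_prod hκ hκ') hφ hφs k *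
          u₂.localFourier (IsManifold.mem_maximalAtlas_prod hκ hκ') hψ hψs (-k)) ↔
      (Integrable (fun l => chartFourier u₁.toLin (prodChart hκ hκ') φ l *
          chartFourier u₂.toLin (prodChart hκ hκ') ψ (-l)) ∧
        evalTest w.toLin (fun p => φ p * (ψ p * (μ.prodDensity.val (prodChart hκ hκ') p : ℂ))) =
          ∫ l, chartFourier u₁.toLin (prodChart hκ hκ') φ l *
            chartFourier u₂.toLin (prodChart hκ hκ') ψ (-l)) := by
    intro κ κ' hκ hκ' φ ψ hφ hψ hφs hψs
    have e1 : (fun k => u₁.localFourier (IsManifold.mem_maximalAtlas_prod hκ hκ') hφ hφs k *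
        u₂.localFourier (IsManifold.mem_maximalAtlas_prod hκ hκ') hψ hψs (-k)) = fun k =>
        (fun l => chartFourier u₁.toLin (prodChart hκ hκ') φ l *
          chartFourier u₂.toLin (prodChart hκ hκ') ψ (-l)) (toPair d ((2 * Real.pi)⁻¹ • k)) := by
      ext k
      rw [localFourier_eq_chartFourier, localFourier_eq_chartFourier, smul_neg, map_neg]
      rfl
    have e2 : (fun p => φ p * (ψ p * (μ.prodDensity.val (prodChart hκ hκ') p : ℂ))) =
        fun p => φ p * (ψ p * (μ.density κ κ' p : ℝ)) := by
      ext p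
      by_cases hp : φ p = 0
      · simp [hp]
      · have : μ.prodDensity.val (prodChart hκ hκ') p = μ.density κ κ' p :=
          μ.densityVal_prodChart hκ hκ' (hφs (subset_tsupport _ hp))
        rw [this]
    rw [e1, e2]
    generalize (fun l => chartFourier u₁.toLin (prodChart hκ hκ') φ l *
          chartFourier u₂.toLin (prodChart hκ hκ') ψ (-l)) = f
    rw [integrable_comp_toPair_smul, integral_comp_toPair_smul,
      evalTest_of_mem w.toLin (mul_density_mem μ hκ hκ' hφ hψ hφs)]
  constructor
  · rintro h _ ⟨κ, κ', hκ, hκ', rfl⟩ q hq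
    obtain ⟨V, hVo, hqV, hV, hw⟩ := h κ κ' hκ hκ' q hq
    exact ⟨V, hVo.mem_nhds hqV, hV, fun φ hφ ψ hψ hφV hψV =>
      (key hκ hκ' hφ hψ (hφV.trans hV) (hψV.trans hV)).1 (hw φ ψ hφ hψ hφV hψV)⟩
  · intro h κ κ' hκ hκ' q hq
    obtain ⟨V, hVq, hV, hw⟩ := h (prodChart hκ hκ') ⟨κ, κ', hκ, hκ', rfl⟩ q hq
    refine ⟨interior V, isOpen_interior, mem_interior_iff_mem_nhds.2 hVq,
      interior_subset.trans hV, fun φ ψ hφ hψ hφV hψV => ?_⟩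
    exact (key hκ hκ' hφ hψ _ _).2
      (hw φ hφ ψ hψ (hφV.trans interior_subset) (hψV.trans interior_subset))

/-- Existence and uniqueness of the product of distributions with complementary microlocal
regularity. -/
theorem existsUnique_isProduct [T2Space M] [SecondCountableTopology M] (μ : VolumeForm d M)
    (u₁ u₂ : Distribution₂ d M)
    (hWF : ∀ (p : M × M) (ξ : TangentSpace ((𝓡 d).prod (𝓡 d)) p →L[ℝ] ℝ), ξ ≠ 0 →
      ∃ s₁ s₂ : ℝ, 0 ≤ s₁ + s₂ ∧ ⟨p, ξ⟩ ∉ u₁.sobolevWF s₁ ∧ ⟨p, -ξ⟩ ∉ u₂.sobolevWF s₂) :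
    ∃! w : Distribution₂ d M, Distribution₂.IsProduct μ u₁ u₂ w := by
  have : LocallyCompactSpace M := ChartedSpace.locallyCompactSpace (EuclideanSpace ℝ (Fin d)) M
  have : SigmaCompactSpace (M × M) := inferInstance
  have hreg : ∀ Y ∈ μ.prodDensity.charts, ∀ p ∈ Y.source, ∀ η : EuclideanPair d, η ≠ 0 →
      ∃ s t : ℝ, 0 ≤ s + t ∧ IsSobolevRegular u₁.toLin s Y p η ∧
        IsSobolevRegular u₂.toLin t Y p (-η) := by
    rintro _ ⟨κ, κ', hκ, hκ', rfl⟩ p hp η hη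
    obtain ⟨K, hK⟩ : ∃ K : OpenPartialHomeomorph (M × M)
      (ModelProd (EuclideanSpace ℝ (Fin d)) (EuclideanSpace ℝ (Fin d))), K = κ.prod κ' := ⟨_, rfl⟩
    have hm : K ∈ IsManifold.maximalAtlas ((𝓡 d).prod (𝓡 d)) ∞ (M × M) :=
      hK ▸ IsManifold.mem_maximalAtlas_prod hκ hκ'
    have hpK : p ∈ K.source := hK ▸ hp
    -- The covector with coordinates `η` in the chart; it is nonzero because the differential of the
    -- chart is onto.
    let ξ : TangentSpace ((𝓡 d).prod (𝓡 d)) p →L[ℝ] ℝ :=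
      ((innerSL ℝ η).comp (toPair d).toContinuousLinearMap).comp
        (mfderiv ((𝓡 d).prod (𝓡 d)) ((𝓡 d).prod (𝓡 d)) K p)
    have hξ : ∀ v, ξ v = inner ℝ η
      (toPair d (mfderiv ((𝓡 d).prod (𝓡 d)) ((𝓡 d).prod (𝓡 d)) K p v)) := fun v => rfl
    have hξ0 : ξ ≠ 0 := by
      intro h0
      obtain ⟨v, hv⟩ := (mdifferentiable_of_mem_maximalAtlas hm).mfderiv_surjective hpK
        ((toPair d).symm η)
      have h1 : η = toPair d (mfderiv ((𝓡 d).prod (𝓡 d)) ((𝓡 d).prod (𝓡 d)) K p v) :=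
        (toPair d).symm_apply_eq.1 hv.symm
      have h2 := hξ v
      rw [h0] at h2
      have h3 : (0 : ℝ) = inner ℝ η η := h2.trans (congrArg (inner ℝ η) h1.symm)
      exact hη (inner_self_eq_zero.1 h3.symm)
    obtain ⟨s, t, hst, h1, h2⟩ := hWF p ξ hξ0
    have h1' : u₁.SobolevRegularAt s p ξ := by
      by_contra hc; exact h1 ⟨hξ0, hc⟩
    have h2' : u₂.SobolevRegularAt t p (-ξ) := by
      by_contra hc; exact h2 ⟨neg_ne_zero.2 hξ0, hc⟩
    subst hK
    refine ⟨s, t, hst, h1'.isSobolevRegular hm hpK hξ, h2'.isSobolevRegular hm hp fun v => ?_⟩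
    rw [inner_neg_left]
    exact congrArg Neg.neg (hξ v)
  obtain ⟨w, hw, hp⟩ := exists_isFourierProduct u₁.isDistribution u₂.isDistribution μ.prodDensity
    hreg
  refine ⟨hw.toDistribution₂, (isProduct_iff_isFourierProduct μ _ _ _).2 hp, fun w' hw' => ?_⟩
  exact Distribution₂.ext (((isProduct_iff_isFourierProduct μ _ _ _).1 hw').unique hp)

end Density

/-! ### Kernels of positive type and their double integrals -/

section PositiveKernel

open scoped ComplexOrder Matrix

/-- Over `ℂ` a quadratic form with real values already forces the matrix to be Hermitian, so no
symmetry has to be assumed. -/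
theorem Matrix.posSemidef_of_forall_nonneg {Z : Type*} [Fintype Z] (A : Matrix Z Z ℂ)
    (h : ∀ x : Z → ℂ, 0 ≤ star x ⬝ᵥ (A *ᵥ x)) : A.PosSemidef := by
  classical
  rw [← Matrix.isPositive_toEuclideanLin_iff, LinearMap.isPositive_iff_complex]
  intro x
  have h1 : inner ℂ (A.toEuclideanLin x) x = star (star x.ofLp ⬝ᵥ (A *ᵥ x.ofLp)) := by
    rw [EuclideanSpace.inner_eq_star_dotProduct, dotProduct_comm, Matrix.star_dotProduct]
    rfl
  obtain ⟨h2, h3⟩ := Complex.nonneg_iff.1 (h x.ofLp)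
  rw [h1]
  refine ⟨?_, by simpa using h2⟩
  apply Complex.ext <;> simp [← h3]

variable {X : Type*} [MeasurableSpace X]

/-- Distinct coordinates of a product measure are independent: the joint law of two independent
samples from `ν` is `ν ⊗ ν`. -/
theorem measurePreserving_eval_pair (ν : Measure X) [IsProbabilityMeasure ν] {n : ℕ}
    {i j : Fin n} (hij : i ≠ j) :
    MeasurePreserving (fun x : Fin n → X => (x i, x j)) (Measure.pi fun _ => ν) (ν.prod ν) := by
  refine ⟨(measurable_pi_apply i).prodMk (measurable_pi_apply j), ?_⟩
  have h := (ProbabilityTheory.iIndepFun_pi (μ := fun _ : Fin n => ν) (X := fun _ => id)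
    fun _ => aemeasurable_id).indepFun hij
  have h1 := (ProbabilityTheory.indepFun_iff_map_prod_eq_prod_map_map
    (measurable_pi_apply i).aemeasurable (measurable_pi_apply j).aemeasurable).1 h
  rw [(measurePreserving_eval (fun _ : Fin n => ν) i).map_eq,
    (measurePreserving_eval (fun _ : Fin n => ν) j).map_eq] at h1
  exact h1

/-- The double integral of a kernel of positive type is nonnegative. -/
theorem integral_prod_nonneg_of_sum_nonneg (ν : Measure X) [IsProbabilityMeasure ν]
    {G : X × X → ℂ} (hG : Integrable G (ν.prod ν)) (hd : Integrable (fun x => G (x, x)) ν)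
    (hpos : ∀ (n : ℕ) (x : Fin n → X), 0 ≤ ∑ i, ∑ j, G (x i, x j)) :
    0 ≤ ∫ z, G z ∂(ν.prod ν) := by
  classical
  set D := ∫ x, G (x, x) ∂ν with hD
  set J := ∫ z, G z ∂(ν.prod ν) with hJ
  have hint : ∀ (n : ℕ) (i j : Fin n), Integrable (fun x : Fin n → X => G (x i, x j))
      (Measure.pi fun _ => ν) ∧ ∫ x, G (x i, x j) ∂(Measure.pi fun _ : Fin n => ν) =
        if i = j then D else J := by
    intro n i j
    by_cases hij : i = j
    · subst hij
      have hmp := measurePreserving_eval (fun _ : Fin n => ν) i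
      refine ⟨hmp.integrable_comp_of_integrable hd, ?_⟩
      have h1 := integral_map (μ := Measure.pi fun _ : Fin n => ν) hmp.measurable.aemeasurable
        (f := fun x => G (x, x)) (by rw [hmp.map_eq]; exact hd.aestronglyMeasurable)
      rw [hmp.map_eq] at h1
      rw [if_pos rfl, hD, h1]
    · have hmp := measurePreserving_eval_pair ν hij
      refine ⟨hmp.integrable_comp_of_integrable hG, ?_⟩
      have h1 := integral_map (μ := Measure.pi fun _ : Fin n => ν) hmp.measurable.aemeasurable
        (f := G) (by rw [hmp.map_eq]; exact hG.aestronglyMeasurable)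
      rw [hmp.map_eq] at h1
      rw [if_neg hij, hJ, h1]
  -- Positivity of the kernel is averaged over `n + 1` independent random points. The `n + 1`
  -- diagonal terms contribute `D` each and the `(n + 1) n` others `J` each; division by `(n + 1) n`
  -- makes the diagonal disappear as `n` grows.
  have hn : ∀ n : ℕ, 0 ≤ ((n + 1 : ℕ) : ℂ) * D + (n + 1 : ℕ) * (n * J) := by
    intro n
    have h1 : 0 ≤ ∫ x, ∑ i, ∑ j, G (x i, x j) ∂(Measure.pi fun _ : Fin (n + 1) => ν) :=
      integral_nonneg fun x => hpos _ x
    rw [integral_finsetSum _ fun i _ => integrable_finsetSum _ fun j _ => (hint _ i j).1] at h1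
    have h2 : ∀ i : Fin (n + 1), ∫ x, ∑ j, G (x i, x j) ∂(Measure.pi fun _ : Fin (n + 1) => ν) =
        D + n * J := by
      intro i
      rw [integral_finsetSum _ fun j _ => (hint _ i j).1, Finset.sum_congr rfl
        fun j _ => (hint _ i j).2, Finset.sum_ite, Finset.sum_const, Finset.sum_const,
        Finset.filter_eq, if_pos (Finset.mem_univ _), Finset.card_singleton, one_smul,
        Finset.filter_ne, Finset.card_erase_of_mem (Finset.mem_univ _), Finset.card_univ,
        Fintype.card_fin, Nat.add_sub_cancel, nsmul_eq_mul]
    rw [Finset.sum_congr rfl fun i _ => h2 i, Finset.sum_const, Finset.card_univ,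
      Fintype.card_fin, nsmul_eq_mul, mul_add] at h1
    exact h1
  have hlim : Tendsto (fun n : ℕ => D * ((n : ℝ)⁻¹ : ℝ) + J) atTop (𝓝 (D * (0 : ℝ) + J)) :=
    ((Complex.continuous_ofReal.tendsto _).comp tendsto_inv_atTop_nhds_zero_nat).const_mul D
      |>.add_const J
  rw [Complex.ofReal_zero, mul_zero, zero_add] at hlim
  refine ge_of_tendsto hlim ?_
  filter_upwards [eventually_gt_atTop 0] with n hn0
  have hc : (0 : ℂ) ≤ (((n + 1 : ℝ) * n)⁻¹ : ℝ) := by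
    rw [Complex.zero_le_real]; positivity
  have h3 := mul_nonneg hc (hn n)
  have h4 : (n : ℂ) ≠ 0 := by exact_mod_cast hn0.ne'
  have h5 : (n + 1 : ℂ) ≠ 0 := by exact_mod_cast n.succ_ne_zero
  convert h3 using 1
  push_cast
  field_simp

/-- The probabilistic statement is applied to normalised Lebesgue measure on balls, which exhaust
the space. Continuity on the diagonal makes the diagonal term finite on each ball; no integrability
of it over the whole space is needed. Radius `R + 1` keeps the volume positive. -/
theorem integral_nonneg_of_sum_nonneg {E : Type*} [NormedAddCommGroup E] [NormedSpace ℝ E]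
    [FiniteDimensional ℝ E] [MeasureSpace E] [BorelSpace E]
    [(volume : Measure E).IsAddHaarMeasure] {G : E × E → ℂ}
    (hG : Integrable G) (hd : Continuous fun x => G (x, x))
    (hpos : ∀ (n : ℕ) (x : Fin n → E), 0 ≤ ∑ i, ∑ j, G (x i, x j)) :
    0 ≤ ∫ z, G z := by
  have hball : ∀ R : ℕ, 0 ≤ ∫ z in
      Metric.closedBall (0 : E) (R + 1) ×ˢ Metric.closedBall (0 : E) (R + 1), G z := by
    intro R
    set B := Metric.closedBall (0 : E) (R + 1) with hB
    have hB0 : volume B ≠ 0 :=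
      (Metric.measure_closedBall_pos volume (0 : E) (by positivity)).ne'
    have hBt : volume B ≠ ⊤ := (isCompact_closedBall (0 : E) (R + 1)).measure_lt_top.ne
    have : IsProbabilityMeasure (ProbabilityTheory.cond (volume : Measure E) B) :=
      ProbabilityTheory.cond_isProbabilityMeasure_of_finite hB0 hBt
    have hprod : (ProbabilityTheory.cond (volume : Measure E) B).prod
        (ProbabilityTheory.cond (volume : Measure E) B) =
        ((volume B)⁻¹ * (volume B)⁻¹) • (volume : Measure (E × E)).restrict (B ×ˢ B) := by
      rw [ProbabilityTheory.cond, Measure.prod_smul_left, Measure.prod_smul_right,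
        Measure.prod_restrict, smul_smul]
      rfl
    have hct : (volume B)⁻¹ * (volume B)⁻¹ ≠ ⊤ :=
      ENNReal.mul_ne_top (ENNReal.inv_ne_top.2 hB0) (ENNReal.inv_ne_top.2 hB0)
    have h1 := integral_prod_nonneg_of_sum_nonneg (ProbabilityTheory.cond (volume : Measure E) B)
      (G := G) (by rw [hprod]; exact hG.restrict.smul_measure hct) ?_ hpos
    · rw [hprod, integral_smul_measure] at h1
      have hc : 0 < ((volume B)⁻¹ * (volume B)⁻¹).toReal :=
        ENNReal.toReal_pos (mul_ne_zero (ENNReal.inv_ne_zero.2 hBt) (ENNReal.inv_ne_zero.2 hBt)) hct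
      have h2 := smul_nonneg (inv_nonneg.2 hc.le) h1
      rwa [smul_smul, inv_mul_cancel₀ hc.ne', one_smul] at h2
    · exact (hd.continuousOn.integrableOn_compact (isCompact_closedBall 0 (R + 1))).smul_measure
        (ENNReal.inv_ne_top.2 hB0)
  have hmono : Monotone fun R : ℕ =>
      Metric.closedBall (0 : E) (R + 1) ×ˢ Metric.closedBall (0 : E) (R + 1) := by
    intro R S hRS
    have : Metric.closedBall (0 : E) (R + 1) ⊆ Metric.closedBall (0 : E) (S + 1) :=
      Metric.closedBall_subset_closedBall (by gcongr)
    exact Set.prod_mono this this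
  have hunion : ⋃ R : ℕ, Metric.closedBall (0 : E) (R + 1) ×ˢ Metric.closedBall (0 : E) (R + 1) =
      Set.univ := by
    refine Set.eq_univ_of_forall fun z => ?_
    obtain ⟨R, hR⟩ := exists_nat_ge (max ‖z.1‖ ‖z.2‖)
    refine Set.mem_iUnion.2 ⟨R, ?_, ?_⟩ <;> rw [mem_closedBall_zero_iff]
    · linarith [le_max_left ‖z.1‖ ‖z.2‖]
    · linarith [le_max_right ‖z.1‖ ‖z.2‖]
  have hlim := tendsto_setIntegral_of_monotone (μ := (volume : Measure (E × E)))
    (f := G) (fun R => (Metric.isClosed_closedBall.prod Metric.isClosed_closedBall).measurableSet)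
    hmono hG.integrableOn
  rw [hunion, Measure.restrict_univ] at hlim
  exact ge_of_tendsto' hlim hball

end PositiveKernel

/-! ### Sesquilinear forms of distributions of positive type -/

section Positivity

open scoped ComplexOrder

variable {d : ℕ} {M : Type*} [TopologicalSpace M] [ChartedSpace (EuclideanSpace ℝ (Fin d)) M]

/-- The sesquilinear form `(a, b) ↦ u (ā ⊗ b)`. -/
def Distribution₂.sesq (u : Distribution₂ d M) (a b : M → ℂ) : ℂ :=
  evalTest u.toLin fun p => (starRingEnd ℂ) (a p.1) * b p.2

variable [T2Space M]

theorem Distribution₂.sesq_sum (u : Distribution₂ d M) {Z : Type*} (t : Finset Z) (c : Z → ℂ)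
    {A : Z → M → ℂ} (hA : ∀ z, A z ∈ testFunctions (𝓡 d) M) :
    u.sesq (fun x => ∑ z ∈ t, c z * A z x) (fun x => ∑ z ∈ t, c z * A z x) =
      ∑ z ∈ t, ∑ z' ∈ t, (starRingEnd ℂ) (c z) * (u.sesq (A z) (A z') * c z') := by
  have h1 : (fun p : M × M => (starRingEnd ℂ) (∑ z ∈ t, c z * A z p.1) * ∑ z ∈ t, c z * A z p.2) =
      fun p => ∑ z ∈ t, ∑ z' ∈ t, ((starRingEnd ℂ) (c z) * c z') *
        ((starRingEnd ℂ) (A z p.1) * A z' p.2) := by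
    ext p
    rw [map_sum, Finset.sum_mul_sum]
    refine Finset.sum_congr rfl fun z _ => Finset.sum_congr rfl fun z' _ => ?_
    rw [map_mul]; ring
  have hm : ∀ z z', (fun p : M × M => ((starRingEnd ℂ) (c z) * c z') *
      ((starRingEnd ℂ) (A z p.1) * A z' p.2)) ∈ TestFunctions₂ d M := fun z z' =>
    (TestFunctions₂ d M).smul_mem _ (tensor_mem (hA z) (hA z'))
  have hm' : ∀ z, (fun p : M × M => ∑ z' ∈ t, ((starRingEnd ℂ) (c z) * c z') *
      ((starRingEnd ℂ) (A z p.1) * A z' p.2)) ∈ TestFunctions₂ d M := by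
    intro z
    have := (TestFunctions₂ d M).sum_mem (t := t) fun z' _ => hm z z'
    convert this using 1
    ext p; simp
  unfold sesq
  rw [h1, evalTest_sum u.toLin t fun z _ => hm' z]
  refine Finset.sum_congr rfl fun z _ => ?_
  rw [evalTest_sum u.toLin t fun z' _ => hm z z']
  refine Finset.sum_congr rfl fun z' _ => ?_
  rw [evalTest_smul u.toLin (tensor_mem (hA z) (hA z'))]
  ring

theorem Distribution₂.isPositiveType_iff (u : Distribution₂ d M) :
    u.IsPositiveType ↔ ∀ f ∈ testFunctions (𝓡 d) M, 0 ≤ u.sesq f f := by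
  refine forall₂_congr fun f hf => ?_
  rw [Complex.nonneg_iff, sesq, evalTest_of_mem u.toLin (tensor_mem hf hf), eq_comm (a := (0 : ℝ))]

theorem Distribution₂.IsPositiveType.posSemidef {u : Distribution₂ d M} (hu : u.IsPositiveType)
    {Z : Type*} [Fintype Z] {A : Z → M → ℂ} (hA : ∀ z, A z ∈ testFunctions (𝓡 d) M) :
    (Matrix.of fun z z' => u.sesq (A z) (A z')).PosSemidef := by
  refine Matrix.posSemidef_of_forall_nonneg _ fun x => ?_
  have hmem : (fun q => ∑ z, x z * A z q) ∈ testFunctions (𝓡 d) M := by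
    have := (testFunctions (𝓡 d) M).sum_mem (t := Finset.univ) fun z _ =>
      (testFunctions (𝓡 d) M).smul_mem (x z) (hA z)
    convert this using 1
    ext q; simp
  have h := (u.isPositiveType_iff.1 hu) _ hmem
  rw [u.sesq_sum Finset.univ x hA] at h
  convert h using 1
  simp only [dotProduct, Matrix.mulVec, Finset.mul_sum, Matrix.of_apply]
  rfl

/-- The Schur product theorem: the entrywise product of two positive semidefinite matrices is
positive semidefinite, here evaluated on the vector with all entries `1`. -/
theorem sum_sesq_mul_sesq_nonneg {u₁ u₂ : Distribution₂ d M} (h₁ : u₁.IsPositiveType)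
    (h₂ : u₂.IsPositiveType) {Z : Type*} [Fintype Z] {A B : Z → M → ℂ}
    (hA : ∀ z, A z ∈ testFunctions (𝓡 d) M) (hB : ∀ z, B z ∈ testFunctions (𝓡 d) M) :
    0 ≤ ∑ z, ∑ z', u₁.sesq (A z) (A z') * u₂.sesq (B z) (B z') := by
  have h := ((h₁.posSemidef hA).hadamard (h₂.posSemidef hB)).dotProduct_mulVec_nonneg fun _ => 1
  convert h using 1
  simp [dotProduct, Matrix.mulVec]

/-- The plane wave `e^{-i k·κ}` in a chart `κ` of `M`. -/
def chartWave (κ : OpenPartialHomeomorph M (EuclideanSpace ℝ (Fin d)))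
    (k : EuclideanSpace ℝ (Fin d)) (x : M) : ℂ :=
  Complex.exp (-Complex.I * (inner ℝ k (κ x) : ℝ))

theorem conj_chartWave (κ : OpenPartialHomeomorph M (EuclideanSpace ℝ (Fin d)))
    (k : EuclideanSpace ℝ (Fin d)) (x : M) :
    (starRingEnd ℂ) (chartWave κ k x) = chartWave κ (-k) x := by
  unfold chartWave
  rw [← Complex.exp_conj, inner_neg_left, map_mul, map_neg, Complex.conj_I, Complex.conj_ofReal]
  push_cast
  ring_nf

variable [IsManifold (𝓡 d) ∞ M] {κ κ' : OpenPartialHomeomorph M (EuclideanSpace ℝ (Fin d))}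

theorem mul_chartWave_mem (hκ : κ ∈ IsManifold.maximalAtlas (𝓡 d) ∞ M) {a : M → ℂ}
    (ha : a ∈ testFunctions (𝓡 d) M) (hs : tsupport a ⊆ κ.source)
    (k : EuclideanSpace ℝ (Fin d)) :
    (fun x => a x * chartWave κ k x) ∈ testFunctions (𝓡 d) M := by
  refine mul_mem_testFunctions ha κ.open_source hs ?_
  have h : ContDiff ℝ ∞ (fun x : EuclideanSpace ℝ (Fin d) =>
      Complex.exp (-Complex.I * (inner ℝ k x : ℝ))) :=
    (contDiff_const.mul (Complex.ofRealCLM.contDiff.comp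
      (contDiff_const.inner ℝ contDiff_id))).cexp
  exact h.contMDiff.comp_contMDiffOn (contMDiffOn_of_mem_maximalAtlas hκ)

theorem tsupport_tensor_subset (a b : M → ℂ) :
    tsupport (fun p : M × M => (starRingEnd ℂ) (a p.1) * b p.2) ⊆ tsupport a ×ˢ tsupport b := by
  refine closure_minimal (fun p hp => ?_) ((isClosed_tsupport a).prod (isClosed_tsupport b))
  rw [Function.mem_support, ne_eq, mul_eq_zero, not_or, map_eq_zero] at hp
  exact ⟨subset_tsupport _ hp.1, subset_tsupport _ hp.2⟩

/-- The first slot is conjugated, and conjugation reverses the frequency of a plane wave, hence the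
sign in front of `k.1`. In this form the localised Fourier transform is a matrix entry of the
sesquilinear form of `u`. -/
theorem localFourier_tensor (u : Distribution₂ d M) (hκ : κ ∈ IsManifold.maximalAtlas (𝓡 d) ∞ M)
    (hκ' : κ' ∈ IsManifold.maximalAtlas (𝓡 d) ∞ M) {a b : M → ℂ}
    (hab : (fun p : M × M => (starRingEnd ℂ) (a p.1) * b p.2) ∈ TestFunctions₂ d M)
    (hs : tsupport (fun p : M × M => (starRingEnd ℂ) (a p.1) * b p.2) ⊆ (κ.prod κ').source)
    (k : EuclideanSpace ℝ (Fin d) × EuclideanSpace ℝ (Fin d)) :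
    u.localFourier (IsManifold.mem_maximalAtlas_prod hκ hκ') hab hs k =
      u.sesq (fun x => a x * chartWave κ (-k.1) x) (fun x => b x * chartWave κ' k.2 x) := by
  unfold Distribution₂.localFourier Distribution₂.sesq
  rw [← evalTest_of_mem u.toLin]
  congr 1; ext p
  have h1 : Complex.exp (-Complex.I * (pairing₂ k ((κ.prod κ') p) : ℝ)) =
      chartWave κ k.1 p.1 * chartWave κ' k.2 p.2 := by
    unfold chartWave pairing₂
    rw [← Complex.exp_add]
    congr 1
    push_cast
    rw [mul_add]
    rfl
  rw [map_mul, conj_chartWave, neg_neg]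
  refine (congrArg _ h1).trans ?_
  ring

/-- Regularity on the diagonal, where integrability over pairs of frequencies says nothing; the
diagonal enters through the averaging argument. -/
theorem continuous_sesq_chartWave (u : Distribution₂ d M)
    (hκ : κ ∈ IsManifold.maximalAtlas (𝓡 d) ∞ M) (hκ' : κ' ∈ IsManifold.maximalAtlas (𝓡 d) ∞ M)
    {a b : M → ℂ} (ha : a ∈ testFunctions (𝓡 d) M) (hb : b ∈ testFunctions (𝓡 d) M)
    (has : tsupport a ⊆ κ.source) (hbs : tsupport b ⊆ κ'.source) :
    Continuous fun k : EuclideanSpace ℝ (Fin d) × EuclideanSpace ℝ (Fin d) =>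
      u.sesq (fun x => a x * chartWave κ k.1 x) (fun x => b x * chartWave κ' k.2 x) := by
  have hab := tensor_mem ha hb
  have hs : tsupport (fun p : M × M => (starRingEnd ℂ) (a p.1) * b p.2) ⊆ (κ.prod κ').source :=
    (tsupport_tensor_subset a b).trans (Set.prod_mono has hbs)
  have h1 := (chartFourier_representation u.isDistribution
    (euclideanChart (κ.prod κ') (IsManifold.mem_maximalAtlas_prod hκ hκ')) hab hs).1
  have h2 : Continuous fun k : EuclideanSpace ℝ (Fin d) × EuclideanSpace ℝ (Fin d) =>
      u.localFourier (IsManifold.mem_maximalAtlas_prod hκ hκ') hab hs (-k.1, k.2) := by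
    simp only [localFourier_eq_chartFourier]
    have h3 : Continuous fun k : EuclideanSpace ℝ (Fin d) × EuclideanSpace ℝ (Fin d) =>
        (-k.1, k.2) := by fun_prop
    exact h1.comp ((toPair d).continuous.comp (h3.const_smul (2 * Real.pi)⁻¹))
  refine h2.congr fun k => ?_
  rw [localFourier_tensor u hκ hκ', neg_neg]

/-- The second localising function `b` is chosen to cancel the density factor in the definition of
the product, so that only the cutoff `χ` remains. -/
theorem VolumeForm.exists_mul_abs_formComponent_eq (μ : VolumeForm d M)
    (hκ : κ ∈ IsManifold.maximalAtlas (𝓡 d) ∞ M) {χ : M → ℂ} (hχ : χ ∈ testFunctions (𝓡 d) M)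
    (hs : tsupport χ ⊆ κ.source) :
    ∃ b ∈ testFunctions (𝓡 d) M, tsupport b ⊆ tsupport χ ∧
      ∀ x, b x * (|formComponent μ.form κ (κ x)| : ℝ) = χ x := by
  have h : ContDiffOn ℝ ∞ (fun y => ((|formComponent μ.form κ y|⁻¹ : ℝ) : ℂ)) κ.target :=
    Complex.ofRealCLM.contDiff.comp_contDiffOn
      (((μ.smooth κ hκ).abs fun y hy => μ.formComponent_ne_zero hκ hy).inv
        fun y hy => abs_ne_zero.2 (μ.formComponent_ne_zero hκ hy))
  refine ⟨fun x => χ x * ((|formComponent μ.form κ (κ x)|⁻¹ : ℝ) : ℂ),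
    mul_mem_testFunctions hχ κ.open_source hs
      (h.contMDiffOn.comp (contMDiffOn_of_mem_maximalAtlas hκ) κ.mapsTo),
    tsupport_mul_left_subset _ _, fun x => ?_⟩
  by_cases hx : χ x = 0
  · simp [hx]
  · have := abs_ne_zero.2 (μ.formComponent_ne_zero hκ
      (κ.map_source (hs (subset_tsupport _ hx))))
    rw [mul_assoc, ← Complex.ofReal_mul, inv_mul_cancel₀ this, Complex.ofReal_one, mul_one]

/-- A chart of `M`, as a smooth chart in the sense of `SmoothChart`. -/
def maximalAtlasChart (hκ : κ ∈ IsManifold.maximalAtlas (𝓡 d) ∞ M) :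
    SmoothChart (𝓡 d) M (EuclideanSpace ℝ (Fin d)) where
  toOpenPartialHomeomorph := κ
  smooth := contMDiffOn_of_mem_maximalAtlas hκ
  smooth_symm := contMDiffOn_symm_of_mem_maximalAtlas hκ

end Positivity

/-! ### Decomposition of test functions and the tensor form of the product -/

section ProductPositivity

open scoped ComplexOrder

variable {d : ℕ} {M : Type*} [TopologicalSpace M] [ChartedSpace (EuclideanSpace ℝ (Fin d)) M]
  [T2Space M] [IsManifold (𝓡 d) ∞ M]

/-- Test functions on `M` decompose into pieces such that all products of two pieces are supported
in prescribed small open sets of `M × M`. -/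
theorem exists_decomposition_of_local_cover [SecondCountableTopology M]
    (P : OpenPartialHomeomorph M (EuclideanSpace ℝ (Fin d)) →
      OpenPartialHomeomorph M (EuclideanSpace ℝ (Fin d)) → Set (M × M) → Prop)
    (hP : ∀ κ ∈ IsManifold.maximalAtlas (𝓡 d) ∞ M, ∀ κ' ∈ IsManifold.maximalAtlas (𝓡 d) ∞ M,
      ∀ p ∈ (κ.prod κ').source, ∃ V, IsOpen V ∧ p ∈ V ∧ V ⊆ (κ.prod κ').source ∧ P κ κ' V)
    {f : M → ℂ} (hf : f ∈ testFunctions (𝓡 d) M) :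
    ∃ (ι : Type) (_ : Fintype ι) (κ : ι → OpenPartialHomeomorph M (EuclideanSpace ℝ (Fin d)))
      (U : ι → Set M) (a χ : ι → M → ℂ),
      (∀ i, κ i ∈ IsManifold.maximalAtlas (𝓡 d) ∞ M ∧ U i ⊆ (κ i).source ∧
        (a i ∈ testFunctions (𝓡 d) M ∧ tsupport (a i) ⊆ U i) ∧
        (χ i ∈ testFunctions (𝓡 d) M ∧ tsupport (χ i) ⊆ U i) ∧ ∀ x, a i x * χ i x = a i x) ∧
      (∀ x, f x = ∑ i, a i x) ∧
      ∀ i j, ∃ V ⊆ ((κ i).prod (κ j)).source, U i ×ˢ U j ⊆ V ∧ P (κ i) (κ j) V := by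
  have : LocallyCompactSpace M := ChartedSpace.locallyCompactSpace (EuclideanSpace ℝ (Fin d)) M
  have : TopologicalSpace.MetrizableSpace M := inferInstance
  let _ : MetricSpace M := TopologicalSpace.metrizableSpaceMetric M
  have hK : IsCompact (tsupport f) := hf.2
  have hat : ∀ x : M, chartAt (EuclideanSpace ℝ (Fin d)) x ∈ IsManifold.maximalAtlas (𝓡 d) ∞ M :=
    fun x => chartAt_mem_maximalAtlas x
  have hchart : ∀ q : M, ∃ Y : SmoothChart (𝓡 d) M (EuclideanSpace ℝ (Fin d)), q ∈ Y.source :=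
    fun q => ⟨maximalAtlasChart (hat q), mem_chart_source _ q⟩
  obtain ⟨ι₁, hι₁, c₁, ζ₁, hζ₁, hsum₁⟩ := exists_finite_partition hK
    (fun q => (chartAt (EuclideanSpace ℝ (Fin d)) q).source)
    (fun q _ => chart_source_mem_nhds _ q) hchart
  have hr : ∀ x ∈ tsupport f, ∃ r, x ∈ tsupport (ζ₁ r) := by
    intro x hx
    by_contra! hc
    have h1 := hsum₁ x hx
    rw [Finset.sum_eq_zero fun r _ => image_eq_zero_of_notMem_tsupport (hc r)] at h1
    exact zero_ne_one h1
  let κ₁ : ι₁ → OpenPartialHomeomorph M (EuclideanSpace ℝ (Fin d)) := fun r => chartAt _ (c₁ r)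
  -- The good neighbourhoods depend on points of `M × M` and need not come from a cover of `M`. A
  -- Lebesgue number for each of the finitely many pairs of charts gives one radius that is good
  -- everywhere.
  have hδ : ∀ r s, ∀ᶠ δ in 𝓝[>] (0 : ℝ), ∀ p ∈ tsupport (ζ₁ r) ×ˢ tsupport (ζ₁ s),
      ∃ V ⊆ ((κ₁ r).prod (κ₁ s)).source, Metric.ball p δ ⊆ V ∧ P (κ₁ r) (κ₁ s) V := by
    intro r s
    obtain ⟨δ₀, hδ₀, hl⟩ := lebesgue_number_lemma_of_metric
      (c := fun V : {V : Set (M × M) // IsOpen V ∧ V ⊆ ((κ₁ r).prod (κ₁ s)).source ∧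
        P (κ₁ r) (κ₁ s) V} => V.1)
      ((hζ₁ r).2.1.2.isCompact.prod (hζ₁ s).2.1.2.isCompact) (fun V => V.2.1) (by
        intro p hp
        obtain ⟨V, hVo, hpV, hVs, hPV⟩ := hP (κ₁ r) (hat _) (κ₁ s) (hat _) p
          ⟨(hζ₁ r).2.2 hp.1, (hζ₁ s).2.2 hp.2⟩
        exact Set.mem_iUnion.2 ⟨⟨V, hVo, hVs, hPV⟩, hpV⟩)
    filter_upwards [Ioo_mem_nhdsGT hδ₀] with δ hδ p hp
    obtain ⟨V, hV⟩ := hl p hp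
    exact ⟨V.1, V.2.2.1, (Metric.ball_subset_ball hδ.2.le).trans hV, V.2.2.2⟩
  obtain ⟨δ, hδ, hδ0⟩ := ((eventually_all.2 fun r => eventually_all.2 fun s => hδ r s).and
    self_mem_nhdsWithin).exists
  have hδ0 : 0 < δ := hδ0
  rcases isEmpty_or_nonempty ι₁ with he | hne
  · have hf0 : ∀ x, f x = 0 := fun x => by
      by_contra hx
      obtain ⟨r, -⟩ := hr x (subset_tsupport _ hx)
      exact he.elim r
    exact ⟨Empty, inferInstance, Empty.elim, Empty.elim, Empty.elim, Empty.elim,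
      fun i => i.elim, fun x => by simp [hf0 x], fun i => i.elim⟩
  choose! r hr using hr
  have hχ : ∀ x ∈ tsupport f, ∃ χ ∈ testFunctions (𝓡 d) M,
      tsupport χ ⊆ Metric.ball x δ ∩ (κ₁ (r x)).source ∧ ∀ᶠ q in 𝓝 x, χ q = 1 := by
    intro x hx
    obtain ⟨χ, h1, h2, h3, h4⟩ := exists_testFunction_eq_one
      (maximalAtlasChart (hat (c₁ (r x)))) ((hζ₁ _).2.2 (hr x hx)) (Metric.ball_mem_nhds x hδ0)
    exact ⟨χ, h1, Set.subset_inter h2 h3, h4⟩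
  choose! χ hχ using hχ
  -- Each piece is supported where the cutoff `χ x` of its centre equals `1`, which yields `a i * χ
  -- i = a i`.
  obtain ⟨ι, hι, c, ζ, hζ, hsum⟩ := exists_finite_partition hK
    (fun x => {q | χ x q = 1} ∩ (Metric.ball x δ ∩ (κ₁ (r x)).source))
    (fun x hx => inter_mem (hχ x hx).2.2 (inter_mem (Metric.ball_mem_nhds x hδ0)
      ((κ₁ (r x)).open_source.mem_nhds ((hζ₁ _).2.2 (hr x hx))))) hchart
  refine ⟨ι, hι, fun i => κ₁ (r (c i)), fun i => Metric.ball (c i) δ ∩ (κ₁ (r (c i))).source,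
    fun i x => ζ i x * f x, fun i => χ (c i), fun i => ⟨hat _, Set.inter_subset_right,
    ⟨testFunctions_mul_mem (hζ i).2.1 hf, (tsupport_mul_left_subset _ _).trans
      ((hζ i).2.2.trans Set.inter_subset_right)⟩,
    ⟨(hχ _ (hζ i).1).1, (hχ _ (hζ i).1).2.1⟩, fun x => ?_⟩, fun x => ?_, fun i j => ?_⟩
  · by_cases hx : ζ i x = 0
    · simp [hx]
    · have : χ (c i) x = 1 := ((hζ i).2.2 (subset_tsupport _ hx)).1
      exact (congrArg _ this).trans (mul_one _)
  · by_cases hx : f x = 0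
    · simp [hx]
    · change f x = ∑ i, ζ i x * f x
      rw [← Finset.sum_mul, hsum x (subset_tsupport _ hx), one_mul]
  · obtain ⟨V, hV, hball, hPV⟩ := hδ (r (c i)) (r (c j)) (c i, c j)
      ⟨hr _ (hζ i).1, hr _ (hζ j).1⟩
    refine ⟨V, hV, fun p hp => hball ?_, hPV⟩
    -- The product metric is the maximum metric, so a product of balls of radius `δ` is the ball of
    -- radius `δ` about the pair of centres.
    rw [← ball_prod_same]
    exact ⟨hp.1.1, hp.2.1⟩

theorem integrable_comp_neg_fst {E : Type*} [NormedAddCommGroup E] [NormedSpace ℝ E]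
    [FiniteDimensional ℝ E] [MeasureSpace E] [BorelSpace E]
    [(volume : Measure E).IsAddHaarMeasure] (f : E × E → ℂ) :
    (Integrable (fun k : E × E => f (-k.1, k.2)) ↔ Integrable f) ∧
      ∫ k : E × E, f (-k.1, k.2) = ∫ k, f k := by
  have hmp : MeasurePreserving ((MeasurableEquiv.neg E).prodCongr (MeasurableEquiv.refl E))
      (volume : Measure (E × E)) volume :=
    (Measure.measurePreserving_neg (volume : Measure E)).prod (MeasurePreserving.id volume)
  exact ⟨hmp.integrable_comp_emb (MeasurableEquiv.measurableEmbedding _),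
    hmp.integral_comp (MeasurableEquiv.measurableEmbedding _) f⟩

/-- The integrand of the localised Fourier product of `u₁` and `u₂`, localised by `ā ⊗ a'` and
`b̄ ⊗ b'`, as a kernel in the frequency variables. -/
def productKernel (u₁ u₂ : Distribution₂ d M)
    (κ κ' : OpenPartialHomeomorph M (EuclideanSpace ℝ (Fin d))) (a a' b b' : M → ℂ)
    (k : EuclideanSpace ℝ (Fin d) × EuclideanSpace ℝ (Fin d)) : ℂ :=
  u₁.sesq (fun x => a x * chartWave κ k.1 x) (fun x => a' x * chartWave κ' k.2 x) *
    u₂.sesq (fun x => b x * chartWave κ (-k.1) x) (fun x => b' x * chartWave κ' (-k.2) x)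

/-- The product `w` is given by integrals of `productKernel` on tensor products of test functions
localised in `V`. -/
def IsLocalTensorProduct (μ : VolumeForm d M) (u₁ u₂ w : Distribution₂ d M)
    (κ κ' : OpenPartialHomeomorph M (EuclideanSpace ℝ (Fin d))) (V : Set (M × M)) : Prop :=
  ∀ a ∈ testFunctions (𝓡 d) M, ∀ a' ∈ testFunctions (𝓡 d) M, ∀ b ∈ testFunctions (𝓡 d) M,
    ∀ b' ∈ testFunctions (𝓡 d) M, tsupport a ×ˢ tsupport a' ⊆ V → tsupport b ×ˢ tsupport b' ⊆ V →
    Integrable (productKernel u₁ u₂ κ κ' a a' b b') ∧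
    w.sesq (fun x => a x * (b x * (|formComponent μ.form κ (κ x)| : ℝ)))
      (fun x => a' x * (b' x * (|formComponent μ.form κ' (κ' x)| : ℝ))) =
      ((2 * Real.pi : ℝ) : ℂ)⁻¹ ^ (2 * d) * ∫ k, productKernel u₁ u₂ κ κ' a a' b b' k

/-- Reversing the first frequency, which preserves Lebesgue measure, compensates for the conjugation
in the first slot. The integrand becomes the kernel `productKernel`, in which both slots depend on
their own frequency in the same way, as positivity requires. -/
theorem Distribution₂.IsProduct.exists_isLocalTensorProduct {μ : VolumeForm d M}
    {u₁ u₂ w : Distribution₂ d M} (hw : Distribution₂.IsProduct μ u₁ u₂ w)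
    {κ κ' : OpenPartialHomeomorph M (EuclideanSpace ℝ (Fin d))}
    (hκ : κ ∈ IsManifold.maximalAtlas (𝓡 d) ∞ M) (hκ' : κ' ∈ IsManifold.maximalAtlas (𝓡 d) ∞ M)
    {p : M × M} (hp : p ∈ (κ.prod κ').source) :
    ∃ V, IsOpen V ∧ p ∈ V ∧ V ⊆ (κ.prod κ').source ∧ IsLocalTensorProduct μ u₁ u₂ w κ κ' V := by
  obtain ⟨V, hVo, hpV, hV, h⟩ := hw κ κ' hκ hκ' p hp
  refine ⟨V, hVo, hpV, hV, fun a ha a' ha' b hb b' hb' haV hbV => ?_⟩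
  have hsa := (tsupport_tensor_subset a a').trans haV
  have hsb := (tsupport_tensor_subset b b').trans hbV
  obtain ⟨h1, h2⟩ := h _ _ (tensor_mem ha ha') (tensor_mem hb hb') hsa hsb
  rw [← evalTest_of_mem w.toLin] at h2
  set G := productKernel u₁ u₂ κ κ' a a' b b' with hG
  have hk : ∀ k : EuclideanSpace ℝ (Fin d) × EuclideanSpace ℝ (Fin d),
      u₁.localFourier (IsManifold.mem_maximalAtlas_prod hκ hκ') (tensor_mem ha ha')
        (hsa.trans hV) k *
      u₂.localFourier (IsManifold.mem_maximalAtlas_prod hκ hκ') (tensor_mem hb hb')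
        (hsb.trans hV) (-k) = G (-k.1, k.2) := by
    intro k
    rw [localFourier_tensor u₁ hκ hκ', localFourier_tensor u₂ hκ hκ', hG]
    rfl
  simp only [hk] at h1 h2
  refine ⟨(integrable_comp_neg_fst G).1.1 h1, ?_⟩
  rw [(integrable_comp_neg_fst G).2] at h2
  rw [← h2, Distribution₂.sesq]
  congr 1; ext q
  rw [map_mul, map_mul, Complex.conj_ofReal, VolumeForm.density]
  push_cast
  ring

end ProductPositivity

/-! ### Positivity of the product -/

section ProductPositivity

open scoped ComplexOrder

variable {d : ℕ} {M : Type*} [TopologicalSpace M] [ChartedSpace (EuclideanSpace ℝ (Fin d)) M]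
  [T2Space M] [IsManifold (𝓡 d) ∞ M]

theorem continuous_productKernel (u₁ u₂ : Distribution₂ d M)
    {κ κ' : OpenPartialHomeomorph M (EuclideanSpace ℝ (Fin d))}
    (hκ : κ ∈ IsManifold.maximalAtlas (𝓡 d) ∞ M) (hκ' : κ' ∈ IsManifold.maximalAtlas (𝓡 d) ∞ M)
    {a a' b b' : M → ℂ} (ha : a ∈ testFunctions (𝓡 d) M) (ha' : a' ∈ testFunctions (𝓡 d) M)
    (hb : b ∈ testFunctions (𝓡 d) M) (hb' : b' ∈ testFunctions (𝓡 d) M)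
    (has : tsupport a ⊆ κ.source) (has' : tsupport a' ⊆ κ'.source)
    (hbs : tsupport b ⊆ κ.source) (hbs' : tsupport b' ⊆ κ'.source) :
    Continuous (productKernel u₁ u₂ κ κ' a a' b b') := by
  have h1 := continuous_sesq_chartWave u₁ hκ hκ' ha ha' has has'
  have h2 := continuous_sesq_chartWave u₂ hκ hκ' hb hb' hbs hbs'
  have h3 : Continuous fun k : EuclideanSpace ℝ (Fin d) × EuclideanSpace ℝ (Fin d) =>
      (-k.1, -k.2) := by fun_prop
  have h4 := h2.comp h3
  simp only [Function.comp_def] at h4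
  unfold productKernel
  exact h1.mul h4

/-- The product of two distributions of positive type is of positive type. -/
theorem Distribution₂.IsProduct.isPositiveType [SecondCountableTopology M] {μ : VolumeForm d M}
    {u₁ u₂ w : Distribution₂ d M} (hw : Distribution₂.IsProduct μ u₁ u₂ w)
    (h₁ : u₁.IsPositiveType) (h₂ : u₂.IsPositiveType) : w.IsPositiveType := by
  refine w.isPositiveType_iff.2 fun f hf => ?_
  obtain ⟨ι, hι, κ, U, a, χ, hi, hsum, hij⟩ := exists_decomposition_of_local_cover
    (IsLocalTensorProduct μ u₁ u₂ w)
    (fun κ hκ κ' hκ' p hp => hw.exists_isLocalTensorProduct hκ hκ' hp) hf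
  choose hκ hU ha hχ hmul using hi
  choose b hb hbs hbχ using fun i => μ.exists_mul_abs_formComponent_eq (hκ i) (hχ i).1
    ((hχ i).2.trans (hU i))
  have hbU : ∀ i, tsupport (b i) ⊆ U i := fun i => (hbs i).trans (hχ i).2
  -- By the choice of `b` the last two factors combine to the cutoff `χ i`, which is `1` on the
  -- support of `a i`. So `F i` is just `a i`, in the form required by the local product formula.
  set F : ι → M → ℂ := fun i x => a i x * (b i x * (|formComponent μ.form (κ i) (κ i x)| : ℝ))
    with hF
  have hFa : F = a := by
    ext i x
    simp only [hF, hbχ, hmul]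
  set G := fun i j => productKernel u₁ u₂ (κ i) (κ j) (a i) (a j) (b i) (b j) with hG
  have hpair : ∀ i j, Integrable (G i j) ∧
      w.sesq (F i) (F j) = ((2 * Real.pi : ℝ) : ℂ)⁻¹ ^ (2 * d) * ∫ k, G i j k := by
    intro i j
    obtain ⟨V, hV, hUV, hPV⟩ := hij i j
    exact hPV (a i) (ha i).1 (a j) (ha j).1 (b i) (hb i) (b j) (hb j)
      ((Set.prod_mono (ha i).2 (ha j).2).trans hUV) ((Set.prod_mono (hbU i) (hbU j)).trans hUV)
  have hcont : ∀ i j, Continuous (G i j) := fun i j =>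
    continuous_productKernel u₁ u₂ (hκ i) (hκ j) (ha i).1 (ha j).1 (hb i) (hb j)
      ((ha i).2.trans (hU i)) ((ha j).2.trans (hU j)) ((hbU i).trans (hU i))
      ((hbU j).trans (hU j))
  -- Only the sum over all pairs of pieces is of positive type, not the single `G i j`. At `n`
  -- frequencies the Schur product theorem is used with index set `Fin n × ι`, where an index is a
  -- frequency together with a piece.
  have hnonneg : 0 ≤ ∫ k, ∑ i, ∑ j, G i j k := by
    refine integral_nonneg_of_sum_nonneg
      (integrable_finsetSum _ fun i _ => integrable_finsetSum _ fun j _ => (hpair i j).1)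
      ((continuous_finsetSum _ fun i _ => continuous_finsetSum _ fun j _ => hcont i j).comp
        (continuous_id.prodMk continuous_id)) fun n x => ?_
    have h := sum_sesq_mul_sesq_nonneg h₁ h₂ (Z := Fin n × ι)
      (A := fun z q => a z.2 q * chartWave (κ z.2) (x z.1) q)
      (B := fun z q => b z.2 q * chartWave (κ z.2) (-x z.1) q)
      (fun z => mul_chartWave_mem (hκ z.2) (ha z.2).1 ((ha z.2).2.trans (hU z.2)) _)
      (fun z => mul_chartWave_mem (hκ z.2) (hb z.2) ((hbU z.2).trans (hU z.2)) _)
    simp only [Fintype.sum_prod_type] at h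
    convert h using 1
    exact Finset.sum_congr rfl fun s _ => Finset.sum_comm
  have hff : w.sesq f f = ∑ i, ∑ j, w.sesq (F i) (F j) := by
    have h := w.sesq_sum Finset.univ (fun _ : ι => 1) (A := a) fun i => (ha i).1
    simp only [one_mul, map_one, mul_one, ← hsum] at h
    rw [hFa]
    exact h
  rw [hff]
  simp only [(hpair _ _).2, ← Finset.mul_sum]
  have hI : ∑ i, ∑ j, ∫ k, G i j k = ∫ k, ∑ i, ∑ j, G i j k := by
    rw [integral_finsetSum _ fun i _ => integrable_finsetSum _ fun j _ => (hpair i j).1]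
    exact Finset.sum_congr rfl fun i _ => (integral_finsetSum _ fun j _ => (hpair i j).1).symm
  rw [hI, ← Complex.ofReal_inv, ← Complex.ofReal_pow]
  exact mul_nonneg (Complex.zero_le_real.2 (by positivity)) hnonneg

end ProductPositivity

end

theorem mainTheorem2 {d : ℕ} {M : Type*} [TopologicalSpace M] [T2Space M]
    [SecondCountableTopology M] [ChartedSpace (EuclideanSpace ℝ (Fin d)) M]
    [IsManifold (𝓡 d) ∞ M] (μ : VolumeForm d M) (u₁ u₂ : Distribution₂ d M)
    (h₁ : u₁.IsPositiveType) (h₂ : u₂.IsPositiveType)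
    (hWF : ∀ (p : M × M) (ξ : TangentSpace ((𝓡 d).prod (𝓡 d)) p →L[ℝ] ℝ), ξ ≠ 0 →
      ∃ s₁ s₂ : ℝ, 0 ≤ s₁ + s₂ ∧ ⟨p, ξ⟩ ∉ u₁.sobolevWF s₁ ∧ ⟨p, -ξ⟩ ∉ u₂.sobolevWF s₂) :
    (∃! w : Distribution₂ d M, Distribution₂.IsProduct μ u₁ u₂ w) ∧
      ∀ w : Distribution₂ d M, Distribution₂.IsProduct μ u₁ u₂ w → w.IsPositiveType := by
  exact ⟨existsUnique_isProduct μ u₁ u₂ hWF, fun w hw => hw.isPositiveType h₁ h₂⟩
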